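/- Let $n\ge 5$ and $p\ge 3$ be odd integers, and let $\Sigma_p=\{z\in\mathbb{C}^{n+1} : z_0^2+\dots+z_{n-1}^2+z_n^p=0,\ \|z\|=1\}$ be the Brieskorn sphere, with the contact form $\alpha_p=\lambda_p|_{\Sigma_p}$, $\lambda_p=\frac{i}{8}\sum_{k=0}^n a_k(z_k\,d\bar z_k-\bar z_k\,dz_k)$, $a=(2,\dots,2,p)$. Put $w_0=(z_0+iz_1)/\sqrt2$, $w_1=(z_0-iz_1)/\sqrt2$, and for $\varepsilon>0$ let $\alpha_p'=K^{-1}\alpha_p$, where $K=\|z\|^2+\varepsilon(|w_0|^2-|w_1|^2)$. Let $\varphi^t$ be the Reeb flow of $\alpha'_p$ (it exists for all times, for small $\varepsilon$), and for $T>0$ let $\mathcal{N}^T=\{z\in\Sigma_p:\varphi^T(z)=z\}$. On these sets of periodic points choose Morse functions such that, for every even integer $L>0$, there is exactly one critical point for each of the following Morse indices, and no other critical point: $0,\,n-4,\,n-3,\,2n-7$ on $\mathcal{N}^{L\pi/2}$ if $p\nmid L$; $0,\,2n-5$ on $\mathcal{N}^{L\pi/2}$ if $p\mid L$; $0,\,1$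 on each of $\mathcal{N}^{L\pi/(2(1+\varepsilon))}$ and $\mathcal{N}^{L\pi/(2(1-\varepsilon))}$. Let $b_k$ be the number of pairs $(T,x)$ with $T>0$ and $x$ a critical point of the chosen Morse function on $\mathcal{N}^T$ whose Morse–Bott index $\mu_{CZ}+\mu_{Morse}-\frac12\dim\mathcal{N}^T+\frac12$ is $k$. Here $\mu_{CZ}$ is the Maslov index in the sense of Robbin and Salamon of the linearized Reeb flow on $\ker\alpha'_p$ along the $T$-periodic orbit through $x$, in a symplectic trivialization of $(\ker\alpha_p',d\alpha_p')$ over a disc in $\Sigma_p$ bounded by the orbit. For $l\in\mathbb{Z}$ put $f_p(l)=(l-1)(n-2)+2\lceil l/p\rceil$. Then for every $M\in\mathbb{Z}$ there is $\varepsilon_0>0$ such that for every irrational $\varepsilon\in(0,\varepsilon_0)$, every such choice of Morse functions, and every integer $k\le M$: 1. if $l\ge 4$ is even and $p\nmid l-1$, then $b_k=1$ for $k\in f_p(l)+\{-2,+1\}$ and $b_k=2$ for $k\in f_p(l)+\{-1,0\}$; 2. $b_k=1$ for $k\in f_p(2)+\{-1,0,+1\}=\{n-1,n,n+1\}$; 3.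 if $l\ge 1$ is odd and $p\nmid l-1$, then $b_k=1$ for $k\in f_p(l)+\{-1,0\}$; 4. if $l\ge 1$ is even and $p\mid l-1$, then $b_k=1$ for $k\in f_p(l)+\{-4,-3,-2,-1,0,+1\}$; 5. $b_k=0$ for all other $k$. -/

import Mathlib

open scoped ContDiff

noncomputable section

/-! ### Inertia of quadratic forms and Morse functions on submanifolds -/

/-- The quadratic form `q` is nondegenerate on the subspace `K`, with positive index `pos` and
negative index `neg` (Sylvester): `K` is the direct sum of a subspace of dimension `pos` on which
`q` is positive definite and one of dimension `neg` on which it is negative definite. -/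
def HasInertia {V : Type*} [AddCommGroup V] [Module ℝ V] (q : V → ℝ) (K : Submodule ℝ V)
    (pos neg : ℕ) : Prop :=
  ∃ P N : Submodule ℝ V, P ⊔ N = K ∧ Disjoint P N ∧
    (∀ v ∈ P, v ≠ 0 → 0 < q v) ∧ (∀ v ∈ N, v ≠ 0 → q v < 0) ∧
    Module.finrank ℝ P = pos ∧ Module.finrank ℝ N = neg

/-- `ψ` is a smooth local parametrization around `x = ψ 0` of the `d`-dimensional embedded
submanifold `N` of `E`: an immersion at `0` that maps the neighbourhoods of `0` onto the
neighbourhoods of `x` in `N`. -/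
def IsLocalParam {E : Type*} [NormedAddCommGroup E] [NormedSpace ℝ E] (N : Set E) (x : E) (d : ℕ)
    (ψ : EuclideanSpace ℝ (Fin d) → E) : Prop :=
  x ∈ N ∧ ψ 0 = x ∧ ContDiffAt ℝ ∞ ψ 0 ∧ Function.Injective (fderiv ℝ ψ 0) ∧
    Filter.map ψ (nhds 0) = nhdsWithin x N

/-- `x` is a critical point of the restriction of `h` to the submanifold `N`. -/
def IsCriticalPointOn {E : Type*} [NormedAddCommGroup E] [NormedSpace ℝ E] (N : Set E)
    (h : E → ℝ) (x : E) : Prop :=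
  ∃ (d : ℕ) (ψ : EuclideanSpace ℝ (Fin d) → E), IsLocalParam N x d ψ ∧ fderiv ℝ (h ∘ ψ) 0 = 0

/-- `N` is near `x` a `d`-dimensional submanifold, and `x` is a nondegenerate critical point of
Morse index `c` of the restriction of `h` to `N`. -/
def HasMorseIndexOn {E : Type*} [NormedAddCommGroup E] [NormedSpace ℝ E] (N : Set E)
    (h : E → ℝ) (x : E) (d c : ℕ) : Prop :=
  ∃ ψ : EuclideanSpace ℝ (Fin d) → E, IsLocalParam N x d ψ ∧ fderiv ℝ (h ∘ ψ) 0 = 0 ∧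
    ∃ pos : ℕ, HasInertia (fun v => iteratedFDeriv ℝ 2 (h ∘ ψ) 0 ![v, v]) ⊤ pos c

/-- The restriction of the smooth function `h` to the (compact) submanifold `N` is a Morse function
which has, for each `c ∈ I`, exactly one critical point of Morse index `c`, and no others. -/
def IsMorseWithIndices {E : Type*} [NormedAddCommGroup E] [NormedSpace ℝ E] (N : Set E)
    (h : E → ℝ) (I : Finset ℕ) : Prop :=
  ContDiff ℝ ∞ h ∧
    (∀ x, IsCriticalPointOn N h x → ∃ c ∈ I, ∃ d, HasMorseIndexOn N h x d c) ∧
    (∀ c ∈ I, ∃! x, ∃ d, HasMorseIndexOn N h x d c)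

/-! ### The Maslov index of a path of symplectic matrices

The model space is `ℂʳ = ℝ²ʳ` with its standard symplectic form `ω₀ = ∑ dxⱼ ∧ dyⱼ` and its
standard complex structure, so that `ω₀ (v, i v) = ‖v‖²`. -/

/-- The standard symplectic form on `ℂʳ`. -/
def stdSymplectic {r : ℕ} (v w : EuclideanSpace ℂ (Fin r)) : ℝ := (inner ℂ v w).im

/-- Linear symplectic maps of `ℂʳ = ℝ²ʳ`. -/
def IsSymplectic {r : ℕ} (A : EuclideanSpace ℂ (Fin r) →L[ℝ] EuclideanSpace ℂ (Fin r)) : Prop :=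
  ∀ v w, stdSymplectic (A v) (A w) = stdSymplectic v w

/-- The `C¹` path `Ψ` of symplectic maps on `[0, T]` has only regular crossings (parameters `t` at
which `1` is an eigenvalue of `Ψ t`), and the sum of the signatures of the crossing forms
`v ↦ ω₀ (v, Ψ'(t) v)` on `ker (Ψ t - 1)`, those of the end points counted with weight `1/2`,
is `μ`. -/
def HasCrossingSum {r : ℕ} (T : ℝ)
    (Ψ : ℝ → EuclideanSpace ℂ (Fin r) →L[ℝ] EuclideanSpace ℂ (Fin r)) (μ : ℝ) : Prop :=
  (∀ t ∈ Set.Icc 0 T, IsSymplectic (Ψ t)) ∧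
  ∃ Ψ' : ℝ → EuclideanSpace ℂ (Fin r) →L[ℝ] EuclideanSpace ℂ (Fin r),
    ContinuousOn Ψ' (Set.Icc 0 T) ∧
    (∀ t ∈ Set.Icc 0 T, HasDerivWithinAt Ψ (Ψ' t) (Set.Icc 0 T) t) ∧
    ∃ (C : Finset ℝ) (pos neg : ℝ → ℕ),
      (∀ t, t ∈ C ↔ t ∈ Set.Icc 0 T ∧ ∃ v, v ≠ 0 ∧ Ψ t v = v) ∧
      (∀ t ∈ C, HasInertia (fun v => stdSymplectic v (Ψ' t v))
        (LinearMap.ker (Ψ t - ContinuousLinearMap.id ℝ _).toLinearMap) (pos t) (neg t)) ∧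
      μ = ∑ t ∈ C, (if t = 0 ∨ t = T then (1 / 2 : ℝ) else 1) * ((pos t : ℝ) - neg t)

/-- Homotopy with fixed end points of continuous paths of symplectic maps on `[0, T]`. -/
def SymplecticHomotopic {r : ℕ} (T : ℝ)
    (Ψ₀ Ψ₁ : ℝ → EuclideanSpace ℂ (Fin r) →L[ℝ] EuclideanSpace ℂ (Fin r)) : Prop :=
  ∃ H : ℝ × ℝ → EuclideanSpace ℂ (Fin r) →L[ℝ] EuclideanSpace ℂ (Fin r),
    ContinuousOn H (Set.Icc 0 1 ×ˢ Set.Icc 0 T) ∧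
    (∀ s ∈ Set.Icc (0 : ℝ) 1, ∀ t ∈ Set.Icc 0 T, IsSymplectic (H (s, t))) ∧
    (∀ t ∈ Set.Icc 0 T, H (0, t) = Ψ₀ t ∧ H (1, t) = Ψ₁ t) ∧
    (∀ s ∈ Set.Icc (0 : ℝ) 1, H (s, 0) = Ψ₀ 0 ∧ H (s, T) = Ψ₀ T)

/-- `μ` is the (Robbin–Salamon) Maslov index of the path `Ψ` of symplectic maps on `[0, T]`: the
sum of the crossing signatures of a path with regular crossings that is homotopic to `Ψ` with
fixed end points. -/
def HasMaslovIndex {r : ℕ} (T : ℝ)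
    (Ψ : ℝ → EuclideanSpace ℂ (Fin r) →L[ℝ] EuclideanSpace ℂ (Fin r)) (μ : ℝ) : Prop :=
  ∃ Ψ₁, SymplecticHomotopic T Ψ Ψ₁ ∧ HasCrossingSum T Ψ₁ μ

/-! ### Contact forms on submanifolds of a vector space

`S` is a submanifold of `E` with tangent spaces `TS z`, and the contact form on `S` is the
restriction of the 1-form `α` of `E`, where `α z v` is the value of `α` at the point `z` on the
vector `v`. -/

/-- The exterior derivative of a 1-form, `dα (u, v) = D_u (α v) - D_v (α u)` for constant vector
fields `u, v`. -/
def dOneForm {E : Type*} [NormedAddCommGroup E] [NormedSpace ℝ E] (α : E → E → ℝ)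
    (z u v : E) : ℝ :=
  fderiv ℝ (fun y => α y v) z u - fderiv ℝ (fun y => α y u) z v

/-- `R` is the value of the Reeb vector field at the point `z`: it is tangent to `S`, `α R = 1`,
and `dα (R, ·) = 0` on the tangent space of `S`. -/
def IsReebVector {E : Type*} [NormedAddCommGroup E] [NormedSpace ℝ E] (TS : E → Set E)
    (α : E → E → ℝ) (z R : E) : Prop :=
  R ∈ TS z ∧ α z R = 1 ∧ ∀ v ∈ TS z, dOneForm α z R v = 0

/-- `φ t z`, for `z ∈ S`, is the Reeb flow (the values of `φ` outside `S` play no role). -/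
def IsReebFlow {E : Type*} [NormedAddCommGroup E] [NormedSpace ℝ E] (S : Set E) (TS : E → Set E)
    (α : E → E → ℝ) (φ : ℝ → E → E) : Prop :=
  ∀ z ∈ S, φ 0 z = z ∧ ∀ t, φ t z ∈ S ∧
    ∃ R, IsReebVector TS α (φ t z) R ∧ HasDerivAt (fun s => φ s z) R t

/-- The set `𝒩ᵀ` of the points of `S` on `T`-periodic Reeb orbits. -/
def periodicSet {E : Type*} (S : Set E) (φ : ℝ → E → E) (T : ℝ) : Set E :=
  {z | z ∈ S ∧ φ T z = z}

/-- The contact hyperplane at `z`. -/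
def contactPlane {E : Type*} (TS : E → Set E) (α : E → E → ℝ) (z : E) : Set E :=
  {v | v ∈ TS z ∧ α z v = 0}

/-- `μ` is the Conley–Zehnder index of the `T`-periodic Reeb orbit that starts at `z`, where the
contact structure has rank `2r`. Here `u` is a disc in `S` bounded by the orbit, `Φ` is a
symplectic trivialization over this disc of the contact structure with the form `dα`, and `Ψ t` is
the differential at `z` of the time-`t` map of the Reeb flow (the linear map `D` below, which is
determined on the tangent space of `S`) in this trivialization. -/
def HasConleyZehnderIndex {E : Type*} [NormedAddCommGroup E] [NormedSpace ℝ E] (r : ℕ)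
    (S : Set E) (TS : E → Set E) (α : E → E → ℝ) (φ : ℝ → E → E) (T : ℝ) (z : E) (μ : ℝ) : Prop :=
  ∃ (u : ℂ → E) (Φ : ℂ → EuclideanSpace ℂ (Fin r) →L[ℝ] E)
    (Ψ : ℝ → EuclideanSpace ℂ (Fin r) →L[ℝ] EuclideanSpace ℂ (Fin r)),
    ContinuousOn u (Metric.closedBall 0 1) ∧
    (∀ ζ ∈ Metric.closedBall (0 : ℂ) 1, u ζ ∈ S) ∧
    (∀ t : ℝ, u (Complex.exp (2 * Real.pi * Complex.I * (t / T))) = φ t z) ∧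
    ContinuousOn Φ (Metric.closedBall 0 1) ∧
    (∀ ζ ∈ Metric.closedBall (0 : ℂ) 1,
      Set.range (Φ ζ) = contactPlane TS α (u ζ) ∧
      ∀ v w, dOneForm α (u ζ) (Φ ζ v) (Φ ζ w) = stdSymplectic v w) ∧
    (∀ t ∈ Set.Icc 0 T, ∃ D : E →L[ℝ] E, HasFDerivWithinAt (φ t) D S z ∧
      ∀ v, Φ (Complex.exp (2 * Real.pi * Complex.I * (t / T))) (Ψ t v) = D (Φ 1 v)) ∧
    HasMaslovIndex T Ψ μ

/-- `x` is a critical point of the Morse function `h T` on the manifold `𝒩ᵀ`, and the `T`-periodic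
Reeb orbit that starts at `x` has Morse–Bott index
`k = μ_CZ + μ_Morse - (dim 𝒩ᵀ) / 2 + 1 / 2`. -/
def HasMorseBottIndex {E : Type*} [NormedAddCommGroup E] [NormedSpace ℝ E] (r : ℕ)
    (S : Set E) (TS : E → Set E) (α : E → E → ℝ) (φ : ℝ → E → E) (h : ℝ → E → ℝ)
    (T : ℝ) (x : E) (k : ℤ) : Prop :=
  ∃ (d c : ℕ) (μ : ℝ), HasMorseIndexOn (periodicSet S φ T) (h T) x d c ∧
    HasConleyZehnderIndex r S TS α φ T x μ ∧ (k : ℝ) = μ + c - (d : ℝ) / 2 + 1 / 2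

/-- The number `b_k` of closed Reeb orbits of Morse–Bott index `k`, with respect to the Morse
functions `h T` on the manifolds `𝒩ᵀ`, `T > 0`. -/
def closedOrbitCount {E : Type*} [NormedAddCommGroup E] [NormedSpace ℝ E] (r : ℕ)
    (S : Set E) (TS : E → Set E) (α : E → E → ℝ) (φ : ℝ → E → E) (h : ℝ → E → ℝ) (k : ℤ) : ℕ∞ :=
  {o : ℝ × E | 0 < o.1 ∧ HasMorseBottIndex r S TS α φ h o.1 o.2 k}.encard

/-! ### The Brieskorn manifolds and the perturbed contact form -/

/-- The exponents `(2, …, 2, p)`. -/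
def brieskornExp (n p : ℕ) (k : Fin (n + 1)) : ℕ := if k = Fin.last n then p else 2

/-- The polynomial `z₀ ^ a₀ + ⋯ + zₙ ^ aₙ` for `a = (2, …, 2, p)`. -/
def brieskornPoly (n p : ℕ) (z : EuclideanSpace ℂ (Fin (n + 1))) : ℂ :=
  ∑ k, z k ^ brieskornExp n p k

/-- The Brieskorn manifold `Σ_p`. -/
def brieskornSphere (n p : ℕ) : Set (EuclideanSpace ℂ (Fin (n + 1))) :=
  {z | brieskornPoly n p z = 0 ∧ ‖z‖ = 1}

/-- The tangent spaces of `Σ_p`. -/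
def brieskornTangent (n p : ℕ) (z : EuclideanSpace ℂ (Fin (n + 1))) :
    Set (EuclideanSpace ℂ (Fin (n + 1))) :=
  {v | fderiv ℝ (brieskornPoly n p) z v = 0 ∧ (inner ℂ z v).re = 0}

/-- The 1-form `λ_p = (i / 8) ∑ aₖ (zₖ dz̄ₖ - z̄ₖ dzₖ)`. -/
def brieskornForm (n p : ℕ) (z v : EuclideanSpace ℂ (Fin (n + 1))) : ℝ :=
  (Complex.I / 8 * ∑ k, (brieskornExp n p k : ℂ) *
    (z k * (starRingEnd ℂ) (v k) - (starRingEnd ℂ) (z k) * v k)).re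

/-- The function `K = ‖w‖² + ε (|w₀|² - |w₁|²)`, where `w₀ = (z₀ + i z₁) / √2`,
`w₁ = (z₀ - i z₁) / √2`, and `wₖ = zₖ` for `k ≥ 2` (so that `‖w‖ = ‖z‖`). -/
def perturbK (n : ℕ) (ε : ℝ) (z : EuclideanSpace ℂ (Fin (n + 1))) : ℝ :=
  ‖z‖ ^ 2 + ε * (‖(z 0 + Complex.I * z 1) / (Real.sqrt 2 : ℂ)‖ ^ 2 -
    ‖(z 0 - Complex.I * z 1) / (Real.sqrt 2 : ℂ)‖ ^ 2)

/-- The perturbed contact form `α'_p = K⁻¹ λ_p`. -/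
def perturbedForm (n p : ℕ) (ε : ℝ) (z v : EuclideanSpace ℂ (Fin (n + 1))) : ℝ :=
  (perturbK n ε z)⁻¹ * brieskornForm n p z v

/-- `φ` is the Reeb flow of `α'_p` on `Σ_p`. -/
def IsPerturbedReebFlow (n p : ℕ) (ε : ℝ)
    (φ : ℝ → EuclideanSpace ℂ (Fin (n + 1)) → EuclideanSpace ℂ (Fin (n + 1))) : Prop :=
  IsReebFlow (brieskornSphere n p) (brieskornTangent n p) (perturbedForm n p ε) φ

/-- The choice of Morse functions on the manifolds of closed Reeb orbits of `α'_p`: the orbits with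
`z₀ = z₁ = 0` have the periods `L π / 2`, and the two remaining orbits and their iterates have the
periods `L π / (2 (1 ± ε))`, where `L` is even and positive. -/
def IsMorseChoice (n p : ℕ) (ε : ℝ)
    (φ : ℝ → EuclideanSpace ℂ (Fin (n + 1)) → EuclideanSpace ℂ (Fin (n + 1)))
    (h : ℝ → EuclideanSpace ℂ (Fin (n + 1)) → ℝ) : Prop :=
  ∀ L : ℕ, Even L → 0 < L →
    (¬ p ∣ L → IsMorseWithIndices (periodicSet (brieskornSphere n p) φ (L * Real.pi / 2))
      (h (L * Real.pi / 2)) {0, n - 4, n - 3, 2 * n - 7}) ∧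
    (p ∣ L → IsMorseWithIndices (periodicSet (brieskornSphere n p) φ (L * Real.pi / 2))
      (h (L * Real.pi / 2)) {0, 2 * n - 5}) ∧
    IsMorseWithIndices (periodicSet (brieskornSphere n p) φ (L * Real.pi / (2 * (1 + ε))))
      (h (L * Real.pi / (2 * (1 + ε)))) {0, 1} ∧
    IsMorseWithIndices (periodicSet (brieskornSphere n p) φ (L * Real.pi / (2 * (1 - ε))))
      (h (L * Real.pi / (2 * (1 - ε)))) {0, 1}

/-- The number `b_k` of closed Reeb orbits of `α'_p` of Morse–Bott index `k`; the contact structure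
has rank `2 (n - 1)`. -/
def perturbedCount (n p : ℕ) (ε : ℝ)
    (φ : ℝ → EuclideanSpace ℂ (Fin (n + 1)) → EuclideanSpace ℂ (Fin (n + 1)))
    (h : ℝ → EuclideanSpace ℂ (Fin (n + 1)) → ℝ) (k : ℤ) : ℕ∞ :=
  closedOrbitCount (n - 1) (brieskornSphere n p) (brieskornTangent n p) (perturbedForm n p ε) φ h k

/-- `f_p (l) = (l - 1) (n - 2) + 2 ⌈l / p⌉`. -/
def indexFun (n p : ℕ) (l : ℤ) : ℤ := (l - 1) * ((n : ℤ) - 2) + 2 * ⌈(l : ℚ) / (p : ℚ)⌉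

end

/-!
The argument has three parts: the Reeb flow is linear and its closed orbits can be listed; the
Morse–Bott index of each critical point is well defined and is a sum of integer parts; for small
`ε` these indices fill disjoint windows, one for each integer `l`.

**The flow.** The Reeb field of `K⁻¹ α_p` is the restriction of a linear vector field on `ℂⁿ⁺¹`: it
rotates `w₀` and `w₁` with the angular velocities `2 (1 + ε)` and `2 (1 - ε)`, the coordinates
`z₂, …, z_{n-1}` with the velocity `2`, and `z_n` with the velocity `4 / p`. Hence the flow exists
and is unique (`exists_perturbedReebFlow`, `perturbedReebFlow_unique`). As `ε` is irrational, on a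
closed orbit either `w₀` and `w₁` vanish or only one of them does not and all other coordinates
do. So the periods are `Lπ/2` and `Lπ/(2(1 ± ε))` with `L` even, and the sets of periodic points
are cut out of `Σ_p` by linear equations
(`exists_period`, `periodicSet_period`). Their dimensions are those of the tangent cones
(`IsLocalParam.dim_fixedSet`).

**The index is well defined.** The Hessian of a function at a critical point does not depend on the
parametrization (`HasMorseIndexOn.unique`). For a path of symplectic matrices from the identity,
subdivided into small steps, the fixed vectors of the endpoint form the radical of a symmetric
form, the discrete action functional on closed polygons. The Robbin–Salamon crossing sum is
therefore half the change of its signature along the path (`two_mul_crossingSum`), and as the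
signature is constant while the radical has constant dimension, crossing sums are homotopy
invariant (`CrossingSum.eq_of_homotopic`). A trivialization of the contact structure over a disc
extends to one of the constant bundle `ℂⁿ⁺¹`. There two trivializations over discs differ by a
contractible loop, and the index does not see the stabilization (`crossingSum_unique`,
`HasConleyZehnderIndex.unique`).

**The value of the index.** Each closed orbit bounds a disc in `Σ_p` that is equivariant for a
circle action, and along it the contact structure has an explicit unitary frame which the flow
rotates diagonally (`hasConleyZehnderIndex_adaptVec`). The existence of the frame uses coordinates
of `ℂⁿ`, adapted to the orbit, in which `∑ z_j²` is a sum of two hyperbolic planes and of squares.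
The index is a sum of terms `⌊x⌋ + ⌈x⌉`, one for each rotation (`hasConleyZehnderIndex_period`).

**Counting.** Pairs `(T, x)` thus correspond to labels `(τ, L, c)`, where `τ ∈ {0, 1, -1}` and `L`
give the period and `c` is the Morse index (`perturbedCount_eq`). Orbits with large `L` have large
index uniformly in `ε` (`le_czIndex`), so that for `k ≤ M` only finitely many `L` matter, and for
small `ε` the indices take their limiting values (`mem_labels_iff`). The labels of index `k` are
then read off window by window (`mem_labels_even`, `mem_labels_odd`,
`exists_window_of_mem_labels`).
-/

open scoped ContDiff

noncomputable section

/-! ### Signatures of families of symmetric bilinear forms -/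

section Signature

open Filter Topology Module

variable {E : Type*} [NormedAddCommGroup E] [NormedSpace ℝ E]

/-- The quadratic form `x ↦ B x x`. -/
def formQuad (B : LinearMap.BilinForm ℝ E) : QuadraticForm ℝ E :=
  LinearMap.BilinMap.toQuadraticMap B

@[simp] lemma formQuad_apply (B : LinearMap.BilinForm ℝ E) (x : E) : formQuad B x = B x x := rfl

/-- Symmetric bilinear forms. -/
def IsSymmForm (B : LinearMap.BilinForm ℝ E) : Prop := ∀ x y, B x y = B y x

/-- The radical of a symmetric bilinear form. -/
def formKer (B : LinearMap.BilinForm ℝ E) : Submodule ℝ E := LinearMap.ker B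

lemma mem_formKer {B : LinearMap.BilinForm ℝ E} {x : E} : x ∈ formKer B ↔ ∀ y, B x y = 0 := by
  simp [formKer, LinearMap.ext_iff]

/-- The signature: positive minus negative index of inertia. -/
def formSign (B : LinearMap.BilinForm ℝ E) : ℤ :=
  (sigPos (formQuad B) : ℤ) - (sigNeg (formQuad B) : ℤ)

lemma formQuad_radical {B : LinearMap.BilinForm ℝ E} (hB : IsSymmForm B) :
    (formQuad B).radical = formKer B := by
  rw [QuadraticMap.radical_eq_ker_polarBilin]
  ext x
  rw [mem_formKer, LinearMap.mem_ker, LinearMap.ext_iff]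
  refine forall_congr' fun y => ?_
  simp only [QuadraticMap.polarBilin_apply_apply, QuadraticMap.polar, formQuad_apply, map_add,
    LinearMap.add_apply, LinearMap.zero_apply]
  rw [hB y x]
  constructor <;> intro h <;> linarith

variable [FiniteDimensional ℝ E]

lemma exists_definite_decomposition {B : LinearMap.BilinForm ℝ E} (hB : IsSymmForm B) :
    ∃ P N : Submodule ℝ E, (∀ v ∈ P, v ≠ 0 → 0 < B v v) ∧ (∀ v ∈ N, v ≠ 0 → B v v < 0) ∧
      finrank ℝ P + finrank ℝ N + finrank ℝ (formKer B) = finrank ℝ E ∧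
      formSign B = (finrank ℝ P : ℤ) - finrank ℝ N := by
  obtain ⟨P, hP, hP'⟩ := exists_finrank_eq_sigPos_and_posDef (formQuad B)
  obtain ⟨N, hN, hN'⟩ := exists_finrank_eq_sigNeg_and_negDef (formQuad B)
  refine ⟨P, N, fun v hv h0 => ?_, fun v hv h0 => ?_, ?_, ?_⟩
  · simpa using hP' ⟨v, hv⟩ (by simpa using h0)
  · simpa using hN' ⟨v, hv⟩ (by simpa using h0)
  · rw [hP, hN, ← formQuad_radical hB]
    exact QuadraticForm.sigPos_add_sigNeg_add_radical
  · rw [hP, hN, formSign]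

/-- Definite subspaces of complementary dimensions determine the signature. -/
lemma formSign_eq_of_definite {B : LinearMap.BilinForm ℝ E} (hB : IsSymmForm B)
    {P N : Submodule ℝ E} (hP : ∀ v ∈ P, v ≠ 0 → 0 < B v v) (hN : ∀ v ∈ N, v ≠ 0 → B v v < 0)
    (hd : finrank ℝ E ≤ finrank ℝ P + finrank ℝ N + finrank ℝ (formKer B)) :
    formSign B = (finrank ℝ P : ℤ) - finrank ℝ N := by
  have h1 : finrank ℝ P ≤ sigPos (formQuad B) := by
    refine le_sigPos_of_posDef _ ?_
    rintro ⟨v, hv⟩ h0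
    simpa using hP v hv (by simpa using h0)
  have h2 : finrank ℝ N ≤ sigNeg (formQuad B) := by
    refine le_sigNeg_of_negDef _ ?_
    rintro ⟨v, hv⟩ h0
    simpa using hN v hv (by simpa using h0)
  have h3 := QuadraticForm.sigPos_add_sigNeg_add_radical (Q := formQuad B)
  rw [formQuad_radical hB] at h3
  rw [formSign]
  omega

/-- A bilinear form on a finite-dimensional space is bounded. -/
lemma exists_bilin_bound (B : LinearMap.BilinForm ℝ E) :
    Continuous (fun v => B v v) ∧ ∃ M, 0 ≤ M ∧ ∀ x y, |B x y| ≤ M * ‖x‖ * ‖y‖ := by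
  set C : E →L[ℝ] E →L[ℝ] ℝ :=
    LinearMap.toContinuousLinearMap (LinearMap.toContinuousLinearMap.toLinearMap ∘ₗ B) with hC
  have h : ∀ x y, B x y = C x y := fun x y => rfl
  refine ⟨?_, ‖C‖, norm_nonneg C, fun x y => C.le_opNorm₂ x y⟩
  simp only [h]
  fun_prop

lemma exists_coercive {B : LinearMap.BilinForm ℝ E} {P : Submodule ℝ E}
    (hP : ∀ v ∈ P, v ≠ 0 → 0 < B v v) : ∃ c > 0, ∀ v ∈ P, c * ‖v‖ ^ 2 ≤ B v v := by
  have hcomp : IsCompact ((P : Set E) ∩ Metric.sphere 0 1) :=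
    (isCompact_sphere _ _).inter_left P.closed_of_finiteDimensional
  have hcont := (exists_bilin_bound B).1
  rcases ((P : Set E) ∩ Metric.sphere 0 1).eq_empty_or_nonempty with he | hne
  · refine ⟨1, one_pos, fun v hv => ?_⟩
    rcases eq_or_ne v 0 with rfl | h0
    · simp
    · exfalso
      have : ‖v‖⁻¹ • v ∈ ((P : Set E) ∩ Metric.sphere 0 1) := by
        refine ⟨P.smul_mem _ hv, ?_⟩
        simp [norm_smul, h0]
      rw [he] at this
      exact this
  · obtain ⟨w, hw, hmin⟩ := hcomp.exists_isMinOn hne hcont.continuousOn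
    refine ⟨B w w, hP w hw.1 ?_, fun v hv => ?_⟩
    · rintro rfl
      simpa using hw.2
    · rcases eq_or_ne v 0 with rfl | h0
      · simp
      · have hv' : ‖v‖⁻¹ • v ∈ ((P : Set E) ∩ Metric.sphere 0 1) := by
          refine ⟨P.smul_mem _ hv, ?_⟩
          simp [norm_smul, h0]
        have h := hmin hv'
        simp only [Set.mem_ofPred_eq, map_smul, LinearMap.smul_apply, smul_eq_mul] at h
        have hn : 0 < ‖v‖ := norm_pos_iff.mpr h0
        rw [← mul_assoc, ← mul_inv, ← pow_two, ← div_eq_inv_mul, le_div_iff₀ (by positivity)] at h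
        exact h

lemma eventually_pos_of_tendsto {ι : Type*} {l : Filter ι} {B : ι → LinearMap.BilinForm ℝ E}
    {B₀ : LinearMap.BilinForm ℝ E} (h : ∀ δ > 0, ∀ᶠ i in l, ∀ x, |B i x x - B₀ x x| ≤ δ * ‖x‖ ^ 2) {P : Submodule ℝ E}
    (hP : ∀ v ∈ P, v ≠ 0 → 0 < B₀ v v) : ∀ᶠ i in l, ∀ v ∈ P, v ≠ 0 → 0 < B i v v := by
  obtain ⟨c, hc, hcP⟩ := exists_coercive hP
  filter_upwards [h (c / 2) (by positivity)] with i hi v hv h0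
  have h2 := (abs_le.mp (hi v)).1
  have h3 := hcP v hv
  have hn : 0 < ‖v‖ ^ 2 := pow_pos (norm_pos_iff.mpr h0) 2
  nlinarith

/-- If `B₀` is positive on `P₀`, vanishes on `P₁`, and `B₁` is positive on `P₁`, then
`B₀ + τ B₁ + o(τ)` is positive on `P₀ ⊔ P₁` for small `τ > 0`. -/
lemma eventually_pos_sup {ι : Type*} {l : Filter ι} {B : ι → LinearMap.BilinForm ℝ E} {τ : ι → ℝ}
    {B₀ B₁ : LinearMap.BilinForm ℝ E} (hτ : Tendsto τ l (𝓝[>] 0))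
    (hB : ∀ δ > 0, ∀ᶠ i in l, ∀ x, |B i x x - B₀ x x - τ i * B₁ x x| ≤ δ * |τ i| * ‖x‖ ^ 2) (hS : IsSymmForm B₀)
    {P₀ P₁ : Submodule ℝ E} (h₀ : ∀ v ∈ P₀, v ≠ 0 → 0 < B₀ v v) (hk : P₁ ≤ formKer B₀)
    (h₁ : ∀ v ∈ P₁, v ≠ 0 → 0 < B₁ v v) :
    ∀ᶠ i in l, ∀ v ∈ P₀ ⊔ P₁, v ≠ 0 → 0 < B i v v := by
  obtain ⟨c₀, hc₀, hcP₀⟩ := exists_coercive h₀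
  obtain ⟨c₁, hc₁, hcP₁⟩ := exists_coercive h₁
  set c := min c₀ c₁
  have hc : 0 < c := lt_min hc₀ hc₁
  obtain ⟨M, hM0, hM⟩ := (exists_bilin_bound B₁).2
  set D := M + 2 * M ^ 2 / c + c / 4 with hD
  have hD0 : 0 < D := by positivity
  have e1 : ∀ᶠ i in l, τ i ∈ Set.Ioo 0 (c / D) := hτ.eventually (Ioo_mem_nhdsGT (by positivity))
  have e2 := hB (c / 8) (by positivity)
  filter_upwards [e1, e2] with i hi hb v hv hv0
  obtain ⟨a, ha, b, hb', rfl⟩ := Submodule.mem_sup.mp hv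
  have ht : 0 < τ i := hi.1
  have htD : τ i * D < c := by
    have := hi.2
    rwa [lt_div_iff₀ hD0] at this
  specialize hb (a + b)
  rw [abs_of_pos ht] at hb
  have hb0 : ∀ y, B₀ b y = 0 := mem_formKer.mp (hk hb')
  have hb1 : B₀ a b = 0 := by rw [hS, hb0]
  have k2 := hM a a
  have k3 := hM a b
  have k4 := hM b a
  have k5 := hcP₀ a ha
  have k6 := hcP₁ b hb'
  have k7 : c * ‖a‖ ^ 2 ≤ B₀ a a := le_trans (by gcongr; exact min_le_left _ _) k5
  have k8 : c * ‖b‖ ^ 2 ≤ B₁ b b := le_trans (by gcongr; exact min_le_right _ _) k6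
  have k9 : ‖a + b‖ * ‖a + b‖ ≤ 2 * (‖a‖ ^ 2 + ‖b‖ ^ 2) := by
    have := norm_add_le a b
    nlinarith [sq_nonneg (‖a‖ - ‖b‖), norm_nonneg (a + b), norm_nonneg a, norm_nonneg b]
  have k10 : |B i (a + b) (a + b) - B₀ (a + b) (a + b) - τ i * B₁ (a + b) (a + b)| ≤
      c / 4 * τ i * (‖a‖ ^ 2 + ‖b‖ ^ 2) := by
    refine hb.trans ?_
    rw [pow_two]
    refine (mul_le_mul_of_nonneg_left k9 (by positivity)).trans (le_of_eq (by ring))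
  simp only [map_add, LinearMap.add_apply, hb0, hb1, add_zero] at k10
  have k11 := (abs_le.mp k10).1
  have k2' := (abs_le.mp k2).1
  have k3' := (abs_le.mp k3).1
  have k4' := (abs_le.mp k4).1
  simp only [map_add, LinearMap.add_apply]
  have amgm : 2 * M * ‖a‖ * ‖b‖ ≤ c / 2 * ‖b‖ ^ 2 + 2 * M ^ 2 / c * ‖a‖ ^ 2 := by
    have : 0 ≤ (c * ‖b‖ - 2 * M * ‖a‖) ^ 2 / (2 * c) := by positivity
    have h2 : (c * ‖b‖ - 2 * M * ‖a‖) ^ 2 / (2 * c) =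
        c / 2 * ‖b‖ ^ 2 + 2 * M ^ 2 / c * ‖a‖ ^ 2 - 2 * M * ‖a‖ * ‖b‖ := by
      field_simp
      ring
    linarith
  have lower : B₁ a a + B₁ a b + (B₁ b a + B₁ b b) ≥
      -(M * ‖a‖ ^ 2) - (c / 2 * ‖b‖ ^ 2 + 2 * M ^ 2 / c * ‖a‖ ^ 2) + c * ‖b‖ ^ 2 := by
    nlinarith
  have hL := mul_le_mul_of_nonneg_left lower ht.le
  have hpos : 0 < (c - τ i * D) * ‖a‖ ^ 2 + τ i * (c / 4) * ‖b‖ ^ 2 := by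
    have hab : a ≠ 0 ∨ b ≠ 0 := by
      by_contra hcon
      push Not at hcon
      exact hv0 (by rw [hcon.1, hcon.2, add_zero])
    have q1 : 0 ≤ (c - τ i * D) * ‖a‖ ^ 2 := mul_nonneg (by linarith) (by positivity)
    have q2 : 0 ≤ τ i * (c / 4) * ‖b‖ ^ 2 := by positivity
    rcases hab with h | h
    · have : 0 < (c - τ i * D) * ‖a‖ ^ 2 :=
        mul_pos (by linarith) (pow_pos (norm_pos_iff.mpr h) 2)
      linarith
    · have : 0 < τ i * (c / 4) * ‖b‖ ^ 2 :=
        mul_pos (by positivity) (pow_pos (norm_pos_iff.mpr h) 2)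
      linarith
  have expand : (c - τ i * D) * ‖a‖ ^ 2 + τ i * (c / 4) * ‖b‖ ^ 2 =
      c * ‖a‖ ^ 2 + τ i * (-(M * ‖a‖ ^ 2) - (c / 2 * ‖b‖ ^ 2 + 2 * M ^ 2 / c * ‖a‖ ^ 2) +
        c * ‖b‖ ^ 2) - c / 4 * τ i * (‖a‖ ^ 2 + ‖b‖ ^ 2) := by
    rw [hD]; ring
  have hBb : B i b a + B i b b + (B i a a + B i a b) = 0 + (B i b a + B i b b + (B i a a + B i a b)) := by ring
  nlinarith

/-- The change of signature of `B₀ + τ B₁ + o(τ)` is the signature of `B₁` on the radical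
of `B₀`. -/
lemma eventually_formSign_add {ι : Type*} {l : Filter ι} {B : ι → LinearMap.BilinForm ℝ E} {τ : ι → ℝ}
    {B₀ B₁ : LinearMap.BilinForm ℝ E} (hτ : Tendsto τ l (𝓝[>] 0))
    (hB : ∀ δ > 0, ∀ᶠ i in l, ∀ x, |B i x x - B₀ x x - τ i * B₁ x x| ≤ δ * |τ i| * ‖x‖ ^ 2) (hS : IsSymmForm B₀)
    (hSi : ∀ᶠ i in l, IsSymmForm (B i)) {p n : ℕ}
    (hI : HasInertia (fun v => B₁ v v) (formKer B₀) p n) :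
    ∀ᶠ i in l, formSign (B i) = formSign B₀ + ((p : ℤ) - n) := by
  obtain ⟨P₀, N₀, hP₀, hN₀, hdim, hsgn⟩ := exists_definite_decomposition hS
  obtain ⟨P₁, N₁, hsup, hdisj, hP₁, hN₁, rfl, rfl⟩ := hI
  have hP₁k : P₁ ≤ formKer B₀ := hsup ▸ le_sup_left
  have hN₁k : N₁ ≤ formKer B₀ := hsup ▸ le_sup_right
  have e1 := eventually_pos_sup hτ hB hS hP₀ hP₁k hP₁
  have e2 : ∀ᶠ i in l, ∀ v ∈ N₀ ⊔ N₁, v ≠ 0 → 0 < (-B i) v v := by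
    refine eventually_pos_sup (B := fun i => -B i) (B₀ := -B₀) (B₁ := -B₁) hτ ?_ ?_ ?_ ?_ ?_
    · intro δ hδ
      filter_upwards [hB δ hδ] with i hi x
      refine le_of_eq_of_le ?_ (hi x)
      rw [← abs_neg]
      simp only [LinearMap.neg_apply]
      congr 1; ring
    · intro x y; simp [hS x y]
    · intro v hv h0; simpa using hN₀ v hv h0
    · intro v hv; rw [mem_formKer]; intro y
      simp [mem_formKer.mp (hN₁k hv) y]
    · intro v hv h0; simpa using hN₁ v hv h0
  have key : ∀ {P K : Submodule ℝ E}, (∀ v ∈ P, v ≠ 0 → B₀ v v ≠ 0) → K ≤ formKer B₀ →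
      finrank ℝ ↥(P ⊔ K) = finrank ℝ P + finrank ℝ K := by
    intro P K hP hK
    have hd : Disjoint P K := by
      rw [Submodule.disjoint_def]
      intro x hx hxK
      by_contra h0
      exact hP x hx h0 (mem_formKer.mp (hK hxK) x)
    have := Submodule.finrank_sup_add_finrank_inf_eq P K
    rw [hd.eq_bot, finrank_bot] at this
    omega
  have d1 := key (fun v hv h0 => (hP₀ v hv h0).ne') hP₁k
  have d2 := key (fun v hv h0 => (hN₀ v hv h0).ne) hN₁k
  have d3 := Submodule.finrank_sup_add_finrank_inf_eq P₁ N₁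
  rw [hdisj.eq_bot, finrank_bot, hsup] at d3
  filter_upwards [e1, e2, hSi] with i h1 h2 h3
  rw [formSign_eq_of_definite h3 h1 (N := N₀ ⊔ N₁) (fun v hv h0 => by simpa using h2 v hv h0),
    hsgn, d1, d2]
  · push_cast; ring
  · rw [d1, d2]; omega

/-- The signature is locally constant where the dimension of the radical is constant. -/
lemma eventually_formSign_eq {ι : Type*} {l : Filter ι} {B : ι → LinearMap.BilinForm ℝ E}
    {B₀ : LinearMap.BilinForm ℝ E} (h : ∀ δ > 0, ∀ᶠ i in l, ∀ x, |B i x x - B₀ x x| ≤ δ * ‖x‖ ^ 2) (hS : IsSymmForm B₀)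
    (hSi : ∀ᶠ i in l, IsSymmForm (B i))
    (hk : ∀ᶠ i in l, finrank ℝ (formKer (B i)) = finrank ℝ (formKer B₀)) :
    ∀ᶠ i in l, formSign (B i) = formSign B₀ := by
  obtain ⟨P₀, N₀, hP₀, hN₀, hdim, hsgn⟩ := exists_definite_decomposition hS
  have e1 := eventually_pos_of_tendsto h hP₀
  have e2 := eventually_pos_of_tendsto (B := fun i => -B i) (B₀ := -B₀) (l := l) (P := N₀) (by
    intro δ hδ
    filter_upwards [h δ hδ] with i hi x
    refine le_of_eq_of_le ?_ (hi x)
    rw [← abs_neg]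
    simp only [LinearMap.neg_apply]
    congr 1; ring) (fun v hv h0 => by simpa using hN₀ v hv h0)
  filter_upwards [e1, e2, hSi, hk] with i h1 h2 h3 h4
  rw [formSign_eq_of_definite h3 h1 (fun v hv h0 => by simpa using h2 v hv h0) (by omega), hsgn]

/-- The jumps of the signature of a differentiable family. -/
lemma formSign_jump {B : ℝ → LinearMap.BilinForm ℝ E}
    {B' : LinearMap.BilinForm ℝ E} {s : Set ℝ} {t₀ : ℝ}
    (ht₀ : t₀ ∈ s) (hS : ∀ t ∈ s, IsSymmForm (B t)) 
    (hd : ∀ δ > 0, ∀ᶠ t in 𝓝[s] t₀, ∀ x,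
      |B t x x - B t₀ x x - (t - t₀) * B' x x| ≤ δ * |t - t₀| * ‖x‖ ^ 2) {p n : ℕ}
    (hI : HasInertia (fun v => B' v v) (formKer (B t₀)) p n) :
    (∀ᶠ t in 𝓝[s ∩ Set.Ioi t₀] t₀, formSign (B t) = formSign (B t₀) + ((p : ℤ) - n)) ∧
    (∀ᶠ t in 𝓝[s ∩ Set.Iio t₀] t₀, formSign (B t) = formSign (B t₀) - ((p : ℤ) - n)) := by
  have hIneg : HasInertia (fun v => (-B') v v) (formKer (B t₀)) n p := by
    obtain ⟨P, N, h1, h2, h3, h4, h5, h6⟩ := hI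
    refine ⟨N, P, by rw [sup_comm, h1], h2.symm, fun v hv h0 => ?_, fun v hv h0 => ?_, h6, h5⟩
    · simpa using h4 v hv h0
    · simpa using h3 v hv h0
  constructor
  · refine eventually_formSign_add (τ := fun t => t - t₀) (B₁ := B') ?_
      (fun δ hδ => (hd δ hδ).filter_mono (nhdsWithin_mono _ Set.inter_subset_left)) (hS t₀ ht₀) ?_ hI
    · rw [tendsto_nhdsWithin_iff]
      refine ⟨?_, ?_⟩
      · have : Tendsto (fun t : ℝ => t - t₀) (𝓝 t₀) (𝓝 (t₀ - t₀)) := by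
          exact (continuous_id.sub continuous_const).tendsto _
        rw [sub_self] at this
        exact this.mono_left nhdsWithin_le_nhds
      · filter_upwards [self_mem_nhdsWithin] with t ht
        simpa using ht.2
    · filter_upwards [self_mem_nhdsWithin] with t ht using hS t ht.1
  · have := eventually_formSign_add (l := 𝓝[s ∩ Set.Iio t₀] t₀) (B := B) (B₀ := B t₀)
      (τ := fun t => t₀ - t) (B₁ := -B') ?_ ?_ (hS t₀ ht₀) ?_ hIneg
    · filter_upwards [this] with t ht
      rw [ht]; ring
    · rw [tendsto_nhdsWithin_iff]
      refine ⟨?_, ?_⟩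
      · have : Tendsto (fun t : ℝ => t₀ - t) (𝓝 t₀) (𝓝 (t₀ - t₀)) := by
          exact (continuous_const.sub continuous_id).tendsto _
        rw [sub_self] at this
        exact this.mono_left nhdsWithin_le_nhds
      · filter_upwards [self_mem_nhdsWithin] with t ht
        simpa using ht.2
    · intro δ hδ
      filter_upwards [(hd δ hδ).filter_mono (nhdsWithin_mono _ Set.inter_subset_left)] with t ht x
      refine le_of_eq_of_le ?_ ((ht x).trans (le_of_eq ?_))
      · rw [LinearMap.neg_apply, LinearMap.neg_apply]
        congr 1; ring
      · rw [abs_sub_comm]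
    · filter_upwards [self_mem_nhdsWithin] with t ht using hS t ht.1

end Signature

/-! ### Step functions -/

section Steps

open Filter Topology

/-- A function that jumps at finitely many points by prescribed amounts `s` on each side. -/
lemma sub_eq_sum_jumps {T : ℝ} (hT : 0 < T) {f s : ℝ → ℝ} {C : Finset ℝ}
    (hC : ∀ t ∈ C, t ∈ Set.Icc 0 T) (hs : ∀ t, t ∉ C → s t = 0)
    (hr : ∀ t ∈ Set.Icc 0 T, ∀ᶠ t' in 𝓝[Set.Icc 0 T ∩ Set.Ioi t] t, f t' = f t + s t)
    (hl : ∀ t ∈ Set.Icc 0 T, ∀ᶠ t' in 𝓝[Set.Icc 0 T ∩ Set.Iio t] t, f t' = f t - s t) :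
    f T - f 0 = ∑ t ∈ C, (if t = 0 ∨ t = T then 1 else 2) * s t := by
  set g : ℝ → ℝ := fun t => f t - ∑ c ∈ C, (if c < t then 2 * s c else if c = t then s c else 0)
    with hg
  have near : ∀ t : ℝ, ∀ᶠ t' in 𝓝 t, ∀ c ∈ C, c ≠ t → |t' - t| < |c - t| := by
    intro t
    rw [eventually_all_finset]
    intro c _
    by_cases hct : c = t
    · simp [hct]
    · have : 0 < |c - t| := abs_pos.mpr (sub_ne_zero.mpr hct)
      filter_upwards [Metric.ball_mem_nhds t this] with t' ht' _
      simpa [Real.dist_eq] using ht'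
  have st : ∀ t, s t = ∑ c ∈ C, (if c = t then s c else 0) := by
    intro t
    rw [Finset.sum_ite_eq' C t s]
    split_ifs with h
    · rfl
    · exact hs t h
  have hgc : ∀ t ∈ Set.Icc 0 T, ∀ᶠ t' in 𝓝[Set.Icc 0 T] t, g t' = g t := by
    intro t ht
    have hsplit : Set.Icc 0 T ⊆ ((Set.Icc 0 T ∩ Set.Ioi t) ∪ (Set.Icc 0 T ∩ Set.Iio t)) ∪ {t} := by
      intro x hx
      rcases lt_trichotomy x t with h | h | h
      · exact Or.inl (Or.inr ⟨hx, h⟩)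
      · exact Or.inr h
      · exact Or.inl (Or.inl ⟨hx, h⟩)
    refine Eventually.filter_mono (nhdsWithin_mono t hsplit) ?_
    rw [nhdsWithin_union, nhdsWithin_union, nhdsWithin_singleton]
    refine eventually_sup.mpr ⟨eventually_sup.mpr ⟨?_, ?_⟩, by simp⟩
    · filter_upwards [hr t ht, (near t).filter_mono nhdsWithin_le_nhds, self_mem_nhdsWithin]
        with t' h1 h2 h3
      have h3' : t < t' := h3.2
      simp only [hg]
      rw [h1, st t, add_sub_assoc, sub_eq_add_neg (f t), add_right_inj, ← Finset.sum_sub_distrib,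
        ← Finset.sum_neg_distrib]
      refine Finset.sum_congr rfl fun c hc => ?_
      rcases lt_trichotomy c t with h | h | h
      · simp [h, h.trans h3', h.ne]
      · subst h; simp [h3']; ring
      · have := h2 c hc h.ne'
        rw [abs_of_pos (sub_pos.mpr h3'), abs_of_pos (sub_pos.mpr h)] at this
        have h4 : t' < c := by linarith
        simp [h.not_gt, h4.not_gt, h.ne', h4.ne']
    · filter_upwards [hl t ht, (near t).filter_mono nhdsWithin_le_nhds, self_mem_nhdsWithin]
        with t' h1 h2 h3
      have h3' : t' < t := h3.2
      simp only [hg]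
      rw [h1, st t, sub_sub, sub_eq_add_neg (f t), sub_eq_add_neg (f t), add_right_inj,
        neg_inj, ← Finset.sum_add_distrib]
      refine Finset.sum_congr rfl fun c hc => ?_
      rcases lt_trichotomy c t with h | h | h
      · have := h2 c hc h.ne
        rw [abs_of_neg (sub_neg.mpr h3'), abs_of_neg (sub_neg.mpr h)] at this
        have h4 : c < t' := by linarith
        simp [h, h4, h.ne]
      · subst h; simp [h3'.not_gt, h3'.ne']
      · have h4 := h3'.trans h
        simp [h.not_gt, h4.not_gt, h.ne', h4.ne']
  have hconst : g T = g 0 := by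
    refine constant_of_has_deriv_right_zero (f := g) (a := 0) (b := T) ?_ ?_ T
      (Set.right_mem_Icc.mpr hT.le)
    · intro t ht
      exact (tendsto_const_nhds.congr' ((hgc t ht).mono fun _ h => h.symm))
    · intro t ht
      have h1 : ∀ᶠ t' in 𝓝[Set.Ici t] t, g t' = g t := by
        have h2 := hgc t ⟨ht.1, ht.2.le⟩
        refine Eventually.filter_mono ?_ h2
        rw [nhdsWithin_le_iff]
        filter_upwards [self_mem_nhdsWithin, mem_nhdsWithin_of_mem_nhds (Iio_mem_nhds ht.2)]
          with x hx hx'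
        exact ⟨ht.1.trans hx, (le_of_lt hx')⟩
      exact (hasDerivWithinAt_const t (Set.Ici t) (g t)).congr_of_eventuallyEq h1 rfl
  have hg0 : g 0 = f 0 - ∑ c ∈ C, (if c = 0 then s c else 0) := by
    simp only [hg]
    congr 1
    refine Finset.sum_congr rfl fun c hc => ?_
    simp [(hC c hc).1.not_gt]
  rw [hg0] at hconst
  simp only [hg] at hconst
  have : f T - f 0 = ∑ c ∈ C, (if c < T then 2 * s c else if c = T then s c else 0) -
      ∑ c ∈ C, (if c = 0 then s c else 0) := by linarith
  rw [this, ← Finset.sum_sub_distrib]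
  refine Finset.sum_congr rfl fun c hc => ?_
  rcases eq_or_ne c 0 with rfl | h0
  · simp [hT]; ring
  · rcases eq_or_ne c T with rfl | hT'
    · simp [h0]
    · have : c < T := lt_of_le_of_ne (hC c hc).2 hT'
      simp [h0, hT', this]

end Steps

/-! ### Homotopy invariance of the crossing sum -/

section Crossing

open Filter Topology Module

variable {V : Type*} [NormedAddCommGroup V] [NormedSpace ℝ V]

/-- A symplectic form on a real vector space. -/
structure IsSympForm (Ω : LinearMap.BilinForm ℝ V) : Prop where
  alt : ∀ x, Ω x x = 0
  nondeg : ∀ x, (∀ y, Ω x y = 0) → x = 0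

lemma IsSympForm.skew {Ω : LinearMap.BilinForm ℝ V} (hΩ : IsSympForm Ω) (x y : V) :
    Ω x y = -Ω y x := by
  have := hΩ.alt (x + y)
  simp only [map_add, LinearMap.add_apply, hΩ.alt, zero_add, add_zero] at this
  linarith

/-- Linear maps that preserve the form `Ω`. -/
def PreservesForm (Ω : LinearMap.BilinForm ℝ V) (A : V →L[ℝ] V) : Prop :=
  ∀ v w, Ω (A v) (A w) = Ω v w

/-- `HasCrossingSum` for paths in the symplectic group of an arbitrary form `Ω`. -/
def CrossingSum (Ω : LinearMap.BilinForm ℝ V) (T : ℝ) (Ψ : ℝ → V →L[ℝ] V) (μ : ℝ) : Prop :=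
  (∀ t ∈ Set.Icc 0 T, PreservesForm Ω (Ψ t)) ∧
  ∃ Ψ' : ℝ → V →L[ℝ] V,
    ContinuousOn Ψ' (Set.Icc 0 T) ∧
    (∀ t ∈ Set.Icc 0 T, HasDerivWithinAt Ψ (Ψ' t) (Set.Icc 0 T) t) ∧
    ∃ (C : Finset ℝ) (pos neg : ℝ → ℕ),
      (∀ t, t ∈ C ↔ t ∈ Set.Icc 0 T ∧ ∃ v, v ≠ 0 ∧ Ψ t v = v) ∧
      (∀ t ∈ C, HasInertia (fun v => Ω v (Ψ' t v))
        (LinearMap.ker (Ψ t - ContinuousLinearMap.id ℝ _).toLinearMap) (pos t) (neg t)) ∧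
      μ = ∑ t ∈ C, (if t = 0 ∨ t = T then (1 / 2 : ℝ) else 1) * ((pos t : ℝ) - neg t)

/-- `SymplecticHomotopic` for paths in the symplectic group of an arbitrary form `Ω`. -/
def FormHomotopic (Ω : LinearMap.BilinForm ℝ V) (T : ℝ) (Ψ₀ Ψ₁ : ℝ → V →L[ℝ] V) : Prop :=
  ∃ H : ℝ × ℝ → V →L[ℝ] V,
    ContinuousOn H (Set.Icc 0 1 ×ˢ Set.Icc 0 T) ∧
    (∀ s ∈ Set.Icc (0 : ℝ) 1, ∀ t ∈ Set.Icc 0 T, PreservesForm Ω (H (s, t))) ∧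
    (∀ t ∈ Set.Icc 0 T, H (0, t) = Ψ₀ t ∧ H (1, t) = Ψ₁ t) ∧
    (∀ s ∈ Set.Icc (0 : ℝ) 1, H (s, 0) = Ψ₀ 0 ∧ H (s, T) = Ψ₀ T)

/-- The Cayley transform `2 (A - 1) (A + 1)⁻¹`. -/
def cayley (A : V →L[ℝ] V) : V →L[ℝ] V := (2 : ℝ) • ((A - 1) * Ring.inverse (A + 1))

lemma cayley_apply {A : V →L[ℝ] V} (hA : IsUnit (A + 1)) (y : V) :
    cayley A (A y + y) = (2 : ℝ) • (A y - y) := by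
  have h := Ring.inverse_mul_cancel _ hA
  have h2 : Ring.inverse (A + 1) (A y + y) = y := by
    have := congrArg (fun L : V →L[ℝ] V => L y) h
    simpa using this
  simp [cayley, h2]

lemma exists_cayley_preimage {A : V →L[ℝ] V} (hA : IsUnit (A + 1)) (m : V) :
    ∃ y, m = A y + y := by
  have h := Ring.mul_inverse_cancel _ hA
  refine ⟨Ring.inverse (A + 1) m, ?_⟩
  have := congrArg (fun L : V →L[ℝ] V => L m) h
  simpa using this.symm

lemma cayley_symm {Ω : LinearMap.BilinForm ℝ V} (hΩ : IsSympForm Ω) {A : V →L[ℝ] V}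
    (hA : IsUnit (A + 1)) (hp : PreservesForm Ω A) (m m' : V) :
    Ω m (cayley A m') = Ω m' (cayley A m) := by
  obtain ⟨y, rfl⟩ := exists_cayley_preimage hA m
  obtain ⟨y', rfl⟩ := exists_cayley_preimage hA m'
  rw [cayley_apply hA, cayley_apply hA]
  simp only [map_add, map_sub, map_smul, LinearMap.add_apply, smul_eq_mul]
  rw [hp y y', hp y' y, hΩ.skew (A y) y', hΩ.skew (A y') y, hΩ.skew y' y]
  ring

/-- Midpoint of the edge from `x j` to `x (j + 1)` of a closed polygon. -/
def edgeMid {k : ℕ} (x : Fin (k + 1) → V) (j : Fin (k + 1)) : V := (1 / 2 : ℝ) • (x (j + 1) + x j)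

/-- The bilinear form `∑ Ω (m_j x) (b_j (m_j y))` on closed polygons. -/
def midForm {k : ℕ} (Ω : LinearMap.BilinForm ℝ V) (b : Fin (k + 1) → V →L[ℝ] V) :
    LinearMap.BilinForm ℝ (Fin (k + 1) → V) :=
  LinearMap.mk₂ ℝ (fun x y => ∑ j, Ω (edgeMid x j) (b j (edgeMid y j)))
    (by intro x x' y
        rw [← Finset.sum_add_distrib]
        refine Finset.sum_congr rfl fun j _ => ?_
        simp only [edgeMid, Pi.add_apply, map_add, map_smul, LinearMap.add_apply,
          LinearMap.smul_apply, smul_eq_mul]; ring)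
    (by intro c x y
        rw [Finset.smul_sum]
        refine Finset.sum_congr rfl fun j _ => ?_
        simp only [edgeMid, Pi.smul_apply, map_add, map_smul, LinearMap.add_apply,
          LinearMap.smul_apply, smul_eq_mul]; ring)
    (by intro x y y'
        rw [← Finset.sum_add_distrib]
        refine Finset.sum_congr rfl fun j _ => ?_
        simp only [edgeMid, Pi.add_apply, map_add, map_smul, LinearMap.add_apply,
          LinearMap.smul_apply, smul_eq_mul]; ring)
    (by intro c x y
        rw [Finset.smul_sum]
        refine Finset.sum_congr rfl fun j _ => ?_
        simp only [edgeMid, Pi.smul_apply, map_add, map_smul, LinearMap.add_apply,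
          LinearMap.smul_apply, smul_eq_mul]; ring)

/-- The symplectic area form `∑ Ω (m_j x) (y (j + 1) - y j)` on closed polygons. -/
def areaForm (k : ℕ) (Ω : LinearMap.BilinForm ℝ V) : LinearMap.BilinForm ℝ (Fin (k + 1) → V) :=
  LinearMap.mk₂ ℝ (fun x y => ∑ j, Ω (edgeMid x j) (y (j + 1) - y j))
    (by intro x x' y
        rw [← Finset.sum_add_distrib]
        refine Finset.sum_congr rfl fun j _ => ?_
        simp only [edgeMid, Pi.add_apply, map_add, map_sub, map_smul, LinearMap.add_apply,
          LinearMap.smul_apply, smul_eq_mul]; ring)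
    (by intro c x y
        rw [Finset.smul_sum]
        refine Finset.sum_congr rfl fun j _ => ?_
        simp only [edgeMid, Pi.smul_apply, map_add, map_sub, map_smul, LinearMap.add_apply,
          LinearMap.smul_apply, smul_eq_mul]; ring)
    (by intro x y y'
        rw [← Finset.sum_add_distrib]
        refine Finset.sum_congr rfl fun j _ => ?_
        simp only [edgeMid, Pi.add_apply, map_add, map_sub, map_smul, LinearMap.add_apply,
          LinearMap.smul_apply, smul_eq_mul]; ring)
    (by intro c x y
        rw [Finset.smul_sum]
        refine Finset.sum_congr rfl fun j _ => ?_
        simp only [edgeMid, Pi.smul_apply, map_add, map_sub, map_smul, LinearMap.add_apply,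
          LinearMap.smul_apply, smul_eq_mul]; ring)

/-- The discrete action form of a composition of symplectic maps with Cayley transforms `b j`. -/
def actionForm {k : ℕ} (Ω : LinearMap.BilinForm ℝ V) (b : Fin (k + 1) → V →L[ℝ] V) :
    LinearMap.BilinForm ℝ (Fin (k + 1) → V) :=
  midForm Ω b - areaForm k Ω

lemma actionForm_apply {k : ℕ} (Ω : LinearMap.BilinForm ℝ V) (b : Fin (k + 1) → V →L[ℝ] V)
    (x y : Fin (k + 1) → V) :
    actionForm Ω b x y = ∑ j, Ω (edgeMid x j) (b j (edgeMid y j) - (y (j + 1) - y j)) := by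
  simp only [actionForm, midForm, areaForm, LinearMap.sub_apply, LinearMap.mk₂_apply,
    ← Finset.sum_sub_distrib, map_sub]

lemma sum_shift {k : ℕ} {M : Type*} [AddCommMonoid M] (f : Fin (k + 1) → M) :
    ∑ j, f (j + 1) = ∑ j, f j :=
  Equiv.sum_comp (Equiv.addRight (1 : Fin (k + 1))) f

lemma areaForm_symm {Ω : LinearMap.BilinForm ℝ V} (hΩ : IsSympForm Ω) {k : ℕ}
    (x y : Fin (k + 1) → V) : areaForm k Ω x y = areaForm k Ω y x := by
  have h1 := sum_shift (fun j => Ω (x j) (y j))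
  simp only [areaForm, LinearMap.mk₂_apply]
  rw [← sub_eq_zero, ← Finset.sum_sub_distrib]
  have : ∀ j, Ω (edgeMid x j) (y (j + 1) - y j) - Ω (edgeMid y j) (x (j + 1) - x j) =
      Ω (x (j + 1)) (y (j + 1)) - Ω (x j) (y j) := by
    intro j
    simp only [edgeMid, map_add, map_sub, map_smul, LinearMap.add_apply,
          LinearMap.smul_apply, smul_eq_mul]
    rw [hΩ.skew (y (j + 1)) (x (j + 1)), hΩ.skew (y j) (x j), hΩ.skew (y (j + 1)) (x j),
      hΩ.skew (y j) (x (j + 1))]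
    ring
  rw [Finset.sum_congr rfl fun j _ => this j, Finset.sum_sub_distrib, h1, sub_self]

lemma actionForm_symm {Ω : LinearMap.BilinForm ℝ V} (hΩ : IsSympForm Ω) {k : ℕ}
    {A : Fin (k + 1) → V →L[ℝ] V} (hA : ∀ j, IsUnit (A j + 1)) (hp : ∀ j, PreservesForm Ω (A j)) :
    IsSymmForm (actionForm Ω fun j => cayley (A j)) := by
  intro x y
  simp only [actionForm, LinearMap.sub_apply, areaForm_symm hΩ x y, midForm, LinearMap.mk₂_apply]
  congr 1
  exact Finset.sum_congr rfl fun j _ => cayley_symm hΩ (hA j) (hp j) _ _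

/-- On a cycle of odd length there is no alternating assignment but zero. This is why the
subdivisions below have an odd number `k + 1` of steps. -/
lemma alternating_cycle {k : ℕ} (hk : Even k) {e : Fin (k + 1) → V}
    (h : ∀ j, e (j + 1) + e j = 0) : ∀ j, e j = 0 := by
  have h1 : ∀ i : ℕ, ∀ hi : i < k + 1, e ⟨i, hi⟩ = (-1 : ℝ) ^ i • e 0 := by
    intro i
    induction i with
    | zero => intro hi; simp
    | succ i ih =>
      intro hi
      have h3 : (⟨i, by omega⟩ : Fin (k + 1)) + 1 = ⟨i + 1, hi⟩ := by
        apply Fin.ext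
        rw [Fin.val_add_one_of_lt]
        rw [Fin.lt_def]; simp; omega
      have := h ⟨i, by omega⟩
      rw [← h3, eq_neg_of_add_eq_zero_left this, ih, pow_succ]
      simp
  have h2 := h (Fin.last k)
  have h4 : e (Fin.last k) = e 0 := by
    have := h1 k (by omega)
    rw [hk.neg_one_pow, one_smul] at this
    exact this
  rw [Fin.last_add_one, h4, ← two_smul ℝ, smul_eq_zero] at h2
  have h5 : e 0 = 0 := h2.resolve_left two_ne_zero
  intro j
  rw [h1 j j.2, h5, smul_zero]

/-- The radical of the discrete action form consists of the closed discrete orbits. -/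
lemma mem_formKer_actionForm {Ω : LinearMap.BilinForm ℝ V} (hΩ : IsSympForm Ω) {k : ℕ}
    (hk : Even k) {A : Fin (k + 1) → V →L[ℝ] V} (hA : ∀ j, IsUnit (A j + 1))
    (hp : ∀ j, PreservesForm Ω (A j)) {x : Fin (k + 1) → V} :
    x ∈ formKer (actionForm Ω fun j => cayley (A j)) ↔ ∀ j, x (j + 1) = A j (x j) := by
  have hs := actionForm_symm hΩ hA hp
  set e : Fin (k + 1) → V := fun j => cayley (A j) (edgeMid x j) - (x (j + 1) - x j) with he
  have key : (∀ j, e j = 0) ↔ ∀ j, x (j + 1) = A j (x j) := by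
    refine forall_congr' fun j => ?_
    constructor
    · intro h
      obtain ⟨y, hy⟩ := exists_cayley_preimage (hA j) (edgeMid x j)
      simp only [he, hy, cayley_apply (hA j)] at h
      have h1 : (2 : ℝ) • (A j y + y) = x (j + 1) + x j := by
        rw [← hy, edgeMid, smul_smul]; norm_num
      have h2 : (2 : ℝ) • (A j y - y) = x (j + 1) - x j := sub_eq_zero.mp h
      have h3 : x j = (2 : ℝ) • y := by
        have : (2 : ℝ) • x j = (2 : ℝ) • ((2 : ℝ) • y) := by
          calc (2 : ℝ) • x j = (x (j + 1) + x j) - (x (j + 1) - x j) := by rw [two_smul]; abel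
            _ = (2 : ℝ) • ((2 : ℝ) • y) := by
              rw [← h1, ← h2, ← smul_sub, two_smul ℝ y]; congr 1; abel
        exact smul_right_injective V (two_ne_zero) this
      have h4 : x (j + 1) = (2 : ℝ) • A j y := by
        have : (2 : ℝ) • x (j + 1) = (2 : ℝ) • ((2 : ℝ) • A j y) := by
          calc (2 : ℝ) • x (j + 1) = (x (j + 1) + x j) + (x (j + 1) - x j) := by
                rw [two_smul]; abel
            _ = (2 : ℝ) • ((2 : ℝ) • A j y) := by
              rw [← h1, ← h2, ← smul_add, two_smul ℝ (A j y)]; congr 1; abel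
        exact smul_right_injective V (two_ne_zero) this
      rw [h4, h3, map_smul]
    · intro h
      have : edgeMid x j = A j ((1 / 2 : ℝ) • x j) + (1 / 2 : ℝ) • x j := by
        rw [edgeMid, h, map_smul, smul_add]
      simp only [he]
      rw [this, cayley_apply (hA j), h, map_smul, ← smul_sub, smul_smul]; norm_num
  rw [← key, mem_formKer]
  have hval : ∀ y, actionForm Ω (fun j => cayley (A j)) x y =
      (1 / 2 : ℝ) * ∑ j, Ω (y (j + 1)) (e (j + 1) + e j) := by
    intro y
    have h1 := sum_shift (fun j => Ω (y j) (e j))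
    rw [hs x y, actionForm_apply]
    simp only [map_add, Finset.sum_add_distrib]
    rw [h1, ← Finset.sum_add_distrib, Finset.mul_sum]
    refine Finset.sum_congr rfl fun j _ => ?_
    change Ω (edgeMid y j) (e j) = _
    simp only [edgeMid, map_add, map_smul, LinearMap.add_apply, LinearMap.smul_apply, smul_eq_mul]
    ring
  constructor
  · intro h
    -- The defects `e j` of two adjacent edges cancel; as the number of edges is odd, they vanish.
    refine alternating_cycle hk fun j => hΩ.nondeg _ fun v => ?_
    have h1 := h (Pi.single (j + 1) v)
    rw [hval, Finset.sum_eq_single j] at h1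
    · rw [Pi.single_eq_same] at h1
      rw [hΩ.skew]; linarith
    · intro i _ hij
      rw [Pi.single_eq_of_ne (fun hc => hij (add_right_cancel hc))]; simp
    · simp
  · intro h y
    rw [hval]
    simp [h]

lemma PreservesForm.mul {Ω : LinearMap.BilinForm ℝ V} {A B : V →L[ℝ] V}
    (hA : PreservesForm Ω A) (hB : PreservesForm Ω B) : PreservesForm Ω (A * B) := by
  intro v w
  change Ω (A (B v)) (A (B w)) = _
  rw [hA, hB]

/-- The variation of the generating function of `A`. -/
lemma form_cayley_deriv {Ω : LinearMap.BilinForm ℝ V} (hΩ : IsSympForm Ω) {A A' : V →L[ℝ] V}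
    (hA : IsUnit (A + 1)) (hp : PreservesForm Ω A) (y : V) {m : V}
    (hm : m = (1 / 2 : ℝ) • (A y + y)) :
    Ω m ((((2 : ℝ) • 1 - cayley A) * A' * Ring.inverse (A + 1)) m) = Ω (A y) (A' y) := by
  have h := Ring.inverse_mul_cancel _ hA
  have h2 : Ring.inverse (A + 1) (A y + y) = y := by
    have := congrArg (fun L : V →L[ℝ] V => L y) h
    simpa using this
  have h3 : (((2 : ℝ) • 1 - cayley A) * A' * Ring.inverse (A + 1)) m =
      (1 / 2 : ℝ) • ((2 : ℝ) • A' y - cayley A (A' y)) := by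
    rw [hm, map_smul]
    congr 1
    change ((2 : ℝ) • (1 : V →L[ℝ] V) - cayley A) (A' (Ring.inverse (A + 1) (A y + y))) = _
    rw [h2]; simp
  rw [h3, map_smul, map_sub, map_smul, cayley_symm hΩ hA hp m (A' y), hΩ.skew (A' y), hm,
    map_smul (cayley A), cayley_apply hA]
  simp only [map_add, map_sub, map_smul, LinearMap.add_apply, LinearMap.sub_apply,
    LinearMap.smul_apply, smul_eq_mul]
  ring

lemma frac_mem {k j : ℕ} (hj : j ≤ k + 1) {T t : ℝ} (ht : t ∈ Set.Icc 0 T) :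
    (j : ℝ) / (k + 1) * t ∈ Set.Icc 0 T := by
  have h1 : (j : ℝ) / (k + 1) ≤ 1 := by
    rw [div_le_one (by positivity)]; exact_mod_cast hj
  have h0 : 0 ≤ (j : ℝ) / (k + 1) := by positivity
  constructor
  · exact mul_nonneg h0 ht.1
  · exact (mul_le_of_le_one_left ht.1 h1).trans ht.2

lemma fin_add_one_cases {k : ℕ} (j : Fin (k + 1)) :
    (((j + 1 : Fin (k + 1)) : ℕ) = (j : ℕ) + 1) ∨ ((j : ℕ) = k ∧ j + 1 = 0) := by
  rcases Nat.lt_or_ge (j : ℕ) k with h | h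
  · left
    exact Fin.val_add_one_of_lt (Fin.lt_def.mpr (by simpa using h))
  · right
    have hj : (j : ℕ) = k := le_antisymm (Nat.lt_succ_iff.mp j.2) h
    refine ⟨hj, ?_⟩
    have : j = Fin.last k := Fin.ext hj
    rw [this, Fin.last_add_one]

/-- The `j`-th step of the subdivision of the path `Ψ` on `[0, t]` into `k + 1` steps. -/
def pathStep (k : ℕ) (Ψ : ℝ → V →L[ℝ] V) (t : ℝ) (j : ℕ) : V →L[ℝ] V :=
  Ψ (((j : ℝ) + 1) / (k + 1) * t) * Ring.inverse (Ψ ((j : ℝ) / (k + 1) * t))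

/-- The discrete action form of the path `Ψ` on `[0, t]`. -/
def pathForm (k : ℕ) (Ω : LinearMap.BilinForm ℝ V) (Ψ : ℝ → V →L[ℝ] V) (t : ℝ) :
    LinearMap.BilinForm ℝ (Fin (k + 1) → V) :=
  actionForm Ω fun j => cayley (pathStep k Ψ t j)

/-- The identification of the fixed vectors of `Ψ t` with the radical of the discrete action. -/
def orbitPolygon (k : ℕ) (Ψ : ℝ → V →L[ℝ] V) (t : ℝ) : V →ₗ[ℝ] (Fin (k + 1) → V) :=
  LinearMap.pi fun j => (Ψ (((j : ℕ) : ℝ) / (k + 1) * t)).toLinearMap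

lemma orbitPolygon_injective {k : ℕ} {Ψ : ℝ → V →L[ℝ] V} (h0 : Ψ 0 = 1) (t : ℝ) :
    Function.Injective (orbitPolygon k Ψ t) := by
  intro v w h
  have := congrFun h 0
  simpa [orbitPolygon, h0] using this

lemma HasInertia.map_injective {W : Type*} [AddCommGroup W] [Module ℝ W] {q : V → ℝ} {q' : W → ℝ}
    {K : Submodule ℝ V} {p n : ℕ} (f : V →ₗ[ℝ] W) (hf : Function.Injective f)
    (hq : ∀ v ∈ K, q' (f v) = q v) (h : HasInertia q K p n) : HasInertia q' (K.map f) p n := by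
  obtain ⟨P, N, h1, h2, h3, h4, h5, h6⟩ := h
  refine ⟨P.map f, N.map f, by rw [← Submodule.map_sup, h1], ?_, ?_, ?_, ?_, ?_⟩
  · exact Submodule.disjoint_map hf h2
  · rintro _ ⟨v, hv, rfl⟩ h0
    rw [hq v (h1 ▸ Submodule.mem_sup_left hv)]
    exact h3 v hv (by rintro rfl; simp at h0)
  · rintro _ ⟨v, hv, rfl⟩ h0
    rw [hq v (h1 ▸ Submodule.mem_sup_right hv)]
    exact h4 v hv (by rintro rfl; simp at h0)
  · rw [← h5]
    exact (LinearEquiv.finrank_eq (Submodule.equivMapOfInjective f hf P)).symm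
  · rw [← h6]
    exact (LinearEquiv.finrank_eq (Submodule.equivMapOfInjective f hf N)).symm

variable [FiniteDimensional ℝ V] [CompleteSpace V]

lemma PreservesForm.isUnit {Ω : LinearMap.BilinForm ℝ V} (hΩ : IsSympForm Ω) {A : V →L[ℝ] V}
    (hA : PreservesForm Ω A) : IsUnit A := by
  have hinj : Function.Injective A.toLinearMap := by
    rw [← LinearMap.ker_eq_bot, LinearMap.ker_eq_bot']
    intro x hx
    refine hΩ.nondeg x fun y => ?_
    rw [← hA x y]
    have : A x = 0 := hx
    rw [this]; simp
  set L := (LinearEquiv.ofInjectiveEndo A.toLinearMap hinj).toContinuousLinearEquiv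
  have h1 : ∀ v, L v = A v := fun v => rfl
  refine ⟨⟨A, L.symm.toContinuousLinearMap, ?_, ?_⟩, rfl⟩
  · ext v
    change A (L.symm v) = v
    rw [← h1]; simp
  · ext v
    change L.symm (A v) = v
    rw [← h1]; simp

lemma PreservesForm.inverse {Ω : LinearMap.BilinForm ℝ V} (hΩ : IsSympForm Ω) {A : V →L[ℝ] V}
    (hA : PreservesForm Ω A) : PreservesForm Ω (Ring.inverse A) := by
  have h := Ring.mul_inverse_cancel _ (hA.isUnit hΩ)
  have h1 : ∀ v, A (Ring.inverse A v) = v := fun v => congrArg (fun L : V →L[ℝ] V => L v) h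
  intro v w
  rw [← hA, h1, h1]

lemma midForm_bound {Ω : LinearMap.BilinForm ℝ V} {k : ℕ} :
    ∃ M, 0 < M ∧ ∀ (b : Fin (k + 1) → V →L[ℝ] V) (δ : ℝ), (∀ j, ‖b j‖ ≤ δ) →
      ∀ x, |midForm Ω b x x| ≤ M * δ * ‖x‖ ^ 2 := by
  obtain ⟨M, hM0, hM⟩ := (exists_bilin_bound Ω).2
  refine ⟨(k + 1) * (M + 1), by positivity, fun b δ hb x => ?_⟩
  have hm : ∀ j, ‖edgeMid x j‖ ≤ ‖x‖ := by
    intro j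
    rw [edgeMid, norm_smul]
    have h1 := norm_le_pi_norm x (j + 1)
    have h2 := norm_le_pi_norm x j
    have h3 := norm_add_le (x (j + 1)) (x j)
    rw [Real.norm_of_nonneg (by norm_num)]
    linarith
  simp only [midForm, LinearMap.mk₂_apply]
  refine (Finset.abs_sum_le_sum_abs _ _).trans ?_
  have : ∀ j ∈ Finset.univ, |Ω (edgeMid x j) (b j (edgeMid x j))| ≤ (M + 1) * δ * ‖x‖ ^ 2 := by
    intro j _
    have hδ : 0 ≤ δ := (norm_nonneg _).trans (hb j)
    refine (hM _ _).trans ?_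
    have h1 : ‖b j (edgeMid x j)‖ ≤ δ * ‖x‖ :=
      ((b j).le_opNorm _).trans (mul_le_mul (hb j) (hm j) (norm_nonneg _) hδ)
    calc M * ‖edgeMid x j‖ * ‖b j (edgeMid x j)‖ ≤ (M + 1) * ‖x‖ * (δ * ‖x‖) := by
          refine mul_le_mul ?_ h1 (norm_nonneg _) (by positivity)
          exact mul_le_mul (by linarith) (hm j) (norm_nonneg _) (by positivity)
      _ = _ := by ring
  refine (Finset.sum_le_sum this).trans (le_of_eq ?_)
  simp only [Finset.sum_const, Finset.card_univ, Fintype.card_fin, nsmul_eq_mul]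
  push_cast; ring

lemma cayley_continuousAt {A : V →L[ℝ] V} (hA : IsUnit (A + 1)) : ContinuousAt cayley A := by
  obtain ⟨u, hu⟩ := hA
  have h1 : ContinuousAt (fun B : V →L[ℝ] V => Ring.inverse (B + 1)) A := by
    have h2 : ContinuousAt Ring.inverse (A + 1) := hu ▸ NormedRing.inverse_continuousAt u
    exact ContinuousAt.comp (f := fun B : V →L[ℝ] V => B + 1) h2
      (continuousAt_id.add continuousAt_const)
  exact (((continuousAt_id.sub continuousAt_const).mul h1).const_smul (2 : ℝ))

lemma hasDerivWithinAt_inverse {A : ℝ → V →L[ℝ] V} {A' : V →L[ℝ] V} {s : Set ℝ} {t : ℝ}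
    (h : HasDerivWithinAt A A' s t) (hA : IsUnit (A t)) :
    HasDerivWithinAt (fun t => Ring.inverse (A t))
      (-(Ring.inverse (A t) * A' * Ring.inverse (A t))) s t := by
  obtain ⟨u, hu⟩ := hA
  have h1 := hasFDerivAt_ringInverse (𝕜 := ℝ) u
  rw [hu] at h1
  have h2 := h1.comp_hasDerivWithinAt t h
  rw [← hu, Ring.inverse_unit]
  refine HasDerivWithinAt.congr_deriv h2 ?_
  simp

lemma hasDerivWithinAt_cayley {A : ℝ → V →L[ℝ] V} {A' : V →L[ℝ] V} {s : Set ℝ} {t : ℝ}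
    (h : HasDerivWithinAt A A' s t) (hA : IsUnit (A t + 1)) :
    HasDerivWithinAt (fun t => cayley (A t))
      (((2 : ℝ) • 1 - cayley (A t)) * A' * Ring.inverse (A t + 1)) s t := by
  have h1 := hasDerivWithinAt_inverse (h.add_const 1) hA
  have h2 := ((h.sub_const 1).mul h1).const_smul (2 : ℝ)
  refine h2.congr_deriv ?_
  rw [cayley]
  simp only [sub_mul, mul_neg, smul_add, smul_neg, smul_mul_assoc, one_mul, mul_assoc]
  rw [← sub_eq_add_neg]

lemma pathStep_preserves {k : ℕ} {Ω : LinearMap.BilinForm ℝ V} (hΩ : IsSympForm Ω)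
    {Ψ : ℝ → V →L[ℝ] V} {T : ℝ} (hp : ∀ t ∈ Set.Icc 0 T, PreservesForm Ω (Ψ t)) {t : ℝ}
    (ht : t ∈ Set.Icc 0 T) {j : ℕ} (hj : j < k + 1) : PreservesForm Ω (pathStep k Ψ t j) := by
  refine (hp _ ?_).mul ((hp _ (frac_mem hj.le ht)).inverse hΩ)
  exact_mod_cast frac_mem (k := k) (j := j + 1) hj ht

lemma pathStep_apply {k : ℕ} {Ω : LinearMap.BilinForm ℝ V} (hΩ : IsSympForm Ω)
    {Ψ : ℝ → V →L[ℝ] V} {T : ℝ} (hp : ∀ t ∈ Set.Icc 0 T, PreservesForm Ω (Ψ t)) {t : ℝ}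
    (ht : t ∈ Set.Icc 0 T) {j : ℕ} (hj : j < k + 1) (v : V) :
    pathStep k Ψ t j (Ψ ((j : ℝ) / (k + 1) * t) v) = Ψ (((j : ℝ) + 1) / (k + 1) * t) v := by
  have h := Ring.inverse_mul_cancel _ ((hp _ (frac_mem hj.le ht)).isUnit hΩ)
  have h1 := congrArg (fun L : V →L[ℝ] V => L v) h
  change Ψ _ ((Ring.inverse (Ψ ((j : ℝ) / (k + 1) * t)) * Ψ ((j : ℝ) / (k + 1) * t)) v) = _
  rw [h]; rfl

lemma mem_formKer_pathForm {k : ℕ} (hk : Even k) {Ω : LinearMap.BilinForm ℝ V} (hΩ : IsSympForm Ω)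
    {Ψ : ℝ → V →L[ℝ] V} {T : ℝ} (h0 : Ψ 0 = 1) (hp : ∀ t ∈ Set.Icc 0 T, PreservesForm Ω (Ψ t))
    {t : ℝ} (ht : t ∈ Set.Icc 0 T) (hu : ∀ j < k + 1, IsUnit (pathStep k Ψ t j + 1))
    {x : Fin (k + 1) → V} :
    x ∈ formKer (pathForm k Ω Ψ t) ↔
      Ψ t (x 0) = x 0 ∧ x = fun j : Fin (k + 1) => Ψ (((j : ℕ) : ℝ) / (k + 1) * t) (x 0) := by
  rw [pathForm, mem_formKer_actionForm hΩ hk (fun j => hu j j.2)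
    (fun j => pathStep_preserves hΩ hp ht j.2)]
  have hk1 : ((k : ℝ) + 1) ≠ 0 := by positivity
  constructor
  · intro h
    have h1 : ∀ i : ℕ, ∀ hi : i < k + 1, x ⟨i, hi⟩ = Ψ ((i : ℝ) / (k + 1) * t) (x 0) := by
      intro i
      induction i with
      | zero => intro hi; simp [h0]
      | succ i ih =>
        intro hi
        have h2 := h ⟨i, by omega⟩
        have h3 : (⟨i, by omega⟩ : Fin (k + 1)) + 1 = ⟨i + 1, hi⟩ := by
          apply Fin.ext
          rw [Fin.val_add_one_of_lt]
          rw [Fin.lt_def]; simp; omega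
        rw [h3, ih, pathStep_apply hΩ hp ht (by simp; omega)] at h2
        rw [h2]; push_cast; rfl
    refine ⟨?_, ?_⟩
    · have h2 := h (Fin.last k)
      rw [Fin.last_add_one] at h2
      have h3 := h1 k (by omega)
      have h4 : x (Fin.last k) = Ψ ((k : ℝ) / (k + 1) * t) (x 0) := h3
      rw [h4, Fin.val_last, pathStep_apply hΩ hp ht (by omega), div_self hk1, one_mul] at h2
      exact h2.symm
    · funext j
      exact h1 j j.2
  · rintro ⟨hfix, hx⟩ j
    have hxj : ∀ i : Fin (k + 1), x i = Ψ (((i : ℕ) : ℝ) / (k + 1) * t) (x 0) :=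
      fun i => congrFun hx i
    rw [hxj j, pathStep_apply hΩ hp ht j.2]
    rcases fin_add_one_cases j with h | ⟨h, h'⟩
    · rw [hxj (j + 1), h]; push_cast; rfl
    · rw [h', h, div_self hk1, one_mul, hfix]

lemma formKer_pathForm_eq {k : ℕ} (hk : Even k) {Ω : LinearMap.BilinForm ℝ V} (hΩ : IsSympForm Ω)
    {Ψ : ℝ → V →L[ℝ] V} {T : ℝ} (h0 : Ψ 0 = 1) (hp : ∀ t ∈ Set.Icc 0 T, PreservesForm Ω (Ψ t))
    {t : ℝ} (ht : t ∈ Set.Icc 0 T) (hu : ∀ j < k + 1, IsUnit (pathStep k Ψ t j + 1)) :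
    formKer (pathForm k Ω Ψ t) =
      (LinearMap.ker (Ψ t - ContinuousLinearMap.id ℝ _).toLinearMap).map (orbitPolygon k Ψ t) := by
  ext x
  rw [mem_formKer_pathForm hk hΩ h0 hp ht hu, Submodule.mem_map]
  have hz : ∀ v, orbitPolygon k Ψ t v 0 = v := by
    intro v; simp [orbitPolygon, h0]
  constructor
  · rintro ⟨h1, h2⟩
    refine ⟨x 0, ?_, h2.symm⟩
    rw [LinearMap.mem_ker]
    simp [h1]
  · rintro ⟨v, hv, rfl⟩
    rw [LinearMap.mem_ker] at hv
    rw [hz]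
    refine ⟨?_, rfl⟩
    simpa [sub_eq_zero] using hv

end Crossing

section Crossing

open Filter Topology Module

variable {V : Type*} [NormedAddCommGroup V] [NormedSpace ℝ V] [FiniteDimensional ℝ V]
  [CompleteSpace V]

lemma hasDerivWithinAt_pathStep {k : ℕ} {Ω : LinearMap.BilinForm ℝ V} (hΩ : IsSympForm Ω)
    {Ψ Ψ' : ℝ → V →L[ℝ] V} {T : ℝ} (hp : ∀ t ∈ Set.Icc 0 T, PreservesForm Ω (Ψ t))
    (hd : ∀ t ∈ Set.Icc 0 T, HasDerivWithinAt Ψ (Ψ' t) (Set.Icc 0 T) t) {t : ℝ}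
    (ht : t ∈ Set.Icc 0 T) {j : ℕ} (hj : j < k + 1) :
    HasDerivWithinAt (fun t => pathStep k Ψ t j)
      (((((j : ℝ) + 1) / (k + 1)) • Ψ' (((j : ℝ) + 1) / (k + 1) * t) -
        pathStep k Ψ t j * (((j : ℝ) / (k + 1)) • Ψ' ((j : ℝ) / (k + 1) * t))) *
          Ring.inverse (Ψ ((j : ℝ) / (k + 1) * t))) (Set.Icc 0 T) t := by
  have hP : ∀ i ≤ k + 1, HasDerivWithinAt (fun t => Ψ ((i : ℝ) / (k + 1) * t))
      (((i : ℝ) / (k + 1)) • Ψ' ((i : ℝ) / (k + 1) * t)) (Set.Icc 0 T) t := by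
    intro i hi
    have h1 : HasDerivWithinAt (fun t : ℝ => (i : ℝ) / (k + 1) * t) ((i : ℝ) / (k + 1))
        (Set.Icc 0 T) t := by
      simpa using (hasDerivWithinAt_id t (Set.Icc 0 T)).const_mul ((i : ℝ) / (k + 1))
    exact HasDerivWithinAt.scomp t (hd _ (frac_mem hi ht)) h1 (fun x hx => frac_mem hi hx)
  have h1 := hP (j + 1) hj
  have h0 := hP j hj.le
  push_cast at h1
  have h2 := hasDerivWithinAt_inverse h0 ((hp _ (frac_mem hj.le ht)).isUnit hΩ)
  refine (h1.mul h2).congr_deriv ?_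
  simp only [pathStep]
  noncomm_ring

lemma eventually_cayley_remainder {A : ℝ → V →L[ℝ] V} {D : V →L[ℝ] V} {s : Set ℝ} {t : ℝ}
    (h : HasDerivWithinAt A D s t) {δ : ℝ} (hδ : 0 < δ) :
    ∀ᶠ t' in 𝓝[s] t, ‖A t' - A t - (t' - t) • D‖ ≤ δ * |t' - t| :=
  h.isLittleO.bound hδ

/-- On the radical, the derivative of the discrete action form is the crossing form. -/
lemma pathForm_deriv_on_ker {k : ℕ} {Ω : LinearMap.BilinForm ℝ V} (hΩ : IsSympForm Ω)
    {Ψ Ψ' : ℝ → V →L[ℝ] V} {T : ℝ} (hp : ∀ t ∈ Set.Icc 0 T, PreservesForm Ω (Ψ t)) {t : ℝ}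
    (h0 : Ψ 0 = 1) (ht : t ∈ Set.Icc 0 T) (hu : ∀ j < k + 1, IsUnit (pathStep k Ψ t j + 1))
    {v : V} (hv : Ψ t v = v) :
    midForm Ω (fun j : Fin (k + 1) => ((2 : ℝ) • 1 - cayley (pathStep k Ψ t j)) *
      ((((((j : ℕ) : ℝ) + 1) / (k + 1)) • Ψ' ((((j : ℕ) : ℝ) + 1) / (k + 1) * t) -
        pathStep k Ψ t j * ((((j : ℕ) : ℝ) / (k + 1)) • Ψ' (((j : ℕ) : ℝ) / (k + 1) * t))) *
          Ring.inverse (Ψ (((j : ℕ) : ℝ) / (k + 1) * t))) * Ring.inverse (pathStep k Ψ t j + 1))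
      (orbitPolygon k Ψ t v) (orbitPolygon k Ψ t v) = Ω v (Ψ' t v) := by
  have hk1 : ((k : ℝ) + 1) ≠ 0 := by positivity
  set P : ℕ → V := fun j => Ψ ((j : ℝ) / (k + 1) * t) v with hP
  set P' : ℕ → V := fun j => ((j : ℝ) / (k + 1)) • Ψ' ((j : ℝ) / (k + 1) * t) v with hP'
  have hPj : ∀ j : Fin (k + 1), orbitPolygon k Ψ t v j = P j := fun j => rfl
  have hstep : ∀ j < k + 1, pathStep k Ψ t j (P j) = P (j + 1) := by
    intro j hj
    simp only [hP]
    rw [pathStep_apply hΩ hp ht hj]; push_cast; rfl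
  have hPj1 : ∀ j : Fin (k + 1), orbitPolygon k Ψ t v (j + 1) = P (j + 1) := by
    intro j
    rcases fin_add_one_cases j with h | ⟨h, h'⟩
    · rw [hPj, h]
    · rw [h', h, hPj]
      simp only [hP]
      push_cast
      rw [div_self hk1]; simp [h0, hv]
  have hterm : ∀ j : Fin (k + 1), Ω (edgeMid (orbitPolygon k Ψ t v) j)
      ((((2 : ℝ) • 1 - cayley (pathStep k Ψ t j)) *
      ((((((j : ℕ) : ℝ) + 1) / (k + 1)) • Ψ' ((((j : ℕ) : ℝ) + 1) / (k + 1) * t) -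
        pathStep k Ψ t j * ((((j : ℕ) : ℝ) / (k + 1)) • Ψ' (((j : ℕ) : ℝ) / (k + 1) * t))) *
          Ring.inverse (Ψ (((j : ℕ) : ℝ) / (k + 1) * t))) *
          Ring.inverse (pathStep k Ψ t j + 1)) (edgeMid (orbitPolygon k Ψ t v) j)) =
      Ω (P (j + 1)) (P' (j + 1)) - Ω (P j) (P' j) := by
    intro j
    have hpj := pathStep_preserves hΩ hp ht j.2
    rw [form_cayley_deriv hΩ (hu j j.2) hpj (P j)
      (by rw [edgeMid, hPj1, hPj, hstep j j.2]), hstep j j.2]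
    have h := Ring.inverse_mul_cancel _ ((hp _ (frac_mem (k := k) (j := j) j.2.le ht)).isUnit hΩ)
    have h2 : Ring.inverse (Ψ (((j : ℕ) : ℝ) / (k + 1) * t)) (P j) = v :=
      congrArg (fun L : V →L[ℝ] V => L v) h
    change Ω (P (j + 1)) (((((((j : ℕ) : ℝ) + 1) / (k + 1)) •
      Ψ' ((((j : ℕ) : ℝ) + 1) / (k + 1) * t) -
        pathStep k Ψ t j * ((((j : ℕ) : ℝ) / (k + 1)) • Ψ' (((j : ℕ) : ℝ) / (k + 1) * t))))
          (Ring.inverse (Ψ (((j : ℕ) : ℝ) / (k + 1) * t)) (P j))) = _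
    rw [h2]
    have h3 : (((((((j : ℕ) : ℝ) + 1) / (k + 1)) • Ψ' ((((j : ℕ) : ℝ) + 1) / (k + 1) * t) -
        pathStep k Ψ t j * ((((j : ℕ) : ℝ) / (k + 1)) • Ψ' (((j : ℕ) : ℝ) / (k + 1) * t))))) v =
        P' (j + 1) - pathStep k Ψ t j (P' j) := by
      simp only [hP']
      push_cast
      rfl
    rw [h3, map_sub]
    congr 1
    rw [← hstep j j.2, hpj]
  simp only [midForm, LinearMap.mk₂_apply]
  rw [Finset.sum_congr rfl fun j _ => hterm j,
    Fin.sum_univ_eq_sum_range (fun j => Ω (P (j + 1)) (P' (j + 1)) - Ω (P j) (P' j)),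
    Finset.sum_range_sub (fun j => Ω (P j) (P' j))]
  simp only [hP, hP']
  push_cast
  rw [div_self hk1]
  simp [hv]

/-- The crossing sum is half the change of signature of the discrete action form. -/
lemma two_mul_crossingSum {k : ℕ} (hk : Even k) {Ω : LinearMap.BilinForm ℝ V}
    (hΩ : IsSympForm Ω) {Ψ : ℝ → V →L[ℝ] V} {T μ : ℝ} (hT : 0 < T) (h0 : Ψ 0 = 1)
    (hu : ∀ t ∈ Set.Icc 0 T, ∀ j < k + 1, IsUnit (pathStep k Ψ t j + 1))
    (h : CrossingSum Ω T Ψ μ) :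
    2 * μ = (formSign (pathForm k Ω Ψ T) : ℝ) - formSign (pathForm k Ω (fun _ => 1) T) := by
  obtain ⟨hp, Ψ', -, hd, C, pos, neg, hC, hI, rfl⟩ := h
  obtain ⟨M, hM0, hM⟩ := midForm_bound (Ω := Ω) (k := k)
  have hsymm : ∀ t ∈ Set.Icc 0 T, IsSymmForm (pathForm k Ω Ψ t) := fun t ht =>
    actionForm_symm hΩ (fun j => hu t ht j j.2) (fun j => pathStep_preserves hΩ hp ht j.2)
  set s : ℝ → ℝ := fun t => if t ∈ C then (pos t : ℝ) - neg t else 0 with hs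
  have hjump : ∀ t ∈ Set.Icc 0 T,
      (∀ᶠ t' in 𝓝[Set.Icc 0 T ∩ Set.Ioi t] t,
        (formSign (pathForm k Ω Ψ t') : ℝ) = formSign (pathForm k Ω Ψ t) + s t) ∧
      (∀ᶠ t' in 𝓝[Set.Icc 0 T ∩ Set.Iio t] t,
        (formSign (pathForm k Ω Ψ t') : ℝ) = formSign (pathForm k Ω Ψ t) - s t) := by
    intro t ht
    set D : Fin (k + 1) → V →L[ℝ] V := fun j => ((2 : ℝ) • 1 - cayley (pathStep k Ψ t j)) *
      ((((((j : ℕ) : ℝ) + 1) / (k + 1)) • Ψ' ((((j : ℕ) : ℝ) + 1) / (k + 1) * t) -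
        pathStep k Ψ t j * ((((j : ℕ) : ℝ) / (k + 1)) • Ψ' (((j : ℕ) : ℝ) / (k + 1) * t))) *
          Ring.inverse (Ψ (((j : ℕ) : ℝ) / (k + 1) * t))) * Ring.inverse (pathStep k Ψ t j + 1)
      with hD
    have hrem : ∀ δ > 0, ∀ᶠ t' in 𝓝[Set.Icc 0 T] t, ∀ x,
        |pathForm k Ω Ψ t' x x - pathForm k Ω Ψ t x x - (t' - t) * midForm Ω D x x| ≤
          δ * |t' - t| * ‖x‖ ^ 2 := by
      intro δ hδ
      have h1 : ∀ᶠ t' in 𝓝[Set.Icc 0 T] t, ∀ j : Fin (k + 1),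
          ‖cayley (pathStep k Ψ t' j) - cayley (pathStep k Ψ t j) - (t' - t) • D j‖ ≤
            (δ / M) * |t' - t| := by
        rw [eventually_all]
        intro j
        exact eventually_cayley_remainder (hasDerivWithinAt_cayley
          (hasDerivWithinAt_pathStep hΩ hp hd ht j.2) (hu t ht j j.2)) (by positivity)
      filter_upwards [h1] with t' h2 x
      have h3 := hM _ _ h2 x
      have h4 : midForm Ω (fun j : Fin (k + 1) => cayley (pathStep k Ψ t' j) -
          cayley (pathStep k Ψ t j) - (t' - t) • D j) x x =
          pathForm k Ω Ψ t' x x - pathForm k Ω Ψ t x x - (t' - t) * midForm Ω D x x := by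
        simp only [pathForm, actionForm, LinearMap.sub_apply, midForm, LinearMap.mk₂_apply,
          sub_apply, smul_apply, map_sub, map_smul, Finset.sum_sub_distrib, smul_eq_mul,
          Finset.mul_sum]
        ring
      rw [h4] at h3
      refine h3.trans (le_of_eq ?_)
      field_simp
    have hker := formKer_pathForm_eq hk hΩ h0 hp ht (hu t ht)
    obtain ⟨p, n, hpn, hst⟩ : ∃ p n : ℕ, HasInertia (fun x => midForm Ω D x x)
        (formKer (pathForm k Ω Ψ t)) p n ∧ s t = (p : ℝ) - n := by
      by_cases htC : t ∈ C
      · refine ⟨pos t, neg t, ?_, by simp [hs, htC]⟩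
        rw [hker]
        refine HasInertia.map_injective _ (orbitPolygon_injective h0 t) ?_ (hI t htC)
        intro v hv
        rw [LinearMap.mem_ker] at hv
        have hv' : Ψ t v = v := by simpa [sub_eq_zero] using hv
        exact pathForm_deriv_on_ker hΩ hp h0 ht (hu t ht) hv'
      · refine ⟨0, 0, ?_, by simp [hs, htC]⟩
        have hbot : LinearMap.ker (Ψ t - ContinuousLinearMap.id ℝ _).toLinearMap = ⊥ := by
          rw [LinearMap.ker_eq_bot']
          intro v hv
          by_contra hv0
          exact htC ((hC t).mpr ⟨ht, v, hv0, by simpa [sub_eq_zero] using hv⟩)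
        rw [hker, hbot, Submodule.map_bot]
        exact ⟨⊥, ⊥, by simp, by simp, by simp, by simp, by simp, by simp⟩
    obtain ⟨j1, j2⟩ := formSign_jump ht hsymm hrem hpn
    rw [hst]
    constructor
    · filter_upwards [j1] with t' h; rw [h]; push_cast; ring
    · filter_upwards [j2] with t' h; rw [h]; push_cast; ring
  have h00 : pathForm k Ω Ψ 0 = pathForm k Ω (fun _ => 1) T := by
    simp [pathForm, pathStep, h0]
  have := sub_eq_sum_jumps hT (f := fun t => (formSign (pathForm k Ω Ψ t) : ℝ)) (s := s) (C := C)
    (fun t ht => ((hC t).mp ht).1) (fun t ht => by simp [hs, ht]) (fun t ht => (hjump t ht).1)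
    (fun t ht => (hjump t ht).2)
  rw [← h00, this, Finset.mul_sum]
  refine Finset.sum_congr rfl fun t ht => ?_
  simp only [hs, ht, if_true]
  split_ifs <;> ring

lemma isUnit_add_one_of_norm {A : V →L[ℝ] V} (hA : ‖A - 1‖ < 1) : IsUnit (A + 1) := by
  have h1 : ‖(-(1 / 2 : ℝ)) • (A - 1)‖ < 1 := by
    rw [norm_smul]; norm_num; linarith
  have h2 := (Units.oneSub ((-(1 / 2 : ℝ)) • (A - 1)) h1).isUnit
  rw [Units.val_oneSub] at h2
  have h3 : A + 1 = (2 : ℝ) • (1 - (-(1 / 2 : ℝ)) • (A - 1)) := by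
    rw [smul_sub, smul_smul]
    norm_num
    rw [two_smul]; abel
  rw [h3]
  exact h2.smul (Units.mk0 (2 : ℝ) two_ne_zero)

lemma inverse_continuousOn {X : Type*} [TopologicalSpace X] {f : X → V →L[ℝ] V} {s : Set X}
    (hf : ContinuousOn f s) (hu : ∀ x ∈ s, IsUnit (f x)) :
    ContinuousOn (fun x => Ring.inverse (f x)) s := by
  intro x hx
  obtain ⟨u, hu'⟩ := hu x hx
  have h1 : ContinuousAt Ring.inverse (f x) := hu' ▸ NormedRing.inverse_continuousAt u
  exact h1.comp_continuousWithinAt (hf x hx)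

/-- The steps of a sufficiently fine subdivision are close to the identity, uniformly in a
homotopy. -/
lemma exists_fine_subdivision {Ω : LinearMap.BilinForm ℝ V} (hΩ : IsSympForm Ω) {T : ℝ}
    {H : ℝ × ℝ → V →L[ℝ] V} (hH : ContinuousOn H (Set.Icc 0 1 ×ˢ Set.Icc 0 T))
    (hp : ∀ s ∈ Set.Icc (0 : ℝ) 1, ∀ t ∈ Set.Icc 0 T, PreservesForm Ω (H (s, t))) :
    ∃ k₀ : ℕ, ∀ k ≥ k₀, ∀ s ∈ Set.Icc (0 : ℝ) 1, ∀ t ∈ Set.Icc 0 T, ∀ j < k + 1,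
      IsUnit (pathStep k (fun t => H (s, t)) t j + 1) := by
  have hcomp : IsCompact (Set.Icc (0 : ℝ) 1 ×ˢ Set.Icc 0 T) := isCompact_Icc.prod isCompact_Icc
  have huc := hcomp.uniformContinuousOn_of_continuous hH
  have hinv := inverse_continuousOn hH (fun x hx => (hp x.1 hx.1 x.2 hx.2).isUnit hΩ)
  obtain ⟨K, hK⟩ := hcomp.exists_bound_of_continuousOn hinv
  rw [Metric.uniformContinuousOn_iff] at huc
  obtain ⟨δ, hδ, hδ'⟩ := huc (1 / (|K| + 1)) (by positivity)
  obtain ⟨k₀, hk₀⟩ := exists_nat_gt (|T| / δ)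
  refine ⟨k₀, fun k hk s hs t ht j hj => isUnit_add_one_of_norm ?_⟩
  have m0 := frac_mem hj.le ht (k := k)
  have m1 := frac_mem (j := j + 1) hj ht (k := k)
  push_cast at m1
  set t0 := (j : ℝ) / (k + 1) * t
  set t1 := ((j : ℝ) + 1) / (k + 1) * t
  have hdist : dist ((s, t1) : ℝ × ℝ) (s, t0) < δ := by
    rw [Prod.dist_eq]
    have h1 : t1 - t0 = t / (k + 1) := by simp only [t0, t1]; field_simp; ring
    simp only [dist_self, Real.dist_eq, h1]
    rw [abs_of_nonneg (div_nonneg ht.1 (by positivity)), max_lt_iff]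
    refine ⟨hδ, ?_⟩
    rw [div_lt_iff₀ (by positivity)]
    rw [div_lt_iff₀ hδ] at hk₀
    have h2 : t ≤ |T| := ht.2.trans (le_abs_self T)
    have h3 : (k₀ : ℝ) ≤ k := by exact_mod_cast hk
    nlinarith
  have hu := (hp s hs t0 m0).isUnit hΩ
  have heq : pathStep k (fun t => H (s, t)) t j - 1 =
      (H (s, t1) - H (s, t0)) * Ring.inverse (H (s, t0)) := by
    rw [sub_mul, Ring.mul_inverse_cancel _ hu]; rfl
  have h1 := hδ' (s, t1) ⟨hs, m1⟩ (s, t0) ⟨hs, m0⟩ hdist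
  rw [dist_eq_norm] at h1
  rw [heq]
  refine (norm_mul_le _ _).trans_lt ?_
  have h2 := hK (s, t0) ⟨hs, m0⟩
  have h3 : ‖Ring.inverse (H (s, t0))‖ ≤ |K| := h2.trans (le_abs_self K)
  rw [lt_div_iff₀ (by positivity)] at h1
  nlinarith [norm_nonneg (H (s, t1) - H (s, t0)), norm_nonneg (Ring.inverse (H (s, t0)))]

/-- **Homotopy invariance of the crossing sum.** -/
theorem CrossingSum.eq_of_homotopic {Ω : LinearMap.BilinForm ℝ V} (hΩ : IsSympForm Ω)
    {T μ₀ μ₁ : ℝ} (hT : 0 < T) {Ψ₀ Ψ₁ : ℝ → V →L[ℝ] V} (h0 : Ψ₀ 0 = 1)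
    (h₀ : CrossingSum Ω T Ψ₀ μ₀) (h₁ : CrossingSum Ω T Ψ₁ μ₁) (hH : FormHomotopic Ω T Ψ₀ Ψ₁) :
    μ₀ = μ₁ := by
  obtain ⟨H, hc, hp, hends, hfix⟩ := hH
  obtain ⟨k₀, hk₀⟩ := exists_fine_subdivision hΩ hc hp
  set k := 2 * k₀ with hk
  have hu := hk₀ k (by omega)
  have hev : Even k := even_two_mul k₀
  have i0 : (0 : ℝ) ∈ Set.Icc (0 : ℝ) 1 := by simp
  have i1 : (1 : ℝ) ∈ Set.Icc (0 : ℝ) 1 := by simp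
  have hT0 : (0 : ℝ) ∈ Set.Icc 0 T := ⟨le_rfl, hT.le⟩
  have hTT : T ∈ Set.Icc 0 T := ⟨hT.le, le_rfl⟩
  have hstep0 : ∀ t ∈ Set.Icc 0 T, ∀ j < k + 1,
      pathStep k (fun t => H (0, t)) t j = pathStep k Ψ₀ t j := by
    intro t ht j hj
    have m1 := frac_mem (j := j + 1) hj ht (k := k)
    push_cast at m1
    simp only [pathStep, (hends _ (frac_mem hj.le ht (k := k))).1, (hends _ m1).1]
  have hstep1 : ∀ t ∈ Set.Icc 0 T, ∀ j < k + 1,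
      pathStep k (fun t => H (1, t)) t j = pathStep k Ψ₁ t j := by
    intro t ht j hj
    have m1 := frac_mem (j := j + 1) hj ht (k := k)
    push_cast at m1
    simp only [pathStep, (hends _ (frac_mem hj.le ht (k := k))).2, (hends _ m1).2]
  have e0 := two_mul_crossingSum hev hΩ hT h0
    (fun t ht j hj => by rw [← hstep0 t ht j hj]; exact hu 0 i0 t ht j hj) h₀
  have h10 : Ψ₁ 0 = 1 := by rw [← (hends 0 hT0).2, (hfix 1 i1).1, h0]
  have e1 := two_mul_crossingSum hev hΩ hT h10
    (fun t ht j hj => by rw [← hstep1 t ht j hj]; exact hu 1 i1 t ht j hj) h₁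
  set B : ℝ → LinearMap.BilinForm ℝ (Fin (k + 1) → V) :=
    fun s => pathForm k Ω (fun t => H (s, t)) T with hB
  have hB0 : B 0 = pathForm k Ω Ψ₀ T := by
    simp only [hB, pathForm]
    congr 1
    funext j
    rw [hstep0 T hTT j j.2]
  have hB1 : B 1 = pathForm k Ω Ψ₁ T := by
    simp only [hB, pathForm]
    congr 1
    funext j
    rw [hstep1 T hTT j j.2]
  have hpres : ∀ s ∈ Set.Icc (0 : ℝ) 1, ∀ j : Fin (k + 1),
      PreservesForm Ω (pathStep k (fun t => H (s, t)) T j) := fun s hs j =>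
    pathStep_preserves hΩ (hp s hs) hTT j.2
  have hsymm : ∀ s ∈ Set.Icc (0 : ℝ) 1, IsSymmForm (B s) := fun s hs =>
    actionForm_symm hΩ (fun j => hu s hs T hTT j j.2) (hpres s hs)
  have hker : ∀ s ∈ Set.Icc (0 : ℝ) 1, finrank ℝ (formKer (B s)) =
      finrank ℝ (LinearMap.ker (Ψ₀ T - ContinuousLinearMap.id ℝ _).toLinearMap) := by
    intro s hs
    have hs0 : (fun t => H (s, t)) 0 = 1 := by rw [← h0]; exact (hfix s hs).1
    rw [formKer_pathForm_eq hev hΩ hs0 (hp s hs) hTT (hu s hs T hTT), (hfix s hs).2]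
    exact (LinearEquiv.finrank_eq
      (Submodule.equivMapOfInjective _ (orbitPolygon_injective hs0 T) _)).symm
  obtain ⟨M, hM0, hM⟩ := midForm_bound (Ω := Ω) (k := k)
  have hloc : ∀ s ∈ Set.Icc (0 : ℝ) 1, ∀ᶠ s' in 𝓝[Set.Icc 0 1] s,
      formSign (B s') = formSign (B s) := by
    intro s hs
    refine eventually_formSign_eq ?_ (hsymm s hs) ?_ ?_
    · intro δ hδ
      have h1 : ∀ᶠ s' in 𝓝[Set.Icc 0 1] s, ∀ j : Fin (k + 1),
          ‖cayley (pathStep k (fun t => H (s', t)) T j) -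
            cayley (pathStep k (fun t => H (s, t)) T j)‖ ≤ δ / M := by
        rw [eventually_all]
        intro j
        have hcs : ∀ t ∈ Set.Icc 0 T, ContinuousOn (fun s => H (s, t)) (Set.Icc 0 1) := by
          intro t ht
          exact hc.comp (by fun_prop) (fun s hs => ⟨hs, ht⟩)
        have m0 := frac_mem (j := j) j.2.le hTT (k := k)
        have m1 := frac_mem (j := j + 1) j.2 hTT (k := k)
        push_cast at m1
        have hstepc : ContinuousOn (fun s => pathStep k (fun t => H (s, t)) T j)
            (Set.Icc 0 1) :=
          (hcs _ m1).mul (inverse_continuousOn (hcs _ m0)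
            (fun s hs => (hp s hs _ m0).isUnit hΩ))
        have h2 := (cayley_continuousAt (hu s hs T hTT j j.2)).comp_continuousWithinAt
          (f := fun s => pathStep k (fun t => H (s, t)) T j) (hstepc s hs)
        have h3 := Metric.continuousWithinAt_iff'.mp h2 (δ / M) (by positivity)
        filter_upwards [h3] with s' h4
        rw [← dist_eq_norm]
        exact h4.le
      filter_upwards [h1] with s' h2 x
      have h3 := hM _ _ h2 x
      have h4 : midForm Ω (fun j : Fin (k + 1) => cayley (pathStep k (fun t => H (s', t)) T j) -
            cayley (pathStep k (fun t => H (s, t)) T j)) x x = B s' x x - B s x x := by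
        simp only [hB, pathForm, actionForm, LinearMap.sub_apply, midForm, LinearMap.mk₂_apply,
          sub_apply, map_sub, Finset.sum_sub_distrib]
        ring
      rw [h4] at h3
      refine h3.trans (le_of_eq ?_)
      field_simp
    · filter_upwards [self_mem_nhdsWithin] with s' hs' using hsymm s' hs'
    · filter_upwards [self_mem_nhdsWithin] with s' hs'
      rw [hker s' hs', hker s hs]
  have hconst := sub_eq_sum_jumps one_pos (f := fun s => (formSign (B s) : ℝ)) (s := fun _ => 0)
    (C := ∅) (by simp) (by simp)
    (fun s hs => by
      filter_upwards [(hloc s hs).filter_mono (nhdsWithin_mono _ Set.inter_subset_left)]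
        with s' h
      simp [h])
    (fun s hs => by
      filter_upwards [(hloc s hs).filter_mono (nhdsWithin_mono _ Set.inter_subset_left)]
        with s' h
      simp [h])
  simp only [Finset.sum_empty, hB0, hB1] at hconst
  linarith

end Crossing

/-! ### Stabilization and change of trivialization -/

section Stabilization

open Filter Topology Module

lemma finrank_submodule_prod {V W : Type*} [AddCommGroup V] [Module ℝ V] [AddCommGroup W]
    [Module ℝ W] [FiniteDimensional ℝ V] [FiniteDimensional ℝ W] (P : Submodule ℝ V)
    (Q : Submodule ℝ W) : finrank ℝ (P.prod Q) = finrank ℝ P + finrank ℝ Q := by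
  have h1 : P.prod Q = LinearMap.range (P.subtype.prodMap Q.subtype) := by
    ext ⟨v, w⟩
    simp [Submodule.mem_prod]
  rw [h1, LinearMap.finrank_range_of_inj, finrank_prod]
  rintro ⟨a, b⟩ ⟨c, d⟩ h
  simpa [Prod.ext_iff] using h

variable {V : Type*} [NormedAddCommGroup V] [NormedSpace ℝ V]
variable {W : Type*} [NormedAddCommGroup W] [NormedSpace ℝ W]

/-- The orthogonal sum of two bilinear forms. -/
def prodForm (Ω : LinearMap.BilinForm ℝ V) (Θ : LinearMap.BilinForm ℝ W) :
    LinearMap.BilinForm ℝ (V × W) :=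
  LinearMap.mk₂ ℝ (fun x y => Ω x.1 y.1 + Θ x.2 y.2)
    (by intros; simp only [Prod.fst_add, Prod.snd_add, map_add, LinearMap.add_apply]; ring)
    (by intros; simp only [Prod.smul_fst, Prod.smul_snd, map_smul, LinearMap.smul_apply,
          smul_eq_mul]; ring)
    (by intros; simp only [Prod.fst_add, Prod.snd_add, map_add]; ring)
    (by intros; simp only [Prod.smul_fst, Prod.smul_snd, map_smul, smul_eq_mul]; ring)

@[simp] lemma prodForm_apply (Ω : LinearMap.BilinForm ℝ V) (Θ : LinearMap.BilinForm ℝ W)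
    (x y : V × W) : prodForm Ω Θ x y = Ω x.1 y.1 + Θ x.2 y.2 := rfl

lemma IsSympForm.prod {Ω : LinearMap.BilinForm ℝ V} {Θ : LinearMap.BilinForm ℝ W}
    (hΩ : IsSympForm Ω) (hΘ : IsSympForm Θ) : IsSympForm (prodForm Ω Θ) where
  alt x := by simp [hΩ.alt, hΘ.alt]
  nondeg x h := by
    refine Prod.ext (hΩ.nondeg _ fun v => ?_) (hΘ.nondeg _ fun w => ?_)
    · simpa using h (v, 0)
    · simpa using h (0, w)

lemma FormHomotopic.symm {Ω : LinearMap.BilinForm ℝ V} {T : ℝ} {Ψ₀ Ψ₁ : ℝ → V →L[ℝ] V}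
    (hT : 0 < T) (h : FormHomotopic Ω T Ψ₀ Ψ₁) : FormHomotopic Ω T Ψ₁ Ψ₀ := by
  obtain ⟨H, hc, hp, he, hf⟩ := h
  have hmem : ∀ s ∈ Set.Icc (0 : ℝ) 1, 1 - s ∈ Set.Icc (0 : ℝ) 1 := fun s hs =>
    ⟨by linarith [hs.2], by linarith [hs.1]⟩
  have i1 : (1 : ℝ) ∈ Set.Icc (0 : ℝ) 1 := by simp
  have hT0 : (0 : ℝ) ∈ Set.Icc 0 T := ⟨le_rfl, hT.le⟩
  have hTT : T ∈ Set.Icc 0 T := ⟨hT.le, le_rfl⟩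
  refine ⟨fun x => H (1 - x.1, x.2), ?_, fun s hs t ht => hp _ (hmem s hs) t ht, ?_, ?_⟩
  · exact hc.comp (by fun_prop) (fun x hx => ⟨hmem _ hx.1, hx.2⟩)
  · intro t ht
    simp [(he t ht).1, (he t ht).2]
  · intro s hs
    have h1 := hf _ (hmem s hs)
    have h2 := hf 1 i1
    rw [(he 0 hT0).2, (he T hTT).2] at h2
    exact ⟨h1.1.trans h2.1.symm, h1.2.trans h2.2.symm⟩

lemma FormHomotopic.trans {Ω : LinearMap.BilinForm ℝ V} {T : ℝ} {Ψ₀ Ψ₁ Ψ₂ : ℝ → V →L[ℝ] V}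
    (hT : 0 < T) (h : FormHomotopic Ω T Ψ₀ Ψ₁) (h' : FormHomotopic Ω T Ψ₁ Ψ₂) :
    FormHomotopic Ω T Ψ₀ Ψ₂ := by
  obtain ⟨H, hc, hp, he, hf⟩ := h
  obtain ⟨H', hc', hp', he', hf'⟩ := h'
  have i1 : (1 : ℝ) ∈ Set.Icc (0 : ℝ) 1 := by simp
  have hT0 : (0 : ℝ) ∈ Set.Icc 0 T := ⟨le_rfl, hT.le⟩
  have hTT : T ∈ Set.Icc 0 T := ⟨hT.le, le_rfl⟩
  have hl : ∀ s ∈ Set.Icc (0 : ℝ) (1 / 2), 2 * s ∈ Set.Icc (0 : ℝ) 1 := fun s hs =>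
    ⟨by linarith [hs.1], by linarith [hs.2]⟩
  have hr : ∀ s ∈ Set.Icc (1 / 2 : ℝ) 1, 2 * s - 1 ∈ Set.Icc (0 : ℝ) 1 := fun s hs =>
    ⟨by linarith [hs.1], by linarith [hs.2]⟩
  set K : ℝ × ℝ → V →L[ℝ] V :=
    fun x => if x.1 ≤ 1 / 2 then H (2 * x.1, x.2) else H' (2 * x.1 - 1, x.2) with hK
  have hKl : ∀ s ∈ Set.Icc (0 : ℝ) (1 / 2), ∀ t, K (s, t) = H (2 * s, t) := by
    intro s hs t; simp only [hK, if_pos hs.2]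
  have hKr : ∀ s ∈ Set.Icc (1 / 2 : ℝ) 1, ∀ t ∈ Set.Icc 0 T, K (s, t) = H' (2 * s - 1, t) := by
    intro s hs t ht
    rcases eq_or_lt_of_le hs.1 with h | h
    · subst h
      rw [hKl _ (by norm_num)]
      norm_num
      rw [(he t ht).2, (he' t ht).1]
    · simp only [hK, if_neg (not_le.mpr h)]
  have hsplit : ∀ s ∈ Set.Icc (0 : ℝ) 1, s ∈ Set.Icc (0 : ℝ) (1 / 2) ∨ s ∈ Set.Icc (1 / 2 : ℝ) 1 :=
    fun s hs => (le_total s (1 / 2)).imp (fun h => ⟨hs.1, h⟩) (fun h => ⟨h, hs.2⟩)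
  refine ⟨K, ?_, ?_, ?_, ?_⟩
  · have hA : ContinuousOn K (Set.Icc 0 (1 / 2) ×ˢ Set.Icc 0 T) := by
      have : ContinuousOn (fun x : ℝ × ℝ => H (2 * x.1, x.2))
          (Set.Icc 0 (1 / 2) ×ˢ Set.Icc 0 T) :=
        hc.comp (by fun_prop) (fun x hx => ⟨hl _ hx.1, hx.2⟩)
      exact this.congr fun x hx => hKl x.1 hx.1 x.2
    have hB : ContinuousOn K (Set.Icc (1 / 2) 1 ×ˢ Set.Icc 0 T) := by
      have : ContinuousOn (fun x : ℝ × ℝ => H' (2 * x.1 - 1, x.2))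
          (Set.Icc (1 / 2) 1 ×ˢ Set.Icc 0 T) :=
        hc'.comp (by fun_prop) (fun x hx => ⟨hr _ hx.1, hx.2⟩)
      exact this.congr fun x hx => hKr x.1 hx.1 x.2 hx.2
    refine (hA.union_of_isClosed hB (isClosed_Icc.prod isClosed_Icc)
      (isClosed_Icc.prod isClosed_Icc)).mono ?_
    rintro ⟨s, t⟩ ⟨hs, ht⟩
    exact (hsplit s hs).imp (fun h => ⟨h, ht⟩) (fun h => ⟨h, ht⟩)
  · intro s hs t ht
    rcases hsplit s hs with h | h
    · rw [hKl s h]; exact hp _ (hl s h) t ht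
    · rw [hKr s h t ht]; exact hp' _ (hr s h) t ht
  · intro t ht
    constructor
    · rw [hKl 0 (by norm_num), mul_zero, (he t ht).1]
    · rw [hKr 1 (by norm_num) t ht]
      norm_num
      exact (he' t ht).2
  · have e0 := hf 1 i1
    rw [(he 0 hT0).2, (he T hTT).2] at e0
    intro s hs
    rcases hsplit s hs with h | h
    · rw [hKl s h, hKl s h]; exact hf _ (hl s h)
    · rw [hKr s h 0 hT0, hKr s h T hTT]
      have := hf' _ (hr s h)
      exact ⟨this.1.trans e0.1, this.2.trans e0.2⟩

variable [FiniteDimensional ℝ V] [CompleteSpace V] [FiniteDimensional ℝ W] [CompleteSpace W]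

/-- The crossing sum is invariant under conjugation. -/
lemma CrossingSum.conj {Ω : LinearMap.BilinForm ℝ V} (hΩ : IsSympForm Ω) {T μ : ℝ}
    {Ψ : ℝ → V →L[ℝ] V} (h : CrossingSum Ω T Ψ μ) {S : V →L[ℝ] V} (hS : PreservesForm Ω S) :
    CrossingSum Ω T (fun t => S * Ψ t * Ring.inverse S) μ := by
  obtain ⟨hp, Ψ', hc, hd, C, pos, neg, hC, hI, hμ⟩ := h
  have hSu := hS.isUnit hΩ
  have r1 : ∀ v, S (Ring.inverse S v) = v := fun v =>
    congrArg (fun L : V →L[ℝ] V => L v) (Ring.mul_inverse_cancel _ hSu)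
  have r2 : ∀ v, Ring.inverse S (S v) = v := fun v =>
    congrArg (fun L : V →L[ℝ] V => L v) (Ring.inverse_mul_cancel _ hSu)
  have hinj : Function.Injective S := fun v w h => by rw [← r2 v, h, r2]
  have hfix : ∀ t v, (S * Ψ t * Ring.inverse S) v = v ↔ Ψ t (Ring.inverse S v) = Ring.inverse S v := by
    intro t v
    change S (Ψ t (Ring.inverse S v)) = v ↔ _
    constructor
    · intro h; apply hinj; rw [h, r1]
    · intro h; rw [h, r1]
  refine ⟨fun t ht => (hS.mul (hp t ht)).mul (hS.inverse hΩ),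
    fun t => S * Ψ' t * Ring.inverse S, ?_, ?_, C, pos, neg, ?_, ?_, hμ⟩
  · exact (continuousOn_const.mul hc).mul continuousOn_const
  · intro t ht
    exact ((hd t ht).const_mul S).mul_const _
  · intro t
    rw [hC]
    refine and_congr_right fun _ => ?_
    constructor
    · rintro ⟨v, hv0, hv⟩
      refine ⟨S v, fun h => hv0 (hinj (by rw [h, map_zero])), ?_⟩
      rw [hfix, r2, hv]
    · rintro ⟨v, hv0, hv⟩
      refine ⟨Ring.inverse S v, fun h => hv0 (by rw [← r1 v, h, map_zero]), (hfix t v).mp hv⟩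
  · intro t ht
    have hk : LinearMap.ker ((S * Ψ t * Ring.inverse S) -
        ContinuousLinearMap.id ℝ _).toLinearMap =
        (LinearMap.ker (Ψ t - ContinuousLinearMap.id ℝ _).toLinearMap).map S.toLinearMap := by
      ext v
      rw [Submodule.mem_map, LinearMap.mem_ker]
      have e1 : (S * Ψ t * Ring.inverse S - ContinuousLinearMap.id ℝ _).toLinearMap v = 0 ↔
          (S * Ψ t * Ring.inverse S) v = v := sub_eq_zero
      have e2 : ∀ w, w ∈ LinearMap.ker (Ψ t - ContinuousLinearMap.id ℝ _).toLinearMap ↔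
          Ψ t w = w := fun w => by
        rw [LinearMap.mem_ker]
        exact sub_eq_zero
      rw [e1, hfix]
      constructor
      · intro h
        exact ⟨_, (e2 _).mpr h, r1 v⟩
      · rintro ⟨w, hw, rfl⟩
        have : Ring.inverse S (S.toLinearMap w) = w := r2 w
        rw [this]; exact (e2 w).mp hw
    rw [hk]
    refine HasInertia.map_injective _ hinj ?_ (hI t ht)
    intro v _
    change Ω (S v) (S (Ψ' t (Ring.inverse S (S v)))) = _
    rw [r2, hS]

/-- Adding a path with a single positive definite crossing, at the initial time. -/
lemma CrossingSum.prodMap [Nontrivial V] {Ω : LinearMap.BilinForm ℝ V}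
    {Θ : LinearMap.BilinForm ℝ W} {T μ : ℝ} (hT : 0 < T)
    {Ψ : ℝ → V →L[ℝ] V} (h0 : Ψ 0 = 1) (h : CrossingSum Ω T Ψ μ)
    {Γ Γ' : ℝ → W →L[ℝ] W} (hΓ0 : Γ 0 = 1) (hΓp : ∀ t ∈ Set.Icc 0 T, PreservesForm Θ (Γ t))
    (hΓc : ContinuousOn Γ' (Set.Icc 0 T))
    (hΓd : ∀ t ∈ Set.Icc 0 T, HasDerivWithinAt Γ (Γ' t) (Set.Icc 0 T) t)
    (hΓf : ∀ t ∈ Set.Ioc 0 T, ∀ w, Γ t w = w → w = 0)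
    (hΓq : ∀ w, w ≠ 0 → 0 < Θ w (Γ' 0 w)) :
    CrossingSum (prodForm Ω Θ) T (fun t => (Ψ t).prodMap (Γ t)) (μ + (finrank ℝ W : ℝ) / 2) := by
  obtain ⟨hp, Ψ', hc, hd, C, pos, neg, hC, hI, rfl⟩ := h
  have hT0 : (0 : ℝ) ∈ Set.Icc 0 T := ⟨le_rfl, hT.le⟩
  have h0C : (0 : ℝ) ∈ C := by
    rw [hC]
    obtain ⟨v, hv⟩ := exists_ne (0 : V)
    exact ⟨hT0, v, hv, by simp [h0]⟩
  have hker : ∀ t, t ∈ Set.Icc 0 T →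
      LinearMap.ker ((Ψ t).prodMap (Γ t) - ContinuousLinearMap.id ℝ _).toLinearMap =
      (LinearMap.ker (Ψ t - ContinuousLinearMap.id ℝ _).toLinearMap).prod
        (if t = 0 then ⊤ else ⊥) := by
    intro t ht
    have e2 : ∀ w, w ∈ LinearMap.ker (Ψ t - ContinuousLinearMap.id ℝ _).toLinearMap ↔
          Ψ t w = w := fun w => by
        rw [LinearMap.mem_ker]
        exact sub_eq_zero
    ext ⟨v, w⟩
    rw [LinearMap.mem_ker, Submodule.mem_prod, e2]
    have e1 : ((Ψ t).prodMap (Γ t) - ContinuousLinearMap.id ℝ _).toLinearMap (v, w) = 0 ↔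
        Ψ t v = v ∧ Γ t w = w := by
      rw [← Prod.mk.injEq]
      exact sub_eq_zero
    rw [e1]
    refine and_congr_right fun _ => ?_
    split_ifs with h
    · subst h; simp [hΓ0]
    · constructor
      · intro hw
        simpa using hΓf t ⟨lt_of_le_of_ne ht.1 (Ne.symm h), ht.2⟩ w hw
      · intro hw
        have : w = 0 := by simpa using hw
        simp [this]
  refine ⟨?_, fun t => (Ψ' t).prodMap (Γ' t), ?_, ?_, C,
    fun t => pos t + (if t = 0 then finrank ℝ W else 0), neg, ?_, ?_, ?_⟩
  · intro t ht x y
    simp [hp t ht x.1 y.1, hΓp t ht x.2 y.2]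
  · exact (ContinuousLinearMap.prodMapL ℝ V V W W).continuous.comp_continuousOn (hc.prodMk hΓc)
  · intro t ht
    exact (ContinuousLinearMap.prodMapL ℝ V V W W).hasFDerivAt.comp_hasDerivWithinAt t
      ((hd t ht).prodMk (hΓd t ht))
  · intro t
    constructor
    · intro ht
      obtain ⟨h1, v, hv0, hv⟩ := (hC t).mp ht
      exact ⟨h1, (v, 0), by simpa using hv0, by simp [hv]⟩
    · rintro ⟨h1, ⟨v, w⟩, hv0, hv⟩
      rw [hC]
      have hvw : Ψ t v = v ∧ Γ t w = w := by simpa using hv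
      by_cases ht0 : t = 0
      · subst ht0; exact (hC 0).mp h0C
      · have hw := hΓf t ⟨lt_of_le_of_ne h1.1 (Ne.symm ht0), h1.2⟩ w hvw.2
        exact ⟨h1, v, by rintro rfl; exact hv0 (by rw [hw]; rfl), hvw.1⟩
  · intro t ht
    have htI := ((hC t).mp ht).1
    rw [hker t htI]
    obtain ⟨P, N, h1, h2, h3, h4, h5, h6⟩ := hI t ht
    refine ⟨P.prod (if t = 0 then ⊤ else ⊥), N.prod ⊥, ?_, ?_, ?_, ?_, ?_, ?_⟩
    · rw [Submodule.prod_sup_prod, h1, sup_bot_eq]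
    · rw [Submodule.disjoint_def] at h2 ⊢
      rintro ⟨v, w⟩ hv hw
      have hv1 := (Submodule.mem_prod.mp hv).1
      have hw1 := (Submodule.mem_prod.mp hw)
      have : w = 0 := by simpa using hw1.2
      rw [this, show v = 0 from h2 v hv1 hw1.1]; rfl
    · rintro ⟨v, w⟩ hv hv0
      obtain ⟨hv1, hw1⟩ := Submodule.mem_prod.mp hv
      change 0 < Ω v (Ψ' t v) + Θ w (Γ' t w)
      have q1 : 0 ≤ Ω v (Ψ' t v) := by
        by_cases hvz : v = 0
        · simp [hvz]
        · exact (h3 v hv1 hvz).le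
      split_ifs at hw1 with ht0
      · subst ht0
        by_cases hwz : w = 0
        · subst hwz
          have hvz : v ≠ 0 := by rintro rfl; exact hv0 rfl
          have := h3 v hv1 hvz
          simpa using this
        · have := hΓq w hwz
          change 0 < Ω v (Ψ' 0 v) + Θ w (Γ' 0 w)
          linarith
      · have hw0 : w = 0 := by simpa using hw1
        subst hw0
        have hvz : v ≠ 0 := by rintro rfl; exact hv0 rfl
        have := h3 v hv1 hvz
        simpa using this
    · rintro ⟨v, w⟩ hv hv0
      obtain ⟨hv1, hw1⟩ := Submodule.mem_prod.mp hv
      have hw0 : w = 0 := by simpa using hw1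
      subst hw0
      have hvz : v ≠ 0 := by rintro rfl; exact hv0 rfl
      have := h4 v hv1 hvz
      simpa using this
    · rw [finrank_submodule_prod, h5]
      rcases eq_or_ne t 0 with h | h
      · rw [if_pos h]; simp only [if_pos h, finrank_top]
      · rw [if_neg h]; simp only [if_neg h, finrank_bot]
    · rw [finrank_submodule_prod, h6]
      simp
  · push_cast
    have : (finrank ℝ W : ℝ) / 2 = ∑ t ∈ C, (if t = 0 ∨ t = T then (1 / 2 : ℝ) else 1) *
        (if t = 0 then (finrank ℝ W : ℝ) else 0) := by
      rw [Finset.sum_eq_single_of_mem 0 h0C]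
      · simp; ring
      · intro t _ ht; simp [ht]
    rw [this, ← Finset.sum_add_distrib]
    refine Finset.sum_congr rfl fun t _ => ?_
    ring

/-- The point of the unit circle that corresponds to the time `t` of a loop of period `T`. -/
def circlePt (T t : ℝ) : ℂ := Complex.exp (2 * Real.pi * Complex.I * (t / T))

lemma norm_circlePt (T t : ℝ) : ‖circlePt T t‖ = 1 := by
  rw [circlePt]
  have : (2 * Real.pi * Complex.I * (t / T) : ℂ) = ((2 * Real.pi * (t / T) : ℝ) : ℂ) * Complex.I := by
    push_cast; ring
  rw [this, Complex.norm_exp_ofReal_mul_I]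

@[simp] lemma circlePt_zero (T : ℝ) : circlePt T 0 = 1 := by simp [circlePt]

lemma circlePt_self {T : ℝ} (hT : T ≠ 0) : circlePt T T = 1 := by
  rw [circlePt, div_self (by exact_mod_cast hT), mul_one, Complex.exp_two_pi_mul_I]

lemma continuous_circlePt (T : ℝ) : Continuous (circlePt T) := by
  unfold circlePt; fun_prop

variable {E : Type*} [NormedAddCommGroup E] [NormedSpace ℝ E] [FiniteDimensional ℝ E]

/-- **Change of trivialization.** Two symplectic trivializations `F`, `F'` over discs of the same
symplectic vector space `E`, which on the boundary circle differ only by a change of frame of the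
first summand, give the same crossing sum for the linearized flow `D`: the loop of changes of
frame is contractible after stabilization. -/
theorem crossingSum_unique [Nontrivial V] {Ω : LinearMap.BilinForm ℝ V} (hΩ : IsSympForm Ω)
    {Θ : LinearMap.BilinForm ℝ W} (hΘ : IsSympForm Θ) {Ξ : LinearMap.BilinForm ℝ E}
    (hdim : finrank ℝ E = finrank ℝ V + finrank ℝ W)
    {T μ μ' : ℝ} (hT : 0 < T)
    {Γ Γ' : ℝ → W →L[ℝ] W} (hΓ0 : Γ 0 = 1) (hΓp : ∀ t ∈ Set.Icc 0 T, PreservesForm Θ (Γ t))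
    (hΓc : ContinuousOn Γ' (Set.Icc 0 T))
    (hΓd : ∀ t ∈ Set.Icc 0 T, HasDerivWithinAt Γ (Γ' t) (Set.Icc 0 T) t)
    (hΓf : ∀ t ∈ Set.Ioc 0 T, ∀ w, Γ t w = w → w = 0)
    (hΓq : ∀ w, w ≠ 0 → 0 < Θ w (Γ' 0 w))
    {F F' : ℂ → V × W →L[ℝ] E} (hF : ContinuousOn F (Metric.closedBall 0 1))
    (hF' : ContinuousOn F' (Metric.closedBall 0 1))
    (hFs : ∀ ζ ∈ Metric.closedBall (0 : ℂ) 1, ∀ x y, Ξ (F ζ x) (F ζ y) = prodForm Ω Θ x y)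
    (hFs' : ∀ ζ ∈ Metric.closedBall (0 : ℂ) 1, ∀ x y, Ξ (F' ζ x) (F' ζ y) = prodForm Ω Θ x y)
    (hbd : ∀ t, ∀ v, ∃ v', ∀ w, F' (circlePt T t) (v', w) = F (circlePt T t) (v, w))
    {Ψ Ψ' Ψ₁ Ψ₁' : ℝ → V →L[ℝ] V} (h0 : Ψ 0 = 1) (h0' : Ψ' 0 = 1)
    (hrel : ∀ t ∈ Set.Icc 0 T, ∀ v v' : V, F' 1 (v', 0) = F 1 (v, 0) →
      F' (circlePt T t) (Ψ' t v', 0) = F (circlePt T t) (Ψ t v, 0))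
    (hH : FormHomotopic Ω T Ψ Ψ₁) (hH' : FormHomotopic Ω T Ψ' Ψ₁')
    (hμ : CrossingSum Ω T Ψ₁ μ) (hμ' : CrossingSum Ω T Ψ₁' μ') : μ = μ' := by
  have hT0 : (0 : ℝ) ∈ Set.Icc 0 T := ⟨le_rfl, hT.le⟩
  have hTT : T ∈ Set.Icc 0 T := ⟨hT.le, le_rfl⟩
  have i0 : (0 : ℝ) ∈ Set.Icc (0 : ℝ) 1 := by simp
  have i1 : (1 : ℝ) ∈ Set.Icc (0 : ℝ) 1 := by simp
  have hOm := hΩ.prod hΘ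
  set Om := prodForm Ω Θ with hPi
  let J : E ≃L[ℝ] V × W := ContinuousLinearEquiv.ofFinrankEq (by rw [hdim, finrank_prod])
  set f : ℂ → V × W →L[ℝ] V × W := fun ζ => J.toContinuousLinearMap.comp (F ζ) with hf
  set f' : ℂ → V × W →L[ℝ] V × W := fun ζ => J.toContinuousLinearMap.comp (F' ζ) with hf'
  have hfc : ContinuousOn f (Metric.closedBall 0 1) := continuousOn_const.clm_comp hF
  have hfc' : ContinuousOn f' (Metric.closedBall 0 1) := continuousOn_const.clm_comp hF'
  have hunit : ∀ (A : V × W →L[ℝ] E), (∀ x y, Ξ (A x) (A y) = Om x y) →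
      IsUnit (J.toContinuousLinearMap.comp A) := by
    intro A hA
    have hinj : Function.Injective (J.toContinuousLinearMap.comp A).toLinearMap := by
      rw [← LinearMap.ker_eq_bot, LinearMap.ker_eq_bot']
      intro x hx
      have hx' : A x = 0 := by
        have : J (A x) = 0 := hx
        simpa using this
      refine hOm.nondeg x fun y => ?_
      rw [← hA x y, hx']; simp
    set L := (LinearEquiv.ofInjectiveEndo _ hinj).toContinuousLinearEquiv
    refine ⟨⟨J.toContinuousLinearMap.comp A, L.symm.toContinuousLinearMap, ?_, ?_⟩, rfl⟩
    · refine ContinuousLinearMap.ext fun v => ?_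
      exact L.apply_symm_apply v
    · refine ContinuousLinearMap.ext fun v => ?_
      exact L.symm_apply_apply v
  -- `B ζ = (F' ζ)⁻¹ (F ζ)`
  set B : ℂ → V × W →L[ℝ] V × W := fun ζ => Ring.inverse (f' ζ) * f ζ with hB
  have hFB : ∀ ζ ∈ Metric.closedBall (0 : ℂ) 1, ∀ x, F' ζ (B ζ x) = F ζ x := by
    intro ζ hζ x
    have h1 := Ring.mul_inverse_cancel _ (hunit (F' ζ) (hFs' ζ hζ))
    have h2 := congrArg (fun L : V × W →L[ℝ] V × W => L (f ζ x)) h1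
    have h3 : J (F' ζ (B ζ x)) = J (F ζ x) := h2
    exact J.injective h3
  have hF'inj : ∀ ζ ∈ Metric.closedBall (0 : ℂ) 1, Function.Injective (F' ζ) := by
    intro ζ hζ x y hxy
    rw [← sub_eq_zero]
    refine hOm.nondeg _ fun z => ?_
    rw [← hFs' ζ hζ, map_sub, hxy, sub_self]; simp
  have hBc : ContinuousOn B (Metric.closedBall 0 1) :=
    (inverse_continuousOn hfc' (fun ζ hζ => hunit _ (hFs' ζ hζ))).mul hfc
  have hBp : ∀ ζ ∈ Metric.closedBall (0 : ℂ) 1, PreservesForm Om (B ζ) := by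
    intro ζ hζ x y
    rw [← hFs' ζ hζ, hFB ζ hζ, hFB ζ hζ, hFs ζ hζ]
  have hdisc : ∀ s ∈ Set.Icc (0 : ℝ) 1, ∀ t : ℝ, (s : ℂ) * circlePt T t ∈ Metric.closedBall (0 : ℂ) 1 := by
    intro s hs t
    rw [mem_closedBall_zero_iff, norm_mul, norm_circlePt, mul_one, Complex.norm_real,
      Real.norm_of_nonneg hs.1]
    exact hs.2
  have hcirc : ∀ t : ℝ, circlePt T t ∈ Metric.closedBall (0 : ℂ) 1 := fun t => by
    simpa using hdisc 1 i1 t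
  have h1mem : (1 : ℂ) ∈ Metric.closedBall (0 : ℂ) 1 := by simp
  have hsmem : ∀ s ∈ Set.Icc (0 : ℝ) 1, (s : ℂ) ∈ Metric.closedBall (0 : ℂ) 1 := fun s hs => by
    simpa using hdisc s hs 0
  -- the paths stabilized by `Γ`
  set Ψs : ℝ → V × W →L[ℝ] V × W := fun t => (Ψ t).prodMap (Γ t) with hΨs
  set Ψs' : ℝ → V × W →L[ℝ] V × W := fun t => (Ψ' t).prodMap (Γ t) with hΨs'
  have hΓcont : ContinuousOn Γ (Set.Icc 0 T) := fun t ht => (hΓd t ht).continuousWithinAt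
  have stab : ∀ {Φ₀ Φ₁ : ℝ → V →L[ℝ] V}, FormHomotopic Ω T Φ₀ Φ₁ →
      FormHomotopic Om T (fun t => (Φ₀ t).prodMap (Γ t)) (fun t => (Φ₁ t).prodMap (Γ t)) := by
    rintro Φ₀ Φ₁ ⟨H, hc, hp, he, hfx⟩
    refine ⟨fun x => (H x).prodMap (Γ x.2), ?_, ?_, ?_, ?_⟩
    · exact (ContinuousLinearMap.prodMapL ℝ V V W W).continuous.comp_continuousOn
        (hc.prodMk (hΓcont.comp continuousOn_snd fun x hx => hx.2))
    · intro s hs t ht x y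
      simp [hPi, hp s hs t ht x.1 y.1, hΓp t ht x.2 y.2]
    · intro t ht
      simp only [(he t ht).1, (he t ht).2, and_self]
    · intro s hs
      simp only [(hfx s hs).1, (hfx s hs).2, and_self]
  have hΨp : ∀ t ∈ Set.Icc 0 T, PreservesForm Om (Ψs t) := by
    obtain ⟨H, -, hp, he, -⟩ := hH
    intro t ht x y
    have := hp 0 i0 t ht
    rw [(he t ht).1] at this
    simp [hΨs, hPi, this x.1 y.1, hΓp t ht x.2 y.2]
  have hΨc : ContinuousOn Ψs (Set.Icc 0 T) := by
    obtain ⟨H, hc, -, he, -⟩ := hH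
    have h1 : ContinuousOn Ψ (Set.Icc 0 T) := by
      have h2 : ContinuousOn (fun t => H (0, t)) (Set.Icc 0 T) :=
        hc.comp (by fun_prop) (fun t ht => ⟨i0, ht⟩)
      exact h2.congr fun t ht => ((he t ht).1).symm
    exact (ContinuousLinearMap.prodMapL ℝ V V W W).continuous.comp_continuousOn
      (h1.prodMk hΓcont)
  set S := B 1 with hS
  have hSp : PreservesForm Om S := hBp 1 h1mem
  have hSu := hSp.isUnit hOm
  -- conjugation by the change of frame at the base point
  have conjH : ∀ {Φ₀ Φ₁ : ℝ → V × W →L[ℝ] V × W}, FormHomotopic Om T Φ₀ Φ₁ →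
      FormHomotopic Om T (fun t => S * Φ₀ t * Ring.inverse S)
        (fun t => S * Φ₁ t * Ring.inverse S) := by
    rintro Φ₀ Φ₁ ⟨H, hc, hp, he, hfx⟩
    refine ⟨fun x => S * H x * Ring.inverse S, (continuousOn_const.mul hc).mul continuousOn_const,
      fun s hs t ht => (hSp.mul (hp s hs t ht)).mul (hSp.inverse hOm), ?_, ?_⟩
    · intro t ht
      simp only [(he t ht).1, (he t ht).2, and_self]
    · intro s hs
      simp only [(hfx s hs).1, (hfx s hs).2, and_self]
  -- on the circle, the change of frame relates the two stabilized paths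
  have hbdB : ∀ t, ∀ v, ∃ v', ∀ w, B (circlePt T t) (v, w) = (v', w) := by
    intro t v
    obtain ⟨v', hv'⟩ := hbd t v
    refine ⟨v', fun w => hF'inj _ (hcirc t) ?_⟩
    rw [hFB _ (hcirc t), hv']
  have hpath : ∀ t ∈ Set.Icc 0 T, B (circlePt T t) * Ψs t * Ring.inverse S = Ψs' t := by
    intro t ht
    have : B (circlePt T t) * Ψs t = Ψs' t * S := by
      refine ContinuousLinearMap.ext fun x => ?_
      obtain ⟨v, w⟩ := x
      obtain ⟨v', hv'⟩ := hbdB 0 v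
      obtain ⟨v'', hv''⟩ := hbdB t (Ψ t v)
      rw [circlePt_zero] at hv'
      change B (circlePt T t) (Ψ t v, Γ t w) = Ψs' t (S (v, w))
      rw [hv'', hS, hv']
      change _ = (Ψ' t v', Γ t w)
      have h1 : F' 1 (v', 0) = F 1 (v, 0) := by rw [← hFB 1 h1mem, hv']
      have h2 := hrel t ht v v' h1
      have h3 : F' (circlePt T t) (v'', 0) = F (circlePt T t) (Ψ t v, 0) := by
        rw [← hFB _ (hcirc t), hv'']
      have h4 := hF'inj _ (hcirc t) (h3.trans h2.symm)
      rw [(Prod.mk.inj h4).1]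
    rw [this, mul_assoc, Ring.mul_inverse_cancel _ hSu, mul_one]
  -- the homotopy obtained by contracting the disc
  have main : FormHomotopic Om T (fun t => S * Ψs t * Ring.inverse S) Ψs' := by
    refine ⟨fun x => S * (Ring.inverse (B (x.1 : ℂ)) * B ((x.1 : ℂ) * circlePt T x.2)) * Ψs x.2 *
      Ring.inverse S, ?_, ?_, ?_, ?_⟩
    · have c1 : ContinuousOn (fun x : ℝ × ℝ => B (x.1 : ℂ)) (Set.Icc 0 1 ×ˢ Set.Icc 0 T) :=
        hBc.comp (by fun_prop) (fun x hx => hsmem x.1 hx.1)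
      have c2 : ContinuousOn (fun x : ℝ × ℝ => B ((x.1 : ℂ) * circlePt T x.2))
          (Set.Icc 0 1 ×ˢ Set.Icc 0 T) :=
        hBc.comp (by have := continuous_circlePt T; fun_prop) (fun x hx => hdisc x.1 hx.1 x.2)
      have c3 := inverse_continuousOn c1 (fun x hx => (hBp _ (hsmem x.1 hx.1)).isUnit hOm)
      have c4 : ContinuousOn (fun x : ℝ × ℝ => Ψs x.2) (Set.Icc 0 1 ×ˢ Set.Icc 0 T) :=
        hΨc.comp continuousOn_snd fun x hx => hx.2
      exact (((continuousOn_const.mul (c3.mul c2)).mul c4).mul continuousOn_const)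
    · intro s hs t ht
      exact ((hSp.mul (((hBp _ (hsmem s hs)).inverse hOm).mul (hBp _ (hdisc s hs t)))).mul
        (hΨp t ht)).mul (hSp.inverse hOm)
    · intro t ht
      have hu0 := (hBp 0 (by simp)).isUnit hOm
      constructor
      · simp only [Complex.ofReal_zero, zero_mul]
        rw [Ring.inverse_mul_cancel _ hu0, mul_one]
      · simp only [Complex.ofReal_one, one_mul]
        rw [← hpath t ht, ← mul_assoc, Ring.mul_inverse_cancel _ hSu, one_mul]
    · intro s hs
      have hus := (hBp _ (hsmem s hs)).isUnit hOm
      constructor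
      · simp only [circlePt_zero, mul_one]
        rw [Ring.inverse_mul_cancel _ hus, mul_one]
      · simp only [circlePt_self hT.ne', mul_one]
        rw [Ring.inverse_mul_cancel _ hus, mul_one]
  have h01 : Ψ₁ 0 = 1 := by
    obtain ⟨H, -, -, he, hfx⟩ := hH
    rw [← (he 0 hT0).2, (hfx 1 i1).1, h0]
  have h01' : Ψ₁' 0 = 1 := by
    obtain ⟨H, -, -, he, hfx⟩ := hH'
    rw [← (he 0 hT0).2, (hfx 1 i1).1, h0']
  have s1 := (hμ.prodMap hT h01 hΓ0 hΓp hΓc hΓd hΓf hΓq).conj hOm hSp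
  have s2 := hμ'.prodMap hT h01' hΓ0 hΓp hΓc hΓd hΓf hΓq
  have hchain := ((conjH (stab (hH.symm hT))).trans hT main).trans hT (stab hH')
  have hinit : S * (Ψ₁ 0).prodMap (Γ 0) * Ring.inverse S = 1 := by
    have : (Ψ₁ 0).prodMap (Γ 0) = 1 := by rw [h01, hΓ0]; rfl
    rw [this, mul_one, Ring.mul_inverse_cancel _ hSu]
  have := CrossingSum.eq_of_homotopic hOm hT hinit s1 s2 hchain
  linarith

end Stabilization

/-! ### The standard symplectic form and unitary diagonal paths -/

section Diagonal

open Module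

/-- The standard symplectic form of `ℂʳ` as a bilinear form. -/
def stdForm (r : ℕ) : LinearMap.BilinForm ℝ (EuclideanSpace ℂ (Fin r)) :=
  LinearMap.mk₂ ℝ stdSymplectic
    (by intros; simp [stdSymplectic])
    (by intro c x y; simp [stdSymplectic])
    (by intros; simp [stdSymplectic])
    (by intro c x y; simp [stdSymplectic])

lemma stdForm_apply {r : ℕ} (v w : EuclideanSpace ℂ (Fin r)) :
    stdForm r v w = stdSymplectic v w := rfl

lemma stdForm_eq_sum {r : ℕ} (v w : EuclideanSpace ℂ (Fin r)) :
    stdForm r v w = ∑ j, ((starRingEnd ℂ) (v j) * w j).im := by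
  rw [stdForm_apply, stdSymplectic, PiLp.inner_apply, Complex.im_sum]
  refine Finset.sum_congr rfl fun j _ => ?_
  rw [RCLike.inner_apply, mul_comm]

lemma isSympForm_stdForm (r : ℕ) : IsSympForm (stdForm r) where
  alt x := by
    rw [stdForm_apply, stdSymplectic]
    exact inner_self_im (𝕜 := ℂ) x
  nondeg x h := by
    have := h (Complex.I • x)
    rw [stdForm_apply, stdSymplectic, inner_smul_right, inner_self_eq_norm_sq_to_K] at this
    simpa [← Complex.ofReal_pow] using this

lemma hasCrossingSum_iff {r : ℕ} {T μ : ℝ}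
    {Ψ : ℝ → EuclideanSpace ℂ (Fin r) →L[ℝ] EuclideanSpace ℂ (Fin r)} :
    HasCrossingSum T Ψ μ ↔ CrossingSum (stdForm r) T Ψ μ := by
  unfold HasCrossingSum CrossingSum IsSymplectic PreservesForm
  simp only [stdForm_apply]

lemma symplecticHomotopic_iff {r : ℕ} {T : ℝ}
    {Ψ₀ Ψ₁ : ℝ → EuclideanSpace ℂ (Fin r) →L[ℝ] EuclideanSpace ℂ (Fin r)} :
    SymplecticHomotopic T Ψ₀ Ψ₁ ↔ FormHomotopic (stdForm r) T Ψ₀ Ψ₁ := by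
  unfold SymplecticHomotopic FormHomotopic IsSymplectic PreservesForm
  simp only [stdForm_apply]

/-- The diagonal endomorphism of `ℂʳ` with entries `c`, as a real-linear function of `c`. -/
def diagMap (r : ℕ) : (Fin r → ℂ) →L[ℝ] EuclideanSpace ℂ (Fin r) →L[ℝ] EuclideanSpace ℂ (Fin r) :=
  LinearMap.toContinuousLinearMap
    { toFun := fun c => LinearMap.toContinuousLinearMap
        { toFun := fun v => WithLp.toLp 2 fun j => c j * v j
          map_add' := by intro x y; ext j; simp [mul_add]
          map_smul' := by intro a x; ext j; simp; ring }
      map_add' := by intro x y; ext v j; simp [add_mul]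
      map_smul' := by intro a x; ext v j; simp [mul_assoc] }

@[simp] lemma diagMap_apply {r : ℕ} (c : Fin r → ℂ) (v : EuclideanSpace ℂ (Fin r)) (j : Fin r) :
    diagMap r c v j = c j * v j := rfl

/-- The unitary path `t ↦ diag (exp (i θ₁ t), …, exp (i θᵣ t))`. -/
def diagPath {r : ℕ} (θ : Fin r → ℝ) (t : ℝ) :
    EuclideanSpace ℂ (Fin r) →L[ℝ] EuclideanSpace ℂ (Fin r) :=
  diagMap r fun j => Complex.exp ((θ j * t : ℝ) * Complex.I)

lemma diagPath_zero {r : ℕ} (θ : Fin r → ℝ) : diagPath θ 0 = 1 := by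
  ext v j
  simp [diagPath]

lemma hasDerivAt_diagPath {r : ℕ} (θ : Fin r → ℝ) (t : ℝ) :
    HasDerivAt (diagPath θ)
      (diagMap r fun j => Complex.exp ((θ j * t : ℝ) * Complex.I) * (θ j * Complex.I)) t := by
  refine (diagMap r).hasFDerivAt.comp_hasDerivAt t (hasDerivAt_pi.2 fun j => ?_)
  have h1 : HasDerivAt (fun t : ℝ => ((θ j * t : ℝ) : ℂ) * Complex.I) (θ j * Complex.I) t := by
    have := (((hasDerivAt_id t).const_mul (θ j)).ofReal_comp).mul_const Complex.I
    simpa using this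
  exact h1.cexp

lemma preservesForm_diagPath {r : ℕ} (θ : Fin r → ℝ) (t : ℝ) :
    PreservesForm (stdForm r) (diagPath θ t) := by
  intro v w
  rw [stdForm_eq_sum, stdForm_eq_sum]
  refine Finset.sum_congr rfl fun j _ => ?_
  have h : (starRingEnd ℂ) (Complex.exp ((θ j * t : ℝ) * Complex.I)) *
      Complex.exp ((θ j * t : ℝ) * Complex.I) = 1 := by
    rw [mul_comm, Complex.mul_conj, Complex.normSq_eq_norm_sq, Complex.norm_exp_ofReal_mul_I]
    simp
  rw [diagPath, diagMap_apply, diagMap_apply, map_mul]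
  congr 1
  linear_combination (starRingEnd ℂ (v j) * w j) * h

/-- The coordinate subspace of the vectors that vanish outside `s`. -/
def coordSubspace {r : ℕ} (s : Finset (Fin r)) : Submodule ℝ (EuclideanSpace ℂ (Fin r)) where
  carrier := {v | ∀ j ∉ s, v j = 0}
  zero_mem' := fun _ _ => rfl
  add_mem' := fun ha hb j hj => by simp [ha j hj, hb j hj]
  smul_mem' := fun c v hv j hj => by simp [hv j hj]

lemma mem_coordSubspace {r : ℕ} {s : Finset (Fin r)} {v : EuclideanSpace ℂ (Fin r)} :
    v ∈ coordSubspace s ↔ ∀ j ∉ s, v j = 0 := Iff.rfl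

lemma finrank_coordSubspace {r : ℕ} (s : Finset (Fin r)) :
    finrank ℝ (coordSubspace s) = 2 * s.card := by
  classical
  let e : coordSubspace s ≃ₗ[ℝ] (s → ℂ) :=
    { toFun := fun v j => v.1 j
      map_add' := fun _ _ => rfl
      map_smul' := fun _ _ => rfl
      invFun := fun c => ⟨WithLp.toLp 2 fun j => if h : j ∈ s then c ⟨j, h⟩ else 0, fun j hj => by
        simp [hj]⟩
      left_inv := fun v => by
        ext j
        by_cases hj : j ∈ s
        · simp [hj]
        · simp [hj, v.2 j hj]
      right_inv := fun c => by
        ext j; simp }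
  rw [e.finrank_eq, Module.finrank_pi_fintype]
  simp [Complex.finrank_real_complex, mul_comm]

lemma coordSubspace_sup {r : ℕ} (s t : Finset (Fin r)) :
    coordSubspace s ⊔ coordSubspace t = coordSubspace (s ∪ t) := by
  classical
  apply le_antisymm
  · refine sup_le ?_ ?_ <;> intro v hv j hj <;> rw [Finset.mem_union, not_or] at hj
    · exact hv j hj.1
    · exact hv j hj.2
  · intro v hv
    rw [Submodule.mem_sup]
    refine ⟨WithLp.toLp 2 fun j => if j ∈ s then v j else 0, fun j hj => by simp [hj],
      WithLp.toLp 2 fun j => if j ∈ s then 0 else v j, fun j hj => ?_, ?_⟩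
    · by_cases hs : j ∈ s
      · simp [hs]
      · simp [hs, hv j (by simp [hs, hj])]
    · ext j
      by_cases hs : j ∈ s <;> simp [hs]

/-- The crossings of a rotation of angular speed `θ` on `[0, T]`. -/
def rotationCrossings (T θ : ℝ) : Finset ℝ :=
  (Finset.range (⌊|θ| * T / (2 * Real.pi)⌋₊ + 1)).image fun k : ℕ => 2 * Real.pi * k / |θ|

lemma mem_rotationCrossings {T θ t : ℝ} (hT : 0 < T) (hθ : θ ≠ 0) :
    t ∈ rotationCrossings T θ ↔
      t ∈ Set.Icc 0 T ∧ Complex.exp ((θ * t : ℝ) * Complex.I) = 1 := by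
  have hpi := Real.pi_pos
  have hθ' : 0 < |θ| := abs_pos.2 hθ
  rw [rotationCrossings, Finset.mem_image]
  have key : Complex.exp ((θ * t : ℝ) * Complex.I) = 1 ↔ ∃ k : ℤ, |θ| * t = k * (2 * Real.pi) := by
    rw [Complex.exp_eq_one_iff]
    have : ∀ k : ℤ, ((θ * t : ℝ) * Complex.I = k * (2 * Real.pi * Complex.I)) ↔
        θ * t = k * (2 * Real.pi) := by
      intro k
      rw [← mul_assoc, mul_left_inj' Complex.I_ne_zero]
      exact_mod_cast Iff.rfl
    simp only [this]
    rcases abs_choice θ with h | h <;> rw [h]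
    constructor
    · rintro ⟨k, hk⟩; exact ⟨-k, by push_cast; linarith⟩
    · rintro ⟨k, hk⟩; exact ⟨-k, by push_cast; linarith⟩
  rw [key]
  constructor
  · rintro ⟨k, hk, rfl⟩
    rw [Finset.mem_range, Nat.lt_succ_iff, Nat.le_floor_iff (by positivity),
      le_div_iff₀ (by positivity)] at hk
    refine ⟨⟨by positivity, ?_⟩, k, ?_⟩
    · rw [div_le_iff₀ hθ']; linarith
    · push_cast; field_simp
  · rintro ⟨⟨h0, h1⟩, k, hk⟩
    have hk0 : 0 ≤ k := by
      by_contra hneg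
      push Not at hneg
      have : (k : ℝ) < 0 := by exact_mod_cast hneg
      nlinarith [mul_nonneg hθ'.le h0]
    lift k to ℕ using hk0
    refine ⟨k, ?_, ?_⟩
    · rw [Finset.mem_range, Nat.lt_succ_iff, Nat.le_floor_iff (by positivity),
        le_div_iff₀ (by positivity)]
      push_cast at hk
      rw [← hk]
      exact mul_le_mul_of_nonneg_left h1 hθ'.le
    · push_cast at hk
      rw [div_eq_iff hθ'.ne']; linarith

/-- The weighted number of crossings of a rotation. -/
lemma sum_rotationCrossings {T θ : ℝ} (hT : 0 < T) (hθ : θ ≠ 0) :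
    ∑ t ∈ rotationCrossings T θ, (if t = 0 ∨ t = T then (1 / 2 : ℝ) else 1) * 2 =
      ⌊|θ| * T / (2 * Real.pi)⌋ + ⌈|θ| * T / (2 * Real.pi)⌉ := by
  have hpi := Real.pi_pos
  have hθ' : 0 < |θ| := abs_pos.2 hθ
  set x := |θ| * T / (2 * Real.pi) with hx
  have hx0 : 0 < x := by positivity
  rw [rotationCrossings, Finset.sum_image]
  swap
  · intro a _ b _ hab
    have : (2 * Real.pi * a / |θ|) = 2 * Real.pi * b / |θ| := hab
    field_simp at this
    exact_mod_cast this
  rw [Finset.sum_range_succ']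
  have e0 : ∀ k : ℕ, 2 * Real.pi * k / |θ| = 0 ↔ k = 0 := by
    intro k
    rw [div_eq_zero_iff]
    constructor
    · rintro (h | h)
      · have : (k : ℝ) = 0 := by
          rcases mul_eq_zero.1 h with h | h
          · linarith
          · exact h
        exact_mod_cast this
      · exact absurd h hθ'.ne'
    · rintro rfl; simp
  have e1 : ∀ k : ℕ, 2 * Real.pi * k / |θ| = T ↔ (k : ℝ) = x := by
    intro k
    rw [hx, div_eq_iff hθ'.ne', eq_div_iff (by positivity)]
    constructor <;> intro h <;> linarith
  simp only [e0, e1, ← hx]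
  simp only [Nat.succ_ne_zero, false_or, true_or, if_true]
  have hfl : (⌊x⌋ : ℝ) = ⌊x⌋₊ := by
    exact_mod_cast (Int.natCast_floor_eq_floor hx0.le).symm
  by_cases hint : ∃ m : ℕ, (m : ℝ) = x
  · obtain ⟨m, hm⟩ := hint
    have hm0 : m ≠ 0 := by rintro rfl; simp at hm; linarith
    obtain ⟨m, rfl⟩ := Nat.exists_eq_succ_of_ne_zero hm0
    rw [← hm]
    simp only [Nat.floor_natCast, Int.floor_natCast, Int.ceil_natCast, Nat.cast_inj,
      Nat.succ_eq_add_one]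
    rw [Finset.sum_range_succ, Finset.sum_congr rfl (g := fun _ => (2 : ℝ))]
    · simp; ring
    · intro k hk
      rw [Finset.mem_range] at hk
      rw [if_neg (by omega)]; ring
  · push Not at hint
    rw [Finset.sum_congr rfl (g := fun _ => (2 : ℝ))]
    · have hc : ⌈x⌉ = ⌊x⌋ + 1 := by
        rw [Int.ceil_eq_iff]
        push_cast
        rw [hfl]
        have h1 := Nat.floor_le hx0.le
        have h2 := Nat.lt_floor_add_one x
        refine ⟨?_, h2.le⟩
        have := lt_of_le_of_ne h1 (hint _)
        linarith
      rw [hc]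
      push_cast
      rw [hfl]
      simp; ring
    · intro k _
      rw [if_neg (hint _)]; ring

lemma floor_add_ceil_neg (x : ℝ) : (⌊-x⌋ : ℝ) + ⌈-x⌉ = -((⌊x⌋ : ℝ) + ⌈x⌉) := by
  rw [Int.floor_neg, Int.ceil_neg]; push_cast; ring

/-- The Robbin–Salamon index of a unitary diagonal path. -/
theorem hasCrossingSum_diagPath {r : ℕ} {T : ℝ} (hT : 0 < T) {θ : Fin r → ℝ}
    (hθ : ∀ j, θ j ≠ 0) :
    HasCrossingSum T (diagPath θ)
      (∑ j, ((⌊θ j * T / (2 * Real.pi)⌋ : ℝ) + ⌈θ j * T / (2 * Real.pi)⌉)) := by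
  classical
  refine ⟨fun t _ => preservesForm_diagPath θ t, _, ?_,
    fun t _ => (hasDerivAt_diagPath θ t).hasDerivWithinAt,
    Finset.univ.biUnion fun j => rotationCrossings T (θ j),
    fun t => 2 * (Finset.univ.filter fun j => t ∈ rotationCrossings T (θ j) ∧ 0 < θ j).card,
    fun t => 2 * (Finset.univ.filter fun j => t ∈ rotationCrossings T (θ j) ∧ θ j < 0).card,
    ?_, ?_, ?_⟩
  · apply Continuous.continuousOn
    refine (diagMap r).continuous.comp (continuous_pi fun j => ?_)
    fun_prop
  · intro t
    simp only [Finset.mem_biUnion, Finset.mem_univ, true_and, mem_rotationCrossings hT (hθ _)]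
    constructor
    · rintro ⟨j, htI, hj⟩
      refine ⟨htI, EuclideanSpace.single j 1, ?_, ?_⟩
      · intro h
        have := congrArg (fun v : EuclideanSpace ℂ (Fin r) => v j) h
        simp at this
      · ext i
        rw [diagPath, diagMap_apply]
        by_cases hij : i = j
        · subst hij; rw [hj, one_mul]
        · simp [hij]
    · rintro ⟨htI, v, hv, hfix⟩
      obtain ⟨j, hj⟩ : ∃ j, v j ≠ 0 := by
        by_contra! h
        exact hv (by ext j; exact h j)
      refine ⟨j, htI, ?_⟩
      have := congrArg (fun v : EuclideanSpace ℂ (Fin r) => v j) hfix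
      simp only [diagPath, diagMap_apply] at this
      exact mul_right_cancel₀ hj (by rw [this, one_mul])
  · intro t ht
    have htI : t ∈ Set.Icc 0 T := by
      simp only [Finset.mem_biUnion, Finset.mem_univ, true_and, mem_rotationCrossings hT (hθ _)] at ht
      obtain ⟨j, h, -⟩ := ht
      exact h
    have hpos : ∀ s : Finset (Fin r), (∀ j ∈ s, t ∈ rotationCrossings T (θ j)) →
        ∀ v ∈ coordSubspace s, stdSymplectic v ((diagMap r fun j =>
          Complex.exp ((θ j * t : ℝ) * Complex.I) * (θ j * Complex.I)) v) =
          ∑ j, θ j * ‖v j‖ ^ 2 := by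
      intro s hs v hv
      rw [← stdForm_apply, stdForm_eq_sum]
      refine Finset.sum_congr rfl fun j _ => ?_
      rw [diagMap_apply]
      by_cases hj : j ∈ s
      · rw [((mem_rotationCrossings hT (hθ j)).1 (hs j hj)).2, one_mul]
        have : (starRingEnd ℂ) (v j) * (θ j * Complex.I * v j) =
            ((θ j * ‖v j‖ ^ 2 : ℝ) : ℂ) * Complex.I := by
          have := Complex.mul_conj' (v j)
          push_cast
          linear_combination (θ j * Complex.I) * this
        rw [this, Complex.im_ofReal_mul, Complex.I_im, mul_one]
      · rw [hv j hj]; simp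
    have hnz : ∀ v : EuclideanSpace ℂ (Fin r), v ≠ 0 → ∃ j, v j ≠ 0 := by
      intro v hv
      by_contra! h
      exact hv (by ext j; exact h j)
    refine ⟨coordSubspace (Finset.univ.filter fun j => t ∈ rotationCrossings T (θ j) ∧ 0 < θ j),
      coordSubspace (Finset.univ.filter fun j => t ∈ rotationCrossings T (θ j) ∧ θ j < 0),
      ?_, ?_, ?_, ?_, finrank_coordSubspace _, finrank_coordSubspace _⟩
    · rw [coordSubspace_sup]
      ext v
      rw [mem_coordSubspace, LinearMap.mem_ker]
      have : (diagPath θ t - ContinuousLinearMap.id ℝ _).toLinearMap v = 0 ↔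
          ∀ j, Complex.exp ((θ j * t : ℝ) * Complex.I) * v j = v j := by
        change diagPath θ t v - v = 0 ↔ _
        rw [sub_eq_zero]
        constructor
        · intro h j
          exact congrArg (fun v : EuclideanSpace ℂ (Fin r) => v j) h
        · intro h; ext j; exact h j
      rw [this]
      refine forall_congr' fun j => ?_
      simp only [Finset.mem_union, Finset.mem_filter, Finset.mem_univ, true_and]
      rw [mem_rotationCrossings hT (hθ j)]
      constructor
      · intro h
        by_cases hv : v j = 0
        · simp [hv]
        · have : ¬ ¬ Complex.exp ((θ j * t : ℝ) * Complex.I) = 1 := by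
            intro hne
            exact hv (h (by rintro (h | h) <;> exact hne h.1.2))
          rw [not_not.1 this, one_mul]
      · intro h hn
        by_contra hv
        have h1 : Complex.exp ((θ j * t : ℝ) * Complex.I) = 1 :=
          mul_right_cancel₀ hv (by rw [h, one_mul])
        rcases lt_or_gt_of_ne (hθ j) with h2 | h2
        · exact hn (Or.inr ⟨⟨htI, h1⟩, h2⟩)
        · exact hn (Or.inl ⟨⟨htI, h1⟩, h2⟩)
    · rw [Submodule.disjoint_def]
      intro v h1 h2
      ext j
      by_cases hj : 0 < θ j
      · exact h2 j (by simp [not_lt.2 hj.le])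
      · exact h1 j (by simp [hj])
    · intro v hv hv0
      simp only
      rw [hpos _ (fun j hj => (Finset.mem_filter.1 hj).2.1) v hv]
      obtain ⟨j, hj⟩ := hnz v hv0
      refine Finset.sum_pos' (fun i _ => ?_) ⟨j, Finset.mem_univ _, ?_⟩
      · by_cases hi : 0 < θ i
        · positivity
        · rw [hv i (by simp [hi])]; simp
      · have : 0 < θ j := by
          by_contra h
          exact hj (hv j (by simp [h]))
        positivity
    · intro v hv hv0
      simp only
      rw [hpos _ (fun j hj => (Finset.mem_filter.1 hj).2.1) v hv, ← neg_pos, ← Finset.sum_neg_distrib]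
      obtain ⟨j, hj⟩ := hnz v hv0
      refine Finset.sum_pos' (fun i _ => ?_) ⟨j, Finset.mem_univ _, ?_⟩
      · by_cases hi : θ i < 0
        · nlinarith [sq_nonneg ‖v i‖]
        · rw [hv i (by simp [hi])]; simp
      · have h1 : θ j < 0 := by
          by_contra h
          exact hj (hv j (by simp [h]))
        have : 0 < ‖v j‖ ^ 2 := by positivity
        nlinarith
  · -- exchange the sums over the crossings and over the coordinates
    have h1 : ∀ t, ((2 * (Finset.univ.filter fun j => t ∈ rotationCrossings T (θ j) ∧ 0 < θ j).card
        : ℕ) : ℝ) - ((2 * (Finset.univ.filter fun j =>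
          t ∈ rotationCrossings T (θ j) ∧ θ j < 0).card : ℕ) : ℝ) =
        ∑ j, if t ∈ rotationCrossings T (θ j) then (if 0 < θ j then (2 : ℝ) else -2) else 0 := by
      intro t
      rw [Finset.card_filter, Finset.card_filter]
      push_cast
      rw [← mul_sub, ← Finset.sum_sub_distrib, Finset.mul_sum]
      refine Finset.sum_congr rfl fun j _ => ?_
      by_cases h2 : t ∈ rotationCrossings T (θ j)
      · rcases lt_or_gt_of_ne (hθ j) with h3 | h3
        · simp [h2, h3, not_lt.2 h3.le]
        · simp [h2, h3, not_lt.2 h3.le]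
      · simp [h2]
    simp only [h1, Finset.mul_sum]
    rw [Finset.sum_comm]
    refine Finset.sum_congr rfl fun j _ => ?_
    have hsub : rotationCrossings T (θ j) ⊆ Finset.univ.biUnion fun j => rotationCrossings T (θ j) :=
      Finset.subset_biUnion_of_mem (fun j => rotationCrossings T (θ j)) (Finset.mem_univ j)
    rw [← Finset.sum_subset hsub]
    swap
    · intro t _ ht; rw [if_neg ht, mul_zero]
    have hs := sum_rotationCrossings hT (hθ j)
    rcases lt_or_gt_of_ne (hθ j) with h3 | h3
    · rw [abs_of_neg h3] at hs
      have : -θ j * T / (2 * Real.pi) = -(θ j * T / (2 * Real.pi)) := by ring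
      rw [this, floor_add_ceil_neg, ← neg_inj, neg_neg, ← Finset.sum_neg_distrib] at hs
      rw [← hs]
      refine Finset.sum_congr rfl fun t ht => ?_
      rw [if_pos ht, if_neg (not_lt.2 h3.le)]; ring
    · rw [abs_of_pos h3] at hs
      rw [← hs]
      refine Finset.sum_congr rfl fun t ht => ?_
      rw [if_pos ht, if_pos h3]

end Diagonal

/-! ### Linear algebra of the Brieskorn manifold -/

section Geometry

open Module

/-- The ambient space `ℂⁿ⁺¹`. -/
abbrev Amb (n : ℕ) := EuclideanSpace ℂ (Fin (n + 1))

lemma brieskornExp_pos {n p : ℕ} (hp : 0 < p) (k : Fin (n + 1)) : 0 < brieskornExp n p k := by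
  unfold brieskornExp; split_ifs <;> omega

@[simp] lemma brieskornExp_last (n p : ℕ) : brieskornExp n p (Fin.last n) = p := by
  simp [brieskornExp]

@[simp] lemma brieskornExp_castSucc (n p : ℕ) (k : Fin n) :
    brieskornExp n p k.castSucc = 2 := by
  simp [brieskornExp, Fin.castSucc_ne_last]

/-- The weighted hermitian form `∑ (aₖ / 2) ūₖ vₖ`, whose imaginary part is `dλ_p`. -/
def wHerm (n p : ℕ) (u v : Amb n) : ℂ :=
  ∑ k, (brieskornExp n p k / 2 : ℂ) * ((starRingEnd ℂ) (u k) * v k)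

lemma wHerm_add_left {n p : ℕ} (u u' v : Amb n) :
    wHerm n p (u + u') v = wHerm n p u v + wHerm n p u' v := by
  simp only [wHerm, ← Finset.sum_add_distrib]
  refine Finset.sum_congr rfl fun k _ => ?_
  simp; ring

lemma wHerm_add_right {n p : ℕ} (u v v' : Amb n) :
    wHerm n p u (v + v') = wHerm n p u v + wHerm n p u v' := by
  simp only [wHerm, ← Finset.sum_add_distrib]
  refine Finset.sum_congr rfl fun k _ => ?_
  simp; ring

lemma wHerm_smul_right {n p : ℕ} (u v : Amb n) (c : ℂ) :
    wHerm n p u (c • v) = c * wHerm n p u v := by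
  simp only [wHerm, Finset.mul_sum]
  refine Finset.sum_congr rfl fun k _ => ?_
  simp; ring

lemma wHerm_smul_left {n p : ℕ} (u v : Amb n) (c : ℂ) :
    wHerm n p (c • u) v = (starRingEnd ℂ) c * wHerm n p u v := by
  simp only [wHerm, Finset.mul_sum]
  refine Finset.sum_congr rfl fun k _ => ?_
  simp; ring

lemma wHerm_conj {n p : ℕ} (u v : Amb n) :
    (starRingEnd ℂ) (wHerm n p u v) = wHerm n p v u := by
  simp only [wHerm, map_sum, map_mul, Complex.conj_conj, map_div₀, Complex.conj_natCast,
    Complex.conj_ofNat]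
  refine Finset.sum_congr rfl fun k _ => ?_
  ring

lemma wHerm_self {n p : ℕ} (u : Amb n) :
    wHerm n p u u = ((∑ k, (brieskornExp n p k / 2 : ℝ) * ‖u k‖ ^ 2 : ℝ) : ℂ) := by
  simp only [wHerm]
  push_cast
  refine Finset.sum_congr rfl fun k _ => ?_
  rw [mul_comm ((starRingEnd ℂ) (u k)), Complex.mul_conj']

lemma wHerm_self_pos {n p : ℕ} (hp : 0 < p) {u : Amb n} (hu : u ≠ 0) :
    0 < (wHerm n p u u).re := by
  rw [wHerm_self, Complex.ofReal_re]
  obtain ⟨j, hj⟩ : ∃ j, u j ≠ 0 := by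
    by_contra! h
    exact hu (by ext j; exact h j)
  have hb : ∀ k, 0 < (brieskornExp n p k : ℝ) := fun k => by exact_mod_cast brieskornExp_pos hp k
  refine Finset.sum_pos' (fun k _ => ?_) ⟨j, Finset.mem_univ _, ?_⟩
  · have := hb k; positivity
  · have := hb j; positivity

/-- The symplectic form `dλ_p`. -/
def wForm (n p : ℕ) : LinearMap.BilinForm ℝ (Amb n) :=
  LinearMap.mk₂ ℝ (fun u v => (wHerm n p u v).im)
    (by intros; simp only [wHerm_add_left, Complex.add_im])
    (by
      intro c u v
      have : c • u = (c : ℂ) • u := by ext k; simp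
      rw [this, wHerm_smul_left, Complex.conj_ofReal, Complex.im_ofReal_mul, smul_eq_mul])
    (by intros; simp only [wHerm_add_right, Complex.add_im])
    (by
      intro c u v
      have : c • v = (c : ℂ) • v := by ext k; simp
      rw [this, wHerm_smul_right, Complex.im_ofReal_mul, smul_eq_mul])

lemma wForm_apply {n p : ℕ} (u v : Amb n) : wForm n p u v = (wHerm n p u v).im := rfl

lemma wForm_self {n p : ℕ} (u : Amb n) : wForm n p u u = 0 := by
  rw [wForm_apply, wHerm_self, Complex.ofReal_im]

lemma wForm_skew {n p : ℕ} (u v : Amb n) : wForm n p u v = -wForm n p v u := by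
  rw [wForm_apply, wForm_apply, ← wHerm_conj, Complex.conj_im]

lemma brieskornForm_eq {n p : ℕ} (z v : Amb n) : brieskornForm n p z v = wForm n p z v / 2 := by
  have h : Complex.I / 8 * ∑ k, (brieskornExp n p k : ℂ) *
      (z k * (starRingEnd ℂ) (v k) - (starRingEnd ℂ) (z k) * v k) =
      Complex.I / 4 * ((starRingEnd ℂ) (wHerm n p z v) - wHerm n p z v) := by
    rw [wHerm_conj, wHerm, wHerm, ← Finset.sum_sub_distrib, Finset.mul_sum, Finset.mul_sum]
    refine Finset.sum_congr rfl fun k _ => ?_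
    ring
  rw [brieskornForm, h, wForm_apply]
  have h2 : (starRingEnd ℂ) (wHerm n p z v) - wHerm n p z v =
      ((-2 * (wHerm n p z v).im : ℝ) : ℂ) * Complex.I := by
    apply Complex.ext <;> simp; ring
  rw [h2]
  have h3 : Complex.I / 4 * (((-2 * (wHerm n p z v).im : ℝ) : ℂ) * Complex.I) =
      (((wHerm n p z v).im / 2 : ℝ) : ℂ) := by
    push_cast
    linear_combination (-(wHerm n p z v).im / 2 : ℂ) * Complex.I_mul_I
  rw [h3, Complex.ofReal_re]

/-- The complex differential of `brieskornPoly`. -/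
def polyDiff (n p : ℕ) (z v : Amb n) : ℂ :=
  ∑ k, (brieskornExp n p k : ℂ) * z k ^ (brieskornExp n p k - 1) * v k

lemma polyDiff_add {n p : ℕ} (z u v : Amb n) :
    polyDiff n p z (u + v) = polyDiff n p z u + polyDiff n p z v := by
  simp only [polyDiff, ← Finset.sum_add_distrib]
  refine Finset.sum_congr rfl fun k _ => ?_
  simp; ring

lemma polyDiff_smul {n p : ℕ} (z v : Amb n) (c : ℂ) :
    polyDiff n p z (c • v) = c * polyDiff n p z v := by
  simp only [polyDiff, Finset.mul_sum]
  refine Finset.sum_congr rfl fun k _ => ?_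
  simp; ring

lemma contDiff_brieskornPoly (n p : ℕ) : ContDiff ℝ ∞ (brieskornPoly n p) := by
  unfold brieskornPoly; fun_prop

lemma fderiv_brieskornPoly {n p : ℕ} (z v : Amb n) :
    fderiv ℝ (brieskornPoly n p) z v = polyDiff n p z v := by
  have hd : DifferentiableAt ℝ (brieskornPoly n p) z :=
    (contDiff_brieskornPoly n p).differentiable (by simp) z
  rw [← hd.lineDeriv_eq_fderiv]
  refine HasLineDerivAt.lineDeriv ?_
  unfold HasLineDerivAt brieskornPoly polyDiff
  refine HasDerivAt.fun_sum fun k _ => ?_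
  have h1 : HasDerivAt (fun t : ℝ => (z + t • v) k) (v k) 0 := by
    have h2 : HasDerivAt (fun t : ℝ => z k + (t : ℂ) * v k) (v k) 0 := by
      have := ((Complex.ofRealCLM.hasDerivAt (x := (0 : ℝ))).mul_const (v k)).const_add (z k)
      simpa using this
    refine h2.congr_of_eventuallyEq (Filter.Eventually.of_forall fun t => ?_)
    simp
  refine (h1.fun_pow (brieskornExp n p k)).congr_deriv ?_
  simp

/-- The direction of the Reeb vector field of `λ_p`. -/
def reebDir (n p : ℕ) (z : Amb n) : Amb n :=
  WithLp.toLp 2 fun k => 4 * Complex.I / brieskornExp n p k * z k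

lemma polyDiff_reebDir {n p : ℕ} (hp : 0 < p) (z : Amb n) :
    polyDiff n p z (reebDir n p z) = 4 * Complex.I * brieskornPoly n p z := by
  rw [polyDiff, brieskornPoly, Finset.mul_sum]
  refine Finset.sum_congr rfl fun k _ => ?_
  have ha := brieskornExp_pos (n := n) hp k
  have ha' : (brieskornExp n p k : ℂ) ≠ 0 := by exact_mod_cast ha.ne'
  obtain ⟨b, hb⟩ := Nat.exists_eq_succ_of_ne_zero ha.ne'
  simp only [reebDir]
  rw [hb] at ha' ⊢
  simp only [Nat.succ_eq_add_one, Nat.add_sub_cancel, pow_succ] at ha' ⊢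
  field_simp

lemma inner_eq_sum {n : ℕ} (u v : Amb n) :
    inner ℂ u v = ∑ k, (starRingEnd ℂ) (u k) * v k := by
  rw [PiLp.inner_apply]
  refine Finset.sum_congr rfl fun k _ => ?_
  rw [RCLike.inner_apply, mul_comm]

lemma wHerm_reebDir_left {n p : ℕ} (hp : 0 < p) (z v : Amb n) :
    wHerm n p (reebDir n p z) v = -2 * Complex.I * inner ℂ z v := by
  rw [inner_eq_sum, wHerm, Finset.mul_sum]
  refine Finset.sum_congr rfl fun k _ => ?_
  have ha : (brieskornExp n p k : ℂ) ≠ 0 := by exact_mod_cast (brieskornExp_pos (n := n) hp k).ne'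
  simp only [reebDir, map_mul, map_div₀, Complex.conj_natCast, Complex.conj_I, Complex.conj_ofNat]
  field_simp
  ring

lemma wForm_reebDir_left {n p : ℕ} (hp : 0 < p) (z v : Amb n) :
    wForm n p (reebDir n p z) v = -2 * (inner ℂ z v).re := by
  rw [wForm_apply, wHerm_reebDir_left hp]
  simp

/-- `⟨z, reebDir z⟩ = i s` with `s = reebWeight z > 0`. -/
def reebWeight (n p : ℕ) (z : Amb n) : ℝ := ∑ k, 4 / (brieskornExp n p k : ℝ) * ‖z k‖ ^ 2

lemma inner_reebDir {n p : ℕ} (z : Amb n) :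
    inner ℂ z (reebDir n p z) = reebWeight n p z * Complex.I := by
  rw [inner_eq_sum, reebWeight]
  push_cast
  rw [Finset.sum_mul]
  refine Finset.sum_congr rfl fun k _ => ?_
  have := Complex.mul_conj' (z k)
  simp only [reebDir]
  linear_combination (4 * Complex.I / brieskornExp n p k) * this

lemma reebWeight_pos {n p : ℕ} (hp : 0 < p) {z : Amb n} (hz : z ≠ 0) : 0 < reebWeight n p z := by
  obtain ⟨j, hj⟩ : ∃ j, z j ≠ 0 := by
    by_contra! h
    exact hz (by ext j; exact h j)
  have hb : ∀ k, 0 < (brieskornExp n p k : ℝ) := fun k => by exact_mod_cast brieskornExp_pos hp k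
  refine Finset.sum_pos' (fun k _ => ?_) ⟨j, Finset.mem_univ _, ?_⟩
  · have := hb k; positivity
  · have := hb j; positivity

lemma brieskornForm_reebDir {n p : ℕ} (hp : 0 < p) (z : Amb n) :
    brieskornForm n p z (reebDir n p z) = ‖z‖ ^ 2 := by
  rw [brieskornForm_eq, wForm_skew, wForm_reebDir_left hp, inner_self_eq_norm_sq_to_K]
  simp [← Complex.ofReal_pow]

/-- The component of `v` in the complex subspace `ker dP ∩ z^⊥` along `reebDir z`. -/
def toHol (n p : ℕ) (z v : Amb n) : Amb n :=
  v - ((inner ℂ z v).im / reebWeight n p z : ℝ) • reebDir n p z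

lemma real_smul_eq {n : ℕ} (c : ℝ) (v : Amb n) : c • v = (c : ℂ) • v := by ext k; simp

lemma mem_brieskornTangent {n p : ℕ} {z v : Amb n} :
    v ∈ brieskornTangent n p z ↔ polyDiff n p z v = 0 ∧ (inner ℂ z v).re = 0 := by
  change fderiv ℝ (brieskornPoly n p) z v = 0 ∧ _ ↔ _
  rw [fderiv_brieskornPoly]

lemma brieskornSphere_ne_zero {n p : ℕ} {z : Amb n} (hz : z ∈ brieskornSphere n p) : z ≠ 0 := by
  rintro rfl
  simpa using hz.2

lemma polyDiff_toHol {n p : ℕ} (hp : 0 < p) {z v : Amb n} (hz : z ∈ brieskornSphere n p)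
    (hv : polyDiff n p z v = 0) : polyDiff n p z (toHol n p z v) = 0 := by
  rw [toHol, sub_eq_add_neg, ← neg_smul, real_smul_eq, polyDiff_add, polyDiff_smul,
    polyDiff_reebDir hp, hz.1, hv]
  simp

lemma inner_toHol {n p : ℕ} (hp : 0 < p) {z v : Amb n} (hz : z ∈ brieskornSphere n p)
    (hv : (inner ℂ z v).re = 0) : inner ℂ z (toHol n p z v) = 0 := by
  have h := reebWeight_pos hp (brieskornSphere_ne_zero hz)
  have h' : (reebWeight n p z : ℂ) ≠ 0 := by exact_mod_cast h.ne'
  rw [toHol, inner_sub_right, real_smul_eq, inner_smul_right, inner_reebDir]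
  push_cast
  rw [← mul_assoc, div_mul_cancel₀ _ h', sub_eq_zero]
  apply Complex.ext <;> simp [hv]

lemma re_inner_reebDir {n p : ℕ} (z : Amb n) : (inner ℂ z (reebDir n p z)).re = 0 := by
  rw [inner_reebDir]; simp

lemma wForm_reebDir_reebDir {n p : ℕ} (hp : 0 < p) (z : Amb n) (c d : ℝ) (u v : Amb n)
    (hu : (inner ℂ z u).re = 0) (hv : (inner ℂ z v).re = 0) :
    wForm n p (u - c • reebDir n p z) (v - d • reebDir n p z) = wForm n p u v := by
  simp only [map_sub, map_smul, LinearMap.sub_apply, LinearMap.smul_apply,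
    wForm_reebDir_left hp, wForm_skew u (reebDir n p z), hu, hv, re_inner_reebDir]
  simp

lemma sphere_norm {n p : ℕ} {z : Amb n} (hz : z ∈ brieskornSphere n p) : ‖z‖ = 1 := hz.2

lemma form_reebDir {n p : ℕ} (hp : 0 < p) {z : Amb n} (hz : z ∈ brieskornSphere n p) :
    wForm n p z (reebDir n p z) = 2 := by
  have := brieskornForm_reebDir (n := n) hp z
  rw [brieskornForm_eq, sphere_norm hz] at this
  linarith

/-- `toHol` is inverse to the projection along `reebDir` onto the contact plane. -/
lemma toHol_recover {n p : ℕ} (hp : 0 < p) {z v : Amb n} (hz : z ∈ brieskornSphere n p)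
    (hv : wForm n p z v = 0) :
    toHol n p z v - (wForm n p z (toHol n p z v) / 2) • reebDir n p z = v := by
  have : wForm n p z (toHol n p z v) = -2 * ((inner ℂ z v).im / reebWeight n p z) := by
    rw [toHol, map_sub, map_smul, hv, form_reebDir hp hz, smul_eq_mul]; ring
  rw [this, toHol, sub_sub, ← add_smul]
  have h0 : (inner ℂ z v).im / reebWeight n p z +
    -2 * ((inner ℂ z v).im / reebWeight n p z) / 2 = 0 := by ring
  rw [h0, zero_smul, sub_zero]

lemma eq_zero_of_toHol {n p : ℕ} (hp : 0 < p) {z v : Amb n} (hz : z ∈ brieskornSphere n p)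
    (hv : wForm n p z v = 0) (h : toHol n p z v = 0) : v = 0 := by
  rw [← toHol_recover hp hz hv, h]; simp

/-- `dλ_p` is nondegenerate on the contact planes. -/
lemma wForm_nondeg {n p : ℕ} (hp : 0 < p) {z d : Amb n} (hz : z ∈ brieskornSphere n p)
    (hd : d ∈ brieskornTangent n p z) (hd0 : wForm n p z d = 0)
    (h : ∀ v ∈ brieskornTangent n p z, wForm n p z v = 0 → wForm n p d v = 0) : d = 0 := by
  rw [mem_brieskornTangent] at hd
  set c := toHol n p z d with hc
  have hc1 := polyDiff_toHol hp hz hd.1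
  have hc2 := inner_toHol hp hz hd.2
  rw [← hc] at hc1 hc2
  by_contra hne
  have hcne : c ≠ 0 := fun h0 => hne (eq_zero_of_toHol hp hz hd0 h0)
  obtain ⟨e, he⟩ : ∃ e, e = Complex.I • c := ⟨_, rfl⟩
  have hi : inner ℂ z e = 0 := by rw [he, inner_smul_right, hc2, mul_zero]
  obtain ⟨w, hw⟩ : ∃ w, w = e - (wForm n p z e / 2) • reebDir n p z := ⟨_, rfl⟩
  have hwi : (inner ℂ z w).re = 0 := by
    rw [hw, inner_sub_right, hi, real_smul_eq, inner_smul_right, inner_reebDir]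
    simp
  have hw0 : wForm n p z w = 0 := by
    rw [hw, map_sub, map_smul, form_reebDir hp hz, smul_eq_mul]; ring
  have hwt : w ∈ brieskornTangent n p z := by
    refine mem_brieskornTangent.2 ⟨?_, hwi⟩
    rw [hw, sub_eq_add_neg, ← neg_smul, real_smul_eq, polyDiff_add, he, polyDiff_smul,
      polyDiff_smul, hc1, polyDiff_reebDir hp, hz.1]
    simp
  have h1 : wForm n p c w = 0 := by
    rw [hc, toHol, map_sub, LinearMap.sub_apply, h w hwt hw0, map_smul, LinearMap.smul_apply,
      wForm_reebDir_left hp, hwi]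
    simp
  have h2 := wForm_reebDir_reebDir hp z 0 (wForm n p z e / 2) c e
    (by rw [hc2]; rfl) (by rw [hi]; rfl)
  rw [zero_smul, sub_zero, ← hw, h1, wForm_apply, he, wHerm_smul_right, Complex.I_mul_im] at h2
  exact (wHerm_self_pos hp hcne).ne h2

end Geometry

/-! ### The Reeb flow -/

section ReebFlow

open Module

variable {n p : ℕ}

lemma fin_zero_ne_one (hn : 2 ≤ n) : (0 : Fin (n + 1)) ≠ 1 := by
  intro h
  have := congrArg Fin.val h
  rw [Fin.val_zero, Fin.val_one'] at this
  rw [Nat.mod_eq_of_lt (by omega)] at this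
  omega

lemma fin_zero_ne_last (hn : 2 ≤ n) : (0 : Fin (n + 1)) ≠ Fin.last n := by
  intro h
  have := congrArg Fin.val h
  rw [Fin.val_zero, Fin.val_last] at this
  omega

lemma fin_one_ne_last (hn : 2 ≤ n) : (1 : Fin (n + 1)) ≠ Fin.last n := by
  intro h
  have := congrArg Fin.val h
  rw [Fin.val_one', Fin.val_last, Nat.mod_eq_of_lt (by omega)] at this
  omega

lemma brieskornExp_zero (hn : 2 ≤ n) : brieskornExp n p 0 = 2 := by
  rw [brieskornExp, if_neg (fin_zero_ne_last hn)]

lemma brieskornExp_one (hn : 2 ≤ n) : brieskornExp n p 1 = 2 := by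
  rw [brieskornExp, if_neg (fin_one_ne_last hn)]

/-- Two sums over the coordinates agree if they do so separately over `{0, 1}` and termwise over
the other coordinates. -/
lemma sum_eq_of_pair {M : Type*} [AddCommMonoid M] (hn : 2 ≤ n) {F G : Fin (n + 1) → M}
    (h01 : F 0 + F 1 = G 0 + G 1) (h : ∀ k, k ≠ 0 → k ≠ 1 → F k = G k) :
    ∑ k, F k = ∑ k, G k := by
  have key : ∀ F : Fin (n + 1) → M,
      ∑ k, F k = F 0 + F 1 + ∑ k ∈ (Finset.univ.erase 0).erase 1, F k := by
    intro F
    rw [add_assoc, Finset.add_sum_erase _ _ (by simp [(fin_zero_ne_one hn).symm]),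
      Finset.add_sum_erase _ _ (Finset.mem_univ _)]
  rw [key F, key G, h01]
  congr 1
  refine Finset.sum_congr rfl fun k hk => ?_
  simp only [Finset.mem_erase, Finset.mem_univ, and_true] at hk
  exact h k hk.2 hk.1

/-- The hermitian operator `H` with `K z = ⟨z, H z⟩`. -/
def hamOp (n : ℕ) (ε : ℝ) : Amb n →L[ℂ] Amb n :=
  LinearMap.toContinuousLinearMap
    { toFun := fun z => WithLp.toLp 2 fun k => z k + ε *
        ((if k = 0 then Complex.I * z 1 else 0) + (if k = 1 then -Complex.I * z 0 else 0))
      map_add' := by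
        intro x y; ext k
        simp only [PiLp.add_apply]
        split_ifs <;> ring
      map_smul' := by
        intro c x; ext k
        simp only [PiLp.smul_apply, smul_eq_mul, RingHom.id_apply]
        split_ifs <;> ring }

lemma hamOp_apply (ε : ℝ) (z : Amb n) (k : Fin (n + 1)) : hamOp n ε z k = z k + ε *
    ((if k = 0 then Complex.I * z 1 else 0) + (if k = 1 then -Complex.I * z 0 else 0)) := rfl

lemma inner_hamOp (ε : ℝ) (u v : Amb n) : inner ℂ u (hamOp n ε v) = inner ℂ u v +
    ε * Complex.I * ((starRingEnd ℂ) (u 0) * v 1 - (starRingEnd ℂ) (u 1) * v 0) := by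
  rw [inner_eq_sum, inner_eq_sum]
  simp only [hamOp_apply, mul_add, Finset.sum_add_distrib, mul_ite, mul_zero, Finset.sum_ite_eq',
    Finset.mem_univ, if_true]
  ring

lemma inner_hamOp_left (ε : ℝ) (u v : Amb n) :
    inner ℂ (hamOp n ε u) v = inner ℂ u (hamOp n ε v) := by
  rw [← inner_conj_symm, inner_hamOp, inner_hamOp, map_add, inner_conj_symm]
  congr 1
  simp
  ring

lemma perturbK_eq (ε : ℝ) (z : Amb n) : perturbK n ε z = (inner ℂ z (hamOp n ε z)).re := by
  have h2 : ‖(Real.sqrt 2 : ℂ)‖ ^ 2 = 2 := by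
    rw [Complex.norm_real, Real.norm_of_nonneg (Real.sqrt_nonneg _), Real.sq_sqrt (by norm_num)]
  rw [perturbK, inner_hamOp, inner_self_eq_norm_sq_to_K, norm_div, norm_div, div_pow, div_pow, h2,
    ← Complex.normSq_eq_norm_sq, ← Complex.normSq_eq_norm_sq]
  simp [Complex.normSq_apply, ← Complex.ofReal_pow]
  ring

lemma perturbK_pos {ε : ℝ} (hn : 2 ≤ n) (h0 : 0 < ε) (h1 : ε < 1) {z : Amb n} (hz : z ≠ 0) :
    0 < perturbK n ε z := by
  rw [perturbK_eq, inner_hamOp, inner_self_eq_norm_sq_to_K]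
  have hb : ‖(starRingEnd ℂ) (z 0) * z 1 - (starRingEnd ℂ) (z 1) * z 0‖ ≤ ‖z‖ ^ 2 := by
    have e1 : ‖z 0‖ ^ 2 + ‖z 1‖ ^ 2 ≤ ‖z‖ ^ 2 := by
      rw [EuclideanSpace.norm_sq_eq]
      rw [← Finset.sum_pair (f := fun k => ‖z k‖ ^ 2) (fin_zero_ne_one hn)]
      exact Finset.sum_le_sum_of_subset_of_nonneg (Finset.subset_univ _) (fun _ _ _ => by positivity)
    refine (norm_sub_le _ _).trans ?_
    rw [norm_mul, norm_mul, RCLike.norm_conj, RCLike.norm_conj]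
    nlinarith [sq_nonneg (‖z 0‖ - ‖z 1‖)]
  set w := (starRingEnd ℂ) (z 0) * z 1 - (starRingEnd ℂ) (z 1) * z 0
  have h3 : |(ε * Complex.I * w).re| ≤ ε * ‖w‖ := by
    refine (Complex.abs_re_le_norm _).trans ?_
    rw [norm_mul, norm_mul, Complex.norm_I, Complex.norm_real, Real.norm_of_nonneg h0.le, mul_one]
  have h4 : (((‖z‖ : ℝ) : ℂ) ^ 2).re = ‖z‖ ^ 2 := by rw [← Complex.ofReal_pow, Complex.ofReal_re]
  have h5 : 0 < ‖z‖ ^ 2 := by positivity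
  have h6 := (abs_le.1 h3).1
  rw [Complex.add_re]
  change 0 < (((‖z‖ : ℝ) : ℂ) ^ 2).re + _
  rw [h4]
  nlinarith

/-- The Reeb vector field, as a linear vector field on `ℂⁿ⁺¹`. -/
def reebField (n p : ℕ) (ε : ℝ) : Amb n →L[ℂ] Amb n :=
  LinearMap.toContinuousLinearMap
    { toFun := fun z => reebDir n p (hamOp n ε z)
      map_add' := by
        intro x y; ext k
        simp only [reebDir, map_add, PiLp.add_apply]
        ring
      map_smul' := by
        intro c x; ext k
        simp only [reebDir, map_smul, PiLp.smul_apply, smul_eq_mul, RingHom.id_apply]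
        ring }

lemma reebField_apply (ε : ℝ) (z : Amb n) : reebField n p ε z = reebDir n p (hamOp n ε z) := rfl

lemma brieskornForm_reebField (hp : 0 < p) (ε : ℝ) (z : Amb n) :
    brieskornForm n p z (reebField n p ε z) = perturbK n ε z := by
  rw [brieskornForm_eq, wForm_skew, reebField_apply, wForm_reebDir_left hp, inner_hamOp_left,
    perturbK_eq]
  ring

lemma reebField_mem_tangent (hn : 2 ≤ n) (hp : 0 < p) (ε : ℝ) {z : Amb n}
    (hz : z ∈ brieskornSphere n p) : reebField n p ε z ∈ brieskornTangent n p z := by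
  rw [mem_brieskornTangent]
  have h0 := brieskornExp_zero (p := p) hn
  have h1 := brieskornExp_one (p := p) hn
  have hne := fin_zero_ne_one hn
  constructor
  · have : polyDiff n p z (reebField n p ε z) = polyDiff n p z (reebDir n p z) := by
      refine sum_eq_of_pair hn ?_ ?_
      · simp only [reebField_apply, reebDir, hamOp_apply, h0, h1, hne, hne.symm, if_true, if_false]
        ring
      · intro k hk0 hk1
        simp only [reebField_apply, reebDir, hamOp_apply, hk0, hk1, if_false]
        ring
    rw [this, polyDiff_reebDir hp, hz.1, mul_zero]
  · have : inner ℂ z (reebField n p ε z) = inner ℂ z (reebDir n p z) +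
        2 * ε * ((starRingEnd ℂ) (z 1) * z 0 - (starRingEnd ℂ) (z 0) * z 1) := by
      rw [inner_eq_sum, inner_eq_sum]
      simp only [reebField_apply, reebDir, hamOp_apply, mul_add, Finset.sum_add_distrib, mul_ite,
        mul_zero, Finset.sum_ite_eq', Finset.mem_univ, if_true, h0, h1]
      push_cast
      linear_combination (2 * ε * ((starRingEnd ℂ) (z 0) * z 1 - (starRingEnd ℂ) (z 1) * z 0)) *
        Complex.I_mul_I
    rw [this, inner_reebDir]
    simp
    right
    ring

lemma hasLineDerivAt_perturbK (ε : ℝ) (z u : Amb n) :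
    HasLineDerivAt ℝ (perturbK n ε) (2 * (inner ℂ (hamOp n ε z) u).re) z u := by
  have h : ∀ s : ℝ, perturbK n ε (z + s • u) = perturbK n ε z +
      s * (2 * (inner ℂ (hamOp n ε z) u).re) + s ^ 2 * perturbK n ε u := by
    intro s
    have e1 : (inner ℂ u (hamOp n ε z)).re = (inner ℂ (hamOp n ε z) u).re := by
      rw [← inner_conj_symm, Complex.conj_re]
    simp only [perturbK_eq, real_smul_eq, map_add, map_smul, inner_add_left, inner_add_right,
      inner_smul_left, inner_smul_right, Complex.conj_ofReal, Complex.add_re, Complex.re_ofReal_mul]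
    rw [e1, inner_hamOp_left]
    ring
  unfold HasLineDerivAt
  simp only [h]
  have h1 := ((hasDerivAt_id (0 : ℝ)).mul_const (2 * (inner ℂ (hamOp n ε z) u).re)).const_add
    (perturbK n ε z)
  have h2 := ((hasDerivAt_id (0 : ℝ)).pow 2).mul_const (perturbK n ε u)
  refine (h1.add h2).congr_deriv ?_
  simp

lemma contDiff_perturbK (ε : ℝ) : ContDiff ℝ ∞ (perturbK n ε) := by
  have : perturbK n ε = fun z => Complex.reCLM (inner ℂ z (((hamOp n ε).restrictScalars ℝ) z)) := by
    ext z; exact perturbK_eq ε z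
  rw [this]
  exact Complex.reCLM.contDiff.comp
    (contDiff_id.inner ℂ ((hamOp n ε).restrictScalars ℝ).contDiff)

lemma fderiv_perturbedForm {ε : ℝ} {z : Amb n} (hK : perturbK n ε z ≠ 0) (u v : Amb n) :
    fderiv ℝ (fun y => perturbedForm n p ε y v) z u =
      -(perturbK n ε z)⁻¹ ^ 2 * (2 * (inner ℂ (hamOp n ε z) u).re) * brieskornForm n p z v +
      (perturbK n ε z)⁻¹ * brieskornForm n p u v := by
  have hlin : Differentiable ℝ (fun y : Amb n => brieskornForm n p y v) := by
    have : (fun y : Amb n => brieskornForm n p y v) =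
        fun y => (1 / 2 : ℝ) * ((wForm n p).flip v).toContinuousLinearMap y := by
      ext y
      rw [brieskornForm_eq]
      change _ = 1 / 2 * wForm n p y v
      ring
    rw [this]
    exact (((wForm n p).flip v).toContinuousLinearMap.differentiable).const_mul _
  have hd : DifferentiableAt ℝ (fun y => perturbedForm n p ε y v) z := by
    unfold perturbedForm
    exact (((contDiff_perturbK ε).differentiable (by simp) z).inv hK).mul (hlin z)
  rw [← hd.lineDeriv_eq_fderiv]
  refine HasLineDerivAt.lineDeriv ?_
  unfold HasLineDerivAt perturbedForm
  have h1 : HasDerivAt (fun t : ℝ => perturbK n ε (z + t • u))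
      (2 * (inner ℂ (hamOp n ε z) u).re) 0 := hasLineDerivAt_perturbK ε z u
  have h2 : HasDerivAt (fun t : ℝ => brieskornForm n p (z + t • u) v)
      (brieskornForm n p u v) 0 := by
    have : ∀ t : ℝ, brieskornForm n p (z + t • u) v =
        brieskornForm n p z v + t * brieskornForm n p u v := by
      intro t
      simp only [brieskornForm_eq, map_add, map_smul, LinearMap.add_apply, LinearMap.smul_apply,
        smul_eq_mul]
      ring
    simp only [this]
    simpa using ((hasDerivAt_id (0 : ℝ)).mul_const (brieskornForm n p u v)).const_add
      (brieskornForm n p z v)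
  have h3 := (h1.fun_inv (by simpa using hK)).mul h2
  refine h3.congr_deriv ?_
  simp only [zero_smul, add_zero]
  field_simp

lemma dOneForm_perturbedForm {ε : ℝ} {z : Amb n} (hK : perturbK n ε z ≠ 0) (u v : Amb n) :
    dOneForm (perturbedForm n p ε) z u v = (perturbK n ε z)⁻¹ * wForm n p u v -
      (perturbK n ε z)⁻¹ ^ 2 * ((inner ℂ (hamOp n ε z) u).re * wForm n p z v -
        (inner ℂ (hamOp n ε z) v).re * wForm n p z u) := by
  rw [dOneForm, fderiv_perturbedForm hK, fderiv_perturbedForm hK]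
  simp only [brieskornForm_eq]
  rw [wForm_skew v u]
  ring

lemma perturbedForm_eq_zero_iff {ε : ℝ} {z v : Amb n} (hK : perturbK n ε z ≠ 0) :
    perturbedForm n p ε z v = 0 ↔ wForm n p z v = 0 := by
  rw [perturbedForm, brieskornForm_eq]
  simp [hK]

/-- The Reeb vector of the perturbed form is unique. -/
lemma isReebVector_iff {ε : ℝ} (hn : 2 ≤ n) (hp : 0 < p) (h0 : 0 < ε) (h1 : ε < 1) {z R : Amb n}
    (hz : z ∈ brieskornSphere n p) :
    IsReebVector (brieskornTangent n p) (perturbedForm n p ε) z R ↔ R = reebField n p ε z := by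
  have hK := (perturbK_pos hn h0 h1 (brieskornSphere_ne_zero hz)).ne'
  have hX : IsReebVector (brieskornTangent n p) (perturbedForm n p ε) z (reebField n p ε z) := by
    refine ⟨reebField_mem_tangent hn hp ε hz, ?_, fun v _ => ?_⟩
    · rw [perturbedForm, brieskornForm_reebField hp, inv_mul_cancel₀ hK]
    · have e1 : wForm n p z (reebField n p ε z) = 2 * perturbK n ε z := by
        have := brieskornForm_reebField hp ε z
        rw [brieskornForm_eq] at this
        linarith
      have e2 : ∀ v, wForm n p (reebField n p ε z) v = -2 * (inner ℂ (hamOp n ε z) v).re :=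
        fun v => wForm_reebDir_left hp _ _
      have e3 : (inner ℂ (hamOp n ε z) (reebField n p ε z)).re = 0 := by
        have := e2 (reebField n p ε z)
        rw [wForm_self] at this
        linarith
      rw [dOneForm_perturbedForm hK, e1, e2, e3]
      field_simp
      ring
  constructor
  · intro hR
    rw [← sub_eq_zero]
    have hT : ∀ v ∈ brieskornTangent n p z, v ∈ brieskornTangent n p z := fun _ h => h
    have hd : R - reebField n p ε z ∈ brieskornTangent n p z := by
      have a := mem_brieskornTangent.1 hR.1
      have b := mem_brieskornTangent.1 hX.1
      refine mem_brieskornTangent.2 ⟨?_, ?_⟩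
      · rw [sub_eq_add_neg, polyDiff_add, ← neg_one_smul ℂ, polyDiff_smul, a.1, b.1]; simp
      · rw [inner_sub_right, Complex.sub_re, a.2, b.2, sub_zero]
    have hw : wForm n p z (R - reebField n p ε z) = 0 := by
      have a := hR.2.1
      have b := hX.2.1
      rw [perturbedForm, brieskornForm_eq] at a b
      have c := a.trans b.symm
      have := mul_left_cancel₀ (inv_ne_zero hK) c
      rw [map_sub]; linarith
    refine wForm_nondeg hp hz hd hw fun v hv hv0 => ?_
    have a := hR.2.2 v hv
    have b := hX.2.2 v hv
    rw [dOneForm_perturbedForm hK, hv0] at a b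
    have a' : wForm n p z R = wForm n p z (reebField n p ε z) := by
      rw [map_sub] at hw; linarith
    rw [a'] at a
    have c : (perturbK n ε z)⁻¹ * (wForm n p R v - wForm n p (reebField n p ε z) v) = 0 := by
      linear_combination a - b
    rw [map_sub, LinearMap.sub_apply]
    exact (mul_eq_zero.1 c).resolve_left (inv_ne_zero hK)
  · rintro rfl; exact hX

/-- The phase of the `k`-th coordinate under the unperturbed Reeb flow. -/
def flowPhase (n p : ℕ) (t : ℝ) (k : Fin (n + 1)) : ℂ :=
  Complex.exp ((4 / brieskornExp n p k * t : ℝ) * Complex.I)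

/-- The flow of the linear vector field `reebField`. -/
def flowMap (n p : ℕ) (ε t : ℝ) : Amb n →L[ℂ] Amb n :=
  LinearMap.toContinuousLinearMap
    { toFun := fun z => WithLp.toLp 2 fun k => flowPhase n p t k *
        if k = 0 then Real.cos (2 * ε * t) * z 0 - Real.sin (2 * ε * t) * z 1
        else if k = 1 then Real.sin (2 * ε * t) * z 0 + Real.cos (2 * ε * t) * z 1 else z k
      map_add' := by
        intro x y; ext k
        simp only [PiLp.add_apply]
        split_ifs <;> ring
      map_smul' := by
        intro c x; ext k
        simp only [PiLp.smul_apply, smul_eq_mul, RingHom.id_apply]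
        split_ifs <;> ring }

lemma flowMap_apply (ε t : ℝ) (z : Amb n) (k : Fin (n + 1)) :
    flowMap n p ε t z k = flowPhase n p t k *
        if k = 0 then Real.cos (2 * ε * t) * z 0 - Real.sin (2 * ε * t) * z 1
        else if k = 1 then Real.sin (2 * ε * t) * z 0 + Real.cos (2 * ε * t) * z 1 else z k := rfl

lemma flowMap_zero (ε : ℝ) (z : Amb n) : flowMap n p ε 0 z = z := by
  ext k
  rw [flowMap_apply]
  simp only [flowPhase, mul_zero, Complex.ofReal_zero, zero_mul, Complex.exp_zero, Real.cos_zero,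
    Real.sin_zero]
  split_ifs with h h' <;> simp [*]

lemma hasDerivAt_flowPhase (t : ℝ) (k : Fin (n + 1)) :
    HasDerivAt (fun s => flowPhase n p s k)
      (flowPhase n p t k * (4 / brieskornExp n p k * Complex.I)) t := by
  have h1 : HasDerivAt (fun t : ℝ => ((4 / brieskornExp n p k * t : ℝ) : ℂ) * Complex.I)
      (4 / brieskornExp n p k * Complex.I) t := by
    have := (((hasDerivAt_id t).const_mul (4 / (brieskornExp n p k : ℝ))).ofReal_comp).mul_const
      Complex.I
    simpa using this
  exact h1.cexp

lemma hasDerivAt_flowMap (hn : 2 ≤ n) (ε : ℝ) (z : Amb n) (t : ℝ) :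
    HasDerivAt (fun s => flowMap n p ε s z) (reebField n p ε (flowMap n p ε t z)) t := by
  have hne := fin_zero_ne_one hn
  have hlin : HasDerivAt (fun s : ℝ => 2 * ε * s) (2 * ε) t := by
    simpa using (hasDerivAt_id t).const_mul (2 * ε)
  have hc : HasDerivAt (fun s : ℝ => ((Real.cos (2 * ε * s) : ℝ) : ℂ))
      (-(Real.sin (2 * ε * t) : ℂ) * (2 * ε)) t := by
    have := (hlin.cos).ofReal_comp
    refine this.congr_deriv (by push_cast; ring)
  have hs : HasDerivAt (fun s : ℝ => ((Real.sin (2 * ε * s) : ℝ) : ℂ))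
      ((Real.cos (2 * ε * t) : ℂ) * (2 * ε)) t := by
    have := (hlin.sin).ofReal_comp
    refine this.congr_deriv (by push_cast; ring)
  have hpi : ∀ k, HasDerivAt (fun s => flowMap n p ε s z k)
      (reebField n p ε (flowMap n p ε t z) k) t := by
    intro k
    have hph := hasDerivAt_flowPhase (n := n) (p := p) t k
    by_cases h0 : k = 0
    · subst h0
      simp only [flowMap_apply, if_true]
      refine (hph.mul ((hc.mul_const (z 0)).fun_sub (hs.mul_const (z 1)))).congr_deriv ?_
      simp only [reebField_apply, reebDir, hamOp_apply, flowMap_apply, hne, hne.symm, if_true, if_false,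
        brieskornExp_zero hn, brieskornExp_one hn, flowPhase]
      push_cast
      linear_combination (-2 * ε * Complex.exp (4 / 2 * t * Complex.I) *
        (Complex.sin (2 * ε * t) * z 0 + Complex.cos (2 * ε * t) * z 1)) * Complex.I_mul_I
    · by_cases h1 : k = 1
      · subst h1
        simp only [flowMap_apply, if_true, if_neg h0]
        refine (hph.mul ((hs.mul_const (z 0)).fun_add (hc.mul_const (z 1)))).congr_deriv ?_
        simp only [reebField_apply, reebDir, hamOp_apply, flowMap_apply, hne, hne.symm, if_true,
          if_false, brieskornExp_zero hn, brieskornExp_one hn, flowPhase]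
        push_cast
        linear_combination (2 * ε * Complex.exp (4 / 2 * t * Complex.I) *
          (Complex.cos (2 * ε * t) * z 0 - Complex.sin (2 * ε * t) * z 1)) * Complex.I_mul_I
      · simp only [flowMap_apply, if_neg h0, if_neg h1]
        refine (hph.mul_const (z k)).congr_deriv ?_
        simp only [reebField_apply, reebDir, hamOp_apply, flowMap_apply, h0, h1, if_false]
        ring
  exact (PiLp.continuousLinearEquiv 2 ℝ
    (fun _ : Fin (n + 1) => ℂ)).symm.toContinuousLinearMap.hasFDerivAt.comp_hasDerivAt t
    (hasDerivAt_pi.2 hpi)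

lemma flowPhase_conj_mul (t : ℝ) (k : Fin (n + 1)) :
    (starRingEnd ℂ) (flowPhase n p t k) * flowPhase n p t k = 1 := by
  rw [mul_comm, flowPhase, Complex.mul_conj, Complex.normSq_eq_norm_sq,
    Complex.norm_exp_ofReal_mul_I]
  simp

lemma flowPhase_zero (hn : 2 ≤ n) (t : ℝ) : flowPhase n p t 0 = flowPhase n p t 1 := by
  rw [flowPhase, flowPhase, brieskornExp_zero hn, brieskornExp_one hn]

lemma cos_sq_add_sin_sq' (x : ℝ) : (Real.cos x : ℂ) ^ 2 + (Real.sin x : ℂ) ^ 2 = 1 := by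
  exact_mod_cast Real.cos_sq_add_sin_sq x

/-- A weighted hermitian form is invariant under the flow if the weights of the coordinates
`0` and `1` agree. -/
lemma herm_flowMap (hn : 2 ≤ n) (ε t : ℝ) (c : Fin (n + 1) → ℂ) (hc : c 0 = c 1) (u v : Amb n) :
    ∑ k, c k * ((starRingEnd ℂ) (flowMap n p ε t u k) * flowMap n p ε t v k) =
      ∑ k, c k * ((starRingEnd ℂ) (u k) * v k) := by
  have hne := fin_zero_ne_one hn
  refine sum_eq_of_pair hn ?_ ?_
  · have h0 := flowPhase_conj_mul (n := n) (p := p) t 1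
    have h1 := cos_sq_add_sin_sq' (2 * ε * t)
    simp only [flowMap_apply, if_true, if_neg hne.symm, flowPhase_zero hn, hc, map_mul, map_add,
      map_sub, Complex.conj_ofReal]
    linear_combination c 1 * ((starRingEnd ℂ) (u 0) * v 0 + (starRingEnd ℂ) (u 1) * v 1) * (h1 +
      ((Real.cos (2 * ε * t) : ℂ) ^ 2 + (Real.sin (2 * ε * t) : ℂ) ^ 2) * h0)
  · intro k h0 h1
    simp only [flowMap_apply, if_neg h0, if_neg h1, map_mul]
    linear_combination c k * ((starRingEnd ℂ) (u k) * v k) * flowPhase_conj_mul (n := n) (p := p) t k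

lemma inner_flowMap (hn : 2 ≤ n) (ε t : ℝ) (u v : Amb n) :
    inner ℂ (flowMap n p ε t u) (flowMap n p ε t v) = inner ℂ u v := by
  have := herm_flowMap (p := p) hn ε t (fun _ => 1) rfl u v
  simpa only [inner_eq_sum, one_mul] using this

lemma wHerm_flowMap (hn : 2 ≤ n) (ε t : ℝ) (u v : Amb n) :
    wHerm n p (flowMap n p ε t u) (flowMap n p ε t v) = wHerm n p u v :=
  herm_flowMap hn ε t _ (by rw [brieskornExp_zero hn, brieskornExp_one hn]) u v

lemma brieskornPoly_flowMap (hn : 2 ≤ n) (hp : 0 < p) (ε t : ℝ) (z : Amb n) :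
    brieskornPoly n p (flowMap n p ε t z) =
      Complex.exp ((4 * t : ℝ) * Complex.I) * brieskornPoly n p z := by
  have hne := fin_zero_ne_one hn
  have hph : ∀ k, flowPhase n p t k ^ brieskornExp n p k = Complex.exp ((4 * t : ℝ) * Complex.I) := by
    intro k
    have ha : (brieskornExp n p k : ℂ) ≠ 0 := by
      exact_mod_cast (brieskornExp_pos (n := n) hp k).ne'
    rw [flowPhase, ← Complex.exp_nat_mul]
    congr 1
    push_cast
    field_simp
  rw [brieskornPoly, brieskornPoly, Finset.mul_sum]
  refine sum_eq_of_pair hn ?_ ?_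
  · have h0 := hph 0
    have h1 := hph 1
    have h2 := cos_sq_add_sin_sq' (2 * ε * t)
    rw [brieskornExp_zero hn] at h0 ⊢
    rw [brieskornExp_one hn] at h1 ⊢
    simp only [flowMap_apply, if_true, if_neg hne.symm, mul_pow, h0, h1]
    linear_combination Complex.exp ((4 * t : ℝ) * Complex.I) * (z 0 ^ 2 + z 1 ^ 2) * h2
  · intro k h0 h1
    simp only [flowMap_apply, if_neg h0, if_neg h1, mul_pow, hph]

lemma flowMap_mem_sphere (hn : 2 ≤ n) (hp : 0 < p) (ε t : ℝ) {z : Amb n}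
    (hz : z ∈ brieskornSphere n p) : flowMap n p ε t z ∈ brieskornSphere n p := by
  refine ⟨by rw [brieskornPoly_flowMap hn hp, hz.1, mul_zero], ?_⟩
  have := inner_flowMap (p := p) hn ε t z z
  rw [inner_self_eq_norm_sq_to_K, inner_self_eq_norm_sq_to_K, sphere_norm hz] at this
  have h2 : ‖flowMap n p ε t z‖ ^ 2 = 1 := by
    have h3 : ((‖flowMap n p ε t z‖ ^ 2 : ℝ) : ℂ) = ((1 : ℝ) : ℂ) := by
      push_cast; simpa using this
    exact_mod_cast h3
  nlinarith [norm_nonneg (flowMap n p ε t z)]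

lemma reebDir_flowMap (hn : 2 ≤ n) (ε t : ℝ) (z : Amb n) :
    reebDir n p (flowMap n p ε t z) = flowMap n p ε t (reebDir n p z) := by
  have hne := fin_zero_ne_one hn
  ext k
  simp only [reebDir, flowMap_apply]
  by_cases h0 : k = 0
  · subst h0; simp only [if_true, brieskornExp_zero hn, brieskornExp_one hn]; ring
  · by_cases h1 : k = 1
    · subst h1; simp only [if_true, if_neg h0, brieskornExp_zero hn, brieskornExp_one hn]; ring
    · simp only [if_neg h0, if_neg h1]; ring

lemma hamOp_flowMap (hn : 2 ≤ n) (ε t : ℝ) (z : Amb n) :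
    hamOp n ε (flowMap n p ε t z) = flowMap n p ε t (hamOp n ε z) := by
  have hne := fin_zero_ne_one hn
  ext k
  simp only [hamOp_apply, flowMap_apply, hne, hne.symm, if_true, if_false, flowPhase_zero hn]
  by_cases h0 : k = 0
  · subst h0; simp only [if_true, if_neg hne, flowPhase_zero hn]; ring
  · by_cases h1 : k = 1
    · subst h1; simp only [if_true, if_neg h0]; ring
    · simp only [if_neg h0, if_neg h1]; ring

lemma perturbK_flowMap (hn : 2 ≤ n) (ε t : ℝ) (z : Amb n) :
    perturbK n ε (flowMap n p ε t z) = perturbK n ε z := by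
  rw [perturbK_eq, perturbK_eq, hamOp_flowMap hn, inner_flowMap hn]

theorem exists_perturbedReebFlow {ε : ℝ} (hn : 2 ≤ n) (hp : 0 < p) (h0 : 0 < ε) (h1 : ε < 1) :
    IsPerturbedReebFlow n p ε fun t z => flowMap n p ε t z := by
  intro z hz
  refine ⟨flowMap_zero ε z, fun t => ⟨flowMap_mem_sphere hn hp ε t hz, _, ?_,
    hasDerivAt_flowMap hn ε z t⟩⟩
  exact (isReebVector_iff hn hp h0 h1 (flowMap_mem_sphere hn hp ε t hz)).2 rfl

theorem perturbedReebFlow_unique {ε : ℝ} (hn : 2 ≤ n) (hp : 0 < p) (h0 : 0 < ε) (h1 : ε < 1)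
    {φ : ℝ → Amb n → Amb n} (hφ : IsPerturbedReebFlow n p ε φ) {z : Amb n}
    (hz : z ∈ brieskornSphere n p) (t : ℝ) : φ t z = flowMap n p ε t z := by
  obtain ⟨hz0, hd⟩ := hφ z hz
  have hd' : ∀ t, HasDerivAt (fun s => φ s z)
      (((reebField n p ε).restrictScalars ℝ) (φ t z)) t := by
    intro t
    obtain ⟨ht, R, hR, hd⟩ := hd t
    rw [(isReebVector_iff hn hp h0 h1 ht).1 hR] at hd
    exact hd
  have := ODE_solution_unique_univ (v := fun _ y => ((reebField n p ε).restrictScalars ℝ) y)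
    (s := fun _ => Set.univ) (t₀ := 0) (f := fun s => φ s z) (g := fun s => flowMap n p ε s z)
    (K := ‖(reebField n p ε).restrictScalars ℝ‖₊)
    (fun _ => ((reebField n p ε).restrictScalars ℝ).lipschitz.lipschitzOnWith)
    (fun t => ⟨hd' t, Set.mem_univ _⟩)
    (fun t => ⟨hasDerivAt_flowMap hn ε z t, Set.mem_univ _⟩)
    (hz0.trans (flowMap_zero ε z).symm)
  exact congrFun this t

end ReebFlow

/-! ### Tangent cones, local parametrizations and Morse indices -/

section LocalParametrizations

open Module Filter Topology Asymptotics

variable {E : Type*} [NormedAddCommGroup E] [NormedSpace ℝ E]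

/-- The velocity of a curve in `N` belongs to the tangent cone. -/
lemma mem_tangentConeAt_of_curve {N : Set E} {x v : E} {γ : ℝ → E} (h0 : γ 0 = x)
    (hγ : HasDerivAt γ v 0) (hN : ∀ᶠ s in 𝓝 (0 : ℝ), γ s ∈ N) : v ∈ tangentConeAt ℝ N x := by
  refine mem_tangentConeAt_of_seq (𝓝[≠] (0 : ℝ)) (fun s => s⁻¹) (fun s => γ s - x) ?_ ?_ ?_
  · have : Tendsto (fun s => γ s - x) (𝓝 0) (𝓝 (γ 0 - x)) := hγ.continuousAt.tendsto.sub_const x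
    rw [h0, sub_self] at this
    exact this.mono_left nhdsWithin_le_nhds
  · filter_upwards [nhdsWithin_le_nhds hN] with s hs
    simpa using hs
  · have := hasDerivAt_iff_tendsto_slope.1 hγ
    refine this.congr fun s => ?_
    rw [slope_def_module, h0, sub_zero]

/-- The tangent cone of a level set of a submersion is the kernel of the differential. -/
lemma tangentConeAt_levelSet [CompleteSpace E] {F : Type*} [NormedAddCommGroup F]
    [NormedSpace ℝ F] [FiniteDimensional ℝ F] {f : E → F} {f' : E →L[ℝ] F} {x : E}
    (hf : HasStrictFDerivAt f f' x) (hs : Function.Surjective f') {N : Set E}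
    (hN : N = {y | f y = f x}) :
    tangentConeAt ℝ N x = (LinearMap.ker f'.toLinearMap : Set E) := by
  apply Set.Subset.antisymm
  · intro v hv
    have h1 : HasFDerivWithinAt f f' N x := hf.hasFDerivAt.hasFDerivWithinAt
    have h2 : HasFDerivWithinAt f (0 : E →L[ℝ] F) N x :=
      (hasFDerivWithinAt_const (f x) x N).congr (fun y hy => by rw [hN] at hy; exact hy) rfl
    exact h1.unique_on h2 hv
  · intro v hv
    have hr : f'.range = ⊤ := LinearMap.range_eq_top.2 hs
    set ψ := hf.implicitFunction f f' hr (f x) with hψ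
    have hd := hf.to_implicitFunction hr
    set w : LinearMap.ker f'.toLinearMap := ⟨v, hv⟩
    have hx : ψ 0 = x := hf.implicitFunction_apply_image hr
    have hc : HasDerivAt (fun s : ℝ => ψ (s • w)) v 0 := by
      have h1 : HasDerivAt (fun s : ℝ => s • w) w 0 := by
        simpa using (hasDerivAt_id (0 : ℝ)).smul_const w
      have h2 : HasFDerivAt ψ (f'.ker.subtypeL) ((0 : ℝ) • w) := by
        rw [zero_smul]; exact hd.hasFDerivAt
      exact h2.comp_hasDerivAt 0 h1
    refine mem_tangentConeAt_of_curve (by simp [hx]) hc ?_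
    have h3 := hf.map_implicitFunction_eq hr
    have h4 : Tendsto (fun s : ℝ => (f x, s • w)) (𝓝 0) (𝓝 (f x, (0 : f'.ker))) := by
      refine tendsto_const_nhds.prodMk_nhds ?_
      have : Continuous fun s : ℝ => s • w := by fun_prop
      simpa using this.tendsto 0
    filter_upwards [h4.eventually h3] with s hs
    rw [hN]
    exact hs

lemma exists_antilipschitz_bound {d : ℕ} {A : EuclideanSpace ℝ (Fin d) →L[ℝ] E}
    (hA : Function.Injective A) : ∃ c > 0, ∀ v, c * ‖v‖ ≤ ‖A v‖ := by
  obtain ⟨K, hK, h⟩ := A.toLinearMap.exists_antilipschitzWith (LinearMap.ker_eq_bot.2 hA)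
  refine ⟨(K : ℝ)⁻¹, by positivity, fun v => ?_⟩
  have := h.le_mul_dist v 0
  rw [dist_zero_right, map_zero, dist_zero_right] at this
  rw [inv_mul_le_iff₀ (by exact_mod_cast hK)]
  exact this

lemma IsLocalParam.hasFDerivAt {N : Set E} {x : E} {d : ℕ} {ψ : EuclideanSpace ℝ (Fin d) → E}
    (h : IsLocalParam N x d ψ) : HasFDerivAt ψ (fderiv ℝ ψ 0) 0 :=
  (h.2.2.1.differentiableAt (by simp)).hasFDerivAt

/-- The points of `N` near `x` have parameters of comparable size. -/
lemma IsLocalParam.exists_preimage {N : Set E} {x : E} {d : ℕ} {ψ : EuclideanSpace ℝ (Fin d) → E}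
    (h : IsLocalParam N x d ψ) :
    ∃ K : ℝ, ∀ᶠ y in 𝓝[N] x, ∃ ξ, ψ ξ = y ∧ ‖ξ‖ ≤ K * ‖y - x‖ := by
  obtain ⟨c, hc, hA⟩ := exists_antilipschitz_bound h.2.2.2.1
  have ho := h.hasFDerivAt.isLittleO.def (half_pos hc)
  refine ⟨2 / c, ?_⟩
  rw [← h.2.2.2.2, eventually_map]
  filter_upwards [ho] with ξ hξ
  refine ⟨ξ, rfl, ?_⟩
  rw [h.2.1, sub_zero] at hξ
  have h1 := hA ξ
  have h2 := norm_sub_norm_le (fderiv ℝ ψ 0 ξ) (fderiv ℝ ψ 0 ξ - (ψ ξ - x))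
  rw [sub_sub_cancel, norm_sub_rev (fderiv ℝ ψ 0 ξ)] at h2
  rw [div_mul_eq_mul_div, le_div_iff₀ hc]
  linarith

/-- The range of the differential of a local parametrization is the tangent cone. -/
lemma IsLocalParam.range_fderiv {N : Set E} {x : E} {d : ℕ} {ψ : EuclideanSpace ℝ (Fin d) → E}
    (h : IsLocalParam N x d ψ) :
    (LinearMap.range (fderiv ℝ ψ 0).toLinearMap : Set E) = tangentConeAt ℝ N x := by
  apply Set.Subset.antisymm
  · rintro _ ⟨η, rfl⟩
    have h1 : HasDerivAt (fun s : ℝ => s • η) η 0 := by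
      simpa using (hasDerivAt_id (0 : ℝ)).smul_const η
    have h2 : HasFDerivAt ψ (fderiv ℝ ψ 0) ((0 : ℝ) • η) := by
      rw [zero_smul]; exact h.hasFDerivAt
    refine mem_tangentConeAt_of_curve (γ := fun s => ψ (s • η)) (by simp [h.2.1])
      (h2.comp_hasDerivAt 0 h1) ?_
    have h3 : ∀ᶠ ξ in 𝓝 (0 : EuclideanSpace ℝ (Fin d)), ψ ξ ∈ N := by
      have : N ∈ 𝓝[N] x := self_mem_nhdsWithin
      rw [← h.2.2.2.2] at this
      exact this
    have h4 : Tendsto (fun s : ℝ => s • η) (𝓝 0) (𝓝 0) := by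
      have : Continuous fun s : ℝ => s • η := by fun_prop
      simpa using this.tendsto 0
    exact h4.eventually h3
  · intro v hv
    obtain ⟨ι, l, hl, c, δ, hδ, hN, hcd⟩ := exists_fun_of_mem_tangentConeAt hv
    obtain ⟨K, hK⟩ := h.exists_preimage
    have ht : Tendsto (fun a => x + δ a) l (𝓝[N] x) := by
      refine tendsto_nhdsWithin_iff.2 ⟨?_, hN⟩
      simpa using hδ.const_add x
    obtain ⟨ξ, hξ⟩ := (ht.eventually hK).choice
    have hξO : ξ =O[l] δ := by
      refine IsBigO.of_bound K ?_
      filter_upwards [hξ] with a ha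
      simpa using ha.2
    have hξ0 : Tendsto ξ l (𝓝 0) := hξO.trans_tendsto hδ
    have ho : (fun a => ψ (ξ a) - ψ 0 - fderiv ℝ ψ 0 (ξ a - 0)) =o[l] fun a => ξ a - 0 :=
      h.hasFDerivAt.isLittleO.comp_tendsto hξ0
    simp only [sub_zero, h.2.1] at ho
    have ho2 : (fun a => c a • (δ a - fderiv ℝ ψ 0 (ξ a))) =o[l] fun a => c a • δ a := by
      have h5 : (fun a => δ a - fderiv ℝ ψ 0 (ξ a)) =o[l] δ := by
        refine (ho.trans_isBigO hξO).congr' ?_ EventuallyEq.rfl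
        filter_upwards [hξ] with a ha
        rw [ha.1]; abel_nf
      exact (isBigO_refl c l).smul_isLittleO h5
    have hlim0 : Tendsto (fun a => c a • (δ a - fderiv ℝ ψ 0 (ξ a))) l (𝓝 0) :=
      (ho2.trans_isBigO (hcd.isBigO_one ℝ)).tendsto_zero_of_tendsto tendsto_const_nhds
    have hlim : Tendsto (fun a => fderiv ℝ ψ 0 (c a • ξ a)) l (𝓝 v) := by
      have := hcd.sub hlim0
      rw [sub_zero] at this
      refine this.congr fun a => ?_
      rw [map_smul, smul_sub, sub_sub_cancel]
    have hclosed : IsClosed (LinearMap.range (fderiv ℝ ψ 0).toLinearMap : Set E) :=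
      Submodule.closed_of_finiteDimensional _
    exact hclosed.mem_of_tendsto hlim (Eventually.of_forall fun a => ⟨_, rfl⟩)

/-- The dimension of a local parametrization of a level set of a submersion. -/
lemma IsLocalParam.dim_eq [FiniteDimensional ℝ E] {F : Type*} [NormedAddCommGroup F]
    [NormedSpace ℝ F] [FiniteDimensional ℝ F] {f : E → F} {f' : E →L[ℝ] F} {x : E}
    (hf : HasStrictFDerivAt f f' x) (hs : Function.Surjective f') {N : Set E}
    (hN : N = {y | f y = f x}) {d : ℕ} {ψ : EuclideanSpace ℝ (Fin d) → E}
    (h : IsLocalParam N x d ψ) : d + finrank ℝ F = finrank ℝ E := by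
  have := FiniteDimensional.complete ℝ E
  have h1 := h.range_fderiv.trans (tangentConeAt_levelSet hf hs hN)
  have h2 := SetLike.coe_injective h1
  have h3 := LinearMap.finrank_range_of_inj (f := (fderiv ℝ ψ 0).toLinearMap) h.2.2.2.1
  rw [h2, finrank_euclideanSpace_fin] at h3
  have h4 := f'.toLinearMap.finrank_range_add_finrank_ker
  rw [LinearMap.range_eq_top.2 hs, finrank_top] at h4
  omega

/-- Second order Taylor expansion at a critical point. -/
lemma taylor_two_of_fderiv_eq_zero {f : E → ℝ} (hf : ContDiffAt ℝ ∞ f 0) (h0 : fderiv ℝ f 0 = 0) :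
    (fun ξ => f ξ - f 0 - (1 / 2 : ℝ) * fderiv ℝ (fderiv ℝ f) 0 ξ ξ) =o[𝓝 0] fun ξ => ‖ξ‖ ^ 2 := by
  have hsym : IsSymmSndFDerivAt ℝ f 0 := hf.isSymmSndFDerivAt (by
    rw [minSmoothness_of_isRCLikeNormedField]; exact ENat.LEInfty.out)
  have hd : DifferentiableAt ℝ (fderiv ℝ f) 0 :=
    (hf.fderiv_right (m := ∞) (by simp)).differentiableAt (by simp)
  set B := fderiv ℝ (fderiv ℝ f) 0 with hB
  have ho := hd.hasFDerivAt.isLittleO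
  simp only [h0, sub_zero, ← hB] at ho
  have hdiff : ∀ᶠ ξ in 𝓝 (0 : E), DifferentiableAt ℝ f ξ := by
    have := (hf.of_le (m := 1) (by simp)).eventually (by simp)
    filter_upwards [this] with ξ hξ using hξ.differentiableAt (by simp)
  refine IsLittleO.of_bound fun c hc => ?_
  obtain ⟨r, hr, hball⟩ := Metric.eventually_nhds_iff_ball.1 (hdiff.and (ho.def hc))
  refine Metric.eventually_nhds_iff_ball.2 ⟨r, hr, fun ξ hξ => ?_⟩
  have hsub : ∀ y ∈ Metric.closedBall (0 : E) ‖ξ‖, y ∈ Metric.ball (0 : E) r := by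
    intro y hy
    rw [mem_closedBall_zero_iff] at hy
    rw [mem_ball_zero_iff] at hξ ⊢
    exact hy.trans_lt hξ
  have hder : ∀ y ∈ Metric.closedBall (0 : E) ‖ξ‖,
      HasFDerivWithinAt (fun ξ => f ξ - (1 / 2 : ℝ) * B ξ ξ) (fderiv ℝ f y - B y)
        (Metric.closedBall (0 : E) ‖ξ‖) y := by
    intro y hy
    have h1 := ((hball y (hsub y hy)).1).hasFDerivAt
    have h2 := ((B.hasFDerivAt (x := y)).clm_apply (hasFDerivAt_id y)).const_mul (1 / 2 : ℝ)
    refine ((h1.sub h2).congr_fderiv ?_).hasFDerivWithinAt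
    ext w
    have := hsym.eq w y
    rw [← hB] at this
    simp [this]
    ring
  have hbd : ∀ y ∈ Metric.closedBall (0 : E) ‖ξ‖, ‖fderiv ℝ f y - B y‖ ≤ c * ‖ξ‖ := by
    intro y hy
    refine (hball y (hsub y hy)).2.trans ?_
    rw [mem_closedBall_zero_iff] at hy
    gcongr
  have := Convex.norm_image_sub_le_of_norm_hasFDerivWithin_le hder hbd (convex_closedBall _ _)
    (x := 0) (y := ξ) (by simp) (by simp)
  simp only [map_zero, mul_zero, sub_zero] at this
  have e : f ξ - f 0 - 1 / 2 * B ξ ξ = f ξ - 1 / 2 * B ξ ξ - f 0 := by ring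
  rw [e]
  refine this.trans (le_of_eq ?_)
  rw [Real.norm_of_nonneg (by positivity)]
  ring

/-- If `ξ s = s ξ₀ + o(s)`, the second difference quotient of `f` along `ξ` at a critical point
tends to half of the Hessian. -/
lemma tendsto_second_quotient {f : E → ℝ} (hf : ContDiffAt ℝ ∞ f 0) (h0 : fderiv ℝ f 0 = 0)
    {ξ : ℝ → E} {ξ₀ : E} (hξ : Tendsto (fun s => s⁻¹ • ξ s) (𝓝[>] 0) (𝓝 ξ₀)) :
    Tendsto (fun s => (s ^ 2)⁻¹ * (f (ξ s) - f 0)) (𝓝[>] 0)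
      (𝓝 ((1 / 2 : ℝ) * fderiv ℝ (fderiv ℝ f) 0 ξ₀ ξ₀)) := by
  set B := fderiv ℝ (fderiv ℝ f) 0 with hB
  have hpos : ∀ᶠ s in 𝓝[>] (0 : ℝ), 0 < s := self_mem_nhdsWithin
  have hid : Tendsto (fun s : ℝ => s) (𝓝[>] 0) (𝓝 0) := tendsto_id.mono_left nhdsWithin_le_nhds
  have hξ0 : Tendsto ξ (𝓝[>] 0) (𝓝 0) := by
    have := hid.smul hξ
    rw [zero_smul] at this
    refine this.congr' ?_
    filter_upwards [hpos] with s hs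
    rw [smul_inv_smul₀ hs.ne']
  have ht := (taylor_two_of_fderiv_eq_zero hf h0).comp_tendsto hξ0
  have hO : (fun s => ‖ξ s‖ ^ 2) =O[𝓝[>] 0] fun s : ℝ => s ^ 2 := by
    have h1 : ξ =O[𝓝[>] 0] fun s : ℝ => s := by
      have h2 : (fun s : ℝ => s • (s⁻¹ • ξ s)) =O[𝓝[>] 0] fun s : ℝ => s • (1 : ℝ) :=
        (isBigO_refl (fun s : ℝ => s) _).smul (hξ.isBigO_one ℝ)
      refine h2.congr' ?_ ?_
      · filter_upwards [hpos] with s hs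
        rw [smul_inv_smul₀ hs.ne']
      · exact Eventually.of_forall fun s => by simp
    exact h1.norm_left.pow 2
  have h3 : Tendsto (fun s => (s ^ 2)⁻¹ * (f (ξ s) - f 0 - (1 / 2 : ℝ) * B (ξ s) (ξ s))) (𝓝[>] 0)
      (𝓝 0) := by
    have := (ht.trans_isBigO hO).tendsto_div_nhds_zero
    refine this.congr fun s => ?_
    simp only [Function.comp]
    rw [div_eq_inv_mul]
  have h4 : Tendsto (fun s => (1 / 2 : ℝ) * B (s⁻¹ • ξ s) (s⁻¹ • ξ s)) (𝓝[>] 0)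
      (𝓝 ((1 / 2 : ℝ) * B ξ₀ ξ₀)) := by
    have hc : Continuous fun y : E => (1 / 2 : ℝ) * B y y :=
      continuous_const.mul (B.continuous.clm_apply continuous_id)
    exact (hc.tendsto ξ₀).comp hξ
  have := h3.add h4
  rw [zero_add] at this
  refine this.congr' ?_
  filter_upwards [hpos] with s hs
  simp only [map_smul, smul_apply, smul_eq_mul]
  field_simp
  ring

/-- The Hessians of a function in two local parametrizations at a critical point agree under the
transition of the differentials. -/
lemma hessian_eq_of_localParam {N : Set E} {x : E} {d d' : ℕ} {ψ : EuclideanSpace ℝ (Fin d) → E}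
    {ψ' : EuclideanSpace ℝ (Fin d') → E} (h : IsLocalParam N x d ψ) (h' : IsLocalParam N x d' ψ')
    {g : E → ℝ} (hg : ContDiff ℝ ∞ g) (hc : fderiv ℝ (g ∘ ψ) 0 = 0) (hc' : fderiv ℝ (g ∘ ψ') 0 = 0)
    {ξ : EuclideanSpace ℝ (Fin d)} {η : EuclideanSpace ℝ (Fin d')}
    (hξη : fderiv ℝ ψ 0 ξ = fderiv ℝ ψ' 0 η) :
    fderiv ℝ (fderiv ℝ (g ∘ ψ)) 0 ξ ξ = fderiv ℝ (fderiv ℝ (g ∘ ψ')) 0 η η := by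
  have hpos : ∀ᶠ s in 𝓝[>] (0 : ℝ), 0 < s := self_mem_nhdsWithin
  have hid : Tendsto (fun s : ℝ => s) (𝓝[>] 0) (𝓝 0) := tendsto_id.mono_left nhdsWithin_le_nhds
  have hη0 : Tendsto (fun s : ℝ => s • η) (𝓝[>] 0) (𝓝 0) := by
    simpa using hid.smul_const η
  have ht' : Tendsto (fun s : ℝ => ψ' (s • η)) (𝓝[>] 0) (𝓝[N] x) := by
    rw [← h'.2.2.2.2]
    exact tendsto_map.comp hη0
  obtain ⟨K, hK⟩ := h.exists_preimage
  obtain ⟨ζ, hζ⟩ := (ht'.eventually hK).choice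
  have hder' : (fun s : ℝ => ψ' (s • η) - x - s • fderiv ℝ ψ' 0 η) =o[𝓝[>] 0] fun s : ℝ => s := by
    have h1 := h'.hasFDerivAt.isLittleO.comp_tendsto hη0
    have h2 : (fun s : ℝ => s • η - 0) =O[𝓝[>] 0] fun s : ℝ => s := by
      refine IsBigO.of_bound ‖η‖ (Eventually.of_forall fun s => ?_)
      rw [sub_zero, norm_smul, mul_comm]
    refine (h1.trans_isBigO h2).congr_left fun s => ?_
    simp only [Function.comp, sub_zero, map_smul, h'.2.1]
  have hyO : (fun s : ℝ => ψ' (s • η) - x) =O[𝓝[>] 0] fun s : ℝ => s := by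
    have h1 : (fun s : ℝ => s • fderiv ℝ ψ' 0 η) =O[𝓝[>] 0] fun s : ℝ => s := by
      refine IsBigO.of_bound ‖fderiv ℝ ψ' 0 η‖ (Eventually.of_forall fun s => ?_)
      rw [norm_smul, mul_comm]
    refine (hder'.isBigO.add h1).congr_left fun s => ?_
    abel
  have hζO : ζ =O[𝓝[>] 0] fun s : ℝ => s := by
    have h1 : ζ =O[𝓝[>] 0] fun s : ℝ => ψ' (s • η) - x := by
      refine IsBigO.of_bound K ?_
      filter_upwards [hζ] with s hs using hs.2
    exact h1.trans hyO
  have hζ0 : Tendsto ζ (𝓝[>] 0) (𝓝 0) := hζO.trans_tendsto hid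
  have hder : (fun s : ℝ => ψ' (s • η) - x - fderiv ℝ ψ 0 (ζ s)) =o[𝓝[>] 0] fun s : ℝ => s := by
    have h1 := h.hasFDerivAt.isLittleO.comp_tendsto hζ0
    have h2 : (fun s => ψ (ζ s) - x - fderiv ℝ ψ 0 (ζ s)) =o[𝓝[>] 0] ζ := by
      refine h1.congr (fun s => ?_) fun s => ?_
      · simp only [Function.comp, sub_zero, h.2.1]
      · simp
    refine (h2.trans_isBigO hζO).congr' ?_ EventuallyEq.rfl
    filter_upwards [hζ] with s hs
    rw [hs.1]
  obtain ⟨c, hcpos, hA⟩ := exists_antilipschitz_bound h.2.2.2.1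
  have hlin : (fun s : ℝ => ζ s - s • ξ) =o[𝓝[>] 0] fun s : ℝ => s := by
    have h1 : (fun s : ℝ => fderiv ℝ ψ 0 (ζ s - s • ξ)) =o[𝓝[>] 0] fun s : ℝ => s := by
      refine (hder'.sub hder).congr_left fun s => ?_
      rw [map_sub, map_smul, hξη]
      abel
    refine IsBigO.trans_isLittleO (IsBigO.of_bound c⁻¹ (Eventually.of_forall fun s => ?_)) h1
    rw [← div_eq_inv_mul, le_div_iff₀ hcpos, mul_comm]
    exact hA _
  have hζlim : Tendsto (fun s => s⁻¹ • ζ s) (𝓝[>] 0) (𝓝 ξ) := by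
    have h1 : Tendsto (fun s => s⁻¹ • (ζ s - s • ξ)) (𝓝[>] 0) (𝓝 0) := by
      rw [tendsto_zero_iff_norm_tendsto_zero]
      refine (hlin.norm_norm.tendsto_div_nhds_zero).congr fun s => ?_
      rw [norm_smul, norm_inv, div_eq_inv_mul]
    have h2 := h1.add_const ξ
    rw [zero_add] at h2
    refine h2.congr' ?_
    filter_upwards [hpos] with s hs
    rw [smul_sub, inv_smul_smul₀ hs.ne', sub_add_cancel]
  have hηlim : Tendsto (fun s : ℝ => s⁻¹ • (s • η)) (𝓝[>] 0) (𝓝 η) := by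
    refine tendsto_const_nhds.congr' ?_
    filter_upwards [hpos] with s hs
    rw [inv_smul_smul₀ hs.ne']
  have r1 := tendsto_second_quotient (hg.contDiffAt.comp 0 h.2.2.1) hc hζlim
  have r2 := tendsto_second_quotient (hg.contDiffAt.comp 0 h'.2.2.1) hc' hηlim
  have r3 := r1.congr' (f₂ := fun s => (s ^ 2)⁻¹ * ((g ∘ ψ') (s • η) - (g ∘ ψ') 0)) (by
    filter_upwards [hζ] with s hs
    simp only [Function.comp, hs.1, h.2.1, h'.2.1])
  have := tendsto_nhds_unique r3 r2
  linarith

/-- Sylvester's law of inertia, for the negative index. -/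
lemma HasInertia.neg_le {V : Type*} [AddCommGroup V] [Module ℝ V] [FiniteDimensional ℝ V]
    {q : V → ℝ} {pos neg pos' neg' : ℕ} (h : HasInertia q ⊤ pos neg)
    (h' : HasInertia q ⊤ pos' neg') : neg ≤ neg' := by
  obtain ⟨P, N, -, -, -, hN, -, rfl⟩ := h
  obtain ⟨P', N', hs, hd, hP', -, rfl, rfl⟩ := h'
  have h1 : Disjoint P' N := by
    rw [Submodule.disjoint_def]
    intro v hv hv'
    by_contra hne
    exact lt_asymm (hP' v hv hne) (hN v hv' hne)
  have h2 := Submodule.finrank_add_finrank_le_of_disjoint h1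
  have h3 := Submodule.finrank_sup_add_finrank_inf_eq P' N'
  rw [hs, hd.eq_bot, finrank_bot, finrank_top] at h3
  omega

/-- The dimension and the Morse index at a critical point are well defined. -/
theorem HasMorseIndexOn.unique {N : Set E} {g : E → ℝ} (hg : ContDiff ℝ ∞ g) {x : E}
    {d c d' c' : ℕ} (h : HasMorseIndexOn N g x d c) (h' : HasMorseIndexOn N g x d' c') :
    d = d' ∧ c = c' := by
  obtain ⟨ψ, hψ, hc, pos, hI⟩ := h
  obtain ⟨ψ', hψ', hc', pos', hI'⟩ := h'
  have hr : LinearMap.range (fderiv ℝ ψ 0).toLinearMap = LinearMap.range (fderiv ℝ ψ' 0).toLinearMap :=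
    SetLike.coe_injective (hψ.range_fderiv.trans hψ'.range_fderiv.symm)
  have hd : d = d' := by
    have h1 := LinearMap.finrank_range_of_inj (f := (fderiv ℝ ψ 0).toLinearMap) hψ.2.2.2.1
    have h2 := LinearMap.finrank_range_of_inj (f := (fderiv ℝ ψ' 0).toLinearMap) hψ'.2.2.2.1
    rw [hr, h2, finrank_euclideanSpace_fin, finrank_euclideanSpace_fin] at h1
    exact h1.symm
  subst hd
  obtain ⟨L, hL⟩ := (fderiv ℝ ψ 0).toLinearMap.exists_leftInverse_of_injective
    (LinearMap.ker_eq_bot.2 hψ.2.2.2.1)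
  have hA : ∀ η, fderiv ℝ ψ 0 (L (fderiv ℝ ψ' 0 η)) = fderiv ℝ ψ' 0 η := by
    intro η
    have : fderiv ℝ ψ' 0 η ∈ LinearMap.range (fderiv ℝ ψ 0).toLinearMap := by
      rw [hr]; exact ⟨η, rfl⟩
    obtain ⟨ξ, hξ⟩ := this
    rw [← hξ]
    have := LinearMap.congr_fun hL ξ
    simp only [LinearMap.comp_apply, LinearMap.id_apply] at this
    rw [this]
    rfl
  have hinj : Function.Injective (L ∘ₗ (fderiv ℝ ψ' 0).toLinearMap) := by
    intro a b hab
    apply hψ'.2.2.2.1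
    have hab' : L (fderiv ℝ ψ' 0 a) = L (fderiv ℝ ψ' 0 b) := hab
    rw [← hA a, ← hA b, hab']
  have hI2 := HasInertia.map_injective (f := L ∘ₗ (fderiv ℝ ψ' 0).toLinearMap)
    (q' := fun v => iteratedFDeriv ℝ 2 (g ∘ ψ) 0 ![v, v]) hinj (fun v _ => by
      simp only [iteratedFDeriv_two_apply]
      exact hessian_eq_of_localParam hψ hψ' hg hc hc' (hA v)) hI'
  rw [Submodule.map_top, LinearMap.range_eq_top.2 (LinearMap.injective_iff_surjective.1 hinj)] at hI2
  exact ⟨rfl, le_antisymm (hI.neg_le hI2) (hI2.neg_le hI)⟩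

end LocalParametrizations

/-! ### Uniqueness of the Conley–Zehnder index -/

section Uniqueness

open Module

variable {n p : ℕ}

/-- The gradient of `brieskornPoly` with respect to the weighted hermitian form. -/
def gradVec (n p : ℕ) (z : Amb n) : Amb n :=
  WithLp.toLp 2 fun k => 2 * (starRingEnd ℂ) (z k ^ (brieskornExp n p k - 1))

lemma wHerm_gradVec (z v : Amb n) : wHerm n p (gradVec n p z) v = polyDiff n p z v := by
  refine Finset.sum_congr rfl fun k _ => ?_
  simp only [gradVec, map_mul, Complex.conj_conj, Complex.conj_ofNat]
  ring

lemma gradVec_ne_zero {z : Amb n} (hz : z ≠ 0) : gradVec n p z ≠ 0 := by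
  obtain ⟨j, hj⟩ : ∃ j, z j ≠ 0 := by
    by_contra! h
    exact hz (by ext j; exact h j)
  intro h
  have := congrArg (fun v : Amb n => v j) h
  simp [gradVec] at this
  exact hj this.1

lemma inner_gradVec (hp : 0 < p) {z : Amb n} (hz : z ∈ brieskornSphere n p) :
    inner ℂ z (gradVec n p z) = 0 := by
  have h1 := wHerm_reebDir_left hp z (gradVec n p z)
  rw [← wHerm_conj, wHerm_gradVec, polyDiff_reebDir hp, hz.1, mul_zero, map_zero] at h1
  have := h1.symm
  simpa using this

lemma hamOp_zero (z : Amb n) : hamOp n 0 z = z := by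
  ext k; rw [hamOp_apply]; simp

lemma perturbK_zero (z : Amb n) : perturbK n 0 z = ‖z‖ ^ 2 := by
  rw [perturbK]; ring

/-- The constraints that cut out of `ℂⁿ⁺¹` the part of the Brieskorn manifold on which the
coordinates in `s` vanish. -/
def sliceMap (n p : ℕ) (s : Finset (Fin (n + 1))) (z : Amb n) : (s → ℂ) × ℝ × ℂ :=
  (fun k => z k, perturbK n 0 z, brieskornPoly n p z)

/-- Restriction of a vector to the coordinates in `s`. -/
def coordRestrict (n : ℕ) (s : Finset (Fin (n + 1))) : Amb n →L[ℝ] (s → ℂ) :=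
  LinearMap.toContinuousLinearMap
    { toFun := fun z k => z k
      map_add' := fun _ _ => rfl
      map_smul' := fun _ _ => rfl }

lemma fderiv_perturbK (ε : ℝ) (z v : Amb n) :
    fderiv ℝ (perturbK n ε) z v = 2 * (inner ℂ (hamOp n ε z) v).re := by
  rw [← ((contDiff_perturbK ε).differentiable (by simp) z).lineDeriv_eq_fderiv]
  exact (hasLineDerivAt_perturbK ε z v).lineDeriv

lemma hasStrictFDerivAt_sliceMap (s : Finset (Fin (n + 1))) (z : Amb n) :
    HasStrictFDerivAt (sliceMap n p s) ((coordRestrict n s).prod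
      ((fderiv ℝ (perturbK n 0) z).prod (fderiv ℝ (brieskornPoly n p) z))) z :=
  (coordRestrict n s).hasStrictFDerivAt.prodMk
    (((contDiff_perturbK 0).contDiffAt.hasStrictFDerivAt (by simp)).prodMk
      ((contDiff_brieskornPoly n p).contDiffAt.hasStrictFDerivAt (by simp)))

lemma surjective_sliceMap_deriv (hp : 2 ≤ p) {s : Finset (Fin (n + 1))} {z : Amb n}
    (hz : z ∈ brieskornSphere n p) (hs : ∀ k ∈ s, z k = 0) :
    Function.Surjective ((coordRestrict n s).prod
      ((fderiv ℝ (perturbK n 0) z).prod (fderiv ℝ (brieskornPoly n p) z))) := by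
  classical
  rintro ⟨y, r, c⟩
  have hp0 : 0 < p := by omega
  have hz0 := brieskornSphere_ne_zero hz
  have hG := wHerm_self_pos hp0 (gradVec_ne_zero (p := p) hz0)
  rw [wHerm_gradVec] at hG
  have hGc : polyDiff n p z (gradVec n p z) ≠ 0 := fun h => by rw [h] at hG; simp at hG
  have hw := reebWeight_pos hp0 hz0
  have hexp : ∀ k, brieskornExp n p k - 1 ≠ 0 := by
    intro k; unfold brieskornExp; split_ifs <;> omega
  set Y : Amb n := WithLp.toLp 2 fun k => if h : k ∈ s then y ⟨k, h⟩ else 0 with hY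
  have hYp : polyDiff n p z Y = 0 := by
    refine Finset.sum_eq_zero fun k _ => ?_
    by_cases h : k ∈ s
    · rw [hs k h, zero_pow (hexp k)]; ring
    · simp [hY, h]
  have hYi : inner ℂ z Y = 0 := by
    rw [inner_eq_sum]
    refine Finset.sum_eq_zero fun k _ => ?_
    by_cases h : k ∈ s
    · rw [hs k h]; simp
    · simp [hY, h]
  refine ⟨Y + (c / polyDiff n p z (gradVec n p z)) • gradVec n p z +
    (-Complex.I * (r / (2 * reebWeight n p z) : ℝ)) • reebDir n p z, ?_⟩
  refine Prod.ext ?_ (Prod.ext ?_ ?_)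
  · funext k
    change (Y + (c / polyDiff n p z (gradVec n p z)) • gradVec n p z +
      (-Complex.I * (r / (2 * reebWeight n p z) : ℝ)) • reebDir n p z) k.1 = y k
    simp [hY, gradVec, reebDir, hs k.1 k.2, hexp k.1]
  · change fderiv ℝ (perturbK n 0) z _ = r
    rw [fderiv_perturbK, hamOp_zero, inner_add_right, inner_add_right, inner_smul_right,
      inner_smul_right, hYi, inner_gradVec hp0 hz, inner_reebDir]
    have : -Complex.I * ((r / (2 * reebWeight n p z) : ℝ) : ℂ) * (reebWeight n p z * Complex.I) =
        ((r / 2 : ℝ) : ℂ) := by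
      have h2 : (reebWeight n p z : ℂ) ≠ 0 := by exact_mod_cast hw.ne'
      push_cast
      field_simp
      rw [Complex.I_sq]; ring
    rw [this, mul_zero, zero_add, zero_add, Complex.ofReal_re]
    ring
  · change fderiv ℝ (brieskornPoly n p) z _ = c
    rw [fderiv_brieskornPoly, polyDiff_add, polyDiff_add, polyDiff_smul, polyDiff_smul, hYp,
      polyDiff_reebDir hp0, hz.1, div_mul_cancel₀ _ hGc]
    ring

lemma mem_slice_iff {s : Finset (Fin (n + 1))} {x y : Amb n} (hx : x ∈ brieskornSphere n p)
    (hs : ∀ k ∈ s, x k = 0) :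
    sliceMap n p s y = sliceMap n p s x ↔ y ∈ brieskornSphere n p ∧ ∀ k ∈ s, y k = 0 := by
  have h1 : ‖y‖ ^ 2 = ‖x‖ ^ 2 ↔ ‖y‖ = 1 := by
    rw [sphere_norm hx]
    constructor
    · intro h; nlinarith [norm_nonneg y]
    · intro h; rw [h]
  simp only [sliceMap, Prod.ext_iff, funext_iff, perturbK_zero, h1, hx.1]
  constructor
  · rintro ⟨h, hn, hP⟩
    exact ⟨⟨hP, hn⟩, fun k hk => (h ⟨k, hk⟩).trans (hs k hk)⟩
  · rintro ⟨⟨hP, hn⟩, h⟩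
    exact ⟨fun k => (h k.1 k.2).trans (hs k.1 k.2).symm, hn, hP⟩

lemma tangentConeAt_brieskornSphere (hp : 2 ≤ p) {z : Amb n} (hz : z ∈ brieskornSphere n p) :
    tangentConeAt ℝ (brieskornSphere n p) z = brieskornTangent n p z := by
  have h := tangentConeAt_levelSet (hasStrictFDerivAt_sliceMap (p := p) ∅ z)
    (surjective_sliceMap_deriv hp hz (by simp)) (N := brieskornSphere n p) (by
      ext y
      have := mem_slice_iff (s := ∅) (y := y) hz (by simp)
      simp only [Finset.notMem_empty, false_imp_iff, implies_true, and_true] at this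
      exact this.symm)
  rw [h]
  ext v
  change ((coordRestrict n ∅).prod
      ((fderiv ℝ (perturbK n 0) z).prod (fderiv ℝ (brieskornPoly n p) z))) v = 0 ↔ _
  rw [mem_brieskornTangent, ← fderiv_brieskornPoly]
  have e1 := fderiv_perturbK 0 z v
  rw [hamOp_zero] at e1
  constructor
  · intro h
    have h1 : fderiv ℝ (perturbK n 0) z v = 0 := congrArg (fun y => y.2.1) h
    have h2 : fderiv ℝ (brieskornPoly n p) z v = 0 := congrArg (fun y => y.2.2) h
    exact ⟨h2, by linarith⟩
  · rintro ⟨h1, h2⟩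
    refine Prod.ext ?_ (Prod.ext ?_ h1)
    · funext k; exact absurd k.2 (Finset.notMem_empty _)
    · change fderiv ℝ (perturbK n 0) z v = 0
      rw [e1, h2, mul_zero]

/-- The linearized Reeb flow on the tangent spaces of the Brieskorn manifold is the restriction of
`flowMap`. -/
lemma linearizedFlow_eq {ε : ℝ} (hn : 2 ≤ n) (hp : 2 ≤ p) (h0 : 0 < ε) (h1 : ε < 1)
    {φ : ℝ → Amb n → Amb n} (hφ : IsPerturbedReebFlow n p ε φ) {z : Amb n}
    (hz : z ∈ brieskornSphere n p) {t : ℝ} {D : Amb n →L[ℝ] Amb n}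
    (hD : HasFDerivWithinAt (φ t) D (brieskornSphere n p) z) {v : Amb n}
    (hv : v ∈ brieskornTangent n p z) : D v = flowMap n p ε t v := by
  have h2 : HasFDerivWithinAt (φ t) ((flowMap n p ε t).restrictScalars ℝ)
      (brieskornSphere n p) z :=
    ((flowMap n p ε t).restrictScalars ℝ).hasFDerivAt.hasFDerivWithinAt.congr
      (fun y hy => perturbedReebFlow_unique hn (by omega) h0 h1 hφ hy t)
      (perturbedReebFlow_unique hn (by omega) h0 h1 hφ hz t)
  rw [← tangentConeAt_brieskornSphere hp hz] at hv
  exact hD.unique_on h2 hv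

/-- Extension of a trivialization of the contact structure to one of `ℂⁿ⁺¹`: the contact plane is
moved onto the complex subspace `ker dP ∩ z^⊥` by `toHol`, whose complement has the frame
`reebDir z`, `gradVec z`. -/
def stabMap (n p : ℕ) (ε : ℝ) (z : Amb n) : Amb n × EuclideanSpace ℂ (Fin 2) →L[ℝ] Amb n :=
  LinearMap.toContinuousLinearMap
    { toFun := fun x => (√(perturbK n ε z))⁻¹ • toHol n p z x.1 +
        (((√(wHerm n p (reebDir n p z) (reebDir n p z)).re)⁻¹ : ℝ) * x.2 0) • reebDir n p z +
        (((√(wHerm n p (gradVec n p z) (gradVec n p z)).re)⁻¹ : ℝ) * x.2 1) • gradVec n p z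
      map_add' := by
        intro x y
        ext k
        simp only [toHol, Prod.fst_add, Prod.snd_add, inner_add_right, Complex.add_im, add_div,
          PiLp.add_apply, PiLp.sub_apply, PiLp.smul_apply, add_smul, smul_eq_mul, smul_add, smul_sub]
        ring
      map_smul' := by
        intro c x
        ext k
        simp only [toHol, Prod.smul_fst, Prod.smul_snd, real_smul_eq, inner_smul_right,
          Complex.im_ofReal_mul, PiLp.add_apply, PiLp.sub_apply, PiLp.smul_apply, smul_eq_mul,
          RingHom.id_apply]
        push_cast
        ring }

lemma stabMap_apply (ε : ℝ) (z v : Amb n) (w : EuclideanSpace ℂ (Fin 2)) :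
    stabMap n p ε z (v, w) = (√(perturbK n ε z))⁻¹ • toHol n p z v +
      (((√(wHerm n p (reebDir n p z) (reebDir n p z)).re)⁻¹ : ℝ) * w 0) • reebDir n p z +
      (((√(wHerm n p (gradVec n p z) (gradVec n p z)).re)⁻¹ : ℝ) * w 1) • gradVec n p z := rfl

lemma wHerm_zero_right (u : Amb n) : wHerm n p u 0 = 0 := by simp [wHerm]

lemma wForm_toHol (hp : 0 < p) {z v v' : Amb n} (hv : v ∈ brieskornTangent n p z)
    (hv' : v' ∈ brieskornTangent n p z) :
    wForm n p (toHol n p z v) (toHol n p z v') = wForm n p v v' :=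
  wForm_reebDir_reebDir hp z _ _ v v' (mem_brieskornTangent.1 hv).2 (mem_brieskornTangent.1 hv').2

lemma sqrt_inv_mul_self {x : ℝ} (hx : 0 < x) : (√x)⁻¹ * (√x)⁻¹ * x = 1 := by
  rw [← mul_inv, Real.mul_self_sqrt hx.le, inv_mul_cancel₀ hx.ne']

lemma wForm_stabMap (hp : 0 < p) {ε : ℝ} {z v v' : Amb n} (hz : z ∈ brieskornSphere n p)
    (hK : 0 < perturbK n ε z) (hv : v ∈ brieskornTangent n p z) (hv' : v' ∈ brieskornTangent n p z)
    (w w' : EuclideanSpace ℂ (Fin 2)) :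
    wForm n p (stabMap n p ε z (v, w)) (stabMap n p ε z (v', w')) =
      (perturbK n ε z)⁻¹ * wForm n p v v' + stdForm 2 w w' := by
  have hz0 := brieskornSphere_ne_zero hz
  have hT := mem_brieskornTangent.1 hv
  have hT' := mem_brieskornTangent.1 hv'
  have hX := wHerm_self_pos hp (u := reebDir n p z) (fun h => by
    have := form_reebDir hp hz
    rw [h, map_zero] at this
    norm_num at this)
  have hG := wHerm_self_pos hp (gradVec_ne_zero (p := p) hz0)
  have hXself : wHerm n p (reebDir n p z) (reebDir n p z) =
      ((wHerm n p (reebDir n p z) (reebDir n p z)).re : ℂ) := by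
    conv_lhs => rw [wHerm_self]
    rw [wHerm_self, Complex.ofReal_re]
  have hGself : wHerm n p (gradVec n p z) (gradVec n p z) =
      ((wHerm n p (gradVec n p z) (gradVec n p z)).re : ℂ) := by
    conv_lhs => rw [wHerm_self]
    rw [wHerm_self, Complex.ofReal_re]
  have oXv : ∀ v ∈ brieskornTangent n p z, wHerm n p (reebDir n p z) (toHol n p z v) = 0 := by
    intro v hv
    rw [wHerm_reebDir_left hp, inner_toHol hp hz (mem_brieskornTangent.1 hv).2, mul_zero]
  have oGv : ∀ v ∈ brieskornTangent n p z, wHerm n p (gradVec n p z) (toHol n p z v) = 0 := by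
    intro v hv
    rw [wHerm_gradVec, polyDiff_toHol hp hz (mem_brieskornTangent.1 hv).1]
  have oGX : wHerm n p (gradVec n p z) (reebDir n p z) = 0 := by
    rw [wHerm_gradVec, polyDiff_reebDir hp, hz.1, mul_zero]
  have flip : ∀ u v : Amb n, wHerm n p u v = 0 → wHerm n p v u = 0 := by
    intro u v h; rw [← wHerm_conj, h, map_zero]
  have main := wForm_toHol hp hv hv'
  have hs2 := sqrt_inv_mul_self hK
  have hsX := sqrt_inv_mul_self hX
  have hsG := sqrt_inv_mul_self hG
  rw [stabMap_apply, stabMap_apply, stdForm_eq_sum, Fin.sum_univ_two, wForm_apply]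
  rw [wForm_apply] at main
  simp only [real_smul_eq, wHerm_add_left, wHerm_add_right, wHerm_smul_left, wHerm_smul_right,
    oXv v' hv', oGv v' hv', oGX, flip _ _ (oXv v hv),
    flip _ _ (oGv v hv), flip _ _ oGX, mul_zero, add_zero, zero_add,
    map_mul, Complex.conj_ofReal]
  generalize wHerm n p (reebDir n p z) (reebDir n p z) = A at *
  generalize wHerm n p (gradVec n p z) (gradVec n p z) = B at *
  rw [Complex.add_im, Complex.add_im]
  have r1 : ((((√A.re)⁻¹ : ℝ) : ℂ) * (starRingEnd ℂ) (w 0) * ((((√A.re)⁻¹ : ℝ) : ℂ) * w' 0 * A)) =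
      (starRingEnd ℂ) (w 0) * w' 0 := by
    have : ((((√A.re)⁻¹ : ℝ) : ℂ) * (((√A.re)⁻¹ : ℝ) : ℂ) * A) = 1 := by
      rw [hXself]
      exact_mod_cast hsX
    linear_combination ((starRingEnd ℂ) (w 0) * w' 0) * this
  have r2 : ((((√B.re)⁻¹ : ℝ) : ℂ) * (starRingEnd ℂ) (w 1) * ((((√B.re)⁻¹ : ℝ) : ℂ) * w' 1 * B)) =
      (starRingEnd ℂ) (w 1) * w' 1 := by
    have : ((((√B.re)⁻¹ : ℝ) : ℂ) * (((√B.re)⁻¹ : ℝ) : ℂ) * B) = 1 := by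
      rw [hGself]
      exact_mod_cast hsG
    linear_combination ((starRingEnd ℂ) (w 1) * w' 1) * this
  have r3 : (perturbK n ε z)⁻¹ = (√(perturbK n ε z))⁻¹ * (√(perturbK n ε z))⁻¹ := by
    rw [← mul_inv, Real.mul_self_sqrt hK.le]
  simp only [mul_comm, mul_left_comm, mul_assoc] at r1 r2 ⊢
  have r4 : ∀ (h : ℂ) (s : ℝ), (h * ((s : ℂ) * s)).im = s * s * h.im := by
    intro h s
    rw [mul_comm, mul_assoc, Complex.im_ofReal_mul, Complex.im_ofReal_mul, mul_assoc]
  rw [r4, main, r1, r2, r3, add_assoc]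

lemma continuous_toHol (v : Amb n) (hp : 0 < p) :
    ContinuousOn (fun z => toHol n p z v) (brieskornSphere n p) := by
  have hX : Continuous (reebDir n p) := by
    have : (reebDir n p) = fun z => reebField n p 0 z := by
      funext z; rw [reebField_apply, hamOp_zero]
    rw [this]; exact (reebField n p 0).continuous
  have hW : Continuous (reebWeight n p) := by unfold reebWeight; fun_prop
  have hI : Continuous fun z : Amb n => (inner ℂ z v).im := by fun_prop
  unfold toHol
  refine continuousOn_const.sub (ContinuousOn.fun_smul ?_ hX.continuousOn)
  exact hI.continuousOn.div hW.continuousOn fun z hz =>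
    (reebWeight_pos hp (brieskornSphere_ne_zero hz)).ne'

lemma continuous_reebDir : Continuous (reebDir n p) := by
  have : (reebDir n p) = fun z => reebField n p 0 z := by
    funext z; rw [reebField_apply, hamOp_zero]
  rw [this]; exact (reebField n p 0).continuous

lemma continuous_gradVec : Continuous (gradVec n p) := by
  unfold gradVec
  refine (PiLp.continuous_toLp 2 _).comp (continuous_pi fun k => ?_)
  fun_prop

lemma continuous_wHerm {X : Type*} [TopologicalSpace X] {f g : X → Amb n} (hf : Continuous f)
    (hg : Continuous g) : Continuous fun x => wHerm n p (f x) (g x) := by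
  unfold wHerm; fun_prop

lemma continuousOn_stabMap (hn : 2 ≤ n) (hp : 0 < p) {ε : ℝ} (h0 : 0 < ε) (h1 : ε < 1) :
    ContinuousOn (stabMap n p ε) (brieskornSphere n p) := by
  rw [continuousOn_clm_apply]
  rintro ⟨v, w⟩
  simp only [stabMap_apply]
  have hKc : ContinuousOn (fun z => (√(perturbK n ε z))⁻¹) (brieskornSphere n p) :=
    ((Real.continuous_sqrt.comp (contDiff_perturbK ε).continuous).continuousOn).inv₀
      fun z hz => (Real.sqrt_pos.2 (perturbK_pos hn h0 h1 (brieskornSphere_ne_zero hz))).ne'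
  have hfr : ∀ f : Amb n → Amb n, Continuous f → (∀ z ∈ brieskornSphere n p, f z ≠ 0) → ∀ c : ℂ,
      ContinuousOn (fun z => (((√(wHerm n p (f z) (f z)).re)⁻¹ : ℝ) * c) • f z)
        (brieskornSphere n p) := by
    intro f hf hne c
    have h2 : ContinuousOn (fun z => (√(wHerm n p (f z) (f z)).re)⁻¹) (brieskornSphere n p) :=
      ((Real.continuous_sqrt.comp (Complex.continuous_re.comp
        (continuous_wHerm hf hf))).continuousOn).inv₀
        fun z hz => (Real.sqrt_pos.2 (wHerm_self_pos hp (hne z hz))).ne'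
    exact (((Complex.continuous_ofReal.comp_continuousOn h2)).mul continuousOn_const).smul
      hf.continuousOn
  refine ((hKc.smul (continuous_toHol v hp)).add (hfr _ continuous_reebDir ?_ _)).add
    (hfr _ continuous_gradVec ?_ _)
  · intro z hz h
    have := form_reebDir hp hz
    rw [h, map_zero] at this
    norm_num at this
  · intro z hz
    exact gradVec_ne_zero (brieskornSphere_ne_zero hz)

lemma dOneForm_contactPlane {ε : ℝ} {z u v : Amb n} (hK : perturbK n ε z ≠ 0)
    (hu : u ∈ contactPlane (brieskornTangent n p) (perturbedForm n p ε) z)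
    (hv : v ∈ contactPlane (brieskornTangent n p) (perturbedForm n p ε) z) :
    dOneForm (perturbedForm n p ε) z u v = (perturbK n ε z)⁻¹ * wForm n p u v := by
  rw [dOneForm_perturbedForm hK, (perturbedForm_eq_zero_iff hK).1 hu.2,
    (perturbedForm_eq_zero_iff hK).1 hv.2]
  ring

lemma finrank_amb_eq (hn : 2 ≤ n) : finrank ℝ (Amb n) =
    finrank ℝ (EuclideanSpace ℂ (Fin (n - 1))) + finrank ℝ (EuclideanSpace ℂ (Fin 2)) := by
  have : ∀ r, finrank ℝ (EuclideanSpace ℂ (Fin r)) = 2 * r := by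
    intro r
    rw [← Module.finrank_mul_finrank ℝ ℂ, Complex.finrank_real_complex, finrank_euclideanSpace_fin]
  rw [this, this, this]
  omega

/-- The Conley–Zehnder index of a closed Reeb orbit does not depend on the choices of the disc and
of the trivialization. -/
theorem HasConleyZehnderIndex.unique {ε : ℝ} (hn : 2 ≤ n) (hp : 2 ≤ p) (h0 : 0 < ε) (h1 : ε < 1)
    {φ : ℝ → Amb n → Amb n} (hφ : IsPerturbedReebFlow n p ε φ) {z : Amb n}
    (hz : z ∈ brieskornSphere n p) {T μ μ' : ℝ} (hT : 0 < T)
    (h : HasConleyZehnderIndex (n - 1) (brieskornSphere n p) (brieskornTangent n p)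
      (perturbedForm n p ε) φ T z μ)
    (h' : HasConleyZehnderIndex (n - 1) (brieskornSphere n p) (brieskornTangent n p)
      (perturbedForm n p ε) φ T z μ') : μ = μ' := by
  obtain ⟨u, Φ, Ψ, huc, huS, hub, hΦc, hΦ, hD, Ψ₁, hH, hμ⟩ := h
  obtain ⟨u', Φ', Ψ', huc', huS', hub', hΦc', hΦ', hD', Ψ₁', hH', hμ'⟩ := h'
  have hp0 : 0 < p := by omega
  have hKpos : ∀ y ∈ brieskornSphere n p, 0 < perturbK n ε y := fun y hy =>
    perturbK_pos hn h0 h1 (brieskornSphere_ne_zero hy)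
  have hcirc : ∀ t : ℝ, circlePt T t ∈ Metric.closedBall (0 : ℂ) 1 := fun t => by
    rw [mem_closedBall_zero_iff, norm_circlePt]
  have h1mem : (1 : ℂ) ∈ Metric.closedBall (0 : ℂ) 1 := by simp
  have hu0 : u 1 = z := by
    have := hub 0
    rw [(hφ z hz).1] at this
    simpa using this
  have hu0' : u' 1 = z := by
    have := hub' 0
    rw [(hφ z hz).1] at this
    simpa using this
  have huu : ∀ t, u' (circlePt T t) = u (circlePt T t) := fun t => (hub' t).trans (hub t).symm
  -- the frames of `ℂⁿ⁺¹` over the two discs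
  set Fr : (ℂ → Amb n) → (ℂ → EuclideanSpace ℂ (Fin (n - 1)) →L[ℝ] Amb n) → ℂ →
      EuclideanSpace ℂ (Fin (n - 1)) × EuclideanSpace ℂ (Fin 2) →L[ℝ] Amb n :=
    fun u Φ ζ => (stabMap n p ε (u ζ)).comp ((Φ ζ).prodMap (ContinuousLinearMap.id ℝ _)) with hFr
  have Fr_apply : ∀ u Φ ζ v w, Fr u Φ ζ (v, w) = stabMap n p ε (u ζ) (Φ ζ v, w) :=
    fun _ _ _ _ _ => rfl
  have Fr_cont : ∀ (u : ℂ → Amb n) (Φ : ℂ → EuclideanSpace ℂ (Fin (n - 1)) →L[ℝ] Amb n),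
      ContinuousOn u (Metric.closedBall 0 1) →
      (∀ ζ ∈ Metric.closedBall (0 : ℂ) 1, u ζ ∈ brieskornSphere n p) →
      ContinuousOn Φ (Metric.closedBall 0 1) → ContinuousOn (Fr u Φ) (Metric.closedBall 0 1) := by
    intro u Φ huc huS hΦc
    refine ((continuousOn_stabMap hn hp0 h0 h1).comp huc huS).clm_comp ?_
    exact (ContinuousLinearMap.prodMapL ℝ _ _ _ _).continuous.comp_continuousOn
      (hΦc.prodMk continuousOn_const)
  have Fr_symp : ∀ (u : ℂ → Amb n) (Φ : ℂ → EuclideanSpace ℂ (Fin (n - 1)) →L[ℝ] Amb n),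
      (∀ ζ ∈ Metric.closedBall (0 : ℂ) 1, u ζ ∈ brieskornSphere n p) →
      (∀ ζ ∈ Metric.closedBall (0 : ℂ) 1,
        Set.range (Φ ζ) = contactPlane (brieskornTangent n p) (perturbedForm n p ε) (u ζ) ∧
        ∀ v w, dOneForm (perturbedForm n p ε) (u ζ) (Φ ζ v) (Φ ζ w) = stdSymplectic v w) →
      ∀ ζ ∈ Metric.closedBall (0 : ℂ) 1, ∀ x y,
        wForm n p (Fr u Φ ζ x) (Fr u Φ ζ y) = prodForm (stdForm (n - 1)) (stdForm 2) x y := by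
    rintro u Φ huS hΦ ζ hζ ⟨v, w⟩ ⟨v', w'⟩
    have hm : ∀ v, Φ ζ v ∈ contactPlane (brieskornTangent n p) (perturbedForm n p ε) (u ζ) :=
      fun v => by rw [← (hΦ ζ hζ).1]; exact ⟨v, rfl⟩
    have hK := hKpos _ (huS ζ hζ)
    rw [Fr_apply, Fr_apply, wForm_stabMap hp0 (huS ζ hζ) hK (hm v).1 (hm v').1,
      ← dOneForm_contactPlane hK.ne' (hm v) (hm v'), (hΦ ζ hζ).2]
    rfl
  have Φ_inj : ∀ (u : ℂ → Amb n) (Φ : ℂ → EuclideanSpace ℂ (Fin (n - 1)) →L[ℝ] Amb n),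
      (∀ ζ ∈ Metric.closedBall (0 : ℂ) 1, u ζ ∈ brieskornSphere n p) →
      (∀ ζ ∈ Metric.closedBall (0 : ℂ) 1,
        Set.range (Φ ζ) = contactPlane (brieskornTangent n p) (perturbedForm n p ε) (u ζ) ∧
        ∀ v w, dOneForm (perturbedForm n p ε) (u ζ) (Φ ζ v) (Φ ζ w) = stdSymplectic v w) →
      Function.Injective (Φ 1) := by
    intro u Φ huS hΦ
    have hm : ∀ v, Φ 1 v ∈ contactPlane (brieskornTangent n p) (perturbedForm n p ε) (u 1) :=
      fun v => by rw [← (hΦ 1 h1mem).1]; exact ⟨v, rfl⟩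
    intro x y hxy
    rw [← sub_eq_zero]
    refine (isSympForm_stdForm _).nondeg _ fun w => ?_
    rw [stdForm_apply, ← (hΦ 1 h1mem).2,
      dOneForm_contactPlane (hKpos _ (huS 1 h1mem)).ne' (hm _) (hm _), map_sub, hxy, sub_self]
    simp
  -- the linearized flow is the identity at time `0`
  have path_zero : ∀ (u : ℂ → Amb n) (Φ : ℂ → EuclideanSpace ℂ (Fin (n - 1)) →L[ℝ] Amb n)
      (Ψ : ℝ → EuclideanSpace ℂ (Fin (n - 1)) →L[ℝ] EuclideanSpace ℂ (Fin (n - 1))), u 1 = z →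
      (∀ ζ ∈ Metric.closedBall (0 : ℂ) 1, u ζ ∈ brieskornSphere n p) →
      (∀ ζ ∈ Metric.closedBall (0 : ℂ) 1,
        Set.range (Φ ζ) = contactPlane (brieskornTangent n p) (perturbedForm n p ε) (u ζ) ∧
        ∀ v w, dOneForm (perturbedForm n p ε) (u ζ) (Φ ζ v) (Φ ζ w) = stdSymplectic v w) →
      (∀ t ∈ Set.Icc 0 T, ∃ D : Amb n →L[ℝ] Amb n,
        HasFDerivWithinAt (φ t) D (brieskornSphere n p) z ∧
        ∀ v, Φ (Complex.exp (2 * Real.pi * Complex.I * (t / T))) (Ψ t v) = D (Φ 1 v)) →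
      (∀ t ∈ Set.Icc 0 T, ∀ v, Φ (circlePt T t) (Ψ t v) = flowMap n p ε t (Φ 1 v)) ∧
        Ψ 0 = 1 := by
    intro u Φ Ψ hu1 huS hΦ hD
    have key : ∀ t ∈ Set.Icc 0 T, ∀ v, Φ (circlePt T t) (Ψ t v) = flowMap n p ε t (Φ 1 v) := by
      intro t ht v
      obtain ⟨D, hd, he⟩ := hD t ht
      have hm : Φ 1 v ∈ contactPlane (brieskornTangent n p) (perturbedForm n p ε) (u 1) := by
        rw [← (hΦ 1 h1mem).1]; exact ⟨v, rfl⟩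
      rw [hu1] at hm
      rw [← linearizedFlow_eq hn hp h0 h1 hφ hz hd hm.1]
      exact he v
    refine ⟨key, ContinuousLinearMap.ext fun v => Φ_inj u Φ huS hΦ ?_⟩
    have := key 0 ⟨le_rfl, hT.le⟩ v
    rw [circlePt_zero, flowMap_zero] at this
    exact this
  obtain ⟨hkey, hΨ0⟩ := path_zero u Φ Ψ hu0 huS hΦ hD
  obtain ⟨hkey', hΨ0'⟩ := path_zero u' Φ' Ψ' hu0' huS' hΦ' hD'
  have hne : Nonempty (Fin (n - 1)) := ⟨⟨0, by omega⟩⟩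
  have hpiT : 0 < Real.pi / T := div_pos Real.pi_pos hT
  refine crossingSum_unique (isSympForm_stdForm (n - 1)) (isSympForm_stdForm 2) (Ξ := wForm n p)
    (finrank_amb_eq hn) hT
    (Γ := diagPath fun _ => Real.pi / T) (diagPath_zero _)
    (fun t _ => preservesForm_diagPath _ t) ?_
    (fun t _ => (hasDerivAt_diagPath _ t).hasDerivWithinAt) ?_ ?_
    (Fr_cont u Φ huc huS hΦc) (Fr_cont u' Φ' huc' huS' hΦc') (Fr_symp u Φ huS hΦ)
    (Fr_symp u' Φ' huS' hΦ') ?_ hΨ0 hΨ0' ?_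
    (symplecticHomotopic_iff.1 hH) (symplecticHomotopic_iff.1 hH')
    (hasCrossingSum_iff.1 hμ) (hasCrossingSum_iff.1 hμ')
  · refine ((diagMap 2).continuous.comp (continuous_pi fun j => ?_)).continuousOn
    fun_prop
  · intro t ht w hw
    ext j
    have h2 := congrArg (fun v : EuclideanSpace ℂ (Fin 2) => v j) hw
    simp only [diagPath, diagMap_apply] at h2
    by_contra hj
    have h3 : Complex.exp ((Real.pi / T * t : ℝ) * Complex.I) = 1 :=
      mul_right_cancel₀ hj (by rw [h2, one_mul])
    rw [Complex.exp_eq_one_iff] at h3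
    obtain ⟨k, hk⟩ := h3
    rw [← mul_assoc, mul_left_inj' Complex.I_ne_zero] at hk
    have hk' : Real.pi / T * t = k * (2 * Real.pi) := by exact_mod_cast hk
    have h4 : t / T = 2 * k := by
      have := Real.pi_pos.ne'
      field_simp at hk' ⊢
      linarith
    have h5 : 0 < t / T := div_pos ht.1 hT
    have h6 : t / T ≤ 1 := (div_le_one hT).2 ht.2
    rw [h4] at h5 h6
    have h7 : (0 : ℤ) < 2 * k := by exact_mod_cast h5
    have h8 : 2 * k ≤ (1 : ℤ) := by exact_mod_cast h6
    omega
  · intro w hw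
    rw [stdForm_eq_sum]
    obtain ⟨j, hj⟩ : ∃ j, w j ≠ 0 := by
      by_contra! h
      exact hw (by ext j; exact h j)
    have hterm : ∀ i, ((starRingEnd ℂ) (w i) * (diagMap 2 (fun _ =>
        Complex.exp ((Real.pi / T * 0 : ℝ) * Complex.I) * ((Real.pi / T : ℝ) * Complex.I)) w) i).im =
        Real.pi / T * ‖w i‖ ^ 2 := by
      intro i
      rw [diagMap_apply]
      have : (starRingEnd ℂ) (w i) * (Complex.exp ((Real.pi / T * 0 : ℝ) * Complex.I) *
          ((Real.pi / T : ℝ) * Complex.I) * w i) =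
          ((Real.pi / T * ‖w i‖ ^ 2 : ℝ) : ℂ) * Complex.I := by
        have := Complex.mul_conj' (w i)
        simp only [mul_zero, Complex.ofReal_zero, zero_mul, Complex.exp_zero, one_mul]
        push_cast
        linear_combination ((Real.pi : ℂ) / T * Complex.I) * this
      rw [this, Complex.im_ofReal_mul, Complex.I_im, mul_one]
    simp only [hterm]
    exact Finset.sum_pos' (fun i _ => by positivity) ⟨j, Finset.mem_univ _, by positivity⟩
  · intro t v
    have hr : Φ (circlePt T t) v ∈ Set.range (Φ' (circlePt T t)) := by
      rw [(hΦ' _ (hcirc t)).1, huu, ← (hΦ _ (hcirc t)).1]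
      exact ⟨v, rfl⟩
    obtain ⟨v', hv'⟩ := hr
    exact ⟨v', fun w => by rw [Fr_apply, Fr_apply, hv', huu]⟩
  · intro t ht v v' hvv
    have h2 : Φ' 1 v' = Φ 1 v := by
      have hm : ∀ v, Φ 1 v ∈ contactPlane (brieskornTangent n p) (perturbedForm n p ε) z :=
        fun v => by rw [← hu0, ← (hΦ 1 h1mem).1]; exact ⟨v, rfl⟩
      have hm' : ∀ v, Φ' 1 v ∈ contactPlane (brieskornTangent n p) (perturbedForm n p ε) z :=
        fun v => by rw [← hu0', ← (hΦ' 1 h1mem).1]; exact ⟨v, rfl⟩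
      obtain ⟨v₂, hv₂⟩ : Φ' 1 v' ∈ Set.range (Φ 1) := by
        rw [(hΦ 1 h1mem).1, hu0]; exact hm' v'
      have h3 : Fr u Φ 1 (v₂, 0) = Fr u Φ 1 (v, 0) := by
        rw [← hvv, Fr_apply, Fr_apply, hv₂, hu0, hu0']
      have h4 : v₂ - v = 0 := by
        refine (isSympForm_stdForm _).nondeg _ fun w => ?_
        have h5 := Fr_symp u Φ huS hΦ 1 h1mem (v₂ - v, 0) (w, 0)
        have h6 : Fr u Φ 1 (v₂ - v, 0) = 0 := by
          have : ((v₂ - v, 0) : EuclideanSpace ℂ (Fin (n - 1)) × EuclideanSpace ℂ (Fin 2)) =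
            (v₂, 0) - (v, 0) := by simp
          rw [this, map_sub, h3, sub_self]
        rw [h6] at h5
        simpa using h5.symm
      rw [← hv₂, sub_eq_zero.1 h4]
    rw [Fr_apply, Fr_apply, hkey t ht, hkey' t ht, h2, huu]

end Uniqueness

/-! ### The Conley–Zehnder index from a unitary frame over a disc -/

section Frames

open Module

variable {n p : ℕ}

/-- The projection onto the contact plane along `reebDir z`. -/
def fromHol (n p : ℕ) (z c : Amb n) : Amb n := c - (wForm n p z c / 2) • reebDir n p z

lemma fromHol_smul (z c : Amb n) (a : ℝ) : fromHol n p z (a • c) = a • fromHol n p z c := by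
  rw [fromHol, fromHol, map_smul, smul_sub, smul_smul, smul_eq_mul, mul_div_assoc]

lemma continuous_fromHol : Continuous fun x : Amb n × Amb n => fromHol n p x.1 x.2 := by
  have h : Continuous fun x : Amb n × Amb n => (wHerm n p x.1 x.2).im / 2 :=
    (Complex.continuous_im.comp (continuous_wHerm continuous_fst continuous_snd)).div_const 2
  exact continuous_snd.sub (h.fun_smul (continuous_reebDir.comp continuous_fst))

/-- A unitary frame of `ker dP ∩ z^⊥` spans this space. -/
lemma mem_span_frame (hn : 2 ≤ n) (hp : 0 < p) {z : Amb n} (hz : z ∈ brieskornSphere n p)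
    {e : Fin (n - 1) → Amb n} (he1 : ∀ j, polyDiff n p z (e j) = 0)
    (he2 : ∀ j, inner ℂ z (e j) = 0)
    (he3 : ∀ i j, wHerm n p (e i) (e j) = if i = j then 1 else 0) {c : Amb n}
    (hc1 : polyDiff n p z c = 0) (hc2 : inner ℂ z c = 0) : ∃ v : Fin (n - 1) → ℂ, ∑ j, v j • e j = c := by
  have hX0 : reebDir n p z ≠ 0 := fun h => by
    have := form_reebDir hp hz
    rw [h, map_zero] at this
    norm_num at this
  have hX := wHerm_self_pos hp hX0
  have hG := wHerm_self_pos hp (gradVec_ne_zero (p := p) (brieskornSphere_ne_zero hz))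
  have hX' : wHerm n p (reebDir n p z) (reebDir n p z) ≠ 0 := fun h => by rw [h] at hX; simp at hX
  have hG' : wHerm n p (gradVec n p z) (gradVec n p z) ≠ 0 := fun h => by rw [h] at hG; simp at hG
  have flip : ∀ u v : Amb n, wHerm n p u v = 0 → wHerm n p v u = 0 := by
    intro u v h; rw [← wHerm_conj, h, map_zero]
  have oX : ∀ v, inner ℂ z v = 0 → wHerm n p (reebDir n p z) v = 0 := by
    intro v hv; rw [wHerm_reebDir_left hp, hv, mul_zero]
  have oG : ∀ v, polyDiff n p z v = 0 → wHerm n p (gradVec n p z) v = 0 := by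
    intro v hv; rw [wHerm_gradVec, hv]
  have oGX : wHerm n p (gradVec n p z) (reebDir n p z) = 0 := by
    rw [wHerm_gradVec, polyDiff_reebDir hp, hz.1, mul_zero]
  have hsum : ∀ (u : Amb n) (v : Fin (n - 1) → ℂ),
      wHerm n p u (∑ j, v j • e j) = ∑ j, v j * wHerm n p u (e j) := by
    intro u v
    let l : Amb n →ₗ[ℂ] ℂ :=
      { toFun := wHerm n p u
        map_add' := wHerm_add_right u
        map_smul' := fun c v => wHerm_smul_right u v c }
    change l (∑ j, v j • e j) = ∑ j, v j * l (e j)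
    simp [map_sum]
  let Λ : ((Fin (n - 1) → ℂ) × (ℂ × ℂ)) →ₗ[ℂ] Amb n :=
    { toFun := fun x => ∑ j, x.1 j • e j + x.2.1 • reebDir n p z + x.2.2 • gradVec n p z
      map_add' := by
        intro x y
        simp only [Prod.fst_add, Prod.snd_add, Pi.add_apply, add_smul, Finset.sum_add_distrib]
        abel
      map_smul' := by
        intro a x
        simp only [Prod.smul_fst, Prod.smul_snd, Pi.smul_apply, smul_eq_mul, RingHom.id_apply,
          smul_add, Finset.smul_sum, mul_smul] }
  have hΛ : ∀ v a b, Λ (v, a, b) = ∑ j, v j • e j + a • reebDir n p z + b • gradVec n p z :=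
    fun _ _ _ => rfl
  have kX : ∀ v a b, wHerm n p (reebDir n p z) (Λ (v, a, b)) =
      a * wHerm n p (reebDir n p z) (reebDir n p z) := by
    intro v a b
    rw [hΛ, wHerm_add_right, wHerm_add_right, wHerm_smul_right, wHerm_smul_right, hsum,
      flip _ _ oGX, Finset.sum_eq_zero fun j _ => by rw [oX _ (he2 j), mul_zero]]
    ring
  have kG : ∀ v a b, wHerm n p (gradVec n p z) (Λ (v, a, b)) =
      b * wHerm n p (gradVec n p z) (gradVec n p z) := by
    intro v a b
    rw [hΛ, wHerm_add_right, wHerm_add_right, wHerm_smul_right, wHerm_smul_right, hsum,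
      oGX, Finset.sum_eq_zero fun j _ => by rw [oG _ (he1 j), mul_zero]]
    ring
  have ke : ∀ v a b i, wHerm n p (e i) (Λ (v, a, b)) = v i := by
    intro v a b i
    rw [hΛ, wHerm_add_right, wHerm_add_right, wHerm_smul_right, wHerm_smul_right, hsum,
      flip _ _ (oX _ (he2 i)), flip _ _ (oG _ (he1 i))]
    simp [he3]
  have hinj : Function.Injective Λ := by
    rw [← LinearMap.ker_eq_bot, LinearMap.ker_eq_bot']
    rintro ⟨v, a, b⟩ h
    have h1 := kX v a b
    have h2 := kG v a b
    rw [h, wHerm_zero_right] at h1 h2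
    have h3 : v = 0 := by
      funext i
      have := ke v a b i
      rw [h, wHerm_zero_right] at this
      exact this.symm
    have h4 := (mul_eq_zero.1 h1.symm).resolve_right hX'
    have h5 := (mul_eq_zero.1 h2.symm).resolve_right hG'
    rw [h3, h4, h5]; rfl
  have hdim : finrank ℂ ((Fin (n - 1) → ℂ) × (ℂ × ℂ)) = finrank ℂ (Amb n) := by
    simp only [finrank_prod, finrank_fin_fun, finrank_self, finrank_euclideanSpace_fin]
    omega
  obtain ⟨⟨v, a, b⟩, h⟩ := (LinearMap.injective_iff_surjective_of_finrank_eq_finrank hdim).1 hinj c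
  have h1 := kX v a b
  have h2 := kG v a b
  rw [h, oX c hc2] at h1
  rw [h, oG c hc1] at h2
  have h4 := (mul_eq_zero.1 h1.symm).resolve_right hX'
  have h5 := (mul_eq_zero.1 h2.symm).resolve_right hG'
  refine ⟨v, ?_⟩
  rw [← h, hΛ, h4, h5]
  simp

/-- The symplectic trivialization of the contact plane given by a unitary frame of
`ker dP ∩ z^⊥`. -/
def frameMap (n p : ℕ) (ε : ℝ) (z : Amb n) (e : Fin (n - 1) → Amb n) :
    EuclideanSpace ℂ (Fin (n - 1)) →L[ℝ] Amb n :=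
  LinearMap.toContinuousLinearMap
    { toFun := fun v => √(perturbK n ε z) • fromHol n p z (∑ j, v j • e j)
      map_add' := by
        intro x y
        simp only [fromHol, PiLp.add_apply, add_smul, Finset.sum_add_distrib, map_add, add_div,
          smul_sub, smul_add]
        abel
      map_smul' := by
        intro c x
        have h : ∑ j, (c • x) j • e j = c • ∑ j, x j • e j := by
          rw [Finset.smul_sum]
          refine Finset.sum_congr rfl fun j _ => ?_
          have hj : (c • x) j = (c : ℂ) * x j := by simp
          rw [hj, mul_smul, real_smul_eq]
        rw [h, fromHol_smul, RingHom.id_apply, smul_smul, smul_smul, mul_comm] }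

lemma frameMap_apply (ε : ℝ) (z : Amb n) (e : Fin (n - 1) → Amb n)
    (v : EuclideanSpace ℂ (Fin (n - 1))) :
    frameMap n p ε z e v = √(perturbK n ε z) • fromHol n p z (∑ j, v j • e j) := rfl

lemma fromHol_mem (hp : 0 < p) {z c : Amb n} (hz : z ∈ brieskornSphere n p)
    (hc1 : polyDiff n p z c = 0) (hc2 : inner ℂ z c = 0) :
    fromHol n p z c ∈ brieskornTangent n p z ∧ wForm n p z (fromHol n p z c) = 0 := by
  refine ⟨mem_brieskornTangent.2 ⟨?_, ?_⟩, ?_⟩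
  · rw [fromHol, sub_eq_add_neg, ← neg_smul, real_smul_eq, polyDiff_add, polyDiff_smul,
      polyDiff_reebDir hp, hz.1, hc1]
    simp
  · rw [fromHol, inner_sub_right, real_smul_eq, inner_smul_right, hc2, inner_reebDir]
    simp
  · rw [fromHol, map_sub, map_smul, form_reebDir hp hz, smul_eq_mul]; ring

lemma sum_frame_mem {z : Amb n} {e : Fin (n - 1) → Amb n} (he1 : ∀ j, polyDiff n p z (e j) = 0)
    (he2 : ∀ j, inner ℂ z (e j) = 0) (v : Fin (n - 1) → ℂ) :
    polyDiff n p z (∑ j, v j • e j) = 0 ∧ inner ℂ z (∑ j, v j • e j) = 0 := by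
  constructor
  · let l : Amb n →ₗ[ℂ] ℂ :=
      { toFun := polyDiff n p z
        map_add' := polyDiff_add z
        map_smul' := fun c v => polyDiff_smul z v c }
    change l (∑ j, v j • e j) = 0
    rw [map_sum]
    refine Finset.sum_eq_zero fun j _ => ?_
    rw [map_smul]
    change v j • polyDiff n p z (e j) = 0
    rw [he1, smul_zero]
  · rw [inner_sum]
    exact Finset.sum_eq_zero fun j _ => by rw [inner_smul_right, he2, mul_zero]

lemma frameMap_spec (hn : 2 ≤ n) (hp : 0 < p) {ε : ℝ} {z : Amb n} (hz : z ∈ brieskornSphere n p)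
    (hK : 0 < perturbK n ε z) {e : Fin (n - 1) → Amb n} (he1 : ∀ j, polyDiff n p z (e j) = 0)
    (he2 : ∀ j, inner ℂ z (e j) = 0)
    (he3 : ∀ i j, wHerm n p (e i) (e j) = if i = j then 1 else 0) :
    Set.range (frameMap n p ε z e) =
        contactPlane (brieskornTangent n p) (perturbedForm n p ε) z ∧
      ∀ v w, dOneForm (perturbedForm n p ε) z (frameMap n p ε z e v) (frameMap n p ε z e w) =
        stdSymplectic v w := by
  have hs := Real.sqrt_pos.2 hK
  have hsmul : ∀ (a : ℝ) (d : Amb n), d ∈ brieskornTangent n p z → wForm n p z d = 0 →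
      a • d ∈ contactPlane (brieskornTangent n p) (perturbedForm n p ε) z := by
    intro a d hd hd0
    have h1 := mem_brieskornTangent.1 hd
    refine ⟨mem_brieskornTangent.2 ⟨?_, ?_⟩, (perturbedForm_eq_zero_iff hK.ne').2 ?_⟩
    · rw [real_smul_eq, polyDiff_smul, h1.1, mul_zero]
    · rw [real_smul_eq, inner_smul_right, Complex.re_ofReal_mul, h1.2, mul_zero]
    · rw [map_smul, hd0, smul_zero]
  have hmem : ∀ v, frameMap n p ε z e v ∈
      contactPlane (brieskornTangent n p) (perturbedForm n p ε) z := by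
    intro v
    obtain ⟨a, b⟩ := sum_frame_mem he1 he2 v
    obtain ⟨c, d⟩ := fromHol_mem hp hz a b
    exact hsmul _ _ c d
  refine ⟨Set.Subset.antisymm ?_ ?_, fun v w => ?_⟩
  · rintro _ ⟨v, rfl⟩; exact hmem v
  · intro d hd
    have h0 := (perturbedForm_eq_zero_iff hK.ne').1 hd.2
    have hT := mem_brieskornTangent.1 hd.1
    obtain ⟨v, hv⟩ := mem_span_frame hn hp hz he1 he2 he3 (polyDiff_toHol hp hz hT.1)
      (inner_toHol hp hz hT.2)
    refine ⟨WithLp.toLp 2 fun j => ((√(perturbK n ε z))⁻¹ : ℝ) * v j, ?_⟩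
    have h1 : ∑ j, (((√(perturbK n ε z))⁻¹ : ℝ) * v j) • e j =
        (√(perturbK n ε z))⁻¹ • toHol n p z d := by
      rw [← hv, real_smul_eq, Finset.smul_sum]
      simp only [mul_smul]
    rw [frameMap_apply]
    simp only [h1]
    rw [fromHol_smul, smul_inv_smul₀ hs.ne', fromHol, toHol_recover hp hz h0]
  · rw [dOneForm_contactPlane hK.ne' (hmem v) (hmem w), frameMap_apply, frameMap_apply, map_smul,
      map_smul, LinearMap.smul_apply, smul_eq_mul, smul_eq_mul, fromHol, fromHol]
    obtain ⟨-, b⟩ := sum_frame_mem he1 he2 v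
    obtain ⟨-, b'⟩ := sum_frame_mem he1 he2 w
    rw [wForm_reebDir_reebDir hp z _ _ _ _ (by rw [b]; rfl) (by rw [b']; rfl), ← mul_assoc,
      ← mul_assoc]
    have h3 : (perturbK n ε z)⁻¹ * √(perturbK n ε z) * √(perturbK n ε z) = 1 := by
      rw [mul_assoc, Real.mul_self_sqrt hK.le, inv_mul_cancel₀ hK.ne']
    rw [h3, one_mul, ← stdForm_apply, stdForm_eq_sum, wForm_apply, ← Complex.im_sum]
    congr 1
    let l : Amb n → Amb n →ₗ[ℂ] ℂ := fun u =>
      { toFun := wHerm n p u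
        map_add' := wHerm_add_right u
        map_smul' := fun c v => wHerm_smul_right u v c }
    have h4 : ∀ u, wHerm n p u (∑ j, w j • e j) = ∑ j, w j * wHerm n p u (e j) := by
      intro u
      change l u (∑ j, w j • e j) = ∑ j, w j * l u (e j)
      simp [map_sum]
    have h5 : ∀ j, wHerm n p (∑ i, v i • e i) (e j) = (starRingEnd ℂ) (v j) := by
      intro j
      rw [← wHerm_conj]
      congr 1
      change l (e j) (∑ i, v i • e i) = v j
      rw [map_sum]
      simp only [map_smul, smul_eq_mul]
      change ∑ i, v i * wHerm n p (e j) (e i) = v j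
      simp [he3]
    rw [h4]
    simp only [h5]
    exact Finset.sum_congr rfl fun j _ => mul_comm _ _

lemma flowMap_fromHol (hn : 2 ≤ n) (ε t : ℝ) (z c : Amb n) :
    flowMap n p ε t (fromHol n p z c) =
      fromHol n p (flowMap n p ε t z) (flowMap n p ε t c) := by
  rw [fromHol, fromHol, map_sub, real_smul_eq, map_smul, reebDir_flowMap hn, real_smul_eq,
    wForm_apply, wForm_apply, wHerm_flowMap hn]

lemma continuousOn_sum_frame {s : Set ℂ} {e : Fin (n - 1) → ℂ → Amb n}
    (hec : ∀ j, ContinuousOn (e j) s) (v : EuclideanSpace ℂ (Fin (n - 1))) :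
    ContinuousOn (fun ζ => ∑ j, v j • e j ζ) s := by
  refine continuousOn_finsetSum _ fun j _ => ?_
  exact ContinuousOn.fun_smul continuousOn_const (hec j)

lemma continuousOn_sqrt_perturbK {ε : ℝ} {s : Set ℂ} {u : ℂ → Amb n} (huc : ContinuousOn u s) :
    ContinuousOn (fun ζ => √(perturbK n ε (u ζ))) s :=
  (Real.continuous_sqrt.comp (contDiff_perturbK ε).continuous).comp_continuousOn huc

lemma continuousOn_fromHol {s : Set ℂ} {u e : ℂ → Amb n} (huc : ContinuousOn u s)
    (hec : ContinuousOn e s) : ContinuousOn (fun ζ => fromHol n p (u ζ) (e ζ)) s :=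
  continuous_fromHol.comp_continuousOn (huc.prodMk hec)

lemma continuousOn_frameMap {ε : ℝ} {s : Set ℂ} {u : ℂ → Amb n} (huc : ContinuousOn u s)
    {e : Fin (n - 1) → ℂ → Amb n} (hec : ∀ j, ContinuousOn (e j) s)
    (v : EuclideanSpace ℂ (Fin (n - 1))) :
    ContinuousOn (fun ζ => frameMap n p ε (u ζ) (fun j => e j ζ) v) s := by
  simp only [frameMap_apply]
  exact ContinuousOn.fun_smul (continuousOn_sqrt_perturbK huc)
    (continuousOn_fromHol huc (continuousOn_sum_frame hec v))

/-- The Conley–Zehnder index of a closed orbit that bounds a disc with a unitary frame of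
`ker dP ∩ u^⊥` whose vectors are eigenvectors of the linearized flow along the orbit. -/
theorem hasConleyZehnderIndex_of_frame {ε : ℝ} (hn : 2 ≤ n) (hp : 2 ≤ p) (h0 : 0 < ε) (h1 : ε < 1)
    {φ : ℝ → Amb n → Amb n} (hφ : IsPerturbedReebFlow n p ε φ) {z : Amb n}
    (hz : z ∈ brieskornSphere n p) {T : ℝ} (hT : 0 < T) {u : ℂ → Amb n}
    (huc : ContinuousOn u (Metric.closedBall 0 1))
    (huS : ∀ ζ ∈ Metric.closedBall (0 : ℂ) 1, u ζ ∈ brieskornSphere n p)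
    (hub : ∀ t, u (circlePt T t) = flowMap n p ε t z)
    {e : Fin (n - 1) → ℂ → Amb n} (hec : ∀ j, ContinuousOn (e j) (Metric.closedBall 0 1))
    (he1 : ∀ ζ ∈ Metric.closedBall (0 : ℂ) 1, ∀ j, polyDiff n p (u ζ) (e j ζ) = 0)
    (he2 : ∀ ζ ∈ Metric.closedBall (0 : ℂ) 1, ∀ j, inner ℂ (u ζ) (e j ζ) = 0)
    (he3 : ∀ ζ ∈ Metric.closedBall (0 : ℂ) 1, ∀ i j,
      wHerm n p (e i ζ) (e j ζ) = if i = j then 1 else 0)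
    {θ : Fin (n - 1) → ℝ} (hθ : ∀ j, θ j ≠ 0)
    (hflow : ∀ t j, flowMap n p ε t (e j 1) =
      Complex.exp ((θ j * t : ℝ) * Complex.I) • e j (circlePt T t)) :
    HasConleyZehnderIndex (n - 1) (brieskornSphere n p) (brieskornTangent n p)
      (perturbedForm n p ε) φ T z
      (∑ j, ((⌊θ j * T / (2 * Real.pi)⌋ : ℝ) + ⌈θ j * T / (2 * Real.pi)⌉)) := by
  have hp0 : 0 < p := by omega
  have hKpos : ∀ y ∈ brieskornSphere n p, 0 < perturbK n ε y := fun y hy =>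
    perturbK_pos hn h0 h1 (brieskornSphere_ne_zero hy)
  have hu1 : u 1 = z := by
    have := hub 0
    rwa [circlePt_zero, flowMap_zero] at this
  refine ⟨u, fun ζ => frameMap n p ε (u ζ) fun j => e j ζ, diagPath θ, huc, huS, ?_, ?_, ?_, ?_,
    diagPath θ, ?_, hasCrossingSum_diagPath hT hθ⟩
  · intro t
    rw [perturbedReebFlow_unique hn hp0 h0 h1 hφ hz]
    exact hub t
  · rw [continuousOn_clm_apply]
    intro v
    exact continuousOn_frameMap huc hec v
  · intro ζ hζ
    exact frameMap_spec hn hp0 (huS ζ hζ) (hKpos _ (huS ζ hζ)) (he1 ζ hζ) (he2 ζ hζ) (he3 ζ hζ)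
  · intro t _
    refine ⟨(flowMap n p ε t).restrictScalars ℝ,
      ((flowMap n p ε t).restrictScalars ℝ).hasFDerivAt.hasFDerivWithinAt.congr
      (fun y hy => perturbedReebFlow_unique hn (by omega) h0 h1 hφ hy t)
      (perturbedReebFlow_unique hn (by omega) h0 h1 hφ hz t), fun v => ?_⟩
    change frameMap n p ε (u (circlePt T t)) (fun j => e j (circlePt T t)) (diagPath θ t v) =
      flowMap n p ε t (frameMap n p ε (u 1) (fun j => e j 1) v)
    rw [frameMap_apply, frameMap_apply, hub, hu1, perturbK_flowMap hn, real_smul_eq (√_) (fromHol n p z _),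
      map_smul, flowMap_fromHol hn, real_smul_eq]
    congr 2
    rw [map_sum]
    refine Finset.sum_congr rfl fun j _ => ?_
    rw [map_smul, hflow, smul_smul, diagPath, diagMap_apply, mul_comm]
  · refine ⟨fun x => diagPath θ x.2, ?_, ?_, fun t _ => ⟨rfl, rfl⟩, fun s _ => ⟨rfl, rfl⟩⟩
    · have : Continuous (diagPath θ) := by
        unfold diagPath
        exact (diagMap (n - 1)).continuous.comp (continuous_pi fun j => by fun_prop)
      exact (this.comp continuous_snd).continuousOn
    · intro s _ t _
      exact preservesForm_diagPath θ t

end Frames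

/-! ### Hyperbolic coordinates adapted to a closed orbit -/

section Adapted

open Module

variable {m p : ℕ}

lemma inv_sqrt_two_mul_self : (((√2)⁻¹ : ℝ) : ℂ) * (((√2)⁻¹ : ℝ) : ℂ) = 1 / 2 := by
  have : (√2)⁻¹ * (√2)⁻¹ = (1 / 2 : ℝ) := by
    rw [← mul_inv, Real.mul_self_sqrt (by norm_num)]; norm_num
  have h : (((√2)⁻¹ * (√2)⁻¹ : ℝ) : ℂ) = ((1 / 2 : ℝ) : ℂ) := by rw [this]
  push_cast at h ⊢
  exact h

/-- The orthonormal coordinates of the vector with coordinates `y₀, y₁, y₂, y₃, y`, in which the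
quadratic form `∑ xⱼ²` is `2 y₀ y₁ + 2 y₂ y₃ + ∑ yₖ²`. -/
def hypCoord (y₀ y₁ y₂ y₃ : ℂ) (y : Fin m → ℂ) : Fin (m + 4) → ℂ :=
  Fin.cons (((√2)⁻¹ : ℝ) * (y₀ + y₁)) (Fin.cons (-Complex.I * ((√2)⁻¹ : ℝ) * (y₀ - y₁))
    (Fin.cons (((√2)⁻¹ : ℝ) * (y₂ + y₃)) (Fin.cons (-Complex.I * ((√2)⁻¹ : ℝ) * (y₂ - y₃)) y)))

lemma sum_fin_add_four (F : Fin (m + 4) → ℂ) :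
    ∑ j, F j = F 0 + F 1 + F 2 + F 3 + ∑ j : Fin m, F j.succ.succ.succ.succ := by
  rw [Fin.sum_univ_succ, Fin.sum_univ_succ, Fin.sum_univ_succ, Fin.sum_univ_succ]
  simp only [add_assoc]
  rfl

lemma hypCoord_zero (y₀ y₁ y₂ y₃ : ℂ) (y : Fin m → ℂ) :
    hypCoord y₀ y₁ y₂ y₃ y 0 = ((√2)⁻¹ : ℝ) * (y₀ + y₁) := rfl
lemma hypCoord_one (y₀ y₁ y₂ y₃ : ℂ) (y : Fin m → ℂ) :
    hypCoord y₀ y₁ y₂ y₃ y 1 = -Complex.I * ((√2)⁻¹ : ℝ) * (y₀ - y₁) := rfl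
lemma hypCoord_two (y₀ y₁ y₂ y₃ : ℂ) (y : Fin m → ℂ) :
    hypCoord y₀ y₁ y₂ y₃ y 2 = ((√2)⁻¹ : ℝ) * (y₂ + y₃) := rfl
lemma hypCoord_three (y₀ y₁ y₂ y₃ : ℂ) (y : Fin m → ℂ) :
    hypCoord y₀ y₁ y₂ y₃ y 3 = -Complex.I * ((√2)⁻¹ : ℝ) * (y₂ - y₃) := rfl
lemma hypCoord_succ (y₀ y₁ y₂ y₃ : ℂ) (y : Fin m → ℂ) (j : Fin m) :
    hypCoord y₀ y₁ y₂ y₃ y j.succ.succ.succ.succ = y j := rfl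

lemma hypCoord_mul (y₀ y₁ y₂ y₃ x₀ x₁ x₂ x₃ : ℂ) (y x : Fin m → ℂ) :
    ∑ j, hypCoord y₀ y₁ y₂ y₃ y j * hypCoord x₀ x₁ x₂ x₃ x j =
      y₀ * x₁ + y₁ * x₀ + y₂ * x₃ + y₃ * x₂ + ∑ j, y j * x j := by
  rw [sum_fin_add_four]
  simp only [hypCoord_zero, hypCoord_one, hypCoord_two, hypCoord_three, hypCoord_succ]
  linear_combination (2 * (y₀ * x₁ + y₁ * x₀ + y₂ * x₃ + y₃ * x₂)) * inv_sqrt_two_mul_self +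
    ((((√2)⁻¹ : ℝ) : ℂ) * (((√2)⁻¹ : ℝ) : ℂ) * ((y₀ - y₁) * (x₀ - x₁) + (y₂ - y₃) * (x₂ - x₃))) *
      Complex.I_mul_I

lemma conj_hypCoord_mul (y₀ y₁ y₂ y₃ x₀ x₁ x₂ x₃ : ℂ) (y x : Fin m → ℂ) :
    ∑ j, (starRingEnd ℂ) (hypCoord y₀ y₁ y₂ y₃ y j) * hypCoord x₀ x₁ x₂ x₃ x j =
      (starRingEnd ℂ) y₀ * x₀ + (starRingEnd ℂ) y₁ * x₁ + (starRingEnd ℂ) y₂ * x₂ +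
        (starRingEnd ℂ) y₃ * x₃ + ∑ j, (starRingEnd ℂ) (y j) * x j := by
  rw [sum_fin_add_four]
  simp only [hypCoord_zero, hypCoord_one, hypCoord_two, hypCoord_three, hypCoord_succ, map_mul,
    map_add, map_sub, map_neg, Complex.conj_I, Complex.conj_ofReal]
  linear_combination (2 * ((starRingEnd ℂ) y₀ * x₀ + (starRingEnd ℂ) y₁ * x₁ +
    (starRingEnd ℂ) y₂ * x₂ + (starRingEnd ℂ) y₃ * x₃)) * inv_sqrt_two_mul_self -
    ((((√2)⁻¹ : ℝ) : ℂ) * (((√2)⁻¹ : ℝ) : ℂ) *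
      (((starRingEnd ℂ) y₀ - (starRingEnd ℂ) y₁) * (x₀ - x₁) +
      ((starRingEnd ℂ) y₂ - (starRingEnd ℂ) y₃) * (x₂ - x₃))) * Complex.I_mul_I

/-- Orthonormal bases of `ℝⁿ`, `n = m + 4`. -/
abbrev RealBasis (m : ℕ) := OrthonormalBasis (Fin (m + 4)) ℝ (EuclideanSpace ℝ (Fin (m + 4)))

lemma RealBasis.sum_mul (b : RealBasis m) (i j : Fin (m + 4)) :
    ∑ k, ((b i k : ℝ) : ℂ) * ((b j k : ℝ) : ℂ) = if i = j then 1 else 0 := by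
  have h := orthonormal_iff_ite.1 b.orthonormal i j
  rw [PiLp.inner_apply] at h
  have h2 : ∑ k, b i k * b j k = if i = j then 1 else 0 := by
    rw [← h]
    refine Finset.sum_congr rfl fun k _ => ?_
    simp [mul_comm]
  have h3 : ((∑ k, b i k * b j k : ℝ) : ℂ) = ((if i = j then 1 else 0 : ℝ) : ℂ) := by rw [h2]
  push_cast at h3
  rw [h3]
  split_ifs <;> simp

lemma RealBasis.sum_sum_mul (b : RealBasis m) (f g : Fin (m + 4) → ℂ) :
    ∑ k, (∑ i, f i * (b i k : ℝ)) * (∑ j, g j * (b j k : ℝ)) = ∑ i, f i * g i := by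
  simp only [Finset.sum_mul_sum]
  rw [Finset.sum_comm]
  refine Finset.sum_congr rfl fun i _ => ?_
  rw [Finset.sum_comm]
  have : ∀ j, ∑ k, f i * ((b i k : ℝ) : ℂ) * (g j * ((b j k : ℝ) : ℂ)) =
      f i * g j * if i = j then 1 else 0 := by
    intro j
    rw [← b.sum_mul i j, Finset.mul_sum]
    exact Finset.sum_congr rfl fun k _ => by ring
  simp [this]

/-- The vector of `ℂⁿ⁺¹` with the given hyperbolic coordinates, in the orthonormal basis `b` of
`ℝⁿ`, and last coordinate `w`. -/
def adaptVec (b : RealBasis m) (y₀ y₁ y₂ y₃ : ℂ) (y : Fin m → ℂ) (w : ℂ) : Amb (m + 4) :=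
  WithLp.toLp 2 (Fin.snoc (α := fun _ => ℂ)
    (fun k => ∑ j, hypCoord y₀ y₁ y₂ y₃ y j * (b j k : ℝ)) w)

lemma adaptVec_last (b : RealBasis m) (y₀ y₁ y₂ y₃ : ℂ) (y : Fin m → ℂ) (w : ℂ) :
    adaptVec b y₀ y₁ y₂ y₃ y w (Fin.last _) = w := by
  simp [adaptVec]

lemma adaptVec_castSucc (b : RealBasis m) (y₀ y₁ y₂ y₃ : ℂ) (y : Fin m → ℂ) (w : ℂ)
    (k : Fin (m + 4)) : adaptVec b y₀ y₁ y₂ y₃ y w k.castSucc =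
      ∑ j, hypCoord y₀ y₁ y₂ y₃ y j * (b j k : ℝ) := by
  simp [adaptVec]

lemma brieskornPoly_adaptVec (b : RealBasis m) (y₀ y₁ y₂ y₃ : ℂ) (y : Fin m → ℂ) (w : ℂ) :
    brieskornPoly (m + 4) p (adaptVec b y₀ y₁ y₂ y₃ y w) =
      2 * (y₀ * y₁ + y₂ * y₃) + ∑ j, y j * y j + w ^ p := by
  rw [brieskornPoly, Fin.sum_univ_castSucc]
  simp only [brieskornExp_castSucc, brieskornExp_last, adaptVec_castSucc, adaptVec_last, sq]
  rw [b.sum_sum_mul, hypCoord_mul]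
  ring

lemma polyDiff_adaptVec (b : RealBasis m) (y₀ y₁ y₂ y₃ x₀ x₁ x₂ x₃ : ℂ) (y x : Fin m → ℂ)
    (w v : ℂ) : polyDiff (m + 4) p (adaptVec b y₀ y₁ y₂ y₃ y w) (adaptVec b x₀ x₁ x₂ x₃ x v) =
      2 * (y₀ * x₁ + y₁ * x₀ + y₂ * x₃ + y₃ * x₂ + ∑ j, y j * x j) + p * w ^ (p - 1) * v := by
  rw [polyDiff, Fin.sum_univ_castSucc]
  simp only [brieskornExp_castSucc, brieskornExp_last, adaptVec_castSucc, adaptVec_last]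
  rw [← (b.sum_sum_mul (hypCoord y₀ y₁ y₂ y₃ y) (hypCoord x₀ x₁ x₂ x₃ x)).trans
    (hypCoord_mul ..), Finset.mul_sum]
  congr 1
  refine Finset.sum_congr rfl fun k _ => ?_
  norm_num
  ring

lemma conj_sum_mul_real (b : RealBasis m) (f : Fin (m + 4) → ℂ) (k : Fin (m + 4)) :
    (starRingEnd ℂ) (∑ j, f j * (b j k : ℝ)) = ∑ j, (starRingEnd ℂ) (f j) * (b j k : ℝ) := by
  rw [map_sum]
  simp

lemma inner_adaptVec (b : RealBasis m) (y₀ y₁ y₂ y₃ x₀ x₁ x₂ x₃ : ℂ) (y x : Fin m → ℂ)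
    (w v : ℂ) : inner ℂ (adaptVec b y₀ y₁ y₂ y₃ y w) (adaptVec b x₀ x₁ x₂ x₃ x v) =
      (starRingEnd ℂ) y₀ * x₀ + (starRingEnd ℂ) y₁ * x₁ + (starRingEnd ℂ) y₂ * x₂ +
        (starRingEnd ℂ) y₃ * x₃ + ∑ j, (starRingEnd ℂ) (y j) * x j + (starRingEnd ℂ) w * v := by
  rw [inner_eq_sum, Fin.sum_univ_castSucc]
  simp only [adaptVec_castSucc, adaptVec_last, conj_sum_mul_real]
  rw [← conj_hypCoord_mul, b.sum_sum_mul]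

lemma wHerm_adaptVec (b : RealBasis m) (y₀ y₁ y₂ y₃ x₀ x₁ x₂ x₃ : ℂ) (y x : Fin m → ℂ)
    (w v : ℂ) : wHerm (m + 4) p (adaptVec b y₀ y₁ y₂ y₃ y w) (adaptVec b x₀ x₁ x₂ x₃ x v) =
      (starRingEnd ℂ) y₀ * x₀ + (starRingEnd ℂ) y₁ * x₁ + (starRingEnd ℂ) y₂ * x₂ +
        (starRingEnd ℂ) y₃ * x₃ + ∑ j, (starRingEnd ℂ) (y j) * x j +
        p / 2 * ((starRingEnd ℂ) w * v) := by
  rw [wHerm, Fin.sum_univ_castSucc]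
  simp only [brieskornExp_castSucc, brieskornExp_last, adaptVec_castSucc, adaptVec_last,
    conj_sum_mul_real]
  rw [← (b.sum_sum_mul (fun j => (starRingEnd ℂ) (hypCoord y₀ y₁ y₂ y₃ y j))
    (hypCoord x₀ x₁ x₂ x₃ x)).trans (conj_hypCoord_mul ..)]
  congr 1
  refine Finset.sum_congr rfl fun k _ => ?_
  norm_num

lemma smul_adaptVec (b : RealBasis m) (c y₀ y₁ y₂ y₃ : ℂ) (y : Fin m → ℂ) (w : ℂ) :
    c • adaptVec b y₀ y₁ y₂ y₃ y w =
      adaptVec b (c * y₀) (c * y₁) (c * y₂) (c * y₃) (fun k => c * y k) (c * w) := by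
  have h : ∀ j, hypCoord (c * y₀) (c * y₁) (c * y₂) (c * y₃) (fun k => c * y k) j =
      c * hypCoord y₀ y₁ y₂ y₃ y j := by
    refine Fin.cases ?_ (Fin.cases ?_ (Fin.cases ?_ (Fin.cases ?_ fun j => rfl)))
    · change _ * (_ + _) = _ * (_ * (_ + _)); ring
    · change _ * (_ - _) = _ * (_ * (_ - _)); ring
    · change _ * (_ + _) = _ * (_ * (_ + _)); ring
    · change _ * (_ - _) = _ * (_ * (_ - _)); ring
  ext k
  refine Fin.lastCases ?_ (fun k => ?_) k
  · simp [adaptVec_last]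
  · rw [PiLp.smul_apply, adaptVec_castSucc, adaptVec_castSucc, smul_eq_mul, Finset.mul_sum]
    refine Finset.sum_congr rfl fun j _ => ?_
    rw [h]; ring

lemma continuousOn_adaptVec (b : RealBasis m) {s : Set ℂ} {y₀ y₁ y₂ y₃ w : ℂ → ℂ}
    (h₀ : ContinuousOn y₀ s) (h₁ : ContinuousOn y₁ s) (h₂ : ContinuousOn y₂ s)
    (h₃ : ContinuousOn y₃ s) (hw : ContinuousOn w s) (y : Fin m → ℂ) :
    ContinuousOn (fun ζ => adaptVec b (y₀ ζ) (y₁ ζ) (y₂ ζ) (y₃ ζ) y (w ζ)) s := by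
  refine (PiLp.continuous_toLp 2 _).comp_continuousOn (continuousOn_pi.2 fun k => ?_)
  refine Fin.lastCases ?_ (fun k => ?_) k
  · simpa using hw
  · simp only [Fin.snoc_castSucc]
    refine continuousOn_finsetSum _ fun j _ => ContinuousOn.mul ?_ continuousOn_const
    refine Fin.cases ?_ (Fin.cases ?_ (Fin.cases ?_ (Fin.cases ?_ fun j => ?_))) j
    · exact continuousOn_const.mul (h₀.add h₁)
    · exact continuousOn_const.mul (h₀.sub h₁)
    · exact continuousOn_const.mul (h₂.add h₃)
    · exact continuousOn_const.mul (h₂.sub h₃)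
    · exact continuousOn_const

/-- The unit complex number `exp (i κ t)`. -/
def phase (κ t : ℝ) : ℂ := Complex.exp ((κ * t : ℝ) * Complex.I)

lemma phase_add (κ κ' t : ℝ) : phase (κ + κ') t = phase κ t * phase κ' t := by
  rw [phase, phase, phase, ← Complex.exp_add]; congr 1; push_cast; ring

lemma phase_pow (κ t : ℝ) (k : ℕ) : phase κ t ^ k = phase (k * κ) t := by
  rw [phase, phase, ← Complex.exp_nat_mul]; congr 1; push_cast; ring

lemma norm_phase (κ t : ℝ) : ‖phase κ t‖ = 1 := Complex.norm_exp_ofReal_mul_I _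

lemma conj_phase (κ t : ℝ) : (starRingEnd ℂ) (phase κ t) = phase (-κ) t := by
  rw [phase, phase, ← Complex.exp_conj]; congr 1; simp

lemma circlePt_pow {T : ℝ} (hT : T ≠ 0) {κ : ℝ} {N : ℕ} (h : κ * T = 2 * Real.pi * N) (t : ℝ) :
    circlePt T t ^ N = phase κ t := by
  rw [circlePt, ← Complex.exp_nat_mul, phase]
  congr 1
  have hT' : (T : ℂ) ≠ 0 := by exact_mod_cast hT
  have h' : (κ : ℂ) * T = 2 * Real.pi * N := by exact_mod_cast h
  push_cast
  rw [show ((κ : ℂ) * t * Complex.I) = (κ * T) * (t / T) * Complex.I by field_simp, h']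
  ring

end Adapted

/-! ### The Reeb flow in adapted coordinates -/

section AdaptedFlow

open Module

variable {m p : ℕ}

/-- The Reeb flow acts on the hyperbolic coordinates attached to `b` by rotations with the angular
velocities `κ₀, κ₁, κ₂, κ₃` on the first four, `2` on the following and `4 / p` on the last one. -/
def FlowDiag (p : ℕ) (ε : ℝ) (b : RealBasis m) (κ₀ κ₁ κ₂ κ₃ : ℝ) : Prop :=
  ∀ (t : ℝ) (y₀ y₁ y₂ y₃ : ℂ) (y : Fin m → ℂ) (w : ℂ),
    flowMap (m + 4) p ε t (adaptVec b y₀ y₁ y₂ y₃ y w) =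
      adaptVec b (phase κ₀ t * y₀) (phase κ₁ t * y₁) (phase κ₂ t * y₂) (phase κ₃ t * y₃)
        (fun k => phase 2 t * y k) (phase (4 / p) t * w)

lemma flowPhase_castSucc (t : ℝ) (k : Fin (m + 4)) :
    flowPhase (m + 4) p t k.castSucc = phase 2 t := by
  rw [flowPhase, brieskornExp_castSucc, phase]; norm_num

lemma flowPhase_last (t : ℝ) : flowPhase (m + 4) p t (Fin.last _) = phase (4 / p) t := by
  rw [flowPhase, brieskornExp_last, phase]

lemma apply_of_single {b : RealBasis m} {a k : Fin (m + 4)} {σ : ℝ} (hσ : σ * σ = 1)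
    (h : b a = EuclideanSpace.single k σ) (j : Fin (m + 4)) : b j k = if a = j then σ else 0 := by
  have h2 := orthonormal_iff_ite.1 b.orthonormal a j
  rw [h, EuclideanSpace.inner_single_left] at h2
  simp only [conj_trivial] at h2
  have h3 : σ * (σ * b j k) = b j k := by rw [← mul_assoc, hσ, one_mul]
  rw [← h3, h2]
  split_ifs <;> simp

/-- The flow, when the pair `a, a'` of basis vectors spans the plane that the perturbation
rotates. -/
lemma flowMap_apply_of_pair {b : RealBasis m} {a a' : Fin (m + 4)} {σ : ℝ} (hσ : σ * σ = 1)
    (ha : b a = EuclideanSpace.single 0 1) (ha' : b a' = EuclideanSpace.single 1 σ) (ε t : ℝ)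
    {y₀ y₁ y₂ y₃ x₀ x₁ x₂ x₃ : ℂ} {y x : Fin m → ℂ} {w : ℂ}
    (h₀ : hypCoord x₀ x₁ x₂ x₃ x a = phase 2 t * (Real.cos (2 * ε * t) * hypCoord y₀ y₁ y₂ y₃ y a -
      σ * Real.sin (2 * ε * t) * hypCoord y₀ y₁ y₂ y₃ y a'))
    (h₁ : hypCoord x₀ x₁ x₂ x₃ x a' = phase 2 t * (σ * Real.sin (2 * ε * t) *
      hypCoord y₀ y₁ y₂ y₃ y a + Real.cos (2 * ε * t) * hypCoord y₀ y₁ y₂ y₃ y a'))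
    (h₂ : ∀ j, j ≠ a → j ≠ a' → hypCoord x₀ x₁ x₂ x₃ x j = phase 2 t * hypCoord y₀ y₁ y₂ y₃ y j) :
    flowMap (m + 4) p ε t (adaptVec b y₀ y₁ y₂ y₃ y w) =
      adaptVec b x₀ x₁ x₂ x₃ x (phase (4 / p) t * w) := by
  have e0 : ∀ f : Fin (m + 4) → ℂ, ∑ j, f j * ((b j 0 : ℝ) : ℂ) = f a := by
    intro f
    simp only [apply_of_single (one_mul 1) ha]
    rw [Finset.sum_eq_single a] <;> simp +contextual [eq_comm]
  have e1 : ∀ f : Fin (m + 4) → ℂ, ∑ j, f j * ((b j 1 : ℝ) : ℂ) = σ * f a' := by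
    intro f
    simp only [apply_of_single hσ ha']
    rw [Finset.sum_eq_single a'] <;> simp +contextual [eq_comm, mul_comm]
  have hσ' : (σ : ℂ) * σ = 1 := by exact_mod_cast hσ
  ext k
  rw [flowMap_apply]
  refine Fin.lastCases ?_ (fun k => ?_) k
  · rw [if_neg (fin_zero_ne_last (by omega)).symm, if_neg (fin_one_ne_last (by omega)).symm,
      adaptVec_last, adaptVec_last, flowPhase_last]
  · have c0 : adaptVec b y₀ y₁ y₂ y₃ y w 0 = hypCoord y₀ y₁ y₂ y₃ y a :=
      (adaptVec_castSucc b y₀ y₁ y₂ y₃ y w 0).trans (e0 _)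
    have c1 : adaptVec b y₀ y₁ y₂ y₃ y w 1 = σ * hypCoord y₀ y₁ y₂ y₃ y a' :=
      (adaptVec_castSucc b y₀ y₁ y₂ y₃ y w 1).trans (e1 _)
    rw [flowPhase_castSucc, adaptVec_castSucc, adaptVec_castSucc, c0, c1]
    by_cases hk0 : k = 0
    · rw [if_pos (by rw [hk0]; rfl), hk0, e0, h₀]; ring
    have n0 : k.castSucc ≠ (0 : Fin (m + 4 + 1)) := fun h => hk0 (Fin.castSucc_injective _ h)
    rw [if_neg n0]
    by_cases hk1 : k = 1
    · rw [if_pos (by rw [hk1]; rfl), hk1, e1, h₁]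
      linear_combination (-phase 2 t * Real.sin (2 * ε * t) * hypCoord y₀ y₁ y₂ y₃ y a) * hσ'
    have n1 : k.castSucc ≠ (1 : Fin (m + 4 + 1)) := fun h => hk1 (Fin.castSucc_injective _ h)
    rw [if_neg n1, Finset.mul_sum]
    refine Finset.sum_congr rfl fun j _ => ?_
    by_cases hj : j = a
    · have : b j k = 0 := by rw [hj, ha]; simp [hk0]
      rw [this]; simp
    by_cases hj' : j = a'
    · have : b j k = 0 := by rw [hj', ha']; simp [hk1]
      rw [this]; simp
    rw [h₂ j hj hj']; ring

lemma phase_eq (κ t : ℝ) :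
    phase κ t = Real.cos (κ * t) + Real.sin (κ * t) * Complex.I := by
  rw [phase, Complex.exp_mul_I, Complex.ofReal_cos, Complex.ofReal_sin]

lemma phase_two_add (δ t : ℝ) {σ : ℝ} (hσ : σ = 1 ∨ σ = -1) : phase (2 + σ * (2 * δ)) t =
    phase 2 t * (Real.cos (2 * δ * t) + σ * Real.sin (2 * δ * t) * Complex.I) := by
  rw [phase_add, phase_eq (σ * (2 * δ))]
  rcases hσ with rfl | rfl
  · simp
  · simp

lemma phase_two_sub (δ t : ℝ) {σ : ℝ} (hσ : σ = 1 ∨ σ = -1) : phase (2 - σ * (2 * δ)) t =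
    phase 2 t * (Real.cos (2 * δ * t) - σ * Real.sin (2 * δ * t) * Complex.I) := by
  have h : -σ = 1 ∨ -σ = -1 := by rcases hσ with rfl | rfl <;> simp
  have := phase_two_add δ t h
  rw [show 2 - σ * (2 * δ) = 2 + -σ * (2 * δ) by ring, this]
  push_cast
  ring

lemma flowDiag_of_first {b : RealBasis m} {σ : ℝ} (hσ : σ = 1 ∨ σ = -1)
    (h0 : b 0 = EuclideanSpace.single 0 1) (h1 : b 1 = EuclideanSpace.single 1 σ) (ε : ℝ) :
    FlowDiag p ε b (2 + σ * (2 * ε)) (2 - σ * (2 * ε)) 2 2 := by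
  intro t y₀ y₁ y₂ y₃ y w
  have hσ2 : σ * σ = 1 := by rcases hσ with rfl | rfl <;> norm_num
  refine flowMap_apply_of_pair hσ2 h0 h1 ε t ?_ ?_ ?_
  · rw [hypCoord_zero, hypCoord_zero, hypCoord_one, phase_two_add _ _ hσ, phase_two_sub _ _ hσ]
    ring
  · rw [hypCoord_zero, hypCoord_one, hypCoord_one, phase_two_add _ _ hσ, phase_two_sub _ _ hσ]
    linear_combination (-phase 2 t * ((√2)⁻¹ : ℝ) * σ * Real.sin (2 * ε * t) * (y₀ + y₁)) *
      Complex.I_mul_I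
  · refine Fin.cases (fun h => absurd rfl h) (Fin.cases (fun _ h => absurd rfl h)
      (Fin.cases (fun _ _ => ?_) (Fin.cases (fun _ _ => ?_) fun j _ _ => rfl)))
    · change _ * (_ + _) = _ * (_ * (_ + _)); ring
    · change _ * (_ - _) = _ * (_ * (_ - _)); ring

lemma flowDiag_of_second {b : RealBasis m}
    (h0 : b 2 = EuclideanSpace.single 0 1) (h1 : b 3 = EuclideanSpace.single 1 1) (ε : ℝ) :
    FlowDiag p ε b 2 2 (2 + 2 * ε) (2 - 2 * ε) := by
  intro t y₀ y₁ y₂ y₃ y w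
  have e1 := phase_two_add ε t (Or.inl rfl : (1 : ℝ) = 1 ∨ (1 : ℝ) = -1)
  have e2 := phase_two_sub ε t (Or.inl rfl : (1 : ℝ) = 1 ∨ (1 : ℝ) = -1)
  rw [one_mul, Complex.ofReal_one, one_mul] at e1 e2
  refine flowMap_apply_of_pair (one_mul 1) h0 h1 ε t ?_ ?_ ?_
  · rw [hypCoord_two, hypCoord_two, hypCoord_three, e1, e2]
    rw [Complex.ofReal_one]
    ring
  · rw [hypCoord_two, hypCoord_three, hypCoord_three, e1, e2]
    rw [Complex.ofReal_one]
    linear_combination (-phase 2 t * ((√2)⁻¹ : ℝ) * Real.sin (2 * ε * t) * (y₂ + y₃)) *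
      Complex.I_mul_I
  · refine Fin.cases (fun _ _ => ?_) (Fin.cases (fun _ _ => ?_)
      (Fin.cases (fun h => absurd rfl h) (Fin.cases (fun _ h => absurd rfl h) fun j _ _ => rfl)))
    · change _ * (_ + _) = _ * (_ * (_ + _)); ring
    · change _ * (_ - _) = _ * (_ * (_ - _)); ring

lemma exists_realBasis {s : Set (Fin (m + 4))} {v : Fin (m + 4) → EuclideanSpace ℝ (Fin (m + 4))}
    (h : Orthonormal ℝ (s.domRestrict v)) : ∃ b : RealBasis m, ∀ j ∈ s, b j = v j :=
  h.exists_orthonormalBasis_extension_of_card_eq (by simp)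

end AdaptedFlow

/-! ### Spanning discs -/

section Discs

open Complex (normSq)

local notation "cj" => starRingEnd ℂ

/-- The first component of a vector that is tangent to the curve `2 A B + b ^ p = 0` and orthogonal
to its position vector. -/
def crossA (p : ℕ) (A B b : ℂ) : ℂ := 2 * A * cj b - p * b ^ (p - 1) * cj B

/-- The second component of that vector. -/
def crossB (p : ℕ) (A B b : ℂ) : ℂ := p * b ^ (p - 1) * cj A - 2 * B * cj b

/-- The third component of that vector. -/
def crossC (A B : ℂ) : ℂ := 2 * (B * cj B - A * cj A)

/-- The square of the length of that vector. -/
def crossSq (p : ℕ) (A B b : ℂ) : ℝ :=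
  normSq (crossA p A B b) + normSq (crossB p A B b) + p / 2 * normSq (crossC A B)

variable {p : ℕ} {A B b : ℂ}

lemma cross_tangent : A * crossB p A B b + B * crossA p A B b + p / 2 * b ^ (p - 1) * crossC A B = 0 := by
  rw [crossA, crossB, crossC]; ring

lemma cross_orthogonal : cj A * crossA p A B b + cj B * crossB p A B b + cj b * crossC A B = 0 := by
  rw [crossA, crossB, crossC]; ring

lemma crossSq_pos (hp : 2 ≤ p) (hA : A ≠ 0) (h : 2 * A * B + b ^ p = 0) : 0 < crossSq p A B b := by
  have hp' : (0 : ℝ) < p := by exact_mod_cast (by omega : 0 < p)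
  have n1 := Complex.normSq_nonneg (crossA p A B b)
  have n2 := Complex.normSq_nonneg (crossB p A B b)
  have n3 := Complex.normSq_nonneg (crossC A B)
  by_contra hle
  have hle : crossSq p A B b ≤ 0 := not_lt.1 hle
  have n3' : (0 : ℝ) ≤ p / 2 * normSq (crossC A B) := by positivity
  rw [crossSq] at hle
  have e2 : crossB p A B b = 0 := Complex.normSq_eq_zero.1 (by linarith)
  have e3' : p / 2 * normSq (crossC A B) = 0 := by linarith
  have e3 : crossC A B = 0 := Complex.normSq_eq_zero.1 (by
    rcases mul_eq_zero.1 e3' with h | h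
    · linarith
    · exact h)
  have hAB : A * cj A = B * cj B := by
    rw [crossC] at e3; linear_combination (-1 / 2) * e3
  have hbp : b ^ p = b ^ (p - 1) * b := by rw [← pow_succ]; congr 1; omega
  have h5 : B * (p * (A * cj A) + b * cj b) = 0 := by
    rw [crossB] at e2
    rw [hbp] at h
    linear_combination (-1 / 2) * b * e2 + (p / 2) * cj A * h
  have hB : B = 0 := by
    refine (mul_eq_zero.1 h5).resolve_right fun h6 => ?_
    rw [Complex.mul_conj, Complex.mul_conj] at h6
    have h7 : (p : ℝ) * normSq A + normSq b = 0 := by exact_mod_cast h6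
    have := Complex.normSq_pos.2 hA
    have := Complex.normSq_nonneg b
    have : 0 < (p : ℝ) * normSq A := by positivity
    linarith
  rw [hB, zero_mul, Complex.mul_conj] at hAB
  exact hA (Complex.normSq_eq_zero.1 (by exact_mod_cast hAB))

/-- A disc in the surface `2 A B + b ^ p = 0`, `|A|² + |B|² + |b|² = 1` which is invariant under
the circle action with the weights `0, p, 1`, and whose boundary passes through the point
`(A₀, B₀, b₀)`. -/
lemma exists_equivariantDisc {A₀ B₀ b₀ : ℂ} (h1 : 2 * A₀ * B₀ + b₀ ^ p = 0)
    (h2 : normSq A₀ + normSq B₀ + normSq b₀ = 1) (hAB : normSq B₀ ≤ normSq A₀) :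
    ∃ A B : ℂ → ℂ, ContinuousOn A (Metric.closedBall 0 1) ∧
      ContinuousOn B (Metric.closedBall 0 1) ∧
      (∀ w ∈ Metric.closedBall (0 : ℂ) 1, A w ≠ 0 ∧ 2 * A w * B w + (w * b₀) ^ p = 0 ∧
        normSq (A w) + normSq (B w) + normSq (w * b₀) = 1) ∧
      ∀ w, ‖w‖ = 1 → A w = A₀ ∧ B w = w ^ p * B₀ := by
  have hA₀ : A₀ ≠ 0 := by
    rintro rfl
    have hB : B₀ = 0 := Complex.normSq_eq_zero.1
      (le_antisymm (by simpa using hAB) (Complex.normSq_nonneg _))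
    rw [mul_zero, zero_mul, zero_add] at h1
    have hb := eq_zero_of_pow_eq_zero h1
    rw [hB, hb] at h2
    simp at h2
  have hA₀n := Complex.normSq_pos.2 hA₀
  have h4 : normSq b₀ ^ p = 4 * normSq A₀ * normSq B₀ := by
    have : b₀ ^ p = -(2 * A₀ * B₀) := by linear_combination h1
    rw [← map_pow, this, Complex.normSq_neg, map_mul, map_mul]
    norm_num [Complex.normSq_apply]
  obtain ⟨S, hS⟩ : ∃ S : ℂ → ℝ, S = fun w => 1 - normSq (w * b₀) := ⟨_, rfl⟩
  obtain ⟨D, hD⟩ : ∃ D : ℂ → ℝ, D = fun w => S w ^ 2 - normSq (w * b₀) ^ p := ⟨_, rfl⟩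
  -- `|A|²` is the larger root of `4 Q² - 4 S Q + |w b₀| ^ (2 p) = 0`, which stays positive up to the
  -- centre of the disc.
  obtain ⟨Q, hQ⟩ : ∃ Q : ℂ → ℝ, Q = fun w => (S w + √(D w)) / 2 := ⟨_, rfl⟩
  have hnc : Continuous fun w => normSq (w * b₀) := Complex.continuous_normSq.comp (by fun_prop)
  have hSc : Continuous S := by rw [hS]; fun_prop
  have hDc : Continuous D := by rw [hD]; fun_prop
  have hQc : Continuous Q := by rw [hQ]; fun_prop
  have hle : ∀ w ∈ Metric.closedBall (0 : ℂ) 1, normSq (w * b₀) ≤ normSq b₀ := by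
    intro w hw
    rw [mem_closedBall_zero_iff] at hw
    rw [map_mul, Complex.normSq_eq_norm_sq w]
    have : ‖w‖ ^ 2 ≤ 1 := pow_le_one₀ (norm_nonneg _) hw
    nlinarith [Complex.normSq_nonneg b₀]
  have hSpos : ∀ w ∈ Metric.closedBall (0 : ℂ) 1, normSq A₀ + normSq B₀ ≤ S w := by
    intro w hw
    have := hle w hw
    rw [hS]; simp only; linarith
  have hDnn : ∀ w ∈ Metric.closedBall (0 : ℂ) 1, 0 ≤ D w := by
    intro w hw
    have i1 : normSq (w * b₀) ^ p ≤ normSq b₀ ^ p :=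
      pow_le_pow_left₀ (Complex.normSq_nonneg _) (hle w hw) p
    have i2 := hSpos w hw
    have : (normSq A₀ + normSq B₀) ^ 2 ≤ S w ^ 2 :=
      pow_le_pow_left₀ (add_nonneg (Complex.normSq_nonneg _) (Complex.normSq_nonneg _)) i2 2
    rw [hD]; simp only
    nlinarith [sq_nonneg (normSq A₀ - normSq B₀)]
  have hQpos : ∀ w ∈ Metric.closedBall (0 : ℂ) 1, 0 < Q w := by
    intro w hw
    have := hSpos w hw
    have := Complex.normSq_nonneg B₀
    have := Real.sqrt_nonneg (D w)
    rw [hQ]; simp only; linarith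
  have hQeq : ∀ w ∈ Metric.closedBall (0 : ℂ) 1,
      4 * Q w * Q w + normSq (w * b₀) ^ p = 4 * Q w * S w := by
    intro w hw
    have h := Real.mul_self_sqrt (hDnn w hw)
    have e : normSq (w * b₀) ^ p = S w ^ 2 - D w := by rw [hD]; ring
    rw [e, hQ]; simp only
    linear_combination h
  have hna : ‖A₀‖ ≠ 0 := norm_ne_zero_iff.2 hA₀
  obtain ⟨A, hAdef⟩ : ∃ A : ℂ → ℂ, A = fun w => ((√(Q w) / ‖A₀‖ : ℝ) : ℂ) * A₀ := ⟨_, rfl⟩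
  have hAn : ∀ w ∈ Metric.closedBall (0 : ℂ) 1, normSq (A w) = Q w := by
    intro w hw
    rw [hAdef]; simp only
    rw [map_mul, Complex.normSq_ofReal, Complex.normSq_eq_norm_sq]
    have := Real.mul_self_sqrt (hQpos w hw).le
    field_simp
    linear_combination this
  have hA0 : ∀ w ∈ Metric.closedBall (0 : ℂ) 1, A w ≠ 0 := fun w hw =>
    Complex.normSq_pos.1 (by rw [hAn w hw]; exact hQpos w hw)
  have hAc : Continuous A := by
    rw [hAdef]; fun_prop
  refine ⟨A, fun w => -(w * b₀) ^ p / (2 * A w), hAc.continuousOn,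
    ContinuousOn.div (by fun_prop) (by fun_prop)
      fun w hw => mul_ne_zero two_ne_zero (hA0 w hw), fun w hw => ⟨hA0 w hw, ?_, ?_⟩, ?_⟩
  · have := hA0 w hw
    field_simp
    ring
  · have hq := hQpos w hw
    have h2' : normSq (2 : ℂ) = 4 := by norm_num [Complex.normSq_apply]
    rw [map_div₀, Complex.normSq_neg, map_pow, map_mul normSq 2 (A w), h2', hAn w hw]
    have := hQeq w hw
    have e : normSq (w * b₀) = 1 - S w := by rw [hS]; ring
    field_simp
    rw [e] at this ⊢
    linear_combination this
  · intro w hw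
    have hwn : normSq w = 1 := by rw [Complex.normSq_eq_norm_sq, hw]; norm_num
    have hwb : normSq (w * b₀) = normSq b₀ := by rw [map_mul, hwn, one_mul]
    have hSw : S w = normSq A₀ + normSq B₀ := by rw [hS]; simp only; rw [hwb]; linarith
    have hDw : D w = (normSq A₀ - normSq B₀) ^ 2 := by
      rw [hD]; simp only; rw [hSw, hwb, h4]; ring
    have hQw : Q w = ‖A₀‖ ^ 2 := by
      rw [hQ]; simp only
      rw [hDw, Real.sqrt_sq (by linarith), hSw, ← Complex.normSq_eq_norm_sq]; ring
    have hAw : A w = A₀ := by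
      rw [hAdef]; simp only
      rw [hQw, Real.sqrt_sq (norm_nonneg _), div_self hna]; simp
    refine ⟨hAw, ?_⟩
    simp only [hAw]
    rw [div_eq_iff (mul_ne_zero two_ne_zero hA₀), mul_pow]
    linear_combination (-w ^ p) * h1

lemma crossSq_rotate (hp : 2 ≤ p) {w : ℂ} (hw : ‖w‖ = 1) :
    crossA p A (w ^ p * B) (w * b) = cj w * crossA p A B b ∧
    crossB p A (w ^ p * B) (w * b) = w ^ (p - 1) * crossB p A B b ∧
    crossC A (w ^ p * B) = crossC A B ∧ crossSq p A (w ^ p * B) (w * b) = crossSq p A B b := by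
  have hww : w * cj w = 1 := by
    rw [Complex.mul_conj, Complex.normSq_eq_norm_sq, hw]; norm_num
  have hwn : normSq w = 1 := by rw [Complex.normSq_eq_norm_sq, hw]; norm_num
  obtain ⟨q, rfl⟩ : ∃ q, p = q + 1 := ⟨p - 1, by omega⟩
  have hwp : w ^ q * cj w ^ q = 1 := by rw [← mul_pow, hww, one_pow]
  have e1 : crossA (q + 1) A (w ^ (q + 1) * B) (w * b) = cj w * crossA (q + 1) A B b := by
    simp only [crossA, map_mul, map_pow, Nat.add_sub_cancel]
    linear_combination (-((q + 1 : ℕ) : ℂ) * b ^ q * cj B * cj w) * hwp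
  have e2 : crossB (q + 1) A (w ^ (q + 1) * B) (w * b) = w ^ q * crossB (q + 1) A B b := by
    simp only [crossB, map_mul, Nat.add_sub_cancel]
    linear_combination (-2 * w ^ q * B * cj b) * hww
  have e3 : crossC A (w ^ (q + 1) * B) = crossC A B := by
    simp only [crossC, map_mul, map_pow]
    linear_combination (2 * B * cj B * w * cj w) * hwp + (2 * B * cj B) * hww
  refine ⟨e1, e2, e3, ?_⟩
  rw [crossSq, crossSq, e1, e2, e3, map_mul, map_mul, Complex.normSq_conj, map_pow, hwn, one_pow,
    one_mul, one_mul]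

end Discs

/-! ### The Conley–Zehnder indices -/

section Index

open Complex (normSq)

local notation "cj" => starRingEnd ℂ

variable {m p : ℕ}

/-- The Robbin–Salamon index of the path of rotations of `ℂ` through the angles from `0` to
`2 π x`. -/
def rotIndex (x : ℝ) : ℤ := ⌊x⌋ + ⌈x⌉

/-- With `s = fillSq N ζ`, the pair `(ζ ^ N, s)` fills the loop `ζ ^ N` by a disc in the unit sphere
`|q|² + s² = 1`. -/
def fillSq (N : ℕ) (ζ : ℂ) : ℝ := √(1 - normSq ζ ^ N)

lemma continuous_fillSq (N : ℕ) : Continuous (fillSq N) := by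
  have := Complex.continuous_normSq
  unfold fillSq
  fun_prop

lemma fillSq_sq {N : ℕ} {ζ : ℂ} (hζ : ζ ∈ Metric.closedBall (0 : ℂ) 1) :
    ζ ^ N * cj (ζ ^ N) + (fillSq N ζ : ℂ) * fillSq N ζ = 1 := by
  have h : normSq ζ ^ N ≤ 1 := by
    rw [mem_closedBall_zero_iff] at hζ
    rw [Complex.normSq_eq_norm_sq]
    exact pow_le_one₀ (by positivity) (pow_le_one₀ (norm_nonneg _) hζ)
  have h2 := Real.mul_self_sqrt (sub_nonneg.2 h)
  rw [Complex.mul_conj, map_pow]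
  rw [fillSq]
  norm_cast
  linarith

lemma fillSq_of_norm_eq_one {N : ℕ} {ζ : ℂ} (hζ : ‖ζ‖ = 1) : fillSq N ζ = 0 := by
  rw [fillSq, Complex.normSq_eq_norm_sq, hζ]; simp

lemma adaptVec_congr {b : RealBasis m} {y₀ y₁ y₂ y₃ x₀ x₁ x₂ x₃ : ℂ} {y x : Fin m → ℂ} {w v : ℂ}
    (h₀ : y₀ = x₀) (h₁ : y₁ = x₁) (h₂ : y₂ = x₂) (h₃ : y₃ = x₃) (h : y = x) (hw : w = v) :
    adaptVec b y₀ y₁ y₂ y₃ y w = adaptVec b x₀ x₁ x₂ x₃ x v := by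
  subst h₀ h₁ h₂ h₃ h hw; rfl

/-- A frame of `ker dP ∩ z^⊥` at the points `z = (q A, q̄ B, s A, s B, 0, b)`, where
`|q|² + s² = 1` and `(C₀, C₁, Cn)` is tangent to the curve `2 A B + b ^ p = 0` and orthogonal to
`(A, B, b)`. -/
def discFrame (b : RealBasis m) (q s C₀ C₁ Cn : ℂ) : Fin (m + 3) → Amb (m + 4) :=
  Fin.cons (adaptVec b (-s) 0 (cj q) 0 0 0) (Fin.cons (adaptVec b 0 (-s) 0 q 0 0)
    (Fin.cons (adaptVec b (q * C₀) (cj q * C₁) (s * C₀) (s * C₁) 0 Cn)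
      fun k => adaptVec b 0 0 0 0 (Pi.single k 1) 0))

lemma polyDiff_discFrame (b : RealBasis m) {A B w q s C₀ C₁ Cn : ℂ}
    (hqs : q * cj q + s * s = 1)
    (hC : A * C₁ + B * C₀ + p / 2 * w ^ (p - 1) * Cn = 0) (j : Fin (m + 3)) :
    polyDiff (m + 4) p (adaptVec b (q * A) (cj q * B) (s * A) (s * B) 0 w)
      (discFrame b q s C₀ C₁ Cn j) = 0 := by
  refine Fin.cases ?_ (Fin.cases ?_ (Fin.cases ?_ fun k => ?_)) j <;>
    (refine (polyDiff_adaptVec ..).trans ?_; simp only [Pi.zero_apply, zero_mul,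
      Finset.sum_const_zero])
  · ring
  · ring
  · linear_combination 2 * hC + 2 * (A * C₁ + B * C₀) * hqs
  · ring

lemma inner_discFrame (b : RealBasis m) {A B w q C₀ C₁ Cn : ℂ} {s : ℝ}
    (hqs : q * cj q + (s : ℂ) * s = 1)
    (hC : cj A * C₀ + cj B * C₁ + cj w * Cn = 0) (j : Fin (m + 3)) :
    inner ℂ (adaptVec b (q * A) (cj q * B) (s * A) (s * B) 0 w)
      (discFrame b q s C₀ C₁ Cn j) = 0 := by
  refine Fin.cases ?_ (Fin.cases ?_ (Fin.cases ?_ fun k => ?_)) j <;>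
    (refine (inner_adaptVec ..).trans ?_; simp only [Pi.zero_apply, zero_mul, map_mul, map_zero,
      Complex.conj_conj, Complex.conj_ofReal, Finset.sum_const_zero])
  · ring
  · ring
  · linear_combination hC + (cj A * C₀ + cj B * C₁) * hqs
  · ring

lemma wHerm_discFrame (b : RealBasis m) {q C₀ C₁ Cn : ℂ} {s : ℝ}
    (hqs : q * cj q + (s : ℂ) * s = 1)
    (hC : cj C₀ * C₀ + cj C₁ * C₁ + p / 2 * (cj Cn * Cn) = 1) (i j : Fin (m + 3)) :
    wHerm (m + 4) p (discFrame b q s C₀ C₁ Cn i) (discFrame b q s C₀ C₁ Cn j) =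
      if i = j then 1 else 0 := by
  refine Fin.cases ?_ (Fin.cases ?_ (Fin.cases ?_ fun k => ?_)) i <;>
    refine Fin.cases ?_ (Fin.cases ?_ (Fin.cases ?_ fun k' => ?_)) j <;>
    (refine (wHerm_adaptVec ..).trans ?_; simp only [Pi.zero_apply, zero_mul, map_mul, map_zero,
      map_neg, Complex.conj_conj, Complex.conj_ofReal, Finset.sum_const_zero, mul_zero])
  · rw [if_pos trivial]; linear_combination hqs
  · rw [if_neg (by simp only [Fin.ext_iff, Fin.val_succ, Fin.val_zero]; omega)]; ring
  · rw [if_neg (by simp only [Fin.ext_iff, Fin.val_succ, Fin.val_zero]; omega)]; ring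
  · rw [if_neg (by simp only [Fin.ext_iff, Fin.val_succ, Fin.val_zero]; omega)]; ring
  · rw [if_neg (by simp only [Fin.ext_iff, Fin.val_succ, Fin.val_zero]; omega)]; ring
  · rw [if_pos trivial]; linear_combination hqs
  · rw [if_neg (by simp only [Fin.ext_iff, Fin.val_succ, Fin.val_zero]; omega)]; ring
  · rw [if_neg (by simp only [Fin.ext_iff, Fin.val_succ, Fin.val_zero]; omega)]; ring
  · rw [if_neg (by simp only [Fin.ext_iff, Fin.val_succ, Fin.val_zero]; omega)]; ring
  · rw [if_neg (by simp only [Fin.ext_iff, Fin.val_succ, Fin.val_zero]; omega)]; ring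
  · rw [if_pos trivial]; linear_combination hC + (cj C₀ * C₀ + cj C₁ * C₁) * hqs
  · rw [if_neg (by simp only [Fin.ext_iff, Fin.val_succ, Fin.val_zero]; omega)]; ring
  · rw [if_neg (by simp only [Fin.ext_iff, Fin.val_succ, Fin.val_zero]; omega)]; ring
  · rw [if_neg (by simp only [Fin.ext_iff, Fin.val_succ, Fin.val_zero]; omega)]; ring
  · rw [if_neg (by simp only [Fin.ext_iff, Fin.val_succ, Fin.val_zero]; omega)]; ring
  · simp only [Fin.succ_inj, ← Pi.single_apply]
    rw [Finset.sum_eq_single k (fun j _ hj => by simp [Pi.single_apply, hj]) (by simp)]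
    simp [Pi.single_apply]

/-- The flow multiplies the frame vectors by phases. -/
lemma flowMap_discFrame {ε : ℝ} {b : RealBasis m} {κ₀ κ₁ κ₂ κ₃ : ℝ}
    (hb : FlowDiag p ε b κ₀ κ₁ κ₂ κ₃) {t : ℝ} {C₀ C₁ Cn C₀' C₁' : ℂ}
    (h₀ : phase κ₀ t * C₀ = phase (4 / p) t * (phase κ₀ t * C₀'))
    (h₁ : phase κ₁ t * C₁ = phase (4 / p) t * (cj (phase κ₀ t) * C₁')) (j : Fin (m + 3)) :
    flowMap (m + 4) p ε t (discFrame b 1 0 C₀ C₁ Cn j) =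
      Complex.exp (((Fin.cons (κ₂ + κ₀) (Fin.cons (κ₃ - κ₀) (Fin.cons (4 / p) fun _ => 2)) :
        Fin (m + 3) → ℝ) j * t : ℝ) * Complex.I) •
        discFrame b (phase κ₀ t) 0 C₀' C₁' Cn j := by
  have hph : phase κ₀ t * cj (phase κ₀ t) = 1 := by
    rw [Complex.mul_conj, Complex.normSq_eq_norm_sq, norm_phase]; norm_num
  refine Fin.cases ?_ (Fin.cases ?_ (Fin.cases ?_ fun k => ?_)) j
  · refine (hb ..).trans (Eq.trans ?_ (smul_adaptVec ..).symm)
    change _ = adaptVec b (phase (κ₂ + κ₀) t * _) (phase (κ₂ + κ₀) t * _) (phase (κ₂ + κ₀) t * _)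
      (phase (κ₂ + κ₀) t * _) (fun k => phase (κ₂ + κ₀) t * _) (phase (κ₂ + κ₀) t * _)
    rw [phase_add]
    refine adaptVec_congr (by simp) (by simp) ?_ (by simp) (by simp) (by simp)
    rw [map_one]; linear_combination (-phase κ₂ t) * hph
  · refine (hb ..).trans (Eq.trans ?_ (smul_adaptVec ..).symm)
    change _ = adaptVec b (phase (κ₃ - κ₀) t * _) (phase (κ₃ - κ₀) t * _) (phase (κ₃ - κ₀) t * _)
      (phase (κ₃ - κ₀) t * _) (fun k => phase (κ₃ - κ₀) t * _) (phase (κ₃ - κ₀) t * _)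
    rw [sub_eq_add_neg, phase_add, ← conj_phase]
    refine adaptVec_congr (by simp) (by simp) (by simp) ?_ (by simp) (by simp)
    linear_combination (-phase κ₃ t) * hph
  · refine (hb ..).trans (Eq.trans ?_ (smul_adaptVec ..).symm)
    change _ = adaptVec b (phase (4 / p) t * _) (phase (4 / p) t * _) (phase (4 / p) t * _)
      (phase (4 / p) t * _) (fun k => phase (4 / p) t * _) (phase (4 / p) t * _)
    refine adaptVec_congr ?_ ?_ (by simp) (by simp) (by simp) rfl
    · rw [one_mul]; exact h₀
    · rw [map_one, one_mul]; exact h₁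
  · refine (hb ..).trans (Eq.trans ?_ (smul_adaptVec ..).symm)
    change _ = adaptVec b (phase 2 t * _) (phase 2 t * _) (phase 2 t * _)
      (phase 2 t * _) (fun k => phase 2 t * _) (phase 2 t * _)
    exact adaptVec_congr (by simp) (by simp) (by simp) (by simp) rfl (by simp)

lemma continuousOn_discFrame (b : RealBasis m) {S : Set ℂ} {q s C₀ C₁ Cn : ℂ → ℂ}
    (hq : ContinuousOn q S) (hs : ContinuousOn s S) (h₀ : ContinuousOn C₀ S)
    (h₁ : ContinuousOn C₁ S) (hn : ContinuousOn Cn S) (j : Fin (m + 3)) :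
    ContinuousOn (fun ζ => discFrame b (q ζ) (s ζ) (C₀ ζ) (C₁ ζ) (Cn ζ) j) S := by
  have hq' : ContinuousOn (fun ζ => cj (q ζ)) S := Complex.continuous_conj.comp_continuousOn hq
  refine Fin.cases ?_ (Fin.cases ?_ (Fin.cases ?_ fun k => ?_)) j
  · exact continuousOn_adaptVec b hs.neg continuousOn_const hq' continuousOn_const
      continuousOn_const 0
  · exact continuousOn_adaptVec b continuousOn_const hs.neg continuousOn_const hq
      continuousOn_const 0
  · exact continuousOn_adaptVec b (hq.mul h₀) (hq'.mul h₁) (hs.mul h₀) (hs.mul h₁) hn 0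
  · exact continuousOn_const

/-- The unit vector (for the Hermitian form with the weights `1, 1, p / 2`) in the direction of
`(crossA, crossB, crossC)`, multiplied by `x`. -/
def crossUnit (p : ℕ) (A B b x : ℂ) : ℂ := ((√(crossSq p A B b))⁻¹ : ℝ) * x

lemma crossUnit_spec (hp : 2 ≤ p) {A B b : ℂ} (hA : A ≠ 0) (h : 2 * A * B + b ^ p = 0)
    {C₀ C₁ Cn : ℂ} (h₀ : C₀ = crossUnit p A B b (crossA p A B b))
    (h₁ : C₁ = crossUnit p A B b (crossB p A B b)) (hn : Cn = crossUnit p A B b (crossC A B)) :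
    A * C₁ + B * C₀ + p / 2 * b ^ (p - 1) * Cn = 0 ∧
      cj A * C₀ + cj B * C₁ + cj b * Cn = 0 ∧
      cj C₀ * C₀ + cj C₁ * C₁ + p / 2 * (cj Cn * Cn) = 1 := by
  subst h₀ h₁ hn
  have hpos := crossSq_pos hp hA h
  refine ⟨?_, ?_, ?_⟩
  · simp only [crossUnit]
    linear_combination (((√(crossSq p A B b))⁻¹ : ℝ) : ℂ) * cross_tangent (p := p) (A := A) (B := B) (b := b)
  · simp only [crossUnit]
    linear_combination (((√(crossSq p A B b))⁻¹ : ℝ) : ℂ) * cross_orthogonal (p := p) (A := A) (B := B) (b := b)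
  · have h1 : (√(crossSq p A B b))⁻¹ * (√(crossSq p A B b))⁻¹ * crossSq p A B b = 1 :=
      sqrt_inv_mul_self hpos
    rw [← Complex.normSq_eq_conj_mul_self, ← Complex.normSq_eq_conj_mul_self,
      ← Complex.normSq_eq_conj_mul_self]
    simp only [crossUnit, map_mul, Complex.normSq_ofReal]
    have h2 : (√(crossSq p A B b))⁻¹ * (√(crossSq p A B b))⁻¹ * (normSq (crossA p A B b) +
      normSq (crossB p A B b) + p / 2 * normSq (crossC A B)) = 1 := h1
    have h3 : (((√(crossSq p A B b))⁻¹ * (√(crossSq p A B b))⁻¹ * (normSq (crossA p A B b) +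
      normSq (crossB p A B b) + p / 2 * normSq (crossC A B)) : ℝ) : ℂ) = 1 := by rw [h2]; simp
    rw [← h3]
    push_cast
    ring

lemma continuousOn_cross {S : Set ℂ} {f g h : ℂ → ℂ} (hf : ContinuousOn f S)
    (hg : ContinuousOn g S) (hh : ContinuousOn h S) :
    ContinuousOn (fun ζ => crossA p (f ζ) (g ζ) (h ζ)) S ∧
      ContinuousOn (fun ζ => crossB p (f ζ) (g ζ) (h ζ)) S ∧
      ContinuousOn (fun ζ => crossC (f ζ) (g ζ)) S := by
  have hf' : ContinuousOn (fun ζ => cj (f ζ)) S := Complex.continuous_conj.comp_continuousOn hf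
  have hg' : ContinuousOn (fun ζ => cj (g ζ)) S := Complex.continuous_conj.comp_continuousOn hg
  have hh' : ContinuousOn (fun ζ => cj (h ζ)) S := Complex.continuous_conj.comp_continuousOn hh
  have h2 : ContinuousOn (fun _ : ℂ => (2 : ℂ)) S := continuousOn_const
  have hp : ContinuousOn (fun _ : ℂ => (p : ℂ)) S := continuousOn_const
  exact ⟨((h2.mul hf).mul hh').sub ((hp.mul (hh.pow _)).mul hg'),
    ((hp.mul (hh.pow _)).mul hf').sub ((h2.mul hg).mul hh'), h2.mul ((hg.mul hg').sub (hf.mul hf'))⟩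

/-- The orbit through the point with the hyperbolic coordinates `A₀, B₀, 0, 0, 0` bounds a disc
over which the contact structure has an explicit frame that the flow diagonalizes. -/
theorem hasConleyZehnderIndex_adaptVec {ε : ℝ} (hp : 2 ≤ p) (h0 : 0 < ε) (h1 : ε < 1)
    {φ : ℝ → Amb (m + 4) → Amb (m + 4)} (hφ : IsPerturbedReebFlow (m + 4) p ε φ)
    {b : RealBasis m} {κ₀ κ₁ κ₂ κ₃ : ℝ} (hb : FlowDiag p ε b κ₀ κ₁ κ₂ κ₃) (hκ : κ₀ + κ₁ = 4)
    {A₀ B₀ b₀ : ℂ} (hz : adaptVec b A₀ B₀ 0 0 0 b₀ ∈ brieskornSphere (m + 4) p)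
    (hAB : normSq B₀ ≤ normSq A₀) {T : ℝ} (hT : 0 < T) {N j : ℕ}
    (hN : κ₀ * T = 2 * Real.pi * N) (hj : b₀ = 0 ∨ (4 / p : ℝ) * T = 2 * Real.pi * j)
    (hθ₂ : κ₂ + κ₀ ≠ 0) (hθ₃ : κ₃ - κ₀ ≠ 0) :
    HasConleyZehnderIndex (m + 4 - 1) (brieskornSphere (m + 4) p) (brieskornTangent (m + 4) p)
      (perturbedForm (m + 4) p ε) φ T (adaptVec b A₀ B₀ 0 0 0 b₀)
      ((rotIndex ((κ₂ + κ₀) * T / (2 * Real.pi)) + rotIndex ((κ₃ - κ₀) * T / (2 * Real.pi)) +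
        rotIndex (4 / p * T / (2 * Real.pi)) + m * rotIndex (2 * T / (2 * Real.pi)) : ℤ) : ℝ) := by
  have hp0 : (p : ℝ) ≠ 0 := by exact_mod_cast (by omega : p ≠ 0)
  have hP : 2 * A₀ * B₀ + b₀ ^ p = 0 := by
    have := hz.1
    rw [brieskornPoly_adaptVec] at this
    simpa [mul_assoc] using this
  have hNm : normSq A₀ + normSq B₀ + normSq b₀ = 1 := by
    have h : inner ℂ (adaptVec b A₀ B₀ 0 0 0 b₀) (adaptVec b A₀ B₀ 0 0 0 b₀) = (1 : ℂ) := by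
      rw [inner_self_eq_norm_sq_to_K, hz.2]; simp
    rw [inner_adaptVec] at h
    simp only [Pi.zero_apply, mul_zero, Finset.sum_const_zero, add_zero,
      ← Complex.normSq_eq_conj_mul_self] at h
    exact_mod_cast h
  obtain ⟨A, B, hAc, hBc, hAB', hbd⟩ := exists_equivariantDisc hP hNm hAB
  -- the disc in the coordinates `(A, B, b)` is traversed `j` times
  obtain ⟨W, hWdef⟩ : ∃ W : ℂ → ℂ, W = fun ζ => ζ ^ j := ⟨_, rfl⟩
  have hWc : Continuous W := by rw [hWdef]; fun_prop
  have hWm : ∀ ζ ∈ Metric.closedBall (0 : ℂ) 1, W ζ ∈ Metric.closedBall (0 : ℂ) 1 := by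
    intro ζ hζ
    rw [mem_closedBall_zero_iff] at hζ ⊢
    rw [hWdef]; simp only
    rw [norm_pow]; exact pow_le_one₀ (norm_nonneg _) hζ
  have hA₀ : A₀ ≠ 0 := by
    rw [← (hbd 1 (by simp)).1]
    exact (hAB' 1 (by simp)).1
  have hB₀ : b₀ = 0 → B₀ = 0 := by
    intro h
    rw [h, zero_pow (by omega), add_zero] at hP
    exact (mul_eq_zero.1 hP).resolve_left (mul_ne_zero two_ne_zero hA₀)
  have hWb : ∀ t, W (circlePt T t) * b₀ = phase (4 / p) t * b₀ ∧
      W (circlePt T t) ^ p * B₀ = phase (4 / p) t ^ p * B₀ := by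
    intro t
    rcases hj with h | h
    · rw [hB₀ h, h]; simp
    · have : W (circlePt T t) = phase (4 / p) t := by
        rw [hWdef]; exact circlePt_pow hT.ne' h t
      rw [this]; exact ⟨rfl, rfl⟩
  have hphp : ∀ t, phase (4 / p) t ^ p = phase κ₁ t * phase κ₀ t := by
    intro t
    rw [phase_pow, ← phase_add]; congr 1; field_simp; linarith
  have hconj : ∀ κ t, phase κ t * cj (phase κ t) = 1 := by
    intro κ t
    rw [Complex.mul_conj, Complex.normSq_eq_norm_sq, norm_phase]; norm_num
  have hAWc : ContinuousOn (fun ζ => A (W ζ)) (Metric.closedBall 0 1) :=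
    hAc.comp hWc.continuousOn hWm
  have hBWc : ContinuousOn (fun ζ => B (W ζ)) (Metric.closedBall 0 1) :=
    hBc.comp hWc.continuousOn hWm
  have hbWc : ContinuousOn (fun ζ => W ζ * b₀) (Metric.closedBall 0 1) := by fun_prop
  obtain ⟨hcA, hcB, hcC⟩ := continuousOn_cross (p := p) hAWc hBWc hbWc
  have hcS : ContinuousOn (fun ζ => (((√(crossSq p (A (W ζ)) (B (W ζ)) (W ζ * b₀)))⁻¹ : ℝ) : ℂ))
      (Metric.closedBall 0 1) := by
    refine Complex.continuous_ofReal.comp_continuousOn (ContinuousOn.inv₀ (ContinuousOn.sqrt ?_)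
      fun ζ hζ => ?_)
    · have hq : Continuous normSq := Complex.continuous_normSq
      exact ((hq.comp_continuousOn hcA).add (hq.comp_continuousOn hcB)).add
        (continuousOn_const.mul (hq.comp_continuousOn hcC))
    · have h := hAB' _ (hWm ζ hζ)
      exact (Real.sqrt_pos.2 (crossSq_pos hp h.1 h.2.1)).ne'
  have hqc : Continuous fun ζ : ℂ => ζ ^ N := by fun_prop
  have hsc : Continuous fun ζ : ℂ => (fillSq N ζ : ℂ) :=
    Complex.continuous_ofReal.comp (continuous_fillSq N)
  obtain ⟨u, hu⟩ : ∃ u : ℂ → Amb (m + 4), u = fun ζ => adaptVec b (ζ ^ N * A (W ζ))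
      (cj (ζ ^ N) * B (W ζ)) (fillSq N ζ * A (W ζ)) (fillSq N ζ * B (W ζ)) 0 (W ζ * b₀) := ⟨_, rfl⟩
  obtain ⟨e, he⟩ : ∃ e : Fin (m + 3) → ℂ → Amb (m + 4), e = fun j ζ => discFrame b (ζ ^ N)
      (fillSq N ζ) (crossUnit p (A (W ζ)) (B (W ζ)) (W ζ * b₀) (crossA p (A (W ζ)) (B (W ζ)) (W ζ * b₀)))
      (crossUnit p (A (W ζ)) (B (W ζ)) (W ζ * b₀) (crossB p (A (W ζ)) (B (W ζ)) (W ζ * b₀)))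
      (crossUnit p (A (W ζ)) (B (W ζ)) (W ζ * b₀) (crossC (A (W ζ)) (B (W ζ)))) j := ⟨_, rfl⟩
  have hspec := fun (ζ : ℂ) (hζ : ζ ∈ Metric.closedBall (0 : ℂ) 1) =>
    crossUnit_spec hp (hAB' _ (hWm ζ hζ)).1 (hAB' _ (hWm ζ hζ)).2.1 rfl rfl rfl
  have hbdy : ∀ t j, e j (circlePt T t) = discFrame b (phase κ₀ t) 0
      (cj (phase (4 / p) t) * crossUnit p A₀ B₀ b₀ (crossA p A₀ B₀ b₀))
      (phase (4 / p) t ^ (p - 1) * crossUnit p A₀ B₀ b₀ (crossB p A₀ B₀ b₀))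
      (crossUnit p A₀ B₀ b₀ (crossC A₀ B₀)) j := by
    intro t j'
    have hn := norm_circlePt T t
    have hWn : ‖W (circlePt T t)‖ = 1 := by rw [hWdef]; simp [hn]
    obtain ⟨r1, r2, r3, r4⟩ := crossSq_rotate (A := A₀) (B := B₀) (b := b₀) hp (norm_phase (4 / p) t)
    rw [he]
    simp only
    rw [(hbd _ hWn).1, (hbd _ hWn).2, (hWb t).1, (hWb t).2, circlePt_pow hT.ne' hN,
      fillSq_of_norm_eq_one hn, Complex.ofReal_zero]
    simp only [crossUnit, r1, r2, r3, r4]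
    congr 1 <;> ring
  have hmain := hasConleyZehnderIndex_of_frame (n := m + 4) (p := p) (by omega) hp h0 h1 hφ hz hT
    (u := u) (e := e) (θ := (Fin.cons (κ₂ + κ₀) (Fin.cons (κ₃ - κ₀) (Fin.cons (4 / p) fun _ => 2)) :
        Fin (m + 3) → ℝ)) ?_ ?_ ?_ ?_ ?_ ?_ ?_ ?_ ?_
  · convert hmain using 1
    change _ = ∑ j : Fin (m + 3), _
    rw [Fin.sum_univ_succ, Fin.sum_univ_succ, Fin.sum_univ_succ]
    simp only [Fin.cons_zero, Fin.cons_succ, Finset.sum_const, Finset.card_univ, Fintype.card_fin,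
      rotIndex, nsmul_eq_mul]
    push_cast
    ring
  · rw [hu]
    exact continuousOn_adaptVec b (hqc.continuousOn.mul hAWc)
      ((Complex.continuous_conj.comp hqc).continuousOn.mul hBWc) (hsc.continuousOn.mul hAWc)
      (hsc.continuousOn.mul hBWc) hbWc 0
  · intro ζ hζ
    obtain ⟨-, hP', hN'⟩ := hAB' _ (hWm ζ hζ)
    have hqs := fillSq_sq (N := N) hζ
    rw [hu]
    constructor
    · simp only
      rw [brieskornPoly_adaptVec]
      simp only [Pi.zero_apply, zero_mul, Finset.sum_const_zero]
      linear_combination hP' + 2 * A (W ζ) * B (W ζ) * hqs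
    · rw [← sq_eq_sq₀ (norm_nonneg _) zero_le_one, one_pow]
      have h : ((‖adaptVec b (ζ ^ N * A (W ζ)) (cj (ζ ^ N) * B (W ζ)) (fillSq N ζ * A (W ζ))
          (fillSq N ζ * B (W ζ)) 0 (W ζ * b₀)‖ ^ 2 : ℝ) : ℂ) = 1 := by
        have h2 := inner_self_eq_norm_sq_to_K (𝕜 := ℂ) (adaptVec b (ζ ^ N * A (W ζ))
          (cj (ζ ^ N) * B (W ζ)) (fillSq N ζ * A (W ζ)) (fillSq N ζ * B (W ζ)) 0 (W ζ * b₀))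
        rw [inner_adaptVec] at h2
        push_cast
        refine h2.symm.trans ?_
        have h3 : ((normSq (A (W ζ)) + normSq (B (W ζ)) + normSq (W ζ * b₀) : ℝ) : ℂ) = 1 := by
          rw [hN']; simp
        push_cast [Complex.normSq_eq_conj_mul_self] at h3
        rw [map_mul cj (W ζ) b₀] at h3
        simp only [Pi.zero_apply, mul_zero, Finset.sum_const_zero, map_mul, Complex.conj_ofReal,
          Complex.conj_conj]
        linear_combination h3 + (cj (A (W ζ)) * A (W ζ) + cj (B (W ζ)) * B (W ζ)) * hqs
      exact_mod_cast h
  · intro t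
    have hn := norm_circlePt T t
    have hWn : ‖W (circlePt T t)‖ = 1 := by rw [hWdef]; simp [hn]
    rw [hu, hb]
    simp only
    rw [(hbd _ hWn).1, (hbd _ hWn).2, (hWb t).1, (hWb t).2, circlePt_pow hT.ne' hN,
      fillSq_of_norm_eq_one hn, Complex.ofReal_zero]
    refine adaptVec_congr rfl ?_ (by simp) (by simp) (by ext; simp) rfl
    rw [hphp]
    linear_combination (phase κ₁ t * B₀) * hconj κ₀ t
  · intro j'
    rw [he]
    exact continuousOn_discFrame b hqc.continuousOn hsc.continuousOn (hcS.mul hcA) (hcS.mul hcB)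
      (hcS.mul hcC) j'
  · intro ζ hζ j'
    rw [hu, he]
    exact polyDiff_discFrame b (fillSq_sq hζ) (hspec ζ hζ).1 j'
  · intro ζ hζ j'
    rw [hu, he]
    exact inner_discFrame b (fillSq_sq hζ) (hspec ζ hζ).2.1 j'
  · intro ζ hζ i' j'
    rw [he]
    exact wHerm_discFrame b (fillSq_sq hζ) (hspec ζ hζ).2.2 i' j'
  · refine Fin.cases hθ₂ (Fin.cases hθ₃ (Fin.cases ?_ fun k => two_ne_zero))
    exact div_ne_zero four_ne_zero hp0
  · intro t j'
    have h1' := hbdy 0 j'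
    rw [circlePt_zero] at h1'
    rw [hbdy t j', h1']
    have hz0 : ∀ κ, phase κ 0 = 1 := fun κ => by simp [phase]
    simp only [hz0, map_one, one_pow, one_mul]
    refine flowMap_discFrame hb ?_ ?_ j'
    · linear_combination (-phase κ₀ t * crossUnit p A₀ B₀ b₀ (crossA p A₀ B₀ b₀)) * hconj (4 / p) t
    · have : phase (4 / p) t * phase (4 / p) t ^ (p - 1) = phase κ₁ t * phase κ₀ t := by
        rw [← pow_succ', ← hphp]; congr 1; omega
      linear_combination (-phase κ₁ t * crossUnit p A₀ B₀ b₀ (crossB p A₀ B₀ b₀)) * hconj κ₀ t -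
        (cj (phase κ₀ t) * crossUnit p A₀ B₀ b₀ (crossB p A₀ B₀ b₀)) * this

end Index

/-! ### Periods of the closed orbits -/

section Periods

variable {n p : ℕ}

lemma phase_mul_eq_self {κ T : ℝ} {x : ℂ} :
    phase κ T * x = x ↔ x = 0 ∨ ∃ N : ℤ, κ * T = N * (2 * Real.pi) := by
  have h : phase κ T = 1 ↔ ∃ N : ℤ, κ * T = N * (2 * Real.pi) := by
    rw [phase, Complex.exp_eq_one_iff]
    refine exists_congr fun N => ?_
    rw [← mul_assoc, ← mul_assoc]
    constructor
    · intro h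
      have := mul_right_cancel₀ Complex.I_ne_zero h
      rw [← mul_assoc]
      exact_mod_cast this
    · intro h
      rw [h]; push_cast; ring
  rw [← h]
  constructor
  · intro hx
    by_cases h0 : x = 0
    · exact Or.inl h0
    · exact Or.inr (mul_right_cancel₀ h0 (by rw [hx, one_mul]))
  · rintro (h | h) <;> simp [h]

lemma flowPhase_eq_phase {k : Fin (n + 1)} (hk : k ≠ Fin.last n) (t : ℝ) :
    flowPhase n p t k = phase 2 t := by
  rw [flowPhase, brieskornExp, if_neg hk, phase]; norm_num

/-- The coordinates `w₀` (for `σ = 1`) and `w₁` (for `σ = -1`), up to a constant factor, diagonalize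
the flow on the plane of `z₀, z₁`. -/
lemma flowMap_rotated (hn : 2 ≤ n) {σ : ℝ} (hσ : σ = 1 ∨ σ = -1) (ε t : ℝ) (z : Amb n) :
    flowMap n p ε t z 0 + σ * Complex.I * flowMap n p ε t z 1 =
      phase (2 + σ * (2 * ε)) t * (z 0 + σ * Complex.I * z 1) := by
  have hσ2 : (σ : ℂ) * σ = 1 := by rcases hσ with rfl | rfl <;> norm_num
  rw [flowMap_apply, flowMap_apply, if_pos rfl, if_neg (fin_zero_ne_one hn).symm, if_pos rfl,
    flowPhase_eq_phase (fin_zero_ne_last hn), flowPhase_eq_phase (fin_one_ne_last hn),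
    phase_two_add _ _ hσ]
  linear_combination (-phase 2 t * Real.sin (2 * ε * t) * z 1 * σ * σ) * Complex.I_mul_I +
    (phase 2 t * Real.sin (2 * ε * t) * z 1) * hσ2

lemma flowMap_eq_self_iff (hn : 2 ≤ n) (ε T : ℝ) (z : Amb n) : flowMap n p ε T z = z ↔
    (∀ σ : ℝ, σ = 1 ∨ σ = -1 → z 0 + σ * Complex.I * z 1 = 0 ∨
      ∃ N : ℤ, (2 + σ * (2 * ε)) * T = N * (2 * Real.pi)) ∧
    (∀ k, k ≠ 0 → k ≠ 1 → k ≠ Fin.last n → z k = 0 ∨ ∃ N : ℤ, 2 * T = N * (2 * Real.pi)) ∧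
    (z (Fin.last n) = 0 ∨ ∃ N : ℤ, 4 / p * T = N * (2 * Real.pi)) := by
  simp only [← phase_mul_eq_self]
  have hlast : flowMap n p ε T z (Fin.last n) = phase (4 / p) T * z (Fin.last n) := by
    rw [flowMap_apply, if_neg (fin_zero_ne_last hn).symm, if_neg (fin_one_ne_last hn).symm,
      flowPhase, brieskornExp, if_pos rfl, phase]
  have hmid : ∀ k, k ≠ 0 → k ≠ 1 → k ≠ Fin.last n → flowMap n p ε T z k = phase 2 T * z k := by
    intro k h0 h1 hl
    rw [flowMap_apply, if_neg h0, if_neg h1, flowPhase_eq_phase hl]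
  constructor
  · intro h
    refine ⟨fun σ hσ => ?_, fun k h0 h1 hl => ?_, ?_⟩
    · rw [← flowMap_rotated hn hσ, h]
    · rw [← hmid k h0 h1 hl, h]
    · rw [← hlast, h]
  · rintro ⟨h1, h2, h3⟩
    have e1 := flowMap_rotated (p := p) hn (Or.inl rfl) ε T z
    have e2 := flowMap_rotated (p := p) hn (Or.inr rfl) ε T z
    rw [h1 1 (Or.inl rfl)] at e1
    rw [h1 (-1) (Or.inr rfl)] at e2
    push_cast at e1 e2
    ext k
    by_cases k0 : k = 0
    · rw [k0]; linear_combination (e1 + e2) / 2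
    by_cases k1 : k = 1
    · rw [k1]
      linear_combination (-Complex.I / 2) * (e1 - e2) +
        (flowMap n p ε T z 1 - z 1) * Complex.I_mul_I
    by_cases kl : k = Fin.last n
    · rw [kl, hlast, h3]
    · rw [hmid k k0 k1 kl, h2 k k0 k1 kl]

/-- The periods: `Lπ/2` for `τ = 0`, and `Lπ/(2(1 ± ε))` for `τ = ±1`. -/
def period (ε : ℝ) (τ : SignType) (L : ℕ) : ℝ := L * Real.pi / (2 * (1 + (τ : ℝ) * ε))

lemma one_add_sign_mul_pos {ε : ℝ} (h0 : 0 < ε) (h1 : ε < 1) (τ : SignType) :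
    0 < 1 + (τ : ℝ) * ε := by
  cases τ <;> simp <;> linarith

lemma period_pos {ε : ℝ} (h0 : 0 < ε) (h1 : ε < 1) (τ : SignType) {L : ℕ} (hL : 0 < L) :
    0 < period ε τ L := by
  have := one_add_sign_mul_pos h0 h1 τ
  have : (0 : ℝ) < L := by exact_mod_cast hL
  have := Real.pi_pos
  unfold period; positivity

/-- As `ε` is irrational, a time `T` turns at most one of the angular velocities `1`, `1 ± ε` into
a rational multiple of `π`. -/
lemma sign_eq_of_mul_eq {ε : ℝ} (hε : Irrational ε) (h0 : 0 < ε) (h1 : ε < 1) {τ τ' : SignType}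
    {T : ℝ} (hT : T ≠ 0) {q q' : ℚ} (h : (1 + (τ : ℝ) * ε) * T = q * Real.pi)
    (h' : (1 + (τ' : ℝ) * ε) * T = q' * Real.pi) : τ = τ' ∧ q = q' := by
  have hpi := Real.pi_ne_zero
  have e : (1 + (τ : ℝ) * ε) * q' = (1 + (τ' : ℝ) * ε) * q := by
    have : ((1 + (τ : ℝ) * ε) * q' - (1 + (τ' : ℝ) * ε) * q) * (T * Real.pi) = 0 := by
      linear_combination (-(1 + (τ : ℝ) * ε) * T) * h' + ((1 + (τ' : ℝ) * ε) * T) * h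
    have := (mul_eq_zero.1 this).resolve_right (mul_ne_zero hT hpi)
    linarith
  have hq : (q : ℝ) ≠ 0 := by
    intro hq
    rw [hq, zero_mul] at h
    exact mul_ne_zero (one_add_sign_mul_pos h0 h1 τ).ne' hT h
  have hq' : (q' : ℝ) ≠ 0 := by
    intro hq
    rw [hq, zero_mul] at h'
    exact mul_ne_zero (one_add_sign_mul_pos h0 h1 τ').ne' hT h'
  obtain ⟨s, hs⟩ : ∃ s : ℚ, (τ : ℝ) = s := by cases τ <;> [use 0; use -1; use 1] <;> simp
  obtain ⟨s', hs'⟩ : ∃ s' : ℚ, (τ' : ℝ) = s' := by cases τ' <;> [use 0; use -1; use 1] <;> simp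
  rw [hs, hs'] at e
  have e2 : ε * ((s * q' - s' * q : ℚ) : ℝ) = ((q - q' : ℚ) : ℝ) := by push_cast; linarith
  by_cases hd : s * q' - s' * q = 0
  · rw [hd, Rat.cast_zero, mul_zero] at e2
    have e3 : q = q' := by
      have : q - q' = 0 := by exact_mod_cast e2.symm
      linarith
    refine ⟨?_, e3⟩
    rw [e3] at hd
    have e4 : s = s' := by
      have h5 : (s - s') * q' = 0 := by linarith
      have : q' ≠ 0 := by exact_mod_cast hq'
      linarith [(mul_eq_zero.1 h5).resolve_right this]
    rw [← e4] at hs'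
    have e5 : (τ : ℝ) = τ' := hs.trans hs'.symm
    cases τ <;> cases τ' <;> first | rfl | (norm_num at e5)
  · exfalso
    have hd' : ((s * q' - s' * q : ℚ) : ℝ) ≠ 0 := by exact_mod_cast hd
    refine hε ⟨(q - q') / (s * q' - s' * q), ?_⟩
    rw [Rat.cast_div, div_eq_iff hd', e2]

lemma period_mul {ε : ℝ} (h0 : 0 < ε) (h1 : ε < 1) (τ : SignType) (L : ℕ) :
    (1 + (τ : ℝ) * ε) * period ε τ L = ((L / 2 : ℚ) : ℝ) * Real.pi := by
  have := (one_add_sign_mul_pos h0 h1 τ).ne'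
  unfold period; push_cast; field_simp

lemma period_inj {ε : ℝ} (hε : Irrational ε) (h0 : 0 < ε) (h1 : ε < 1) {τ τ' : SignType}
    {L L' : ℕ} (hL : 0 < L) (h : period ε τ L = period ε τ' L') : τ = τ' ∧ L = L' := by
  have e := period_mul h0 h1 τ L
  have e' := period_mul h0 h1 τ' L'
  rw [← h] at e'
  obtain ⟨h2, h3⟩ := sign_eq_of_mul_eq hε h0 h1 (period_pos h0 h1 τ hL).ne' e e'
  refine ⟨h2, ?_⟩
  have : (L : ℚ) = L' := by linarith
  exact_mod_cast this

/-- The part of `Σ_p` that is fixed by the time-`period ε τ L` map. -/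
def fixedSet (n p : ℕ) (τ : SignType) (L : ℕ) : Set (Amb n) :=
  if τ = 0 then {z | z ∈ brieskornSphere n p ∧ z 0 = 0 ∧ z 1 = 0 ∧ (p ∣ L ∨ z (Fin.last n) = 0)}
  else {z | z ∈ brieskornSphere n p ∧ z 0 - ((τ : ℝ) : ℂ) * Complex.I * z 1 = 0 ∧
    ∀ k, k ≠ 0 → k ≠ 1 → z k = 0}

lemma rotated_cond {ε : ℝ} (hε : Irrational ε) (h0 : 0 < ε) (h1 : ε < 1) {τ σ : SignType}
    {L : ℕ} (hL : 0 < L) {N : ℤ} (h : (2 + (σ : ℝ) * (2 * ε)) * period ε τ L = N * (2 * Real.pi)) :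
    τ = σ := by
  refine (sign_eq_of_mul_eq hε h0 h1 (period_pos h0 h1 τ hL).ne' (period_mul h0 h1 τ L)
    (q' := N) ?_).1
  push_cast
  linarith

end Periods

section FixedSets

variable {n p : ℕ}

lemma sign_real_cases {σ : ℝ} (h : σ = 1 ∨ σ = -1) :
    ∃ s : SignType, s ≠ 0 ∧ (s : ℝ) = σ := by
  rcases h with rfl | rfl
  · exact ⟨1, by decide, by simp⟩
  · exact ⟨-1, by decide, by simp⟩

lemma sign_cast_cases {s : SignType} (h : s ≠ 0) : (s : ℝ) = 1 ∨ (s : ℝ) = -1 := by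
  cases s
  · exact absurd rfl h
  · right; simp
  · left; simp

lemma apply_eq_zero_of_rotated {z : Amb n}
    (h : ∀ σ : ℝ, σ = 1 ∨ σ = -1 → z 0 + σ * Complex.I * z 1 = 0) : z 0 = 0 ∧ z 1 = 0 := by
  have e1 := h 1 (Or.inl rfl)
  have e2 := h (-1) (Or.inr rfl)
  push_cast at e1 e2
  constructor
  · linear_combination (e1 + e2) / 2
  · linear_combination (-Complex.I / 2) * (e1 - e2) + z 1 * Complex.I_mul_I

/-- Irrationality of `ε` forces the coordinates with other angular velocities to vanish. -/
theorem flowMap_period_iff {ε : ℝ} (hn : 2 ≤ n) (hp : 0 < p) (hε : Irrational ε) (h0 : 0 < ε)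
    (h1 : ε < 1) (τ : SignType) {L : ℕ} (hL : 0 < L) (hLe : Even L) {z : Amb n}
    (hz : z ∈ brieskornSphere n p) :
    flowMap n p ε (period ε τ L) z = z ↔ z ∈ fixedSet n p τ L := by
  have hpi := Real.pi_ne_zero
  have hT := (period_pos h0 h1 τ hL).ne'
  have hp' : (p : ℝ) ≠ 0 := by exact_mod_cast hp.ne'
  obtain ⟨N, hN⟩ := hLe
  have hNr : (L : ℝ) = 2 * N := by rw [hN]; push_cast; ring
  rw [flowMap_eq_self_iff hn, fixedSet]
  split_ifs with hτ
  · subst hτ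
    have hper : period ε 0 L = L * Real.pi / 2 := by simp [period]
    constructor
    · rintro ⟨a1, a2, a3⟩
      obtain ⟨z0, z1⟩ := apply_eq_zero_of_rotated (z := z) fun σ hσ => by
        refine (a1 σ hσ).resolve_right ?_
        rintro ⟨M, hM⟩
        obtain ⟨s, hs0, rfl⟩ := sign_real_cases hσ
        exact hs0 (rotated_cond hε h0 h1 hL hM).symm
      refine ⟨hz, z0, z1, a3.symm.imp_left ?_⟩
      rintro ⟨M, hM⟩
      rw [hper] at hM
      have : (L : ℝ) = p * M := by field_simp at hM; linarith
      have h2 : (L : ℤ) = p * M := by exact_mod_cast this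
      exact Int.natCast_dvd_natCast.1 ⟨M, h2⟩
    · rintro ⟨-, z0, z1, hl⟩
      refine ⟨fun σ _ => Or.inl (by rw [z0, z1]; simp), fun k _ _ _ => Or.inr ⟨N, ?_⟩,
        hl.symm.imp_right ?_⟩
      · rw [hper, hNr]; push_cast; ring
      · rintro ⟨j, hj⟩
        refine ⟨j, ?_⟩
        have : (L : ℝ) = p * j := by exact_mod_cast hj
        rw [hper, this]; push_cast; field_simp; ring
  · constructor
    · rintro ⟨a1, a2, a3⟩
      refine ⟨hz, ?_, fun k k0 k1 => ?_⟩
      · have hs : -τ ≠ 0 := by revert hτ; cases τ <;> decide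
        have := (a1 ((-τ : SignType) : ℝ) (sign_cast_cases hs)).resolve_right ?_
        · rw [← this]; cases τ <;> simp [sub_eq_add_neg]
        · rintro ⟨M, hM⟩
          have := rotated_cond hε h0 h1 hL hM
          revert this hτ; cases τ <;> decide
      · by_cases kl : k = Fin.last n
        · rw [kl]
          refine a3.resolve_right ?_
          rintro ⟨M, hM⟩
          refine hτ (sign_eq_of_mul_eq hε h0 h1 (τ' := 0) (q' := p * M / 2) hT
            (period_mul h0 h1 τ L) ?_).1
          push_cast
          field_simp at hM ⊢
          simp
          linarith
        · refine (a2 k k0 k1 kl).resolve_right ?_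
          rintro ⟨M, hM⟩
          refine hτ (sign_eq_of_mul_eq hε h0 h1 (τ' := 0) (q' := M) hT
            (period_mul h0 h1 τ L) ?_).1
          simp
          linarith
    · rintro ⟨-, hz01, hzk⟩
      refine ⟨fun σ hσ => ?_, fun k k0 k1 _ => Or.inl (hzk k k0 k1),
        Or.inl (hzk _ (fin_zero_ne_last hn).symm (fin_one_ne_last hn).symm)⟩
      have h4 : σ = τ ∨ σ = -τ := by
        rcases hσ with rfl | rfl <;> rcases sign_cast_cases hτ with h | h <;> rw [h] <;> norm_num
      rcases h4 with rfl | rfl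
      · refine Or.inr ⟨N, ?_⟩
        have := period_mul h0 h1 τ L
        push_cast at this
        push_cast
        rw [hNr] at this
        linear_combination 2 * this
      · left; rw [← hz01]; push_cast; ring

/-- Every closed orbit has one of the periods `period ε τ L`. -/
theorem exists_period {ε : ℝ} (hn : 2 ≤ n) (hp : 0 < p) (h0 : 0 < ε)
    (h1 : ε < 1) {T : ℝ} (hT : 0 < T) {z : Amb n} (hz : z ∈ brieskornSphere n p)
    (h : flowMap n p ε T z = z) : ∃ τ L, Even L ∧ 0 < L ∧ T = period ε τ L := by
  have hpi := Real.pi_pos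
  rw [flowMap_eq_self_iff hn] at h
  obtain ⟨a1, a2, a3⟩ := h
  have key : ∀ (τ : SignType) (N : ℤ), (2 + (τ : ℝ) * (2 * ε)) * T = N * (2 * Real.pi) →
      ∃ τ L, Even L ∧ 0 < L ∧ T = period ε τ L := by
    intro τ N hN
    have hτ := one_add_sign_mul_pos h0 h1 τ
    have hNpos : 0 < N := by
      have h5 : 0 < (2 + (τ : ℝ) * (2 * ε)) * T := mul_pos (by linarith) hT
      rw [hN] at h5
      exact_mod_cast pos_of_mul_pos_left h5 (by positivity)
    obtain ⟨M, rfl⟩ := Int.eq_ofNat_of_zero_le hNpos.le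
    refine ⟨τ, M + M, ⟨M, rfl⟩, by omega, ?_⟩
    unfold period
    rw [eq_div_iff (by positivity)]
    push_cast at hN ⊢
    linarith
  by_cases hσ : ∀ σ : ℝ, σ = 1 ∨ σ = -1 → z 0 + σ * Complex.I * z 1 = 0
  · obtain ⟨z0, z1⟩ := apply_eq_zero_of_rotated hσ
    by_cases hk : ∀ k, k ≠ 0 → k ≠ 1 → k ≠ Fin.last n → z k = 0
    · exfalso
      have hP := hz.1
      have hz' : ∀ k, k ≠ Fin.last n → z k = 0 := by
        intro k hl
        by_cases k0 : k = 0
        · rw [k0, z0]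
        by_cases k1 : k = 1
        · rw [k1, z1]
        exact hk k k0 k1 hl
      rw [brieskornPoly, Finset.sum_eq_single (Fin.last n)
        (fun k _ hl => by rw [hz' k hl, zero_pow (brieskornExp_pos hp k).ne']) (by simp)] at hP
      refine brieskornSphere_ne_zero hz (PiLp.ext fun k => ?_)
      by_cases hl : k = Fin.last n
      · rw [hl]; exact eq_zero_of_pow_eq_zero hP
      · exact hz' k hl
    · push Not at hk
      obtain ⟨k, k0, k1, kl, hkz⟩ := hk
      obtain ⟨N, hN⟩ := (a2 k k0 k1 kl).resolve_left hkz
      exact key 0 N (by simpa using hN)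
  · push Not at hσ
    obtain ⟨σ, hs, hσz⟩ := hσ
    obtain ⟨N, hN⟩ := (a1 σ hs).resolve_left hσz
    obtain ⟨s, -, rfl⟩ := sign_real_cases hs
    exact key s N hN

theorem periodicSet_period {ε : ℝ} (hn : 2 ≤ n) (hp : 0 < p) (hε : Irrational ε) (h0 : 0 < ε)
    (h1 : ε < 1) {φ : ℝ → Amb n → Amb n} (hφ : IsPerturbedReebFlow n p ε φ) (τ : SignType) {L : ℕ}
    (hL : 0 < L) (hLe : Even L) :
    periodicSet (brieskornSphere n p) φ (period ε τ L) = fixedSet n p τ L := by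
  have hsub : fixedSet n p τ L ⊆ brieskornSphere n p := by
    intro z hz
    rw [fixedSet] at hz
    split_ifs at hz <;> exact hz.1
  ext z
  constructor
  · rintro ⟨hz, h⟩
    rw [perturbedReebFlow_unique hn hp h0 h1 hφ hz] at h
    exact (flowMap_period_iff hn hp hε h0 h1 τ hL hLe hz).1 h
  · intro h
    refine ⟨hsub h, ?_⟩
    rw [perturbedReebFlow_unique hn hp h0 h1 hφ (hsub h)]
    exact (flowMap_period_iff hn hp hε h0 h1 τ hL hLe (hsub h)).2 h

end FixedSets

/-! ### Indices of the closed orbits -/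

section OrbitIndex

open Complex (normSq)

local notation "cj" => starRingEnd ℂ

variable {m p : ℕ}

lemma exists_realBasis_of_pairwise {s : Set (Fin (m + 4))}
    {v : Fin (m + 4) → EuclideanSpace ℝ (Fin (m + 4))} (h1 : ∀ i ∈ s, ‖v i‖ = 1)
    (h2 : ∀ i ∈ s, ∀ j ∈ s, i ≠ j → inner ℝ (v i) (v j) = 0) :
    ∃ b : RealBasis m, ∀ j ∈ s, b j = v j :=
  exists_realBasis ⟨fun i => h1 i i.2, fun i j hij => h2 i i.2 j j.2 fun h => hij (Subtype.ext h)⟩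

lemma exists_basis_of_sign (m : ℕ) {σ : ℝ} (hσ : σ = 1 ∨ σ = -1) : ∃ b : RealBasis m,
    b 0 = EuclideanSpace.single 0 1 ∧ b 1 = EuclideanSpace.single 1 σ := by
  obtain ⟨b, hb⟩ := exists_realBasis_of_pairwise (m := m) (s := Set.univ)
    (v := fun j => EuclideanSpace.single j (if j = 0 then 1 else σ)) (fun j _ => by
      rw [PiLp.norm_single]; rcases hσ with rfl | rfl <;> split_ifs <;> simp)
    (fun i _ j _ hij => by simp [EuclideanSpace.inner_single_left, hij])
  refine ⟨b, ?_, ?_⟩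
  · rw [hb 0 trivial, if_pos rfl]
  · rw [hb 1 trivial, if_neg (by simp)]

lemma exists_basis_of_orthogonal {α β : EuclideanSpace ℝ (Fin (m + 4))} (hα : α ≠ 0)
    (h : inner ℝ α β = 0) (α0 : α 0 = 0) (α1 : α 1 = 0) (β0 : β 0 = 0) (β1 : β 1 = 0) :
    ∃ b : RealBasis m, b 2 = EuclideanSpace.single 0 1 ∧ b 3 = EuclideanSpace.single 1 1 ∧
      α = ‖α‖ • b 0 ∧ β = -(‖β‖ • b 1) := by
  obtain ⟨r0, hr0⟩ : ∃ r0, r0 = ‖α‖⁻¹ • α := ⟨_, rfl⟩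
  obtain ⟨r1, hr1⟩ : ∃ r1, r1 = -(‖β‖⁻¹ • β) := ⟨_, rfl⟩
  obtain ⟨e0, he0⟩ : ∃ e0 : EuclideanSpace ℝ (Fin (m + 4)), e0 = EuclideanSpace.single 0 1 :=
    ⟨_, rfl⟩
  obtain ⟨e1, he1⟩ : ∃ e1 : EuclideanSpace ℝ (Fin (m + 4)), e1 = EuclideanSpace.single 1 1 :=
    ⟨_, rfl⟩
  have f01 : inner ℝ r0 r1 = 0 := by
    rw [hr0, hr1, inner_neg_right, real_inner_smul_left, real_inner_smul_right, h]; simp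
  have f02 : inner ℝ r0 e0 = 0 := by
    rw [hr0, he0, EuclideanSpace.inner_single_right]; simp [α0]
  have f03 : inner ℝ r0 e1 = 0 := by
    rw [hr0, he1, EuclideanSpace.inner_single_right]; simp [α1]
  have f12 : inner ℝ r1 e0 = 0 := by
    rw [hr1, he0, EuclideanSpace.inner_single_right]; simp [β0]
  have f13 : inner ℝ r1 e1 = 0 := by
    rw [hr1, he1, EuclideanSpace.inner_single_right]; simp [β1]
  have f23 : inner ℝ e0 e1 = 0 := by
    rw [he0, he1, EuclideanSpace.inner_single_right]; simp
  have g10 := (real_inner_comm r0 r1).trans f01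
  have g20 := (real_inner_comm r0 e0).trans f02
  have g30 := (real_inner_comm r0 e1).trans f03
  have g21 := (real_inner_comm r1 e0).trans f12
  have g31 := (real_inner_comm r1 e1).trans f13
  have g32 := (real_inner_comm e0 e1).trans f23
  have n0 : ‖r0‖ = 1 := by
    rw [hr0, norm_smul, norm_inv, norm_norm, inv_mul_cancel₀ (norm_ne_zero_iff.2 hα)]
  have n1 : β ≠ 0 → ‖r1‖ = 1 := by
    intro hβ
    rw [hr1, norm_neg, norm_smul, norm_inv, norm_norm, inv_mul_cancel₀ (norm_ne_zero_iff.2 hβ)]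
  have n2 : ‖e0‖ = 1 := by rw [he0]; simp
  have n3 : ‖e1‖ = 1 := by rw [he1]; simp
  obtain ⟨b, hb⟩ := exists_realBasis_of_pairwise (m := m)
    (s := {j | (j = 0 ∨ j = 2 ∨ j = 3) ∨ j = 1 ∧ β ≠ 0})
    (v := Fin.cons r0 (Fin.cons r1 (Fin.cons e0 fun _ => e1)))
    (by
      rintro i ((rfl | rfl | rfl) | ⟨rfl, hβ⟩)
      · exact n0
      · exact n2
      · exact n3
      · exact n1 hβ)
    (by
      rintro i ((rfl | rfl | rfl) | ⟨rfl, -⟩) j ((rfl | rfl | rfl) | ⟨rfl, -⟩) hij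
      · exact absurd rfl hij
      · exact f02
      · exact f03
      · exact f01
      · exact g20
      · exact absurd rfl hij
      · exact f23
      · exact g21
      · exact g30
      · exact g32
      · exact absurd rfl hij
      · exact g31
      · exact g10
      · exact f12
      · exact f13
      · exact absurd rfl hij)
  refine ⟨b, (hb 2 (Or.inl (Or.inr (Or.inl rfl)))).trans he0,
    (hb 3 (Or.inl (Or.inr (Or.inr rfl)))).trans he1, ?_, ?_⟩
  · have : b 0 = r0 := hb 0 (Or.inl (Or.inl rfl))
    rw [this, hr0, smul_smul, mul_inv_cancel₀ (norm_ne_zero_iff.2 hα), one_smul]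
  · by_cases hβ : β = 0
    · simp [hβ]
    · have : b 1 = r1 := hb 1 (Or.inr ⟨rfl, hβ⟩)
      rw [this, hr1, smul_neg, neg_neg, smul_smul, mul_inv_cancel₀ (norm_ne_zero_iff.2 hβ), one_smul]

lemma adaptVec_pair_castSucc (b : RealBasis m) (y₀ y₁ w : ℂ) (k : Fin (m + 4)) :
    adaptVec b y₀ y₁ 0 0 0 w k.castSucc = ((√2)⁻¹ : ℝ) * (y₀ + y₁) * (b 0 k : ℝ) +
      -Complex.I * ((√2)⁻¹ : ℝ) * (y₀ - y₁) * (b 1 k : ℝ) := by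
  rw [adaptVec_castSucc, sum_fin_add_four]
  simp only [hypCoord_zero, hypCoord_one, hypCoord_two, hypCoord_three, hypCoord_succ,
    Pi.zero_apply, zero_mul, Finset.sum_const_zero]
  ring

/-- Points on the two exceptional orbits, in adapted coordinates. -/
lemma exists_adapted_of_sign {τ : SignType} (hτ : τ ≠ 0) {L : ℕ} {z : Amb (m + 4)}
    (hz : z ∈ fixedSet (m + 4) p τ L) (ε : ℝ) : ∃ (b : RealBasis m) (y₀ : ℂ),
      z = adaptVec b y₀ 0 0 0 0 0 ∧
      FlowDiag p ε b (2 + (τ : ℝ) * (2 * ε)) (2 - (τ : ℝ) * (2 * ε)) 2 2 := by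
  rw [fixedSet, if_neg hτ] at hz
  obtain ⟨-, h01, hk⟩ := hz
  have hσ := sign_cast_cases hτ
  obtain ⟨b, hb0, hb1⟩ := exists_basis_of_sign m hσ
  refine ⟨b, √2 * z 0, ?_, flowDiag_of_first hσ hb0 hb1 ε⟩
  have hσ2 : ((τ : ℝ) : ℂ) * (τ : ℝ) = 1 := by rcases hσ with h | h <;> rw [h] <;> norm_num
  have h2 : (((√2)⁻¹ : ℝ) : ℂ) * (√2 : ℝ) = 1 := by
    rw [← Complex.ofReal_mul, inv_mul_cancel₀ (by positivity)]; simp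
  ext k
  refine Fin.lastCases ?_ (fun k => ?_) k
  · rw [adaptVec_last]
    exact hk _ (fin_zero_ne_last (by omega)).symm (fin_one_ne_last (by omega)).symm
  · rw [adaptVec_pair_castSucc, hb0, hb1]
    by_cases k0 : k = 0
    · subst k0
      have e : z (Fin.castSucc 0) = z 0 := rfl
      rw [e]
      simp only [PiLp.single_apply]
      rw [if_pos trivial, if_neg (by simp)]
      push_cast at h2 ⊢
      linear_combination (-z 0) * h2
    by_cases k1 : k = 1
    · subst k1
      have e : z (Fin.castSucc 1) = z 1 := rfl
      rw [e]
      simp only [PiLp.single_apply]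
      rw [if_pos trivial, if_neg (by simp)]
      obtain ⟨c, hc⟩ : ∃ c : ℂ, c = ((τ : ℝ) : ℂ) := ⟨_, rfl⟩
      rw [← hc] at hσ2 h01 ⊢
      rw [Complex.ofReal_zero]
      linear_combination Complex.I * c * z 0 * h2 + Complex.I * c * h01 - z 1 * hσ2 +
        c * c * z 1 * Complex.I_mul_I
    · have n0 : k.castSucc ≠ (0 : Fin (m + 4 + 1)) := fun h => k0 (Fin.castSucc_injective _ h)
      have n1 : k.castSucc ≠ (1 : Fin (m + 4 + 1)) := fun h => k1 (Fin.castSucc_injective _ h)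
      rw [hk _ n0 n1]
      simp [k0, k1]

lemma exists_unit_sq (q : ℂ) : ∃ l : ℂ, l * cj l = 1 ∧ cj l ^ 2 * q = ‖q‖ := by
  refine ⟨phase (q.arg / 2) 1, ?_, ?_⟩
  · rw [Complex.mul_conj, Complex.normSq_eq_norm_sq, norm_phase]; norm_num
  · nth_rewrite 2 [← Complex.norm_mul_exp_arg_mul_I q]
    rw [conj_phase, phase_pow]
    have : phase ((2 : ℕ) * -(q.arg / 2)) 1 * Complex.exp (q.arg * Complex.I) = 1 := by
      rw [phase, ← Complex.exp_add]
      rw [← Complex.exp_zero]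
      congr 1; push_cast; ring
    linear_combination (‖q‖ : ℂ) * this

/-- Points with `z₀ = z₁ = 0`, in adapted coordinates: a unit multiple of the vector of the first
`n` coordinates has orthogonal real and imaginary parts. -/
lemma exists_adapted_of_zero {z : Amb (m + 4)} (hz : z ∈ brieskornSphere (m + 4) p)
    (h0 : z 0 = 0) (h1 : z 1 = 0) (ε : ℝ) : ∃ (b : RealBasis m) (y₀ y₁ : ℂ),
      z = adaptVec b y₀ y₁ 0 0 0 (z (Fin.last _)) ∧ normSq y₁ ≤ normSq y₀ ∧
      FlowDiag p ε b 2 2 (2 + 2 * ε) (2 - 2 * ε) := by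
  obtain ⟨l, hl, hlq⟩ := exists_unit_sq (∑ k : Fin (m + 4), z k.castSucc ^ 2)
  obtain ⟨x, hx⟩ : ∃ x : Fin (m + 4) → ℂ, x = fun k => cj l * z k.castSucc := ⟨_, rfl⟩
  have hzx : ∀ k, z k.castSucc = l * x k := by
    intro k; rw [hx]; simp only; rw [← mul_assoc, hl, one_mul]
  obtain ⟨α, hα⟩ : ∃ α : EuclideanSpace ℝ (Fin (m + 4)), α = WithLp.toLp 2 fun k => (x k).re :=
    ⟨_, rfl⟩
  obtain ⟨β, hβ⟩ : ∃ β : EuclideanSpace ℝ (Fin (m + 4)), β = WithLp.toLp 2 fun k => (x k).im :=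
    ⟨_, rfl⟩
  have hαk : ∀ k, α k = (x k).re := fun k => by rw [hα]
  have hβk : ∀ k, β k = (x k).im := fun k => by rw [hβ]
  have hsum : ∑ k, x k ^ 2 = (‖∑ k : Fin (m + 4), z k.castSucc ^ 2‖ : ℂ) := by
    rw [← hlq, Finset.mul_sum, hx]
    exact Finset.sum_congr rfl fun k _ => by ring
  have hre := congrArg Complex.re hsum
  have him := congrArg Complex.im hsum
  rw [Complex.re_sum, Complex.ofReal_re] at hre
  rw [Complex.im_sum, Complex.ofReal_im] at him
  have hinner : inner ℝ α β = 0 := by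
    rw [PiLp.inner_apply]
    have : ∑ k, (x k ^ 2).im = 2 * ∑ k, inner ℝ (α k) (β k) := by
      rw [Finset.mul_sum]
      refine Finset.sum_congr rfl fun k _ => ?_
      rw [hαk, hβk, sq, Complex.mul_im]; simp; ring
    linarith
  have hnorm : ‖β‖ ^ 2 ≤ ‖α‖ ^ 2 := by
    rw [EuclideanSpace.norm_sq_eq, EuclideanSpace.norm_sq_eq]
    have : ∑ k, (x k ^ 2).re = ∑ k, ‖α k‖ ^ 2 - ∑ k, ‖β k‖ ^ 2 := by
      rw [← Finset.sum_sub_distrib]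
      refine Finset.sum_congr rfl fun k _ => ?_
      rw [hαk, hβk, sq, Complex.mul_re]; simp; ring
    have := norm_nonneg (∑ k : Fin (m + 4), z k.castSucc ^ 2)
    linarith
  have hle : ‖β‖ ≤ ‖α‖ := (sq_le_sq₀ (norm_nonneg _) (norm_nonneg _)).1 hnorm
  have hα0 : α ≠ 0 := by
    intro hα0
    have hβ0 : β = 0 := by
      rw [hα0, norm_zero] at hle
      exact norm_eq_zero.1 (le_antisymm hle (norm_nonneg _))
    have hz0 : ∀ k : Fin (m + 4), z k.castSucc = 0 := by
      intro k
      rw [hzx]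
      have : x k = 0 := by
        apply Complex.ext
        · rw [← hαk, hα0]; rfl
        · rw [← hβk, hβ0]; rfl
      rw [this, mul_zero]
    have hP := hz.1
    rw [brieskornPoly, Fin.sum_univ_castSucc] at hP
    simp only [hz0, brieskornExp_castSucc, brieskornExp_last] at hP
    simp at hP
    refine brieskornSphere_ne_zero hz (PiLp.ext fun k => ?_)
    exact Fin.lastCases hP.1 hz0 k
  have hx0 : x 0 = 0 := by
    have : z (Fin.castSucc 0) = 0 := h0
    rw [hx]; simp only; rw [this, mul_zero]
  have hx1 : x 1 = 0 := by
    have : z (Fin.castSucc 1) = 0 := h1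
    rw [hx]; simp only; rw [this, mul_zero]
  obtain ⟨b, b2, b3, bα, bβ⟩ := exists_basis_of_orthogonal hα0 hinner (by rw [hαk, hx0]; rfl)
    (by rw [hαk, hx1]; rfl) (by rw [hβk, hx0]; rfl) (by rw [hβk, hx1]; rfl)
  refine ⟨b, l * ((√2)⁻¹ * (‖α‖ + ‖β‖) : ℝ), l * ((√2)⁻¹ * (‖α‖ - ‖β‖) : ℝ), ?_, ?_,
    flowDiag_of_second b2 b3 ε⟩
  · ext k
    refine Fin.lastCases ?_ (fun k => ?_) k
    · rw [adaptVec_last]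
    · rw [adaptVec_pair_castSucc, hzx]
      have e1 : (x k).re = ‖α‖ * b 0 k := by
        rw [← hαk]
        have := congrArg (fun v : EuclideanSpace ℝ (Fin (m + 4)) => v k) bα
        simpa using this
      have e2 : (x k).im = -(‖β‖ * b 1 k) := by
        rw [← hβk]
        have := congrArg (fun v : EuclideanSpace ℝ (Fin (m + 4)) => v k) bβ
        simpa using this
      have e3 : x k = ((‖α‖ * b 0 k : ℝ) : ℂ) + ((-(‖β‖ * b 1 k) : ℝ) : ℂ) * Complex.I := by
        rw [← e1, ← e2, Complex.re_add_im]
      rw [e3]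
      have := inv_sqrt_two_mul_self
      push_cast at this ⊢
      linear_combination (-2 * l * (‖α‖ * b 0 k - Complex.I * ‖β‖ * b 1 k)) * this
  · rw [map_mul, map_mul, Complex.normSq_ofReal, Complex.normSq_ofReal]
    refine mul_le_mul_of_nonneg_left ?_ (Complex.normSq_nonneg _)
    have h5 : 0 ≤ (√2)⁻¹ * (√2)⁻¹ * (4 * (‖α‖ * ‖β‖)) := by positivity
    linarith

/-- The Conley–Zehnder index of the orbits of period `period ε τ L`. -/
def czIndex (m p : ℕ) (ε : ℝ) (τ : SignType) (L : ℕ) : ℤ :=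
  if τ = 0 then rotIndex (L + ε * L / 2) + rotIndex (-(ε * L / 2)) + rotIndex (L / p) +
      m * rotIndex (L / 2)
  else rotIndex ((2 + τ * ε) * L / (2 * (1 + τ * ε))) +
    rotIndex (-(τ * ε * L / (2 * (1 + τ * ε)))) + rotIndex (L / (p * (1 + τ * ε))) +
      m * rotIndex (L / (2 * (1 + τ * ε)))

theorem hasConleyZehnderIndex_period {ε : ℝ} (hp : 2 ≤ p) (h0 : 0 < ε)
    (h1 : ε < 1) {φ : ℝ → Amb (m + 4) → Amb (m + 4)} (hφ : IsPerturbedReebFlow (m + 4) p ε φ)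
    (τ : SignType) {L : ℕ} (hL : 0 < L) (hLe : Even L) {z : Amb (m + 4)}
    (hz : z ∈ fixedSet (m + 4) p τ L) :
    HasConleyZehnderIndex (m + 4 - 1) (brieskornSphere (m + 4) p) (brieskornTangent (m + 4) p)
      (perturbedForm (m + 4) p ε) φ (period ε τ L) z (czIndex m p ε τ L) := by
  have hpi := Real.pi_ne_zero
  have hp' : (p : ℝ) ≠ 0 := by exact_mod_cast (by omega : p ≠ 0)
  have hT := period_pos h0 h1 τ hL
  obtain ⟨N, hN⟩ := hLe
  have hNr : (L : ℝ) = 2 * N := by rw [hN]; push_cast; ring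
  by_cases hτ : τ = 0
  · subst hτ
    have hper : period ε 0 L = L * Real.pi / 2 := by simp [period]
    rw [fixedSet, if_pos rfl] at hz
    obtain ⟨hzS, z0, z1, hl⟩ := hz
    obtain ⟨b, y₀, y₁, hzb, hy, hfd⟩ := exists_adapted_of_zero hzS z0 z1 ε
    obtain ⟨w, hw⟩ : ∃ w, w = z (Fin.last _) := ⟨_, rfl⟩
    rw [← hw] at hzb hl
    subst hzb
    obtain ⟨j, hj⟩ : ∃ j : ℕ, w = 0 ∨ (4 / p : ℝ) * period ε 0 L = 2 * Real.pi * j := by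
      rcases hl with ⟨j, hj⟩ | h
      · refine ⟨j, Or.inr ?_⟩
        have : (L : ℝ) = p * j := by exact_mod_cast hj
        rw [hper, this]; field_simp; ring
      · exact ⟨0, Or.inl h⟩
    have key := hasConleyZehnderIndex_adaptVec hp h0 h1 hφ hfd (by norm_num) hzS hy hT (N := N)
      (by rw [hper, hNr]; ring) hj (by linarith) (by linarith)
    convert key using 3
    rw [czIndex, if_pos rfl, hper]
    congr 1
    · congr 1
      · congr 1
        · congr 1; field_simp; ring
        · congr 1; field_simp; ring
      · congr 1; field_simp; ring
    · congr 2; field_simp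
  · have hpos := (one_add_sign_mul_pos h0 h1 τ).ne'
    obtain ⟨b, y₀, hzb, hfd⟩ := exists_adapted_of_sign hτ hz ε
    have hzS : z ∈ brieskornSphere (m + 4) p := by
      rw [fixedSet, if_neg hτ] at hz; exact hz.1
    subst hzb
    have hper := period_mul h0 h1 τ L
    have hσ := sign_cast_cases hτ
    have key := hasConleyZehnderIndex_adaptVec hp h0 h1 hφ hfd (by ring) hzS
      (by rw [map_zero]; exact Complex.normSq_nonneg _) hT (N := N) (j := 0)
      (by push_cast at hper; rw [hNr] at hper; linear_combination 2 * hper) (Or.inl rfl)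
      (by rcases hσ with h | h <;> rw [h] <;> linarith)
      (by rcases hσ with h | h <;> rw [h] <;> linarith)
    convert key using 3
    rw [czIndex, if_neg hτ, period]
    congr 1
    · congr 1
      · congr 1
        · congr 1; field_simp; ring
        · congr 1; field_simp; ring
      · congr 1; field_simp; ring
    · congr 2; field_simp

end OrbitIndex

/-! ### Dimensions of the manifolds of closed orbits -/

section Dimensions

open Module

variable {n p : ℕ}

lemma finrank_amb (n : ℕ) : finrank ℝ (Amb n) = 2 * (n + 1) := by
  rw [finrank_real_of_complex, finrank_euclideanSpace_fin]

lemma finrank_pi_complex (ι : Type*) [Fintype ι] : finrank ℝ (ι → ℂ) = 2 * Fintype.card ι := by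
  rw [finrank_real_of_complex, finrank_fintype_fun_eq_card]

lemma dim_of_slice (hp : 2 ≤ p) {N : Set (Amb n)} {s : Finset (Fin (n + 1))} {x : Amb n}
    (hx : x ∈ N) (hN : N = {y | y ∈ brieskornSphere n p ∧ ∀ k ∈ s, y k = 0}) {d : ℕ}
    {ψ : EuclideanSpace ℝ (Fin d) → Amb n} (h : IsLocalParam N x d ψ) :
    d + (2 * s.card + 3) = 2 * (n + 1) := by
  have hx' := hx
  rw [hN] at hx'
  have hN' : N = {y | sliceMap n p s y = sliceMap n p s x} := by
    rw [hN]; ext y; exact (mem_slice_iff hx'.1 hx'.2).symm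
  have := h.dim_eq (hasStrictFDerivAt_sliceMap s x) (surjective_sliceMap_deriv hp hx'.1 hx'.2) hN'
  rw [finrank_prod, finrank_prod, finrank_pi_complex, Complex.finrank_real_complex,
    finrank_self, finrank_amb, Fintype.card_coe] at this
  omega

/-- The linear equations of the planes of the two exceptional orbits. -/
def axisEq (n : ℕ) (c : ℂ) : Amb n →L[ℝ] ℂ × ({k : Fin (n + 1) // k ≠ 0 ∧ k ≠ 1} → ℂ) :=
  LinearMap.toContinuousLinearMap
    { toFun := fun z => (z 0 - c * z 1, fun k => z k)
      map_add' := fun x y => by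
        refine Prod.ext ?_ rfl
        change x 0 + y 0 - c * (x 1 + y 1) = x 0 - c * x 1 + (y 0 - c * y 1)
        ring
      map_smul' := fun r x => by
        refine Prod.ext ?_ rfl
        change r • x 0 - c * (r • x 1) = r • (x 0 - c * x 1)
        rw [smul_sub, mul_smul_comm] }

lemma axisEq_apply (c : ℂ) (z : Amb n) : axisEq n c z = (z 0 - c * z 1, fun k => z k.1) := rfl

lemma fderiv_sq_self (z : Amb n) (hz : ‖z‖ = 1) : fderiv ℝ (perturbK n 0) z z = 2 := by
  rw [fderiv_perturbK, hamOp_zero, inner_self_eq_norm_sq_to_K, hz]; simp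

lemma mem_axis_iff (hn : 2 ≤ n) (hp : 0 < p) {c : ℂ} (hc : c ^ 2 = -1) {z : Amb n} :
    (z ∈ brieskornSphere n p ∧ z 0 - c * z 1 = 0 ∧ ∀ k, k ≠ 0 → k ≠ 1 → z k = 0) ↔
      axisEq n c z = 0 ∧ perturbK n 0 z = 1 := by
  rw [perturbK_zero, axisEq_apply, Prod.mk_eq_zero]
  constructor
  · rintro ⟨⟨-, h1⟩, h2, h3⟩
    exact ⟨⟨h2, funext fun k => h3 k k.2.1 k.2.2⟩, by rw [h1]; norm_num⟩
  · rintro ⟨⟨h2, h3⟩, h1⟩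
    have h3' : ∀ k, k ≠ 0 → k ≠ 1 → z k = 0 := fun k k0 k1 => congrFun h3 ⟨k, k0, k1⟩
    refine ⟨⟨?_, ?_⟩, h2, h3'⟩
    · rw [brieskornPoly, sum_eq_of_pair hn (G := fun k => if k = 0 then z 0 ^ 2 + z 1 ^ 2 else 0)]
      · rw [Finset.sum_ite_eq' Finset.univ 0]
        simp only [Finset.mem_univ, if_true]
        have : z 0 = c * z 1 := by linear_combination h2
        rw [this, mul_pow, hc]; ring
      · rw [brieskornExp_zero hn, brieskornExp_one hn, if_pos rfl,
          if_neg (fin_zero_ne_one hn).symm, add_zero]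
      · intro k k0 k1
        rw [h3' k k0 k1, zero_pow (brieskornExp_pos hp k).ne', if_neg k0]
    · have : (‖z‖ - 1) * (‖z‖ + 1) = 0 := by linear_combination h1
      have := (mul_eq_zero.1 this).resolve_right (by have := norm_nonneg z; positivity)
      linarith

lemma dim_of_axis (hn : 2 ≤ n) (hp : 0 < p) {c : ℂ} (hc : c ^ 2 = -1) {N : Set (Amb n)}
    (hN : N = {z | z ∈ brieskornSphere n p ∧ z 0 - c * z 1 = 0 ∧ ∀ k, k ≠ 0 → k ≠ 1 → z k = 0})
    {x : Amb n} (hx : x ∈ N) {d : ℕ}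
    {ψ : EuclideanSpace ℝ (Fin d) → Amb n} (h : IsLocalParam N x d ψ) : d = 1 := by
  have hx' := hx
  rw [hN] at hx'
  obtain ⟨hx0, hx1⟩ := (mem_axis_iff hn hp hc).1 hx'
  have hN' : N = {y | (axisEq n c y, perturbK n 0 y) = (axisEq n c x, perturbK n 0 x)} := by
    rw [hN]; ext y
    refine (mem_axis_iff hn hp hc).trans ?_
    change _ ↔ (axisEq n c y, perturbK n 0 y) = _
    rw [hx0, hx1]
    exact Prod.mk_inj.symm
  have hsurj : Function.Surjective ((axisEq n c).prod (fderiv ℝ (perturbK n 0) x)) := by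
    rintro ⟨⟨a, y⟩, r⟩
    obtain ⟨v, hv⟩ : ∃ v : Amb n, v = WithLp.toLp 2 fun k => if h : k ≠ 0 ∧ k ≠ 1 then y ⟨k, h⟩
      else if k = 0 then a else 0 := ⟨_, rfl⟩
    have h10 := (fin_zero_ne_one hn).symm
    have hva : axisEq n c v = (a, y) := by
      rw [axisEq_apply]
      refine Prod.ext ?_ (funext fun k => ?_)
      · rw [hv]; simp [h10]
      · rw [hv]; simp [k.2]
    refine ⟨v + ((r - fderiv ℝ (perturbK n 0) x v) / 2) • x, ?_⟩
    rw [ContinuousLinearMap.prod_apply, map_add, map_add, map_smul, map_smul, hx0, hva,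
      fderiv_sq_self x hx'.1.2]
    simp
  have := h.dim_eq ((axisEq n c).hasStrictFDerivAt.prodMk
    ((contDiff_perturbK 0).contDiffAt.hasStrictFDerivAt (by simp))) hsurj hN'
  have hcard : Fintype.card {k : Fin (n + 1) // k ≠ 0 ∧ k ≠ 1} = n - 1 := by
    rw [Fintype.card_subtype]
    have : (Finset.univ.filter fun k : Fin (n + 1) => k ≠ 0 ∧ k ≠ 1) =
        (Finset.univ.erase 0).erase 1 := by
      ext k; simp [and_comm]
    rw [this, Finset.card_erase_of_mem (by simp [(fin_zero_ne_one hn).symm]),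
      Finset.card_erase_of_mem (by simp)]
    simp
  rw [finrank_prod, finrank_prod, finrank_pi_complex, Complex.finrank_real_complex,
    finrank_self, finrank_amb, hcard] at this
  omega

/-- The dimension of `fixedSet n p τ L`. -/
def fixedDim (n p : ℕ) (τ : SignType) (L : ℕ) : ℕ :=
  if τ = 0 then (if p ∣ L then 2 * n - 5 else 2 * n - 7) else 1

theorem IsLocalParam.dim_fixedSet (hn : 5 ≤ n) (hp : 2 ≤ p) {τ : SignType} {L d : ℕ} {x : Amb n}
    {ψ : EuclideanSpace ℝ (Fin d) → Amb n} (h : IsLocalParam (fixedSet n p τ L) x d ψ) :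
    d = fixedDim n p τ L := by
  rw [fixedDim]
  split_ifs with hτ hL
  · have := dim_of_slice hp (s := {0, 1}) h.1 (by
      ext z; simp [fixedSet, hτ, hL]) h
    rw [Finset.card_pair (fin_zero_ne_one (by omega))] at this
    omega
  · have := dim_of_slice hp (s := {0, 1, Fin.last n}) h.1 (by
      ext z; simp [fixedSet, hτ, hL]) h
    have hc : ({0, 1, Fin.last n} : Finset (Fin (n + 1))).card = 3 :=
      Finset.card_eq_three.2 ⟨0, 1, Fin.last n, fin_zero_ne_one (by omega),
        fin_zero_ne_last (by omega), fin_one_ne_last (by omega), rfl⟩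
    rw [hc] at this
    omega
  · refine dim_of_axis (p := p) (by omega) (by omega) (c := ((τ : ℝ) : ℂ) * Complex.I) ?_ ?_ h.1 h
    · rw [mul_pow, Complex.I_sq]
      rcases sign_cast_cases hτ with h | h <;> rw [h] <;> norm_num
    · rw [fixedSet, if_neg hτ]

end Dimensions

/-! ### Counting closed orbits -/

section Counting

variable {m p : ℕ}

/-- The Morse indices of the critical points on the manifold of orbits of period `period ε τ L`,
for `n = m + 4`. -/
def morseIndices (m p : ℕ) (τ : SignType) (L : ℕ) : Finset ℕ :=
  if τ = 0 then (if p ∣ L then {0, 2 * m + 3} else {0, m, m + 1, 2 * m + 1}) else {0, 1}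

/-- `(dim - 1) / 2` for the manifold of orbits of period `period ε τ L`, for `n = m + 4`. -/
def halfDim (m p : ℕ) (τ : SignType) (L : ℕ) : ℕ :=
  if τ = 0 then (if p ∣ L then m + 1 else m) else 0

lemma fixedDim_eq (m p : ℕ) (τ : SignType) (L : ℕ) :
    fixedDim (m + 4) p τ L = 2 * halfDim m p τ L + 1 := by
  rw [fixedDim, halfDim]; split_ifs <;> omega

/-- The labels `(τ, L, c)` of the critical points (of Morse index `c`, with the period
`period ε τ L`) that have the Morse–Bott index `k`. -/
def labels (m p : ℕ) (ε : ℝ) (k : ℤ) : Set (SignType × ℕ × ℕ) :=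
  {l | Even l.2.1 ∧ 0 < l.2.1 ∧ l.2.2 ∈ morseIndices m p l.1 l.2.1 ∧
    k = czIndex m p ε l.1 l.2.1 + l.2.2 - halfDim m p l.1 l.2.1}

lemma isMorseWithIndices_period {ε : ℝ} {φ : ℝ → Amb (m + 4) → Amb (m + 4)}
    {h : ℝ → Amb (m + 4) → ℝ} (H : IsMorseChoice (m + 4) p ε φ h) (τ : SignType) {L : ℕ}
    (hL : 0 < L) (hLe : Even L) :
    IsMorseWithIndices (periodicSet (brieskornSphere (m + 4) p) φ (period ε τ L))
      (h (period ε τ L)) (morseIndices m p τ L) := by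
  obtain ⟨h1, h2, h3, h4⟩ := H L hLe hL
  cases τ
  · have hper : period ε SignType.zero L = L * Real.pi / 2 := by
      have : ((SignType.zero : SignType) : ℝ) = 0 := by simp
      rw [period, this]; ring
    rw [hper]
    have e : morseIndices m p SignType.zero L =
      if p ∣ L then {0, 2 * m + 3} else {0, m, m + 1, 2 * m + 1} := rfl
    rw [e]
    split_ifs with hd
    · have := h2 hd
      rwa [show 2 * (m + 4) - 5 = 2 * m + 3 by omega] at this
    · have := h1 hd
      rwa [show m + 4 - 4 = m by omega, show m + 4 - 3 = m + 1 by omega,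
        show 2 * (m + 4) - 7 = 2 * m + 1 by omega] at this
  · have hper : period ε SignType.neg L = L * Real.pi / (2 * (1 - ε)) := by
      have : ((SignType.neg : SignType) : ℝ) = -1 := by simp
      rw [period, this]; ring
    rw [hper]
    exact h4
  · have hper : period ε SignType.pos L = L * Real.pi / (2 * (1 + ε)) := by
      have : ((SignType.pos : SignType) : ℝ) = 1 := by simp
      rw [period, this]; ring
    rw [hper]
    exact h3

/-- On each manifold of closed orbits there is one critical point for each admissible Morse index,
and `(τ, L)` is determined by the period: critical points correspond to labels. -/
theorem perturbedCount_eq {ε : ℝ} (hm : 1 ≤ m) (hp : 2 ≤ p) (hε : Irrational ε) (h0 : 0 < ε)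
    (h1 : ε < 1) {φ : ℝ → Amb (m + 4) → Amb (m + 4)} (hφ : IsPerturbedReebFlow (m + 4) p ε φ)
    {h : ℝ → Amb (m + 4) → ℝ} (H : IsMorseChoice (m + 4) p ε φ h) (k : ℤ) :
    perturbedCount (m + 4) p ε φ h k = (labels m p ε k).encard := by
  have hset := fun (τ : SignType) (L : ℕ) (hL : 0 < L) (hLe : Even L) =>
    periodicSet_period (n := m + 4) (by omega) (by omega : 0 < p) hε h0 h1 hφ τ hL hLe
  have hM := fun (τ : SignType) (L : ℕ) (hL : 0 < L) (hLe : Even L) =>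
    isMorseWithIndices_period H τ hL hLe
  have hpt : ∀ l : SignType × ℕ × ℕ, ∃ x : Amb (m + 4), Even l.2.1 → 0 < l.2.1 →
      l.2.2 ∈ morseIndices m p l.1 l.2.1 →
      ∃ d, HasMorseIndexOn (periodicSet (brieskornSphere (m + 4) p) φ (period ε l.1 l.2.1))
        (h (period ε l.1 l.2.1)) x d l.2.2 := by
    intro l
    by_cases hl : Even l.2.1 ∧ 0 < l.2.1 ∧ l.2.2 ∈ morseIndices m p l.1 l.2.1
    · obtain ⟨x, hx, -⟩ := (hM l.1 l.2.1 hl.2.1 hl.1).2.2 l.2.2 hl.2.2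
      exact ⟨x, fun _ _ _ => hx⟩
    · exact ⟨0, fun a b c => absurd ⟨a, b, c⟩ hl⟩
  choose pt hpt using hpt
  have hinj : Set.InjOn (fun l : SignType × ℕ × ℕ => (period ε l.1 l.2.1, pt l))
      (labels m p ε k) := by
    rintro ⟨τ, L, c⟩ ⟨a1, a2, a3, -⟩ ⟨τ', L', c'⟩ ⟨b1, b2, b3, -⟩ heq
    obtain ⟨e1, e2⟩ := Prod.mk.inj heq
    obtain ⟨rfl, rfl⟩ := period_inj hε h0 h1 a2 e1
    obtain ⟨d, hd⟩ := hpt _ a1 a2 a3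
    obtain ⟨d', hd'⟩ := hpt _ b1 b2 b3
    rw [← e2] at hd'
    have := (hd.unique (hM _ _ a2 a1).1 hd').2
    simp only at this
    rw [this]
  rw [← hinj.encard_image]
  unfold perturbedCount closedOrbitCount
  congr 1
  ext ⟨T, x⟩
  constructor
  · rintro ⟨hT, d, c, μ, hMI, hCZ, hk⟩
    simp only at hT hMI hCZ
    have hMI' := hMI
    obtain ⟨ψ, hψ, hcrit, -⟩ := hMI'
    have hx := hψ.1
    have hxf := hx.2
    rw [perturbedReebFlow_unique (by omega) (by omega) h0 h1 hφ hx.1] at hxf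
    obtain ⟨τ, L, hLe, hL, rfl⟩ := exists_period (by omega) (by omega) h0 h1 hT hx.1 hxf
    obtain ⟨c', hc', d', hMI''⟩ := (hM τ L hL hLe).2.1 x ⟨d, ψ, hψ, hcrit⟩
    obtain ⟨rfl, rfl⟩ := hMI.unique (hM τ L hL hLe).1 hMI''
    obtain ⟨y, -, hy⟩ := (hM τ L hL hLe).2.2 c hc'
    have hfix := hset τ L hL hLe ▸ hx
    have hμ := HasConleyZehnderIndex.unique (by omega) hp h0 h1 hφ hx.1 hT hCZ
      (hasConleyZehnderIndex_period hp h0 h1 hφ τ hL hLe hfix)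
    have hd : d = 2 * halfDim m p τ L + 1 := by
      rw [← fixedDim_eq]
      exact IsLocalParam.dim_fixedSet (by omega) hp (hset τ L hL hLe ▸ hψ)
    refine ⟨(τ, L, c), ⟨hLe, hL, hc', ?_⟩, ?_⟩
    · rw [hμ, hd] at hk
      have : (k : ℝ) = ((czIndex m p ε τ L + c - halfDim m p τ L : ℤ) : ℝ) := by
        rw [hk]; push_cast; ring
      exact_mod_cast this
    · refine Prod.ext rfl ?_
      exact (hy _ (hpt (τ, L, c) hLe hL hc')).trans (hy _ ⟨d, hMI⟩).symm
  · rintro ⟨⟨τ, L, c⟩, ⟨hLe, hL, hc, hk⟩, heq⟩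
    obtain ⟨rfl, rfl⟩ := Prod.mk.inj heq
    simp only at hLe hL hc hk
    obtain ⟨d, hMI⟩ := hpt (τ, L, c) hLe hL hc
    refine ⟨period_pos h0 h1 τ hL, d, c, czIndex m p ε τ L, hMI, ?_, ?_⟩
    · obtain ⟨ψ, hψ, -⟩ := hMI
      exact hasConleyZehnderIndex_period hp h0 h1 hφ τ hL hLe (hset τ L hL hLe ▸ hψ.1)
    · obtain ⟨ψ, hψ, -⟩ := hMI
      have hd : d = 2 * halfDim m p τ L + 1 := by
        rw [← fixedDim_eq]
        exact IsLocalParam.dim_fixedSet (by omega) hp (hset τ L hL hLe ▸ hψ)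
      rw [hk, hd]; push_cast; ring

end Counting

/-! ### The values of the indices -/

section IndexValues

variable {m p : ℕ}

/-- `⌈l / p⌉ - 1`, as a floor quotient. -/
def stepFun (p : ℕ) (l : ℤ) : ℤ := (l - 1) / (p : ℤ)

lemma rotIndex_of_lt {p : ℕ} (hp : 0 < p) {a : ℤ} {x : ℝ} (h1 : (a : ℝ) < x * p)
    (h2 : x * p < a + 1) : rotIndex x = 2 * (a / (p : ℤ)) + 1 := by
  have hpr : (0 : ℝ) < p := by exact_mod_cast hp
  have hpz : (0 : ℤ) < p := by exact_mod_cast hp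
  have e := Int.mul_ediv_add_emod a p
  have e1 := Int.emod_nonneg a hpz.ne'
  have e2 := Int.emod_lt_of_pos a hpz
  have i1 : (p : ℝ) * (a / (p : ℤ) : ℤ) ≤ a := by exact_mod_cast (by omega : (p : ℤ) * (a / p) ≤ a)
  have i2 : (a : ℝ) + 1 ≤ p * (a / (p : ℤ) : ℤ) + p := by
    exact_mod_cast (by omega : a + 1 ≤ (p : ℤ) * (a / p) + p)
  have j1 : ((a / (p : ℤ) : ℤ) : ℝ) < x := by nlinarith
  have j2 : x < ((a / (p : ℤ) : ℤ) : ℝ) + 1 := by nlinarith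
  have f : ⌊x⌋ = a / (p : ℤ) := Int.floor_eq_iff.2 ⟨j1.le, j2⟩
  have c : ⌈x⌉ = a / (p : ℤ) + 1 := Int.ceil_eq_iff.2 ⟨by push_cast; linarith, by push_cast; linarith⟩
  rw [rotIndex, f, c]; ring

lemma ceil_div_eq {p : ℕ} (hp : 0 < p) (l : ℤ) : ⌈(l : ℚ) / (p : ℚ)⌉ = stepFun p l + 1 := by
  have hpr : (0 : ℚ) < p := by exact_mod_cast hp
  have hpz : (0 : ℤ) < p := by exact_mod_cast hp
  have e := Int.mul_ediv_add_emod (l - 1) p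
  have e1 := Int.emod_nonneg (l - 1) hpz.ne'
  have e2 := Int.emod_lt_of_pos (l - 1) hpz
  rw [Int.ceil_eq_iff, lt_div_iff₀ hpr, div_le_iff₀ hpr, stepFun]
  constructor
  · have : ((l - 1) / (p : ℤ)) * p < l := by rw [mul_comm]; omega
    push_cast
    have h2 : ((((l - 1) / (p : ℤ) : ℤ) : ℚ)) * p < l := by exact_mod_cast this
    linarith
  · have : l ≤ ((l - 1) / (p : ℤ) + 1) * p := by rw [add_mul, mul_comm]; omega
    exact_mod_cast this

lemma indexFun_eq {n p : ℕ} (hp : 0 < p) (l : ℤ) :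
    indexFun n p l = (l - 1) * ((n : ℤ) - 2) + 2 * stepFun p l + 2 := by
  rw [indexFun, ceil_div_eq hp]; ring

lemma rotIndex_natCast_div {p : ℕ} (hp : 0 < p) (L : ℕ) :
    rotIndex ((L : ℝ) / p) = stepFun p (L + 1) + stepFun p L + 1 := by
  have h1 := ceil_div_eq hp (L : ℤ)
  have h2 : ⌈(L : ℝ) / p⌉ = ⌈((L : ℤ) : ℚ) / (p : ℚ)⌉ := by
    rw [← Rat.ceil_cast (α := ℝ)]; push_cast; rfl
  have h3 : ⌊(L : ℝ) / p⌋ = (L : ℤ) / p := by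
    have : ((L / p : ℕ) : ℤ) = (L : ℤ) / p := by push_cast; rfl
    rw [← this, ← Nat.floor_div_eq_div (K := ℝ), Int.natCast_floor_eq_floor (by positivity)]
  have h4 : stepFun p (L + 1) = (L : ℤ) / p := by rw [stepFun, add_sub_cancel_right]
  rw [rotIndex, h2, h1, h3, h4]; ring

lemma stepFun_succ {p : ℕ} (hp : 2 ≤ p) (l : ℤ) :
    stepFun p (l + 1) = stepFun p l + if (p : ℤ) ∣ l then 1 else 0 := by
  have hpz : (0 : ℤ) < p := by exact_mod_cast (by omega : 0 < p)
  unfold stepFun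
  rw [add_sub_cancel_right]
  have e := Int.mul_ediv_add_emod (l - 1) p
  have e1 := Int.emod_nonneg (l - 1) hpz.ne'
  have e2 := Int.emod_lt_of_pos (l - 1) hpz
  split_ifs with h
  · obtain ⟨j, rfl⟩ := h
    rw [Int.mul_ediv_cancel_left _ hpz.ne']
    have : (p * j - 1) / (p : ℤ) = j - 1 := by
      rw [Int.ediv_eq_iff_of_pos hpz]
      constructor
      · rw [sub_mul, mul_comm]; omega
      · rw [sub_mul, mul_comm]; omega
    omega
  · have hne : (l - 1) % p + 1 ≠ p := by
      intro h5
      refine h ⟨(l - 1) / p + 1, ?_⟩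
      rw [mul_add]; omega
    rw [add_zero, Int.ediv_eq_iff_of_pos hpz]
    constructor
    · rw [mul_comm]; omega
    · rw [mul_comm]; omega

/-- The Conley–Zehnder indices in the limit of a small perturbation. -/
def czLimit (m p : ℕ) (τ : SignType) (L : ℕ) : ℤ :=
  match τ with
  | 0 => (m + 2) * L + stepFun p (L + 1) + stepFun p L + 1
  | 1 => (m + 2) * L - m - 1 + 2 * stepFun p L
  | -1 => (m + 2) * L + m + 3 + 2 * stepFun p (L + 1)

lemma czIndex_eq_rot {ε : ℝ} (h0 : 0 < ε) (h1 : ε < 1) {τ : SignType} (hτ : τ ≠ 0) (L : ℕ) :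
    czIndex m p ε τ L = rotIndex (L - τ * (ε * L / (2 * (1 + τ * ε)))) +
      rotIndex (-(τ * (ε * L / (2 * (1 + τ * ε))))) +
      rotIndex ((L - 2 * τ * (ε * L / (2 * (1 + τ * ε)))) / p) +
      m * rotIndex ((L - 2 * τ * (ε * L / (2 * (1 + τ * ε)))) / 2) := by
  have hpos := (one_add_sign_mul_pos h0 h1 τ).ne'
  rw [czIndex, if_neg hτ]
  congr 1
  · congr 1
    · congr 1
      · congr 1; field_simp; ring
      · congr 1; field_simp
    · congr 1
      rw [← div_div, div_right_comm]
      congr 1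
      field_simp; ring
  · congr 2; field_simp; ring

lemma czIndex_eq_limit {ε : ℝ} (hp : 2 ≤ p) (h0 : 0 < ε) (τ : SignType) {L : ℕ}
    (hL : 0 < L) (hLe : Even L) (hεL : ε * L < 1 / 2) : czIndex m p ε τ L = czLimit m p τ L := by
  have hLr : (1 : ℝ) ≤ L := by exact_mod_cast hL
  have h1 : ε < 1 / 2 := by nlinarith
  have hpos : 0 < ε * L := by positivity
  have hp0 : 0 < p := by omega
  have hpr : (p : ℝ) ≠ 0 := by exact_mod_cast hp0.ne'
  obtain ⟨N, rfl⟩ := hLe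
  by_cases hτ : τ = 0
  · subst hτ
    have a1 : rotIndex (((N + N : ℕ) : ℝ) + ε * (N + N : ℕ) / 2) = 2 * ((N + N : ℕ) : ℤ) + 1 := by
      have := rotIndex_of_lt (p := 1) one_pos (a := ((N + N : ℕ) : ℤ))
        (x := ((N + N : ℕ) : ℝ) + ε * (N + N : ℕ) / 2) (by push_cast at *; linarith)
        (by push_cast at *; linarith)
      rwa [Nat.cast_one, Int.ediv_one] at this
    have a2 : rotIndex (-(ε * (N + N : ℕ) / 2)) = -1 := by
      have := rotIndex_of_lt (p := 1) one_pos (a := -1)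
        (x := -(ε * (N + N : ℕ) / 2)) (by push_cast at *; linarith)
        (by push_cast at *; linarith)
      rwa [Nat.cast_one, Int.ediv_one] at this
    have a3 : rotIndex (((N + N : ℕ) : ℝ) / 2) = 2 * N := by
      have : ((N + N : ℕ) : ℝ) / 2 = (N : ℤ) := by push_cast; ring
      rw [rotIndex, this, Int.floor_intCast, Int.ceil_intCast]; ring
    rw [czIndex, if_pos rfl, a1, a2, rotIndex_natCast_div hp0, a3]
    change _ = (m + 2) * ((N + N : ℕ) : ℤ) + stepFun p ((N + N : ℕ) + 1) + stepFun p (N + N : ℕ) + 1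
    push_cast; ring
  · rw [czIndex_eq_rot h0 (by linarith) hτ]
    have hτ' := one_add_sign_mul_pos h0 (by linarith : ε < 1) τ
    obtain ⟨η, hη⟩ : ∃ η : ℝ, η = ε * (N + N : ℕ) / (2 * (1 + (τ : ℝ) * ε)) := ⟨_, rfl⟩
    rw [← hη]
    have hη0 : 0 < η := by rw [hη]; positivity
    have hη1 : 2 * η < 1 := by
      have hτ2 : 1 / 2 < 1 + (τ : ℝ) * ε := by
        rcases sign_cast_cases hτ with h | h <;> rw [h] <;> linarith
      have : 2 * η * (1 + (τ : ℝ) * ε) = ε * (N + N : ℕ) := by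
        rw [hη, div_eq_mul_inv, mul_inv]
        have := mul_inv_cancel₀ hτ'.ne'
        linear_combination (ε * (N + N : ℕ)) * this
      nlinarith
    have key : ∀ (s t : ℝ) (a : ℤ), (a : ℝ) < ((N + N : ℕ) : ℝ) - s →
        ((N + N : ℕ) : ℝ) - s < a + 1 → (t = s) → ∀ q : ℕ, 0 < q →
        rotIndex ((((N + N : ℕ) : ℝ) - t) / q) = 2 * (a / (q : ℤ)) + 1 := by
      rintro s t a c1 c2 rfl q hq
      have hq' : (q : ℝ) ≠ 0 := by exact_mod_cast hq.ne'
      refine rotIndex_of_lt hq ?_ ?_ <;> rw [div_mul_cancel₀ _ hq'] <;> assumption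
    cases τ
    · exact absurd rfl hτ
    · have hc : ((SignType.neg : SignType) : ℝ) = -1 := by simp
      rw [hc]
      have a1 := key (-η) (-1 * η) (N + N : ℕ) (by push_cast; linarith) (by push_cast; linarith) (by ring) 1 one_pos
      have a2 := rotIndex_of_lt (p := 1) one_pos (a := 0) (x := -(-1 * η)) (by simpa using hη0)
        (by push_cast; linarith)
      have a3 := key (-(2 * η)) (2 * -1 * η) (N + N : ℕ) (by push_cast; linarith) (by push_cast; linarith)
        (by ring) p hp0
      have a4 := key (-(2 * η)) (2 * -1 * η) (N + N : ℕ) (by push_cast; linarith) (by push_cast; linarith)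
        (by ring) 2 two_pos
      rw [Nat.cast_one, div_one, Nat.cast_one, Int.ediv_one] at a1
      rw [Nat.cast_one, Int.ediv_one] at a2
      rw [Nat.cast_two] at a4
      have a5 : ((N + N : ℕ) : ℤ) / ((2 : ℕ) : ℤ) = N := by omega
      rw [a1, a2, a3, a4, a5]
      change _ = (m + 2) * ((N + N : ℕ) : ℤ) + m + 3 + 2 * stepFun p ((N + N : ℕ) + 1)
      rw [stepFun, add_sub_cancel_right]
      push_cast; ring
    · have hc : ((SignType.pos : SignType) : ℝ) = 1 := by simp
      rw [hc]
      have a1 := key η (1 * η) ((N + N : ℕ) - 1) (by push_cast; linarith) (by push_cast; linarith) (by ring) 1 one_pos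
      have a2 := rotIndex_of_lt (p := 1) one_pos (a := -1) (x := -(1 * η)) (by push_cast; linarith)
        (by push_cast; linarith)
      have a3 := key (2 * η) (2 * 1 * η) ((N + N : ℕ) - 1) (by push_cast; linarith) (by push_cast; linarith)
        (by ring) p hp0
      have a4 := key (2 * η) (2 * 1 * η) ((N + N : ℕ) - 1) (by push_cast; linarith) (by push_cast; linarith)
        (by ring) 2 two_pos
      rw [Nat.cast_one, div_one, Nat.cast_one, Int.ediv_one] at a1
      rw [Nat.cast_one, Int.ediv_one] at a2
      rw [Nat.cast_two] at a4
      have a5 : (((N + N : ℕ) : ℤ) - 1) / ((2 : ℕ) : ℤ) = N - 1 := by omega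
      rw [a1, a2, a3, a4, a5]
      change _ = (m + 2) * ((N + N : ℕ) : ℤ) - m - 1 + 2 * stepFun p (N + N : ℕ)
      rw [stepFun]
      push_cast; ring

lemma two_mul_sub_one_le_rotIndex (x : ℝ) : 2 * x - 1 ≤ rotIndex x := by
  have h1 := Int.lt_floor_add_one x
  have h2 := Int.le_ceil x
  rw [rotIndex]; push_cast; linarith

lemma rotIndex_nonneg {x : ℝ} (hx : 0 ≤ x) : 0 ≤ rotIndex x :=
  add_nonneg (Int.floor_nonneg.2 hx) (Int.ceil_nonneg hx)

/-- Orbits of long period have large index, whatever the size of the perturbation. -/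
lemma le_czIndex {ε : ℝ} (h0 : 0 < ε) (h1 : ε < 1) (τ : SignType) (L : ℕ) :
    (L : ℤ) - 2 ≤ czIndex m p ε τ L := by
  have hLr : (0 : ℝ) ≤ L := by positivity
  by_cases hτ : τ = 0
  · rw [czIndex, if_pos hτ]
    have i1 := two_mul_sub_one_le_rotIndex (L + ε * L / 2)
    have i2 := two_mul_sub_one_le_rotIndex (-(ε * L / 2))
    have i3 : 0 ≤ rotIndex ((L : ℝ) / p) := rotIndex_nonneg (by positivity)
    have i4 : 0 ≤ m * rotIndex ((L : ℝ) / 2) := mul_nonneg (by positivity) (rotIndex_nonneg (by positivity))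
    have i5 : (L : ℤ) - 2 ≤ rotIndex (L + ε * L / 2) + rotIndex (-(ε * L / 2)) := by
      have : ((L - 2 : ℤ) : ℝ) ≤ ((rotIndex (L + ε * L / 2) + rotIndex (-(ε * L / 2)) : ℤ) : ℝ) := by
        push_cast; linarith
      exact_mod_cast this
    linarith
  · rw [czIndex, if_neg hτ]
    have hpos := one_add_sign_mul_pos h0 h1 τ
    have i1 := two_mul_sub_one_le_rotIndex ((2 + τ * ε) * L / (2 * (1 + τ * ε)))
    have i2 := two_mul_sub_one_le_rotIndex (-(τ * ε * L / (2 * (1 + τ * ε))))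
    have i3 : 0 ≤ rotIndex ((L : ℝ) / (p * (1 + τ * ε))) := rotIndex_nonneg (by positivity)
    have i4 : 0 ≤ m * rotIndex ((L : ℝ) / (2 * (1 + τ * ε))) :=
      mul_nonneg (by positivity) (rotIndex_nonneg (by positivity))
    have e : (2 + τ * ε) * L / (2 * (1 + τ * ε)) + -(τ * ε * L / (2 * (1 + τ * ε))) =
        L / (1 + τ * ε) := by field_simp; ring
    have hle : (L : ℝ) / 2 ≤ L / (1 + τ * ε) := by
      refine div_le_div_of_nonneg_left hLr hpos ?_
      rcases sign_cast_cases hτ with h | h <;> rw [h] <;> linarith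
    have i5 : (L : ℤ) - 2 ≤ rotIndex ((2 + τ * ε) * L / (2 * (1 + τ * ε))) +
        rotIndex (-(τ * ε * L / (2 * (1 + τ * ε)))) := by
      have : ((L - 2 : ℤ) : ℝ) ≤ ((rotIndex ((2 + τ * ε) * L / (2 * (1 + τ * ε))) +
          rotIndex (-(τ * ε * L / (2 * (1 + τ * ε)))) : ℤ) : ℝ) := by
        push_cast; linarith
      exact_mod_cast this
    linarith

lemma stepFun_nonneg {p : ℕ} {l : ℤ} (hl : 1 ≤ l) : 0 ≤ stepFun p l :=
  Int.ediv_nonneg (by omega) (by omega)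

lemma le_czLimit (τ : SignType) {L : ℕ} (hL : 0 < L) : (L : ℤ) - 2 ≤ czLimit m p τ L := by
  have s1 : 0 ≤ stepFun p L := stepFun_nonneg (by omega)
  have s2 : 0 ≤ stepFun p (L + 1) := stepFun_nonneg (by omega)
  have hm : (m : ℤ) ≤ m * L := le_mul_of_one_le_right (by omega) (by omega)
  cases τ
  · change _ ≤ (m + 2) * (L : ℤ) + stepFun p (L + 1) + stepFun p L + 1
    rw [add_mul]; omega
  · change _ ≤ (m + 2) * (L : ℤ) + m + 3 + 2 * stepFun p (L + 1)
    rw [add_mul]; omega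
  · change _ ≤ (m + 2) * (L : ℤ) - m - 1 + 2 * stepFun p L
    rw [add_mul]; omega

/-- Below a given index the labels do not depend on the perturbation, when this is small. -/
lemma mem_labels_iff {ε : ℝ} (hp : 2 ≤ p) (h0 : 0 < ε) {k : ℤ} {B : ℕ} (hk : k + m + 3 ≤ B)
    (hB : ε * (B + 1) < 1 / 2) (τ : SignType) (L c : ℕ) :
    (τ, L, c) ∈ labels m p ε k ↔ Even L ∧ 0 < L ∧ c ∈ morseIndices m p τ L ∧
      k = czLimit m p τ L + c - halfDim m p τ L := by
  have hBr : (0 : ℝ) ≤ B := by positivity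
  have h1 : ε < 1 := by nlinarith
  have hhalf : (halfDim m p τ L : ℤ) ≤ m + 1 := by
    rw [halfDim]; split_ifs <;> push_cast <;> omega
  refine and_congr_right fun hLe => and_congr_right fun hL => and_congr_right fun _ => ?_
  change k = czIndex m p ε τ L + c - halfDim m p τ L ↔ k = czLimit m p τ L + c - halfDim m p τ L
  by_cases hLB : L ≤ B
  · rw [czIndex_eq_limit hp h0 τ hL hLe]
    have : (L : ℝ) ≤ B := by exact_mod_cast hLB
    nlinarith
  · have i1 := le_czIndex (m := m) (p := p) h0 h1 τ L
    have i2 := le_czLimit (m := m) (p := p) (L := L) τ hL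
    constructor <;> intro h <;> exfalso <;> omega

end IndexValues

section Windows

variable {m p : ℕ}

/-- The largest Morse index on the manifold of orbits of period `Lπ/2`, for `n = m + 4`. -/
def topIndex (m p L : ℕ) : ℕ := if p ∣ L then 2 * m + 3 else 2 * m + 1

lemma mem_labels_iff_cases {ε : ℝ} (hp : 2 ≤ p) (h0 : 0 < ε) {k : ℤ} {B : ℕ} (hk : k + m + 3 ≤ B)
    (hB : ε * (B + 1) < 1 / 2) (τ : SignType) (L c : ℕ) :
    (τ, L, c) ∈ labels m p ε k ↔ Even L ∧ 0 < L ∧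
      (τ = 1 ∧ c < 2 ∧ k = (m + 2) * (L - 1 : ℤ) + 2 * stepFun p L + 1 + c ∨
      τ = -1 ∧ c < 2 ∧ k = (m + 2) * (L + 1 : ℤ) + 2 * stepFun p (L + 1) + 1 + c ∨
      τ = 0 ∧ c = 0 ∧ k = (m + 2) * (L - 1 : ℤ) + 2 * stepFun p L + 3 ∨
      τ = 0 ∧ c = topIndex m p L ∧ k = (m + 2) * (L + 1 : ℤ) + 2 * stepFun p (L + 1) ∨
      τ = 0 ∧ ¬ (p : ℤ) ∣ L ∧ (c = m ∨ c = m + 1) ∧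
        k = (m + 2) * (L : ℤ) + 2 * stepFun p L + 1 + c - m) := by
  rw [mem_labels_iff hp h0 hk hB]
  refine and_congr_right fun _ => and_congr_right fun hL => ?_
  have e1 : ((m : ℤ) + 2) * ((L : ℤ) - 1) = (m + 2) * L - m - 2 := by ring
  have e2 : ((m : ℤ) + 2) * ((L : ℤ) + 1) = (m + 2) * L + m + 2 := by ring
  have e3 := stepFun_succ hp (L : ℤ)
  rw [e1, e2]
  cases τ
  · have c0 : czLimit m p SignType.zero L = (m + 2) * L + stepFun p (L + 1) + stepFun p L + 1 := rfl
    have n1 : ¬ (0 : SignType) = 1 := by decide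
    have n2 : ¬ (0 : SignType) = -1 := by decide
    have n3 : SignType.zero = 0 := rfl
    simp only [n3]
    simp only [n1, n2, false_and, false_or, true_and]
    rw [n3] at c0
    rw [c0, morseIndices, halfDim, topIndex, if_pos rfl, if_pos rfl]
    by_cases hd : p ∣ L
    · have hd' : (p : ℤ) ∣ L := Int.natCast_dvd_natCast.2 hd
      rw [if_pos hd'] at e3
      rw [if_pos hd, if_pos hd, if_pos hd]
      simp only [hd', not_true, false_and, or_false, Finset.mem_insert, Finset.mem_singleton]
      omega
    · have hd' : ¬ (p : ℤ) ∣ L := fun h => hd (Int.natCast_dvd_natCast.1 h)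
      rw [if_neg hd'] at e3
      rw [if_neg hd, if_neg hd, if_neg hd]
      simp only [hd', not_false_eq_true, true_and, Finset.mem_insert, Finset.mem_singleton]
      omega
  · have c0 : czLimit m p SignType.neg L = (m + 2) * L + m + 3 + 2 * stepFun p (L + 1) := rfl
    have n1 : ¬ SignType.neg = 1 := by decide
    have n2 : SignType.neg = -1 := rfl
    have n3 : ¬ SignType.neg = 0 := by decide
    rw [c0, morseIndices, halfDim, if_neg n3, if_neg n3]
    simp only [n1, n3, false_and, false_or, or_false, Finset.mem_insert, Finset.mem_singleton]
    simp only [n2, true_and]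
    omega
  · have c0 : czLimit m p SignType.pos L = (m + 2) * L - m - 1 + 2 * stepFun p L := rfl
    have n1 : SignType.pos = 1 := rfl
    have n2 : ¬ SignType.pos = -1 := by decide
    have n3 : ¬ SignType.pos = 0 := by decide
    rw [c0, morseIndices, halfDim, if_neg n3, if_neg n3]
    simp only [n2, n3, false_and, or_false, Finset.mem_insert, Finset.mem_singleton]
    simp only [n1, true_and]
    omega

/-- The lower end of the window of `l`, for `n = m + 4`. The windows of consecutive integers are
adjacent, so that they partition `ℤ`. -/
def windowStart (m p : ℕ) (l : ℤ) : ℤ := (m + 2) * (l - 1) + 2 * stepFun p (l - 1) + l % 2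

lemma windowStart_succ (m p : ℕ) (l : ℤ) : windowStart m p (l + 1) =
    (m + 2) * (l - 1) + (m + 2) + 2 * stepFun p l + (l + 1) % 2 := by
  rw [windowStart, add_sub_cancel_right]; ring

lemma stepFun_eq (hp : 2 ≤ p) (l : ℤ) :
    stepFun p l = stepFun p (l - 1) + if (p : ℤ) ∣ l - 1 then 1 else 0 := by
  have := stepFun_succ hp (l - 1)
  rwa [sub_add_cancel] at this

lemma strictMono_windowStart (hm : 1 ≤ m) (hp : 2 ≤ p) : StrictMono (windowStart m p) := by
  refine strictMono_int_of_lt_succ fun l => ?_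
  have h := stepFun_eq hp l
  rw [windowStart_succ, windowStart]
  split_ifs at h <;> omega

lemma window_unique (hm : 1 ≤ m) (hp : 2 ≤ p) {k l l' : ℤ} (h1 : windowStart m p l ≤ k)
    (h2 : k < windowStart m p (l + 1)) (h1' : windowStart m p l' ≤ k)
    (h2' : k < windowStart m p (l' + 1)) : l = l' := by
  have hM := (strictMono_windowStart hm hp).monotone
  rcases lt_trichotomy l l' with h | h | h
  · have := hM (show l + 1 ≤ l' by omega); omega
  · exact h
  · have := hM (show l' + 1 ≤ l by omega); omega

lemma mem_labels_window {ε : ℝ} (hm : 1 ≤ m) (hp : 2 ≤ p) (h0 : 0 < ε) {k : ℤ} {B : ℕ}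
    (hk : k + m + 3 ≤ B) (hB : ε * (B + 1) < 1 / 2) {l o : ℤ}
    (ho : k = (m + 2) * (l - 1) + 2 * stepFun p (l - 1) + o) (h1 : l % 2 ≤ o)
    (h2 : o + l % 2 ≤ 3 + 2 * if (p : ℤ) ∣ l - 1 then 1 else 0) (τ : SignType) (L c : ℕ) :
    (τ, L, c) ∈ labels m p ε k ↔ Even L ∧ 0 < L ∧
      (τ = 1 ∧ (L : ℤ) = l ∧ c < 2 ∧ o = c + 1 + 2 * (if (p : ℤ) ∣ l - 1 then 1 else 0) ∨
      τ = -1 ∧ (L : ℤ) + 2 = l ∧ c < 2 ∧ o = 1 + c ∨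
      τ = 0 ∧ (L : ℤ) = l ∧ c = 0 ∧ o = 3 + 2 * (if (p : ℤ) ∣ l - 1 then 1 else 0) ∨
      τ = 0 ∧ (L : ℤ) + 2 = l ∧ c = topIndex m p L ∧ o = 0 ∨
      τ = 0 ∧ (L : ℤ) + 1 = l ∧ ¬ (p : ℤ) ∣ L ∧ (c = m ∨ c = m + 1) ∧ o = 1 + c - m) := by
  rw [mem_labels_iff_cases hp h0 hk hB]
  refine and_congr_right fun hLe => and_congr_right fun hL => ?_
  have hs := stepFun_eq hp l
  have w1 : windowStart m p l ≤ k := by rw [windowStart]; omega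
  have w2 : k < windowStart m p (l + 1) := by rw [windowStart_succ]; omega
  have hL2 : (L : ℤ) % 2 = 0 := by obtain ⟨N, rfl⟩ := hLe; omega
  have e1 : ((m : ℤ) + 2) * (L + 1) = (m + 2) * (L - 1) + 2 * (m + 2) := by ring
  have e2 : ((m : ℤ) + 2) * L = (m + 2) * (L - 1) + (m + 2) := by ring
  have sL := stepFun_eq hp (L : ℤ)
  have r1 : (L : ℤ) + 1 - 1 = L := by ring
  have r2 : (L : ℤ) + 2 - 1 = L + 1 := by ring
  have sL1 := stepFun_eq hp ((L : ℤ) + 1)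
  have sL2 := stepFun_eq hp ((L : ℤ) + 2)
  rw [r1] at sL1
  rw [r2] at sL2
  -- the window of `L`, that of `L + 1`, and that of `L + 2`
  have v0 : k = (m + 2) * (L - 1 : ℤ) + 2 * stepFun p L + 1 ∨
      k = (m + 2) * (L - 1 : ℤ) + 2 * stepFun p L + 2 ∨
      k = (m + 2) * (L - 1 : ℤ) + 2 * stepFun p L + 3 → (L : ℤ) = l := by
    intro h
    refine window_unique hm hp ?_ ?_ w1 w2
    · rw [windowStart]; split_ifs at sL <;> omega
    · rw [windowStart_succ]; split_ifs at sL <;> omega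
  have v1 : ¬ (p : ℤ) ∣ L → k = (m + 2) * (L : ℤ) + 2 * stepFun p L + 1 ∨
      k = (m + 2) * (L : ℤ) + 2 * stepFun p L + 2 → (L : ℤ) + 1 = l := by
    intro hd h
    rw [if_neg hd] at sL1
    refine window_unique hm hp ?_ ?_ w1 w2
    · rw [windowStart, r1]; omega
    · rw [windowStart_succ, r1]; omega
  have v2 : k = (m + 2) * (L + 1 : ℤ) + 2 * stepFun p (L + 1) ∨
      k = (m + 2) * (L + 1 : ℤ) + 2 * stepFun p (L + 1) + 1 ∨
      k = (m + 2) * (L + 1 : ℤ) + 2 * stepFun p (L + 1) + 2 → (L : ℤ) + 2 = l := by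
    intro h
    refine window_unique hm hp ?_ ?_ w1 w2
    · rw [windowStart, r2]; omega
    · rw [windowStart_succ, r2]; split_ifs at sL2 <;> omega
  constructor
  · rintro (⟨a, b, c⟩ | ⟨a, b, c⟩ | ⟨a, b, c⟩ | ⟨a, b, c⟩ | ⟨a, b, d, c⟩)
    · obtain rfl := v0 (by omega)
      exact Or.inl ⟨a, rfl, b, by omega⟩
    · obtain rfl := v2 (by omega)
      rw [r2] at ho
      exact Or.inr (Or.inl ⟨a, rfl, b, by omega⟩)
    · obtain rfl := v0 (by omega)
      exact Or.inr (Or.inr (Or.inl ⟨a, rfl, b, by omega⟩))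
    · obtain rfl := v2 (by omega)
      rw [r2] at ho
      exact Or.inr (Or.inr (Or.inr (Or.inl ⟨a, rfl, b, by omega⟩)))
    · obtain rfl := v1 b (by omega)
      rw [r1] at ho
      exact Or.inr (Or.inr (Or.inr (Or.inr ⟨a, rfl, b, d, by omega⟩)))
  · rintro (⟨a, rfl, b, c⟩ | ⟨a, rfl, b, c⟩ | ⟨a, rfl, b, c⟩ | ⟨a, rfl, b, c⟩ | ⟨a, rfl, b, d, c⟩)
    · exact Or.inl ⟨a, b, by omega⟩
    · rw [r2] at ho
      exact Or.inr (Or.inl ⟨a, b, by omega⟩)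
    · exact Or.inr (Or.inr (Or.inl ⟨a, b, by omega⟩))
    · rw [r2] at ho
      exact Or.inr (Or.inr (Or.inr (Or.inl ⟨a, b, by omega⟩)))
    · rw [r1] at ho hs
      exact Or.inr (Or.inr (Or.inr (Or.inr ⟨a, b, d, by omega⟩)))

end Windows

section LabelCounts

variable {m p : ℕ}

/-- The label in the lower half of the window of `j + 2` at the offset `o`. -/
def lowLabel (m p j : ℕ) (o : ℤ) : SignType × ℕ × ℕ :=
  if o = 0 then (0, j, topIndex m p j) else (-1, j, (o - 1).toNat)

/-- The label in the upper half of the window of `j` at the offset `o`. -/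
def upLabel (j : ℕ) (o : ℤ) : SignType × ℕ × ℕ :=
  if o = 2 then (0, j, 0) else (1, j, o.toNat)

lemma lowLabel_ne_upLabel (m p j : ℕ) (o o' : ℤ) : lowLabel m p j o ≠ upLabel (j + 2) o' := by
  intro h
  have h1 : (lowLabel m p j o).2.1 = j := by rw [lowLabel]; split_ifs <;> rfl
  have h2 : (upLabel (j + 2) o').2.1 = j + 2 := by rw [upLabel]; split_ifs <;> rfl
  rw [h, h2] at h1
  omega

/-- In the window of an even number `j + 2`, the labels form two runs of three consecutive
indices, that overlap in two places unless `p` divides `j + 1`. -/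
lemma mem_labels_even {ε : ℝ} (hm : 1 ≤ m) (hp : 2 ≤ p) (h0 : 0 < ε) {k : ℤ} {B : ℕ}
    (hk : k + m + 3 ≤ B) (hB : ε * (B + 1) < 1 / 2) {j : ℕ} (hj : Even j) {o δ : ℤ}
    (hδ : δ = if (p : ℤ) ∣ (j : ℤ) + 2 - 1 then 1 else 0)
    (ho : k = indexFun (m + 4) p ((j : ℤ) + 2) - 2 - 2 * δ + o) (h1 : 0 ≤ o)
    (h2 : o ≤ 3 + 2 * δ) (x : SignType × ℕ × ℕ) :
    x ∈ labels m p ε k ↔ (0 < j ∧ o ≤ 2 ∧ x = lowLabel m p j o) ∨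
      (1 + 2 * δ ≤ o ∧ x = upLabel (j + 2) (o - 1 - 2 * δ)) := by
  obtain ⟨τ, L, c⟩ := x
  have hj2 : ((j : ℤ) + 2) % 2 = 0 := by obtain ⟨i, rfl⟩ := hj; omega
  have hs := stepFun_eq hp ((j : ℤ) + 2)
  rw [indexFun_eq (by omega)] at ho
  have hcast : ((m + 4 : ℕ) : ℤ) - 2 = m + 2 := by push_cast; ring
  rw [hcast, mul_comm] at ho
  rw [mem_labels_window hm hp h0 hk hB (l := j + 2) (o := o) (by rw [ho, hs, hδ]; ring) (by omega)
    (by rw [← hδ]; omega), ← hδ]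
  have hδ01 : δ = 0 ∨ δ = 1 := by rw [hδ]; split_ifs <;> simp
  constructor
  · rintro ⟨hLe, hL, (⟨rfl, b, c1, c2⟩ | ⟨rfl, b, c1, c2⟩ | ⟨rfl, b, rfl, c2⟩ | ⟨rfl, b, rfl, c2⟩ |
      ⟨rfl, b, -, -, c2⟩)⟩
    · right
      refine ⟨by omega, ?_⟩
      rw [upLabel, if_neg (by omega), show L = j + 2 by omega, show (o - 1 - 2 * δ).toNat = c by omega]
    · left
      refine ⟨by omega, by omega, ?_⟩
      rw [lowLabel, if_neg (by omega), show L = j by omega, show (o - 1).toNat = c by omega]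
    · right
      refine ⟨by omega, ?_⟩
      rw [upLabel, if_pos (by omega), show L = j + 2 by omega]
    · left
      refine ⟨by omega, by omega, ?_⟩
      rw [lowLabel, if_pos c2, show L = j by omega]
    · obtain ⟨i, rfl⟩ := hLe
      omega
  · rintro (⟨hj0, ho2, h⟩ | ⟨ho1, h⟩)
    · rw [lowLabel] at h
      split_ifs at h with h5
      · obtain ⟨rfl, rfl, rfl⟩ : τ = 0 ∧ L = j ∧ c = topIndex m p j := by simpa using h
        exact ⟨hj, hj0, Or.inr (Or.inr (Or.inr (Or.inl ⟨rfl, rfl, rfl, h5⟩)))⟩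
      · obtain ⟨rfl, rfl, rfl⟩ : τ = -1 ∧ L = j ∧ c = (o - 1).toNat := by simpa using h
        exact ⟨hj, hj0, Or.inr (Or.inl ⟨rfl, rfl, by omega, by omega⟩)⟩
    · have hj' : Even (j + 2) := hj.add even_two
      rw [upLabel] at h
      split_ifs at h with h5
      · obtain ⟨rfl, rfl, rfl⟩ : τ = 0 ∧ L = j + 2 ∧ c = 0 := by simpa using h
        exact ⟨hj', by omega, Or.inr (Or.inr (Or.inl ⟨rfl, by push_cast; rfl, rfl, by omega⟩))⟩
      · obtain ⟨rfl, rfl, rfl⟩ : τ = 1 ∧ L = j + 2 ∧ c = (o - 1 - 2 * δ).toNat := by simpa using h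
        exact ⟨hj', by omega, Or.inl ⟨rfl, by push_cast; rfl, by omega, by omega⟩⟩

lemma mem_labels_odd {ε : ℝ} (hm : 1 ≤ m) (hp : 2 ≤ p) (h0 : 0 < ε) {k : ℤ} {B : ℕ}
    (hk : k + m + 3 ≤ B) (hB : ε * (B + 1) < 1 / 2) {j : ℕ} (hj : Even j) (hpj : ¬ (p : ℤ) ∣ j)
    {o : ℕ} (ho : k = indexFun (m + 4) p ((j : ℤ) + 1) - 1 + o) (h2 : o ≤ 1)
    (x : SignType × ℕ × ℕ) : x ∈ labels m p ε k ↔ x = (0, j, m + o) := by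
  obtain ⟨τ, L, c⟩ := x
  have hj2 : ((j : ℤ) + 1) % 2 = 1 := by obtain ⟨i, rfl⟩ := hj; omega
  have hs := stepFun_eq hp ((j : ℤ) + 1)
  have r1 : (j : ℤ) + 1 - 1 = j := by ring
  rw [r1, if_neg hpj, add_zero] at hs
  rw [indexFun_eq (by omega)] at ho
  have hcast : ((m + 4 : ℕ) : ℤ) - 2 = m + 2 := by push_cast; ring
  rw [hcast, mul_comm, r1] at ho
  have hj0 : 0 < j := by
    rcases Nat.eq_zero_or_pos j with h | h
    · exact absurd (by rw [h]; exact dvd_zero _) hpj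
    · exact h
  rw [mem_labels_window hm hp h0 hk hB (l := j + 1) (o := o + 1) (by rw [ho, r1, hs]; ring)
    (by omega) (by split_ifs <;> omega), r1, if_neg hpj]
  constructor
  · rintro ⟨⟨i, hi⟩, hL, (⟨rfl, b, c1, c2⟩ | ⟨rfl, b, c1, c2⟩ | ⟨rfl, b, rfl, c2⟩ |
      ⟨rfl, b, rfl, c2⟩ | ⟨rfl, b, -, -, c2⟩)⟩
    · omega
    · omega
    · omega
    · omega
    · rw [show L = j by omega, show c = m + o by omega]
  · intro h
    obtain ⟨rfl, rfl, rfl⟩ : τ = 0 ∧ L = j ∧ c = m + o := by simpa using h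
    exact ⟨hj, hj0, Or.inr (Or.inr (Or.inr (Or.inr ⟨rfl, rfl, hpj, by omega, by push_cast; ring⟩)))⟩

lemma encard_eq_one_of_forall {α : Type*} {S : Set α} {a : α} (h : ∀ x, x ∈ S ↔ x = a) :
    S.encard = 1 :=
  Set.encard_eq_one.2 ⟨a, Set.ext h⟩

lemma even_sub_cast {l : ℤ} (hl : 2 ≤ l) (he : Even l) :
    ∃ j : ℕ, Even j ∧ l = (j : ℤ) + 2 := by
  obtain ⟨i, hi⟩ := he
  exact ⟨(l - 2).toNat, ⟨(i - 1).toNat, by omega⟩, by omega⟩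

/-- Every label has an index in one of the windows. -/
lemma exists_window_of_mem_labels {ε : ℝ} (hp : 3 ≤ p) (h0 : 0 < ε) {k : ℤ} {B : ℕ}
    (hk : k + m + 3 ≤ B) (hB : ε * (B + 1) < 1 / 2) {x : SignType × ℕ × ℕ}
    (hx : x ∈ labels m p ε k) :
    (∃ l : ℤ, 4 ≤ l ∧ Even l ∧ ¬ (p : ℤ) ∣ l - 1 ∧
        indexFun (m + 4) p l - 2 ≤ k ∧ k ≤ indexFun (m + 4) p l + 1) ∨
      (indexFun (m + 4) p 2 - 1 ≤ k ∧ k ≤ indexFun (m + 4) p 2 + 1) ∨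
      (∃ l : ℤ, 1 ≤ l ∧ Odd l ∧ ¬ (p : ℤ) ∣ l - 1 ∧
        (k = indexFun (m + 4) p l - 1 ∨ k = indexFun (m + 4) p l)) ∨
      ∃ l : ℤ, 1 ≤ l ∧ Even l ∧ (p : ℤ) ∣ l - 1 ∧
        indexFun (m + 4) p l - 4 ≤ k ∧ k ≤ indexFun (m + 4) p l + 1 := by
  obtain ⟨τ, L, c⟩ := x
  have hf : ∀ l, indexFun (m + 4) p l = (m + 2) * (l - 1) + 2 * stepFun p l + 2 := by
    intro l
    rw [indexFun_eq (by omega)]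
    push_cast; ring
  have hs := stepFun_eq (show 2 ≤ p by omega)
  rw [mem_labels_iff_cases (by omega) h0 hk hB] at hx
  obtain ⟨hLe, hL, hx⟩ := hx
  have hLe' : Even (L : ℤ) := by exact_mod_cast hLe
  have hL2 : 2 ≤ L := by obtain ⟨i, rfl⟩ := hLe; omega
  have up : indexFun (m + 4) p L - 1 ≤ k → k ≤ indexFun (m + 4) p L + 1 →
      (∃ l : ℤ, 4 ≤ l ∧ Even l ∧ ¬ (p : ℤ) ∣ l - 1 ∧
        indexFun (m + 4) p l - 2 ≤ k ∧ k ≤ indexFun (m + 4) p l + 1) ∨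
      (indexFun (m + 4) p 2 - 1 ≤ k ∧ k ≤ indexFun (m + 4) p 2 + 1) ∨
      ∃ l : ℤ, 1 ≤ l ∧ Even l ∧ (p : ℤ) ∣ l - 1 ∧
        indexFun (m + 4) p l - 4 ≤ k ∧ k ≤ indexFun (m + 4) p l + 1 := by
    intro i1 i2
    by_cases h2 : L = 2
    · subst h2
      exact Or.inr (Or.inl ⟨i1, i2⟩)
    have hL4 : 4 ≤ L := by obtain ⟨i, rfl⟩ := hLe; omega
    by_cases hd : (p : ℤ) ∣ (L : ℤ) - 1
    · exact Or.inr (Or.inr ⟨L, by omega, hLe', hd, by omega, i2⟩)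
    · exact Or.inl ⟨L, by omega, hLe', hd, by omega, i2⟩
  have low : (m + 2) * (L + 1 : ℤ) + 2 * stepFun p (L + 1) ≤ k →
      k ≤ (m + 2) * (L + 1 : ℤ) + 2 * stepFun p (L + 1) + 2 →
      (∃ l : ℤ, 4 ≤ l ∧ Even l ∧ ¬ (p : ℤ) ∣ l - 1 ∧
        indexFun (m + 4) p l - 2 ≤ k ∧ k ≤ indexFun (m + 4) p l + 1) ∨
      ∃ l : ℤ, 1 ≤ l ∧ Even l ∧ (p : ℤ) ∣ l - 1 ∧
        indexFun (m + 4) p l - 4 ≤ k ∧ k ≤ indexFun (m + 4) p l + 1 := by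
    intro i1 i2
    have e1 := hf (L + 2)
    have e2 := hs (L + 2)
    have r2 : (L : ℤ) + 2 - 1 = L + 1 := by ring
    rw [r2] at e1 e2
    have hev : Even ((L : ℤ) + 2) := hLe'.add even_two
    by_cases hd : (p : ℤ) ∣ (L : ℤ) + 1
    · rw [if_pos hd] at e2
      exact Or.inr ⟨L + 2, by omega, hev, by rwa [r2], by omega, by omega⟩
    · rw [if_neg hd] at e2
      exact Or.inl ⟨L + 2, by omega, hev, by rwa [r2], by omega, by omega⟩
  have eL := hf L
  rcases hx with ⟨-, b, c⟩ | ⟨-, b, c⟩ | ⟨-, -, c⟩ | ⟨-, -, c⟩ | ⟨-, b, d, c⟩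
  · rcases up (by omega) (by omega) with h | h | h
    exacts [Or.inl h, Or.inr (Or.inl h), Or.inr (Or.inr (Or.inr h))]
  · rcases low (by omega) (by omega) with h | h
    exacts [Or.inl h, Or.inr (Or.inr (Or.inr h))]
  · rcases up (by omega) (by omega) with h | h | h
    exacts [Or.inl h, Or.inr (Or.inl h), Or.inr (Or.inr (Or.inr h))]
  · rcases low (by omega) (by omega) with h | h
    exacts [Or.inl h, Or.inr (Or.inr (Or.inr h))]
  · refine Or.inr (Or.inr (Or.inl ⟨L + 1, by omega, hLe'.add_one, by rwa [add_sub_cancel_right], ?_⟩))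
    have e1 := hf (L + 1)
    have e2 := hs (L + 1)
    rw [add_sub_cancel_right, if_neg b] at e2
    rw [add_sub_cancel_right] at e1
    omega

end LabelCounts

end

theorem mainTheorem12 (n p : ℕ) (hn : 5 ≤ n) (hn_odd : Odd n) (hp : 3 ≤ p) (hp_odd : Odd p)
    (M : ℤ) :
    ∃ ε₀ : ℝ, 0 < ε₀ ∧ ∀ ε : ℝ, Irrational ε → 0 < ε → ε < ε₀ →
      (∃ φ, IsPerturbedReebFlow n p ε φ) ∧
      ∀ φ, IsPerturbedReebFlow n p ε φ → ∀ h, IsMorseChoice n p ε φ h → ∀ k : ℤ, k ≤ M →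
        -- `l` even, `p ∤ l - 1`, `l ≥ 4`
        (∀ l : ℤ, 4 ≤ l → Even l → ¬ (p : ℤ) ∣ l - 1 →
          (k = indexFun n p l - 2 ∨ k = indexFun n p l + 1 → perturbedCount n p ε φ h k = 1) ∧
          (k = indexFun n p l - 1 ∨ k = indexFun n p l → perturbedCount n p ε φ h k = 2)) ∧
        -- `l = 2`
        (indexFun n p 2 - 1 ≤ k → k ≤ indexFun n p 2 + 1 → perturbedCount n p ε φ h k = 1) ∧
        -- `l` odd, `p ∤ l - 1`
        (∀ l : ℤ, 1 ≤ l → Odd l → ¬ (p : ℤ) ∣ l - 1 →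
          (k = indexFun n p l - 1 ∨ k = indexFun n p l → perturbedCount n p ε φ h k = 1)) ∧
        -- `l` even, `p ∣ l - 1`
        (∀ l : ℤ, 1 ≤ l → Even l → (p : ℤ) ∣ l - 1 →
          (indexFun n p l - 4 ≤ k → k ≤ indexFun n p l + 1 → perturbedCount n p ε φ h k = 1)) ∧
        -- all other `k`
        ((¬ ∃ l : ℤ, 4 ≤ l ∧ Even l ∧ ¬ (p : ℤ) ∣ l - 1 ∧
            indexFun n p l - 2 ≤ k ∧ k ≤ indexFun n p l + 1) →
          ¬ (indexFun n p 2 - 1 ≤ k ∧ k ≤ indexFun n p 2 + 1) →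
          (¬ ∃ l : ℤ, 1 ≤ l ∧ Odd l ∧ ¬ (p : ℤ) ∣ l - 1 ∧
            (k = indexFun n p l - 1 ∨ k = indexFun n p l)) →
          (¬ ∃ l : ℤ, 1 ≤ l ∧ Even l ∧ (p : ℤ) ∣ l - 1 ∧
            indexFun n p l - 4 ≤ k ∧ k ≤ indexFun n p l + 1) →
          perturbedCount n p ε φ h k = 0) := by
  obtain ⟨m, rfl⟩ : ∃ m, n = m + 4 := ⟨n - 4, by omega⟩
  have hm : 1 ≤ m := by omega
  have hp2 : 2 ≤ p := by omega
  obtain ⟨B, hBM⟩ : ∃ B : ℕ, M + m + 3 ≤ B := ⟨(M + m + 3).toNat, by omega⟩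
  -- for `L ≤ B` the perturbation moves no index, and larger `L` do not contribute below `M`
  refine ⟨1 / (2 * (B + 1)), by positivity, fun ε hε h0 hε0 => ?_⟩
  have hB : ε * (B + 1) < 1 / 2 := by
    rw [lt_div_iff₀ (by positivity)] at hε0
    linarith
  have h1 : ε < 1 := by nlinarith [(Nat.cast_nonneg B : (0 : ℝ) ≤ B)]
  refine ⟨⟨_, exists_perturbedReebFlow (by omega) (by omega) h0 h1⟩, fun φ hφ h H k hkM => ?_⟩
  have hk : k + m + 3 ≤ B := by omega
  rw [perturbedCount_eq hm hp2 hε h0 h1 hφ H k]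
  refine ⟨fun l hl hle hpl => ?_, fun i1 i2 => ?_, fun l hl hlo hpl => ?_, fun l hl hle hpl i1 i2 => ?_,
    fun n1 n2 n3 n4 => ?_⟩
  · obtain ⟨j, hj, rfl⟩ := even_sub_cast (by omega) hle
    have key := fun (o : ℤ) (a : k = indexFun (m + 4) p ((j : ℤ) + 2) - 2 - 2 * 0 + o) (b : 0 ≤ o)
      (c : o ≤ 3 + 2 * 0) => mem_labels_even hm hp2 h0 hk hB hj (if_neg hpl).symm a b c
    refine ⟨?_, ?_⟩
    · rintro (h | h)
      · refine encard_eq_one_of_forall (a := lowLabel m p j 0) fun x => (key 0 (by omega) (by omega) (by omega) x).trans ?_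
        rw [or_iff_left (by omega)]
        exact ⟨fun a => a.2.2, fun a => ⟨by omega, by omega, a⟩⟩
      · refine encard_eq_one_of_forall (a := upLabel (j + 2) (3 - 1 - 2 * 0)) fun x => (key 3 (by omega) (by omega) (by omega) x).trans ?_
        rw [or_iff_right (by omega)]
        exact ⟨fun a => a.2, fun a => ⟨by omega, a⟩⟩
    · intro h
      obtain ⟨o, ho, ho1, ho2⟩ : ∃ o : ℤ, k = indexFun (m + 4) p ((j : ℤ) + 2) - 2 - 2 * 0 + o ∧
          1 ≤ o ∧ o ≤ 2 := ⟨k - indexFun (m + 4) p ((j : ℤ) + 2) + 2, by omega⟩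
      have : labels m p ε k = {lowLabel m p j o, upLabel (j + 2) (o - 1 - 2 * 0)} := by
        ext x
        rw [key o ho (by omega) (by omega), Set.mem_insert_iff, Set.mem_singleton_iff]
        exact or_congr ⟨fun a => a.2.2, fun a => ⟨by omega, by omega, a⟩⟩
          ⟨fun a => a.2, fun a => ⟨by omega, a⟩⟩
      rw [this, Set.encard_pair (lowLabel_ne_upLabel _ _ _ _ _)]
  · have hp1 : ¬ (p : ℤ) ∣ ((0 : ℕ) : ℤ) + 2 - 1 := fun hd => by
      have := Int.le_of_dvd (by norm_num) hd
      push_cast at this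
      omega
    refine encard_eq_one_of_forall (a := upLabel 2 (k - indexFun (m + 4) p 2 + 2 - 1 - 2 * 0))
      fun x => (mem_labels_even hm hp2 h0 hk hB (j := 0) Even.zero
      (if_neg hp1).symm (o := k - indexFun (m + 4) p 2 + 2) (by push_cast; ring)
      (by omega) (by omega) x).trans ?_
    rw [or_iff_right (by omega)]
    exact ⟨fun a => a.2, fun a => ⟨by omega, a⟩⟩
  · obtain ⟨j, rfl⟩ : ∃ j : ℕ, l = (j : ℤ) + 1 := ⟨(l - 1).toNat, by omega⟩
    rw [add_sub_cancel_right] at hpl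
    have hj : Even j := by
      obtain ⟨i, hi⟩ := hlo
      exact ⟨i.toNat, by omega⟩
    rintro (h | h)
    · exact encard_eq_one_of_forall (mem_labels_odd hm hp2 h0 hk hB hj hpl (o := 0) (by omega)
        (by omega))
    · exact encard_eq_one_of_forall (mem_labels_odd hm hp2 h0 hk hB hj hpl (o := 1) (by omega)
        (by omega))
  · have hl4 : 4 ≤ l := by
      rcases hle with ⟨i, rfl⟩
      by_contra hlt
      have := Int.le_of_dvd (by omega) hpl
      omega
    obtain ⟨j, hj, rfl⟩ := even_sub_cast (by omega) hle
    have key := mem_labels_even hm hp2 h0 hk hB hj (if_pos hpl).symm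
      (o := k - indexFun (m + 4) p ((j : ℤ) + 2) + 4) (by ring) (by omega) (by omega)
    by_cases ho : k - indexFun (m + 4) p ((j : ℤ) + 2) + 4 ≤ 2
    · refine encard_eq_one_of_forall (a := lowLabel m p j (k - indexFun (m + 4) p ((j : ℤ) + 2) + 4))
        fun x => (key x).trans ?_
      rw [or_iff_left (by omega)]
      exact ⟨fun a => a.2.2, fun a => ⟨by omega, ho, a⟩⟩
    · refine encard_eq_one_of_forall (a := upLabel (j + 2)
        (k - indexFun (m + 4) p ((j : ℤ) + 2) + 4 - 1 - 2 * 1)) fun x => (key x).trans ?_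
      rw [or_iff_right (by omega)]
      exact ⟨fun a => a.2, fun a => ⟨by omega, a⟩⟩
  · rw [Set.encard_eq_zero, Set.eq_empty_iff_forall_notMem]
    intro x hx
    rcases exists_window_of_mem_labels hp h0 hk hB hx with h | h | h | h
    exacts [n1 h, n2 h, n3 h, n4 h]
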